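/- Let $W$ be a finite real reflection group of type $D_n$ ($n\ge 4$) or $H_3$ acting on a Euclidean space $V$ and fixing only the origin, with simple reflections $S$ given by a system of simple roots, and let $T$ be the set of all reflections in $W$. Let $S=S_+\sqcup S_-$ be a bipartition of the Coxeter diagram, put $c_\pm=\prod_{s\in S_\pm}s$ and let $c=c_-c_+$ be the corresponding bipartite Coxeter element; let $h$ be the order of $c$, and let $P\subset V$ be the Coxeter plane, that is, the plane on which $c$ acts as a rotation through $2\pi/h$. Let $o$ be a nontrivial $W$-orbit of smallest cardinality. (1) Exactly two points of $o$ project orthogonally to the origin of $P$, and the remaining points of $o$ project bijectively onto the vertices of a regular $h$-gon in $P$ centered at the origin. (2) A parabolic subgroup of $W$ is a subgroup conjugate in $W$ to one generated by a subset of $S$. It is called noncrossing (with respect to $c$) if it is generated by the letters of some reduced $T$-word (a shortest word in the alphabet $T$) for an element $x\le c$, where $u\le v$ means that some reduced $T$-word for $u$ is a prefix of a reduced $T$-word for $v$. The blocks of the Coxeter-plane diagram of a parabolic subgroup $W'$ are the $W'$-orbits in $o$, projected orthogonally to $P$; they are labeled by their preimages in $o$, so different blocks may have the same projection. Then $W'$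 is noncrossing if and only if, for every two different blocks of its diagram, the convex hulls of the two projected blocks are either disjoint or meet in a single point that lies on the boundary of both. Here the boundary of a convex hull is taken relative to its affine span (so the boundary of a segment consists of its endpoints), and a single point is regarded as its own boundary. -/

import Mathlib

open scoped RealInnerProductSpace

noncomputable section

namespace CoxeterPlanar

/-! ### Coxeter types -/

/-- The Coxeter matrix of type `D_n`, with nodes `0, …, n - 1`: the nodes `0, …, n - 2` form a path
and the node `n - 1` is joined to the node `n - 3` only. (Mathlib's `CoxeterMatrix.D` also joins
the nodes `n - 2` and `n - 1`, so it is not used here.) -/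
def typeD (n : ℕ) : CoxeterMatrix (Fin n) where
  M := Matrix.of fun i j : Fin n =>
    if i = j then 1
    else if ((i : ℕ) + 1 = j ∧ (j : ℕ) + 1 < n) ∨ ((j : ℕ) + 1 = i ∧ (i : ℕ) + 1 < n) ∨
        ((i : ℕ) + 2 = j ∧ (j : ℕ) + 1 = n) ∨ ((j : ℕ) + 2 = i ∧ (i : ℕ) + 1 = n) then 3
    else 2
  isSymm := by
    ext i j
    simp only [Matrix.transpose_apply, Matrix.of_apply]
    grind
  diagonal := by simp
  off_diagonal := by
    intro i j hij
    simp only [Matrix.of_apply, if_neg hij]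
    split_ifs <;> simp

/-- `M` is, up to the labelling of the nodes, of type `D_n` with `n ≥ 4`. -/
def IsTypeD {ι : Type*} (M : CoxeterMatrix ι) : Prop :=
  ∃ n : ℕ, 4 ≤ n ∧ ∃ e : ι ≃ Fin n, M.reindex e = typeD n

/-- `M` is, up to the labelling of the nodes, of type `H_3`. -/
def IsTypeH₃ {ι : Type*} (M : CoxeterMatrix ι) : Prop :=
  ∃ e : ι ≃ Fin 3, M.reindex e = CoxeterMatrix.H₃

/-- A bipartition of the Coxeter diagram of `M`, given by signs (`true` for `+`, `false` for `-`):
no two distinct nodes of equal sign are joined, that is, `m(i, j) = 2`. -/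
def IsBipartition {ι : Type*} (M : CoxeterMatrix ι) (ε : ι → Bool) : Prop :=
  ∀ i j, i ≠ j → ε i = ε j → M i j = 2

/-! ### The reflection group -/

variable {V : Type*} [NormedAddCommGroup V] [InnerProductSpace ℝ V]

/-- The orthogonal reflection in the hyperplane orthogonal to `a`. -/
def hyperplaneReflection (a : V) : V ≃ₗᵢ[ℝ] V := (ℝ ∙ a)ᗮ.reflection

theorem hyperplaneReflection_apply {a : V} (ha : ⟪a, a⟫ = 1) (x : V) :
    hyperplaneReflection a x = x - (2 * ⟪a, x⟫) • a := by
  have hn : ‖a‖ = 1 := by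
    have h := real_inner_self_eq_norm_sq a
    rw [ha] at h
    nlinarith [norm_nonneg a]
  rw [hyperplaneReflection, Submodule.reflection_orthogonal_apply,
    Submodule.reflection_singleton_apply, hn]
  simp only [RCLike.ofReal_real_eq_id, id_eq, one_pow, div_one, neg_sub, two_smul, two_mul,
    add_smul]

/-- Unit simple roots in the Euclidean space `V` with Coxeter matrix `M`: the angle between the
roots indexed by `i` and `j` is `π - π / m(i, j)` (for `i = j` the equation says that the root has
norm 1), and the roots span `V`, so that the reflections fix only the origin. -/
structure SimpleSystem {ι : Type*} (M : CoxeterMatrix ι) (V : Type*) [NormedAddCommGroup V]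
    [InnerProductSpace ℝ V] where
  root : ι → V
  inner_root : ∀ i j, ⟪root i, root j⟫ = -Real.cos (Real.pi / (M i j : ℝ))
  span_root : Submodule.span ℝ (Set.range root) = ⊤

/-- The orbit of `x` under a group `G` of linear isometries. -/
def orbitOf (G : Subgroup (V ≃ₗᵢ[ℝ] V)) (x : V) : Set V := {y | ∃ g ∈ G, g x = y}

namespace SimpleSystem

variable {ι : Type*} {M : CoxeterMatrix ι} (Δ : SimpleSystem M V)

/-- The simple reflections; they form the set `S`. -/
def simpleReflection (i : ι) : V ≃ₗᵢ[ℝ] V := hyperplaneReflection (Δ.root i)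

/-- The reflection group `W`. -/
def group : Subgroup (V ≃ₗᵢ[ℝ] V) := Subgroup.closure (Set.range Δ.simpleReflection)

/-- The set `T` of all reflections in `W`: the `W`-conjugates of the simple reflections. -/
def reflections : Set (V ≃ₗᵢ[ℝ] V) :=
  {t | ∃ w ∈ Δ.group, ∃ i, t = w * Δ.simpleReflection i * w⁻¹}

/-- Parabolic subgroups: the `W`-conjugates of the subgroups generated by subsets of `S`. -/
def IsParabolic (W' : Subgroup (V ≃ₗᵢ[ℝ] V)) : Prop :=
  ∃ w ∈ Δ.group, ∃ J : Set ι,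
    W' = (Subgroup.closure (Δ.simpleReflection '' J)).map (MulAut.conj w).toMonoidHom

/-- A smallest nontrivial `W`-orbit. The only trivial orbit is that of the origin. -/
def IsSmallestOrbit (o : Set V) : Prop :=
  ∃ v : V, v ≠ 0 ∧ o = orbitOf Δ.group v ∧
    ∀ u : V, u ≠ 0 → (orbitOf Δ.group v).encard ≤ (orbitOf Δ.group u).encard

theorem commute_simpleReflection {i j : ι} (h : M i j = 2) :
    Commute (Δ.simpleReflection i) (Δ.simpleReflection j) := by
  have hu : ∀ k, ⟪Δ.root k, Δ.root k⟫ = 1 := fun k => by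
    rw [Δ.inner_root, M.diagonal]; simp
  have hij : ⟪Δ.root i, Δ.root j⟫ = 0 := by
    rw [Δ.inner_root, h]; simp
  have hji : ⟪Δ.root j, Δ.root i⟫ = 0 := by rw [real_inner_comm, hij]
  ext x
  simp only [LinearIsometryEquiv.coe_mul, Function.comp_apply, simpleReflection,
    hyperplaneReflection_apply (hu _), inner_sub_right, inner_smul_right, hij, hji]
  module

variable [Fintype ι]

/-- `c_+` (for `b = true`) and `c_-` (for `b = false`): the product of the simple reflections of
the given sign, which commute pairwise. -/
def halfProduct {ε : ι → Bool} (hε : IsBipartition M ε) (b : Bool) : V ≃ₗᵢ[ℝ] V :=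
  Finset.noncommProd {i | ε i = b} Δ.simpleReflection fun i hi j hj hij => by
    have hi' : ε i = b := by simpa using hi
    have hj' : ε j = b := by simpa using hj
    exact Δ.commute_simpleReflection (hε i j hij (hi'.trans hj'.symm))

/-- The bipartite Coxeter element `c = c_- c_+`. -/
def coxeterElement {ε : ι → Bool} (hε : IsBipartition M ε) : V ≃ₗᵢ[ℝ] V :=
  Δ.halfProduct hε false * Δ.halfProduct hε true

end SimpleSystem

/-! ### Absolute order and noncrossing parabolic subgroups -/

/-- `l` is a reduced `T`-word for `w`: it has letters in `T` and product `w`, and is a shortest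
word with these properties. -/
def IsReducedWord (T : Set (V ≃ₗᵢ[ℝ] V)) (l : List (V ≃ₗᵢ[ℝ] V)) (w : V ≃ₗᵢ[ℝ] V) : Prop :=
  (∀ t ∈ l, t ∈ T) ∧ l.prod = w ∧
    ∀ l' : List (V ≃ₗᵢ[ℝ] V), (∀ t ∈ l', t ∈ T) → l'.prod = w → l.length ≤ l'.length

/-- The absolute order: `u` has a reduced `T`-word that is a prefix of some reduced `T`-word
for `v`. -/
def AbsoluteLE (T : Set (V ≃ₗᵢ[ℝ] V)) (u v : V ≃ₗᵢ[ℝ] V) : Prop :=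
  ∃ l l' : List (V ≃ₗᵢ[ℝ] V), IsReducedWord T l u ∧ IsReducedWord T (l ++ l') v

/-- `W'` is noncrossing with respect to `c`: it is generated by the letters of a reduced `T`-word
for some element `x` of the interval `[1, c]` in the absolute order. -/
def IsNoncrossing (T : Set (V ≃ₗᵢ[ℝ] V)) (c : V ≃ₗᵢ[ℝ] V) (W' : Subgroup (V ≃ₗᵢ[ℝ] V)) : Prop :=
  ∃ x, AbsoluteLE T x c ∧ ∃ l, IsReducedWord T l x ∧ W' = Subgroup.closure {t | t ∈ l}

/-! ### The Coxeter plane and diagrams -/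

/-- The Coxeter plane of a Coxeter element `c` of order `h`: the plane on which `c` acts as a
rotation through the angle `2π / h`. As `c` is an isometry, this is the space of all `v` with
`c v + c⁻¹ v = 2 cos (2π / h) v`. -/
def coxeterPlane (c : V ≃ₗᵢ[ℝ] V) : Submodule ℝ V where
  carrier := {v | c v + c⁻¹ v = (2 * Real.cos (2 * Real.pi / (orderOf c : ℝ))) • v}
  add_mem' := by
    intro a b ha hb
    simp only [Set.mem_ofPred_eq, map_add, smul_add] at *
    rw [← ha, ← hb]
    abel
  zero_mem' := by simp
  smul_mem' := by
    intro r a ha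
    simp only [Set.mem_ofPred_eq, map_smul] at *
    rw [← smul_add, ha, smul_comm]

/-- The boundary of a convex polygon, segment or point, relative to its affine span: the edges of
a polygon, the endpoints of a segment. A single point is its own boundary. -/
def relBoundary {E : Type*} [NormedAddCommGroup E] [NormedSpace ℝ E] (K : Set E) : Set E :=
  {p | p ∈ intrinsicFrontier ℝ K ∨ K = {p}}

/-- Two convex sets are disjoint or meet in a single point on the boundary of both. -/
def HullsNoncrossing {E : Type*} [NormedAddCommGroup E] [NormedSpace ℝ E] (K L : Set E) : Prop :=
  Disjoint K L ∨ ∃ p, K ∩ L = {p} ∧ p ∈ relBoundary K ∧ p ∈ relBoundary L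

variable [FiniteDimensional ℝ V]

/-- The convex hull of the orthogonal projection to `P` of a block `B` of a partition. -/
def blockHull (P : Submodule ℝ V) (B : Set V) : Set P :=
  convexHull ℝ (P.orthogonalProjectionOnto '' B)

/-- Any two distinct blocks of the diagram of `W'` are noncrossing. The blocks are the
`W'`-orbits in `o`, projected to `P`; they are told apart as subsets of `o`, so that blocks
with the same projection may be distinct. -/
def DiagramNoncrossing (P : Submodule ℝ V) (o : Set V) (W' : Subgroup (V ≃ₗᵢ[ℝ] V)) : Prop :=
  ∀ x ∈ o, ∀ y ∈ o, orbitOf W' x ≠ orbitOf W' y →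
    HullsNoncrossing (blockHull P (orbitOf W' x)) (blockHull P (orbitOf W' y))

/-- `P` is a plane, exactly two points of `o` project orthogonally to the origin of `P`, and the
other points of `o` project one-to-one onto the vertices of a regular `h`-gon in `P` centered at
the origin. -/
def ProjectsToPolygonAndTwoOrigins (P : Submodule ℝ V) (o : Set V) (h : ℕ) : Prop :=
  ∃ (b : OrthonormalBasis (Fin 2) ℝ P) (r : ℝ), 0 < r ∧
    {x ∈ o | P.orthogonalProjectionOnto x = 0}.ncard = 2 ∧
    Set.BijOn (fun x => P.orthogonalProjectionOnto x)
      {x ∈ o | P.orthogonalProjectionOnto x ≠ 0}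
      (Set.range fun k : Fin h =>
        (r * Real.cos (2 * Real.pi * (k : ℝ) / (h : ℝ))) • b 0 +
          (r * Real.sin (2 * Real.pi * (k : ℝ) / (h : ℝ))) • b 1)

end CoxeterPlanar

end

noncomputable section

namespace CoxeterPlanar

/-! ### Reflections, and products of reflections in independent vectors. -/

section Reflections

variable {V : Type*} [NormedAddCommGroup V] [InnerProductSpace ℝ V]

/-! Let `Z` be the inverse of `1 - c`. The form `⟪Z u, v⟫` is not symmetric, but its symmetrization
is the scalar product. A factorization of `c` into `dim V` reflections uses independent roots, and
then `⟪Z a, b⟫ = 0` whenever `a` comes before `b` (`pairwise_of_prodR`): `Z a` is displaced by `c`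
by exactly `a`, so the reflections after `a` must fix it. Conversely a list of roots that is
triangular for this form is an initial segment of such a factorization
(`isNoncrossing_of_pairwise`), provided that each group element is a product of at most as many
reflections as the codimension of any space it fixes. Noncrossing subgroups are thus those generated
by triangular lists, and the question turns into one about the values of a single bilinear form.

The small orbit is described by a `Frame`: vectors `f i` with `c (f i) = f (i + 1)` and `f (i + m) =
-f i`, and two vectors `±g` with `c g = -g`, where `h = 2m`. The vector `g` is orthogonal to the
Coxeter plane because the eigenvalue of `c + c⁻¹` differs, and the `f i` project to a regular
`2m`-gon (`Frame.exists_basis`, `Frame.projects`). This is part (1).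

In type `D` the vectors `f 0, …, f (m - 1), g` form an orthogonal basis, and the roots are the
differences of nonopposite points. Telescoping gives `Z (f i - f j) = f i + ⋯ + f (j - 1)` for `i ≤
j`, so on vertices the form of a chord is a step function on the circle. It is nonzero on two
crossing chords, and it vanishes when the second block crosses neither the chord nor its opposite.
If `W'` comes from a factorization, the form vanishes between blocks that are neither equal nor
opposite (`DFrame.form_orbit`), which excludes crossings; opposite blocks are handled by showing
that each lies in a half circle (`DFrame.exists_half_of_f`, `DFrame.exists_half_of_g`). If the
diagram is noncrossing, each block yields a triangular chain of successive chords, preceded by one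
or two roots through `±g` where needed. The chains of different blocks are orthogonal for the form
(`DFrame.form_eq_zero`), and a reflection subgroup is determined by its orbits, so the concatenated
list generates `W'`.

In type `H₃` the orbit is the icosahedron. The fifteen reflections are encoded as permutations of
twelve labels, rotation by `c` brings the first of two given reflections to one of three, and the
remaining comparison of crossings with factorizations of `c` is a finite computation
(`orbitsSeparated`, `isFactorization_or_crossing`).

It remains to see that every smallest orbit is, up to scaling, such a frame. In type `D` a vector
with two nonzero coordinates has a large orbit, because many monomials in the coordinates are
orthogonal functions on it; the exceptions in `D₄` are removed by triality. In type `H₃` an orbit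
with at most twelve points cannot contain two disjoint ten-element orbits of `c`, which would
otherwise make `√5` an integer. -/

theorem hyperplaneReflection_eq (a x : V) :
    hyperplaneReflection a x = x - (2 * ⟪a, x⟫ / ⟪a, a⟫) • a := by
  rw [hyperplaneReflection, Submodule.reflection_orthogonal_apply,
    Submodule.reflection_singleton_apply, real_inner_self_eq_norm_sq]
  simp only [RCLike.ofReal_real_eq_id, id_eq]
  module

theorem hyperplaneReflection_of_inner_eq_zero {a x : V} (h : ⟪a, x⟫ = 0) :
    hyperplaneReflection a x = x := by
  rw [hyperplaneReflection_eq, h]; simp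

theorem hyperplaneReflection_self (a : V) : hyperplaneReflection a a = -a := by
  rw [hyperplaneReflection, Submodule.reflection_orthogonalComplement_singleton_eq_neg]

theorem hyperplaneReflection_apply_apply (a x : V) :
    hyperplaneReflection a (hyperplaneReflection a x) = x :=
  Submodule.reflection_reflection _ _

theorem hyperplaneReflection_mul_self (a : V) :
    hyperplaneReflection a * hyperplaneReflection a = 1 :=
  LinearIsometryEquiv.ext fun x => hyperplaneReflection_apply_apply a x

theorem hyperplaneReflection_inv (a : V) :
    (hyperplaneReflection a)⁻¹ = hyperplaneReflection a :=
  inv_eq_of_mul_eq_one_left (hyperplaneReflection_mul_self a)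

theorem hyperplaneReflection_conj (w : V ≃ₗᵢ[ℝ] V) (a : V) :
    w * hyperplaneReflection a * w⁻¹ = hyperplaneReflection (w a) := by
  ext x
  have h : ∀ y, ⟪w a, w y⟫ = ⟪a, y⟫ := fun y => w.inner_map_map a y
  have hx : x = w (w⁻¹ x) := (w.apply_symm_apply x).symm
  conv_rhs => rw [hx]
  simp only [LinearIsometryEquiv.coe_mul, Function.comp_apply, hyperplaneReflection_eq,
    map_sub, map_smul, h]

theorem hyperplaneReflection_smul {r : ℝ} (hr : r ≠ 0) (a : V) :
    hyperplaneReflection (r • a) = hyperplaneReflection a := by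
  ext x
  simp only [hyperplaneReflection_eq, inner_smul_left, inner_smul_right, smul_smul]
  congr 2
  simp only [conj_trivial]
  by_cases ha : ⟪a, a⟫ = 0
  · rw [ha]
    have : a = 0 := inner_self_eq_zero.mp ha
    simp [this]
  · field_simp

theorem hyperplaneReflection_neg (a : V) :
    hyperplaneReflection (-a) = hyperplaneReflection a := by
  have := hyperplaneReflection_smul (r := -1) (by norm_num) a
  simpa using this

theorem hyperplaneReflection_sub_comm (a b : V) :
    hyperplaneReflection (a - b) = hyperplaneReflection (b - a) := by
  rw [← hyperplaneReflection_neg, neg_sub]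

theorem hyperplaneReflection_swap {u w : V} (h : ⟪u, u⟫ = ⟪w, w⟫) :
    hyperplaneReflection (u - w) u = w := by
  refine Submodule.reflection_sub ?_
  rw [real_inner_self_eq_norm_sq, real_inner_self_eq_norm_sq] at h
  exact (sq_eq_sq₀ (norm_nonneg _) (norm_nonneg _)).mp h

theorem hyperplaneReflection_swap' {u w : V} (h : ⟪u, u⟫ = ⟪w, w⟫) :
    hyperplaneReflection (u - w) w = u := by
  rw [hyperplaneReflection_sub_comm, hyperplaneReflection_swap h.symm]

theorem inner_eq_zero_of_hyperplaneReflection_eq {a x : V}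
    (h : hyperplaneReflection a x = x) : ⟪a, x⟫ = 0 := by
  rw [hyperplaneReflection_eq, sub_eq_self, smul_eq_zero] at h
  rcases h with h | h
  · rcases div_eq_zero_iff.mp h with h | h
    · linarith
    · simp [inner_self_eq_zero.mp h]
  · simp [h]

theorem sub_hyperplaneReflection_mem_span (a x : V) :
    x - hyperplaneReflection a x ∈ Submodule.span ℝ {a} := by
  rw [hyperplaneReflection_eq, sub_sub_cancel]
  exact Submodule.smul_mem _ _ (Submodule.mem_span_singleton_self a)

/-- The product of the reflections in the vectors of a list. -/
def prodR (L : List V) : V ≃ₗᵢ[ℝ] V := (L.map hyperplaneReflection).prod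

@[simp] theorem prodR_nil : prodR ([] : List V) = 1 := rfl

theorem prodR_cons (a : V) (L : List V) : prodR (a :: L) = hyperplaneReflection a * prodR L := by
  simp [prodR]

theorem prodR_append (L L' : List V) : prodR (L ++ L') = prodR L * prodR L' := by
  simp [prodR]

theorem prodR_cons_apply (a : V) (L : List V) (x : V) :
    prodR (a :: L) x = hyperplaneReflection a (prodR L x) := by
  rw [prodR_cons]; rfl

theorem prodR_append_apply (L L' : List V) (x : V) :
    prodR (L ++ L') x = prodR L (prodR L' x) := by
  rw [prodR_append]; rfl

/-- Each vector of the list lies outside the span of the later ones. -/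
def ListIndep : List V → Prop
  | [] => True
  | a :: L => a ∉ Submodule.span ℝ {x | x ∈ L} ∧ ListIndep L

theorem span_cons (a : V) (L : List V) :
    Submodule.span ℝ {x | x ∈ a :: L} = Submodule.span ℝ {a} ⊔ Submodule.span ℝ {x | x ∈ L} := by
  rw [← Submodule.span_union]
  congr 1
  ext x
  simp

theorem span_append_left (L L' : List V) :
    Submodule.span ℝ {x | x ∈ L} ≤ Submodule.span ℝ {x | x ∈ L ++ L'} :=
  Submodule.span_mono fun _ hx => List.mem_append.mpr (Or.inl hx)

theorem ListIndep.of_append_left {L L' : List V} (h : ListIndep (L ++ L')) : ListIndep L := by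
  induction L with
  | nil => trivial
  | cons a L ih => exact ⟨fun ha => h.1 (span_append_left L L' ha), ih h.2⟩

theorem sub_prodR_mem_span (L : List V) (x : V) :
    x - prodR L x ∈ Submodule.span ℝ {a | a ∈ L} := by
  induction L with
  | nil => simp
  | cons a L ih =>
    rw [prodR_cons_apply, span_cons, ← sub_add_sub_cancel x (prodR L x), add_comm]
    exact Submodule.add_mem_sup (sub_hyperplaneReflection_mem_span a _) ih

theorem inner_eq_zero_of_forall_mem {L : List V} {x y : V} (h : ∀ a ∈ L, ⟪x, a⟫ = 0)
    (hy : y ∈ Submodule.span ℝ {a | a ∈ L}) : ⟪x, y⟫ = 0 := by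
  induction hy using Submodule.span_induction with
  | mem a ha => exact h a ha
  | zero => simp
  | add y z _ _ hy hz => rw [inner_add_right, hy, hz, add_zero]
  | smul r y _ hy => rw [inner_smul_right, hy, mul_zero]

theorem prodR_apply_of_inner_eq_zero {L : List V} {x : V} (h : ∀ a ∈ L, ⟪x, a⟫ = 0) :
    prodR L x = x := by
  induction L with
  | nil => rfl
  | cons a L ih =>
    rw [prodR_cons_apply, ih fun b hb => h b (List.mem_cons_of_mem _ hb),
      hyperplaneReflection_of_inner_eq_zero]
    rw [real_inner_comm]
    exact h a List.mem_cons_self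

/-- In a factorization along a list outside whose tail span `a` lies, the head acts trivially as
soon as the displacement lies in the span of the tail. -/
theorem ListIndep.split {a : V} {L : List V} (h : ListIndep (a :: L)) {x : V}
    (hx : x - prodR (a :: L) x ∈ Submodule.span ℝ {y | y ∈ L}) :
    hyperplaneReflection a (prodR L x) = prodR L x := by
  rw [prodR_cons_apply] at hx
  obtain ⟨r, hr⟩ := Submodule.mem_span_singleton.mp
    (sub_hyperplaneReflection_mem_span a (prodR L x))
  have hmem : r • a ∈ Submodule.span ℝ {y | y ∈ L} := by
    rw [hr]
    have := Submodule.sub_mem _ hx (sub_prodR_mem_span L x)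
    simpa using this
  have hr0 : r = 0 := by
    by_contra h0
    exact h.1 ((Submodule.smul_mem_iff _ h0).mp hmem)
  rw [hr0, zero_smul, eq_comm, sub_eq_zero] at hr
  exact hr.symm

/-- A vector fixed by a product of reflections in independent vectors is orthogonal to all of
them. -/
theorem ListIndep.inner_eq_zero {L : List V} (h : ListIndep L) {x : V} (hx : prodR L x = x) :
    ∀ a ∈ L, ⟪a, x⟫ = 0 := by
  induction L with
  | nil => simp
  | cons a L ih =>
    have h1 := h.split (x := x) (by rw [hx, sub_self]; exact Submodule.zero_mem _)
    have h2 : prodR L x = x := by rw [← h1, ← prodR_cons_apply, hx]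
    intro b hb
    rcases List.mem_cons.mp hb with rfl | hb
    · rw [h2] at h1
      exact inner_eq_zero_of_hyperplaneReflection_eq h1
    · exact ih h.2 h2 b hb

/-- The reflections before `a` act trivially because the whole displacement `a` already lies in the
span of the tail. By independence only the reflection in `a` contributes to it, so `prodR L₂` fixes
`x`, and a fixed vector is orthogonal to every factor. -/
theorem ListIndep.inner_eq_zero_of_sub {L₁ L₂ : List V} {a : V}
    (h : ListIndep (L₁ ++ a :: L₂)) {x : V} (hx : x - prodR (L₁ ++ a :: L₂) x = a) :
    ∀ b ∈ L₂, ⟪b, x⟫ = 0 := by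
  induction L₁ with
  | nil =>
    have h' : ListIndep (a :: L₂) := h
    refine h'.2.inner_eq_zero ?_
    rw [List.nil_append, prodR_cons_apply] at hx
    obtain ⟨r, hr⟩ := Submodule.mem_span_singleton.mp
      (sub_hyperplaneReflection_mem_span a (prodR L₂ x))
    have key : (1 - r) • a = x - prodR L₂ x := by
      rw [sub_smul, hr, one_smul]
      nth_rewrite 1 [← hx]
      abel
    have hmem : (1 - r) • a ∈ Submodule.span ℝ {y | y ∈ L₂} := by
      rw [key]; exact sub_prodR_mem_span L₂ x
    have hr0 : 1 - r = 0 := by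
      by_contra h0
      exact h'.1 ((Submodule.smul_mem_iff _ h0).mp hmem)
    rw [hr0, zero_smul] at key
    exact (sub_eq_zero.mp key.symm).symm
  | cons d L₁ ih =>
    have h' : ListIndep (d :: (L₁ ++ a :: L₂)) := h
    have h1 := h'.split (x := x) (by
      rw [List.cons_append] at hx
      rw [hx]
      exact Submodule.subset_span (by simp))
    refine ih h'.2 ?_
    rw [← h1, ← prodR_cons_apply]
    exact hx

theorem pairwise_of_forall_append {α : Type*} {R : α → α → Prop} {L : List α}
    (h : ∀ L₁ a L₂, L = L₁ ++ a :: L₂ → ∀ b ∈ L₂, R a b) : L.Pairwise R := by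
  induction L with
  | nil => exact List.Pairwise.nil
  | cons a L ih =>
    refine List.Pairwise.cons (h [] a L rfl) (ih fun L₁ b L₂ hL => ?_)
    exact h (a :: L₁) b L₂ (by rw [hL]; rfl)

/-- The functional `⟪Z a, ·⟫` kills the tail after `a` but not `a` itself. -/
theorem ListIndep.of_pairwise {L : List V} (Z : V →ₗ[ℝ] V)
    (hL : L.Pairwise fun a b => ⟪Z a, b⟫ = 0) (h0 : ∀ a ∈ L, ⟪Z a, a⟫ ≠ 0) : ListIndep L := by
  induction L with
  | nil => trivial
  | cons a L ih =>
    rw [List.pairwise_cons] at hL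
    refine ⟨fun ha => h0 a List.mem_cons_self (inner_eq_zero_of_forall_mem hL.1 ha),
      ih hL.2 fun b hb => h0 b (List.mem_cons_of_mem _ hb)⟩

theorem finrank_span_singleton_le_one (a : V) :
    Module.finrank ℝ (Submodule.span ℝ {a}) ≤ 1 := by
  simpa using finrank_span_le_card (R := ℝ) ({a} : Set V)

theorem finrank_span_le_length [FiniteDimensional ℝ V] (L : List V) :
    Module.finrank ℝ (Submodule.span ℝ {x | x ∈ L}) ≤ L.length := by
  induction L with
  | nil =>
    have : {x : V | x ∈ ([] : List V)} = ∅ := by simp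
    rw [this, Submodule.span_empty]; simp
  | cons a L ih =>
    rw [span_cons]
    refine (Submodule.finrank_add_le_finrank_add_finrank _ _).trans ?_
    have := finrank_span_singleton_le_one a
    simp only [List.length_cons]
    omega

theorem ListIndep.finrank_span [FiniteDimensional ℝ V] {L : List V} (h : ListIndep L) :
    Module.finrank ℝ (Submodule.span ℝ {x | x ∈ L}) = L.length := by
  refine le_antisymm (finrank_span_le_length L) ?_
  induction L with
  | nil => simp
  | cons a L ih =>
    have hlt : Submodule.span ℝ {x | x ∈ L} < Submodule.span ℝ {x | x ∈ a :: L} := by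
      rw [span_cons]
      refine lt_of_le_of_ne le_sup_right fun he => h.1 ?_
      rw [he]
      exact Submodule.mem_sup_left (Submodule.mem_span_singleton_self a)
    have := Submodule.finrank_lt_finrank_of_lt hlt
    have := ih h.2
    simp only [List.length_cons]
    omega

/-- Each vector raises the dimension of the span by at most one, so a list that spans as many
dimensions as its length gains one at every step. -/
theorem listIndep_of_finrank [FiniteDimensional ℝ V] {L : List V}
    (h : L.length ≤ Module.finrank ℝ (Submodule.span ℝ {x | x ∈ L})) : ListIndep L := by
  induction L with
  | nil => trivial
  | cons a L ih =>
    have hL := finrank_span_le_length L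
    have hle : Module.finrank ℝ (Submodule.span ℝ {x | x ∈ a :: L}) ≤
        Module.finrank ℝ (Submodule.span ℝ {x | x ∈ L}) + 1 := by
      rw [span_cons]
      refine (Submodule.finrank_add_le_finrank_add_finrank _ _).trans ?_
      have := finrank_span_singleton_le_one a
      omega
    simp only [List.length_cons] at h
    refine ⟨fun ha => ?_, ih (by omega)⟩
    have : Submodule.span ℝ {x | x ∈ a :: L} = Submodule.span ℝ {x | x ∈ L} := by
      rw [span_cons, sup_eq_right, Submodule.span_singleton_le_iff_mem]
      exact ha
    rw [this] at h
    omega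

end Reflections

/-! ### The form of `c`, and initial segments of its reduced factorizations. -/

section AbsoluteOrder

variable {V : Type*} [NormedAddCommGroup V] [InnerProductSpace ℝ V]

/-- The group generated by the reflections in the vectors of a set. -/
def reflGroup (A : Set V) : Subgroup (V ≃ₗᵢ[ℝ] V) := Subgroup.closure (hyperplaneReflection '' A)

theorem hyperplaneReflection_mem_reflGroup {A : Set V} {a : V} (ha : a ∈ A) :
    hyperplaneReflection a ∈ reflGroup A :=
  Subgroup.subset_closure ⟨a, ha, rfl⟩

theorem prodR_mem {G : Subgroup (V ≃ₗᵢ[ℝ] V)} {L : List V}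
    (h : ∀ a ∈ L, hyperplaneReflection a ∈ G) : prodR L ∈ G := by
  refine Subgroup.list_prod_mem _ fun t ht => ?_
  obtain ⟨a, ha, rfl⟩ := List.mem_map.mp ht
  exact h a ha

theorem exists_list_map {α β : Type*} {f : α → β} {A : Set α} {l : List β}
    (h : ∀ t ∈ l, t ∈ f '' A) : ∃ L : List α, (∀ a ∈ L, a ∈ A) ∧ L.map f = l := by
  induction l with
  | nil => exact ⟨[], by simp, rfl⟩
  | cons t l ih =>
    obtain ⟨L, hL, hl⟩ := ih fun s hs => h s (List.mem_cons_of_mem _ hs)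
    obtain ⟨a, ha, rfl⟩ := h t List.mem_cons_self
    refine ⟨a :: L, fun b hb => ?_, by simp [hl]⟩
    rcases List.mem_cons.mp hb with rfl | hb
    · exact ha
    · exact hL b hb

theorem closure_map_hyperplaneReflection (L : List V) :
    Subgroup.closure {t | t ∈ L.map hyperplaneReflection} = reflGroup {a | a ∈ L} := by
  rw [reflGroup]
  congr 1
  ext t
  simp

variable {c : V ≃ₗᵢ[ℝ] V} {Z : V →ₗ[ℝ] V}

/-- The form `⟪(1 - c)⁻¹ u, v⟫` has the scalar product as its symmetrization. -/
theorem inner_add_inner_of_resolvent (hZ : ∀ u, Z u - c (Z u) = u) (u v : V) :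
    ⟪Z u, v⟫ + ⟪Z v, u⟫ = ⟪u, v⟫ := by
  -- Everything is expressed through `Z u`, `Z v` and their images; since `c` is an isometry, the
  -- claim becomes linear in these scalar products.
  have h : ⟪c (Z u), c (Z v)⟫ = ⟪Z u, Z v⟫ := c.inner_map_map _ _
  have h1 : ⟪Z u - c (Z u), Z v - c (Z v)⟫ = ⟪u, v⟫ := by rw [hZ, hZ]
  have h2 : ⟪Z u, Z v - c (Z v)⟫ = ⟪Z u, v⟫ := by rw [hZ]
  have h3 : ⟪Z v, Z u - c (Z u)⟫ = ⟪Z v, u⟫ := by rw [hZ]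
  simp only [inner_sub_left, inner_sub_right] at h1 h2 h3
  have h4 : ⟪Z v, c (Z u)⟫ = ⟪c (Z u), Z v⟫ := real_inner_comm _ _
  have h5 : ⟪Z v, Z u⟫ = ⟪Z u, Z v⟫ := real_inner_comm _ _
  linarith

theorem inner_self_of_resolvent (hZ : ∀ u, Z u - c (Z u) = u) (u : V) :
    ⟪Z u, u⟫ = ⟪u, u⟫ / 2 := by
  have := inner_add_inner_of_resolvent hZ u u
  linarith

/-- A right inverse makes `1 - c` surjective, hence injective in finite dimension. -/
theorem eq_zero_of_resolvent [FiniteDimensional ℝ V] (hZ : ∀ u, Z u - c (Z u) = u) {u : V}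
    (hu : c u = u) : u = 0 := by
  let D : V →ₗ[ℝ] V := LinearMap.id - c.toLinearEquiv.toLinearMap
  have hs : Function.Surjective D := fun u => ⟨Z u, hZ u⟩
  have hi := LinearMap.injective_iff_surjective.mpr hs
  apply hi
  rw [map_zero]
  exact sub_eq_zero.mpr hu.symm

theorem resolvent_eq [FiniteDimensional ℝ V] (hZ : ∀ u, Z u - c (Z u) = u) {u z : V}
    (h : z - c z = u) : Z u = z := by
  rw [← sub_eq_zero]
  apply eq_zero_of_resolvent hZ
  have h1 : c (Z u) = Z u - u := eq_sub_of_add_eq' (sub_eq_iff_eq_add.mp (hZ u)).symm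
  have h2 : c z = z - u := eq_sub_of_add_eq' (sub_eq_iff_eq_add.mp h).symm
  rw [map_sub, h1, h2]; abel

/-- Any `u` is the displacement of `Z u` under `c`, and displacements lie in the span of the
factors. -/
theorem span_eq_top_of_prodR (hZ : ∀ u, Z u - c (Z u) = u) {L : List V} (hL : prodR L = c) :
    Submodule.span ℝ {x | x ∈ L} = ⊤ := by
  rw [eq_top_iff]
  intro u _
  rw [← hZ u, ← hL]
  exact sub_prodR_mem_span L _

theorem finrank_le_length_of_prodR [FiniteDimensional ℝ V] (hZ : ∀ u, Z u - c (Z u) = u)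
    {L : List V} (hL : prodR L = c) : Module.finrank ℝ V ≤ L.length := by
  have := finrank_span_le_length L
  rwa [span_eq_top_of_prodR hZ hL, finrank_top] at this

theorem listIndep_of_prodR [FiniteDimensional ℝ V] (hZ : ∀ u, Z u - c (Z u) = u) {L : List V}
    (hL : prodR L = c) (hn : L.length ≤ Module.finrank ℝ V) : ListIndep L := by
  refine listIndep_of_finrank ?_
  rwa [span_eq_top_of_prodR hZ hL, finrank_top]

/-- The displacement of `Z a` under `c` is `a`, one of the factors; by
`ListIndep.inner_eq_zero_of_sub` the factors after `a` are orthogonal to `Z a`. This triangularity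
is what links factorizations of `c` to the form. -/
theorem pairwise_of_prodR (hZ : ∀ u, Z u - c (Z u) = u) {L : List V} (hL : prodR L = c)
    (hi : ListIndep L) : L.Pairwise fun a b => ⟪Z a, b⟫ = 0 := by
  refine pairwise_of_forall_append fun L₁ a L₂ h b hb => ?_
  subst h
  rw [real_inner_comm]
  refine hi.inner_eq_zero_of_sub ?_ b hb
  rw [hL, hZ]

/-- On the span of an initial segment of a factorization of `c` with product `x`, the forms of `c`
and of `x` agree. -/
theorem inner_resolvent_sub_prodR (hZ : ∀ u, Z u - c (Z u) = u) {L₁ L₂ : List V}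
    (hL : prodR (L₁ ++ L₂) = c) (hi : ListIndep (L₁ ++ L₂)) (u : V) :
    ∀ b ∈ L₁, ⟪Z (u - prodR L₁ u), b⟫ = ⟪u, b⟫ := by
  have hp := pairwise_of_prodR hZ hL hi
  rw [List.pairwise_append] at hp
  set z := Z (u - prodR L₁ u) with hz
  have hz2 : ∀ b ∈ L₂, ⟪z, b⟫ = 0 := by
    intro b hb
    have hu := sub_prodR_mem_span L₁ u
    rw [hz]
    generalize u - prodR L₁ u = v at hu
    induction hu using Submodule.span_induction with
    | mem a ha => exact hp.2.2 a ha b hb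
    | zero => simp
    | add y z _ _ hy hz => rw [map_add, inner_add_left, hy, hz, add_zero]
    | smul r y _ hy => rw [map_smul, inner_smul_left, hy, mul_zero]
  -- The rest `L₂` of the factorization is orthogonal to `z`, so on `z` the Coxeter element acts
  -- through `L₁` alone.
  have hfix : c z = prodR L₁ z := by
    rw [← hL, prodR_append_apply, prodR_apply_of_inner_eq_zero hz2]
  -- From `z - c z = u - prodR L₁ u` and `c z = prodR L₁ z`. A vector fixed by a product of
  -- independent reflections is orthogonal to all of `L₁`.
  have h1 : prodR L₁ (z - u) = z - u := by
    have := hZ (u - prodR L₁ u)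
    rw [← hz, hfix] at this
    rw [map_sub]
    rw [sub_eq_sub_iff_add_eq_add] at this ⊢
    rw [add_comm, ← this, add_comm]
  intro b hb
  have := hi.of_append_left.inner_eq_zero h1 b hb
  rw [inner_sub_right, sub_eq_zero] at this
  rw [real_inner_comm, this, real_inner_comm]

variable {T : Set (V ≃ₗᵢ[ℝ] V)} {R : Set V}

/-- The word that generates `W'` and the prefix witnessing `x ≤ c` may differ, but both are reduced
for `x`, so the former can replace the latter. The total length is at most `dim V` by `hc` and at
least `dim V` because the factors of `c` span. -/
theorem exists_lists_of_isNoncrossing [FiniteDimensional ℝ V] (hT : T = hyperplaneReflection '' R)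
    (hZ : ∀ u, Z u - c (Z u) = u)
    (hc : ∃ L : List V, (∀ a ∈ L, a ∈ R) ∧ prodR L = c ∧ L.length ≤ Module.finrank ℝ V)
    {W' : Subgroup (V ≃ₗᵢ[ℝ] V)} (h : IsNoncrossing T c W') :
    ∃ L₁ L₂ : List V, (∀ a ∈ L₁ ++ L₂, a ∈ R) ∧ prodR (L₁ ++ L₂) = c ∧
      (L₁ ++ L₂).length = Module.finrank ℝ V ∧ W' = reflGroup {a | a ∈ L₁} := by
  obtain ⟨x, ⟨l, l', hl, hll'⟩, k, hk, rfl⟩ := h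
  obtain ⟨L, hLR, hLc, hLn⟩ := hc
  have hlen : k.length = l.length :=
    le_antisymm (hk.2.2 l hl.1 hl.2.1) (hl.2.2 k hk.1 hk.2.1)
  have hmem : ∀ t ∈ k ++ l', t ∈ hyperplaneReflection '' R := by
    intro t ht
    rw [← hT]
    rcases List.mem_append.mp ht with ht | ht
    · exact hk.1 t ht
    · exact hll'.1 t (List.mem_append.mpr (Or.inr ht))
  obtain ⟨L₁, h1, rfl⟩ := exists_list_map fun t ht => hmem t (List.mem_append.mpr (Or.inl ht))
  obtain ⟨L₂, h2, rfl⟩ := exists_list_map fun t ht => hmem t (List.mem_append.mpr (Or.inr ht))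
  have hprod : prodR (L₁ ++ L₂) = c := by
    rw [prodR_append, prodR, prodR, hk.2.1, ← hl.2.1, ← List.prod_append, hll'.2.1]
  refine ⟨L₁, L₂, ?_, hprod, le_antisymm ?_ (finrank_le_length_of_prodR hZ hprod), ?_⟩
  · intro a ha
    rcases List.mem_append.mp ha with ha | ha
    · exact h1 a ha
    · exact h2 a ha
  · have := hll'.2.2 (L.map hyperplaneReflection) (by
      intro t ht
      obtain ⟨a, ha, rfl⟩ := List.mem_map.mp ht
      rw [hT]
      exact ⟨a, hLR a ha, rfl⟩) hLc
    simp only [List.length_append, List.length_map] at this hlen ⊢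
    omega
  · exact closure_map_hyperplaneReflection L₁

/-- No word for `c` is shorter than `dim V`; a shorter word for the prefix would produce one. -/
theorem isNoncrossing_of_lists [FiniteDimensional ℝ V] (hT : T = hyperplaneReflection '' R)
    (hZ : ∀ u, Z u - c (Z u) = u) {L₁ L₂ : List V} (hR : ∀ a ∈ L₁ ++ L₂, a ∈ R)
    (hc : prodR (L₁ ++ L₂) = c) (hn : (L₁ ++ L₂).length ≤ Module.finrank ℝ V) :
    IsNoncrossing T c (reflGroup {a | a ∈ L₁}) := by
  have hmem : ∀ {L : List V}, (∀ a ∈ L, a ∈ R) → ∀ t ∈ L.map hyperplaneReflection, t ∈ T := by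
    intro L hL t ht
    obtain ⟨a, ha, rfl⟩ := List.mem_map.mp ht
    rw [hT]
    exact ⟨a, hL a ha, rfl⟩
  have h1 : ∀ a ∈ L₁, a ∈ R := fun a ha => hR a (List.mem_append.mpr (Or.inl ha))
  have hlong : ∀ l : List (V ≃ₗᵢ[ℝ] V), (∀ t ∈ l, t ∈ T) → l.prod = c →
      Module.finrank ℝ V ≤ l.length := by
    intro l hl hlc
    rw [hT] at hl
    obtain ⟨L, -, rfl⟩ := exists_list_map hl
    rw [List.length_map]
    exact finrank_le_length_of_prodR hZ hlc
  have hred : IsReducedWord T (L₁.map hyperplaneReflection) (prodR L₁) := by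
    refine ⟨hmem h1, rfl, fun l' hl' hp => ?_⟩
    have := hlong (l' ++ L₂.map hyperplaneReflection) (by
      intro t ht
      rcases List.mem_append.mp ht with ht | ht
      · exact hl' t ht
      · exact hmem (fun a ha => hR a (List.mem_append.mpr (Or.inr ha))) t ht)
      (by rw [List.prod_append, hp, ← hc, prodR_append]; rfl)
    simp only [List.length_append, List.length_map] at this hn ⊢
    omega
  refine ⟨prodR L₁, ⟨_, L₂.map hyperplaneReflection, hred, ?_, ?_, ?_⟩, _, hred,
    (closure_map_hyperplaneReflection L₁).symm⟩
  · rw [← List.map_append]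
    exact hmem hR
  · rw [← List.map_append, ← hc]; rfl
  · intro l' hl' hp
    have := hlong l' hl' hp
    simp only [List.length_append, List.length_map] at hn ⊢
    omega

/-- The factors after `a` fix `Z a` by triangularity. The reflection in `a` subtracts exactly `a`,
because `⟪Z a, a⟫` is half of `⟪a, a⟫`. A factor `b` before `a` fixes the result: `⟪Z b, a⟫ = 0` and
the symmetrization give `⟪Z a, b⟫ = ⟪a, b⟫`. -/
theorem prodR_resolvent (hZ : ∀ u, Z u - c (Z u) = u) {A B : List V} {a : V}
    (hp : (A ++ a :: B).Pairwise fun a b => ⟪Z a, b⟫ = 0) (ha : ⟪a, a⟫ ≠ 0) :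
    prodR (A ++ a :: B) (Z a) = Z a - a := by
  rw [List.pairwise_append, List.pairwise_cons] at hp
  have h1 : hyperplaneReflection a (Z a) = Z a - a := by
    rw [hyperplaneReflection_eq, real_inner_comm, inner_self_of_resolvent hZ]
    congr 1
    rw [mul_div_cancel₀ _ (by norm_num), div_self ha, one_smul]
  rw [prodR_append_apply, prodR_cons_apply, prodR_apply_of_inner_eq_zero hp.2.1.1, h1]
  refine prodR_apply_of_inner_eq_zero fun b hb => ?_
  have h2 := hp.2.2 b hb a List.mem_cons_self
  have h3 := inner_add_inner_of_resolvent hZ a b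
  rw [inner_sub_left]
  linarith

/-- A list of vectors that is triangular for the form of `c` is an initial segment of a
factorization of `c`, once elements of the group are products of as many reflections as the
codimension of their fixed space. -/
theorem isNoncrossing_of_pairwise [FiniteDimensional ℝ V] (hT : T = hyperplaneReflection '' R)
    (hZ : ∀ u, Z u - c (Z u) = u) {G : Subgroup (V ≃ₗᵢ[ℝ] V)} (hcG : c ∈ G)
    (hRG : ∀ a ∈ R, hyperplaneReflection a ∈ G) (hR0 : ∀ a ∈ R, a ≠ 0)
    (carter : ∀ w ∈ G, ∀ F : Submodule ℝ V, (∀ v ∈ F, w v = v) →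
      ∃ L : List V, (∀ a ∈ L, a ∈ R) ∧ prodR L = w ∧
        L.length + Module.finrank ℝ F ≤ Module.finrank ℝ V)
    {L : List V} (hL : ∀ a ∈ L, a ∈ R) (hp : L.Pairwise fun a b => ⟪Z a, b⟫ = 0) :
    IsNoncrossing T c (reflGroup {a | a ∈ L}) := by
  have h0 : ∀ a ∈ L, ⟪a, a⟫ ≠ 0 := fun a ha => by
    rw [Ne, inner_self_eq_zero]; exact hR0 a (hL a ha)
  have hi : ListIndep L := ListIndep.of_pairwise Z hp fun a ha => by
    rw [inner_self_of_resolvent hZ]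
    exact div_ne_zero (h0 a ha) two_ne_zero
  have hZi : Function.Injective Z := by
    intro u v h
    rw [← hZ u, ← hZ v, h]
  have hxG : prodR L ∈ G := prodR_mem fun a ha => hRG a (hL a ha)
  -- On `Z` applied to the span of `L` the product of `L` agrees with `c`. The quotient therefore
  -- fixes a space of dimension `L.length` and needs only `dim V - L.length` further reflections.
  obtain ⟨L', hL', hy, hn⟩ := carter ((prodR L)⁻¹ * c) (G.mul_mem (G.inv_mem hxG) hcG)
    ((Submodule.span ℝ {a | a ∈ L}).map Z) (by
      rintro _ ⟨u, hu, rfl⟩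
      induction hu using Submodule.span_induction with
      | mem a ha =>
        obtain ⟨A, B, hAB⟩ := List.append_of_mem ha
        have h1 : prodR L (Z a) = c (Z a) := by
          have := hZ a
          rw [sub_eq_iff_eq_add, ← sub_eq_iff_eq_add'] at this
          rw [← this]
          subst hAB
          exact prodR_resolvent hZ hp (h0 a ha)
        rw [LinearIsometryEquiv.coe_mul, Function.comp_apply, ← h1]
        exact (prodR L).symm_apply_apply _
      | zero => simp
      | add y z _ _ hy hz => rw [map_add, map_add, hy, hz]
      | smul r y _ hy => rw [map_smul, map_smul, hy])
  rw [← (Submodule.equivMapOfInjective Z hZi _).finrank_eq, hi.finrank_span] at hn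
  refine isNoncrossing_of_lists hT hZ (L₂ := L') ?_ ?_ ?_
  · intro a ha
    rcases List.mem_append.mp ha with ha | ha
    · exact hL a ha
    · exact hL' a ha
  · rw [prodR_append, hy, mul_inv_cancel_left]
  · rw [List.length_append]; omega

end AbsoluteOrder

/-! ### Crossing and separation of convex sets in a plane. -/

section Hulls

variable {E : Type*} [NormedAddCommGroup E] [InnerProductSpace ℝ E]

theorem notMem_intrinsicFrontier_of_mem_intrinsicInterior {K : Set E} {p : E}
    (h : p ∈ intrinsicInterior ℝ K) : p ∉ intrinsicFrontier ℝ K := by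
  intro h'
  rw [← intrinsicClosure_sdiff_intrinsicInterior] at h'
  exact h'.2 h

/-- A point of a convex set from which one can prolong every segment of the set belongs to the
relative interior. -/
theorem mem_intrinsicInterior_of_forall_exists [FiniteDimensional ℝ E] {K : Set E}
    (hK : Convex ℝ K) {p : E} (hp : p ∈ K)
    (h : ∀ q ∈ K, ∃ ε : ℝ, 0 < ε ∧ p - ε • (q - p) ∈ K) : p ∈ intrinsicInterior ℝ K := by
  obtain ⟨_, q, hq, rfl⟩ := Set.Nonempty.intrinsicInterior hK ⟨p, hp⟩
  have hqK : (q : E) ∈ K :=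
    (interior_subset hq : q ∈ ((↑) ⁻¹' K : Set (affineSpan ℝ K)))
  obtain ⟨ε, hε, hp'⟩ := h q hqK
  set p' := p - ε • ((q : E) - p) with hp'_def
  have hpS := subset_affineSpan ℝ K hp
  have hpS' := subset_affineSpan ℝ K hp'
  -- The dilation with center `p'` and ratio `(1 + ε) / ε` takes `p` to the relatively interior
  -- point `q`. A neighborhood of `q` in `K` pulls back to one of `p`, and its points lie in `K` as
  -- convex combinations with `p'`.
  let f : affineSpan ℝ K → affineSpan ℝ K := fun y =>
    ⟨AffineMap.lineMap p' (y : E) ((1 + ε) / ε), AffineMap.lineMap_mem _ hpS' y.2⟩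
  have hf : Continuous f := by
    refine Continuous.subtype_mk ?_ _
    simp only [AffineMap.lineMap_apply_module']
    fun_prop
  have hfp : f ⟨p, hpS⟩ = q := by
    apply Subtype.ext
    simp only [f, AffineMap.lineMap_apply_module', hp'_def]
    have : (1 + ε) / ε * ε = 1 + ε := by field_simp
    rw [sub_sub_cancel, smul_smul, this]
    module
  refine ⟨⟨p, hpS⟩, ?_, rfl⟩
  rw [mem_interior_iff_mem_nhds] at hq ⊢
  have hn : f ⁻¹' ((↑) ⁻¹' K) ∈ nhds (⟨p, hpS⟩ : affineSpan ℝ K) := by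
    apply hf.continuousAt
    rwa [hfp]
  filter_upwards [hn] with y hy
  have hy' : AffineMap.lineMap p' (y : E) ((1 + ε) / ε) ∈ K := hy
  have hcomb : (y : E) = (1 - ε / (1 + ε)) • p' +
      (ε / (1 + ε)) • AffineMap.lineMap p' (y : E) ((1 + ε) / ε) := by
    rw [AffineMap.lineMap_apply_module', smul_add, smul_smul]
    have : ε / (1 + ε) * ((1 + ε) / ε) = 1 := by field_simp
    rw [this]
    module
  change (y : E) ∈ K
  rw [hcomb]
  refine hK hp' hy' ?_ (by positivity) (by ring)
  rw [sub_nonneg, div_le_one (by positivity)]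
  linarith

theorem Convex.add_smul_sub_add_smul_sub_mem {K : Set E} (hK : Convex ℝ K) {p q e : E} {a b : ℝ}
    (hp : p ∈ K) (hq : q ∈ K) (he : e ∈ K) (ha : 0 ≤ a) (hb : 0 ≤ b) (hab : a + b ≤ 1) :
    p + a • (q - p) + b • (e - p) ∈ K := by
  rcases eq_or_lt_of_le (add_nonneg ha hb) with h0 | h0
  · have h1 : a = 0 := by linarith
    have h2 : b = 0 := by linarith
    simpa [h1, h2] using hp
  · have hy : (a / (a + b)) • q + (b / (a + b)) • e ∈ K :=
      hK hq he (by positivity) (by positivity) (by field_simp)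
    have := hK hp hy (a := 1 - (a + b)) (b := a + b) (by linarith) h0.le (by ring)
    convert this using 1
    rw [smul_add, smul_smul, smul_smul, mul_div_cancel₀ _ h0.ne', mul_div_cancel₀ _ h0.ne']
    module

variable (b : OrthonormalBasis (Fin 2) ℝ E)

/-- The determinant of two vectors of an oriented plane. -/
def cross (u v : E) : ℝ := ⟪b 0, u⟫ * ⟪b 1, v⟫ - ⟪b 1, u⟫ * ⟪b 0, v⟫

/-- Twice the oriented area of a triangle. -/
def area (A B C : E) : ℝ := cross b (B - A) (C - A)

/-- Cramer's rule in dimension two, without division. -/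
theorem cross_smul_eq (u v x : E) : cross b u v • x = cross b x v • u + cross b u x • v := by
  have h : ∀ y : E, y = ⟪b 0, y⟫ • b 0 + ⟪b 1, y⟫ • b 1 := fun y => by
    conv_lhs => rw [← b.sum_repr' y]
    rw [Fin.sum_univ_two]
  rw [h x, h u, h v]
  have h00 : ⟪b 0, b 0⟫ = 1 := by simp
  have h11 : ⟪b 1, b 1⟫ = 1 := by simp
  have h01 : ⟪b 0, b 1⟫ = 0 := b.orthonormal.2 (by simp)
  have h10 : ⟪b 1, b 0⟫ = 0 := b.orthonormal.2 (by simp)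
  simp only [cross, inner_add_right, inner_smul_right, h00, h11, h01, h10]
  module

theorem cross_sub_right (u v w : E) : cross b u (v - w) = cross b u v - cross b u w := by
  simp only [cross, inner_sub_right]; ring

theorem cross_smul_right (u v : E) (r : ℝ) : cross b u (r • v) = r * cross b u v := by
  simp only [cross, inner_smul_right]; ring

theorem cross_self (u : E) : cross b u u = 0 := by
  simp only [cross]; ring

theorem cross_comm (u v : E) : cross b u v = -cross b v u := by
  simp only [cross]; ring

/-- Two convex sets that contain the diagonals of a convex quadrilateral cross. -/
theorem not_hullsNoncrossing [FiniteDimensional ℝ E] {K L : Set E} (hK : Convex ℝ K)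
    (hL : Convex ℝ L) {A B C D : E} (hA : A ∈ K) (hB : B ∈ L) (hC : C ∈ K) (hD : D ∈ L)
    (hBCD : 0 < area b B C D) (hABD : 0 < area b A B D) (hACD : 0 < area b A C D)
    (hABC : 0 < area b A B C) : ¬ HullsNoncrossing K L := by
  -- Twice the area of the quadrilateral. The diagonals meet at the point `p` that divides `AC` in
  -- the ratio of the areas of `ABD` and `BCD`.
  set s := area b B C D + area b A B D with hs
  have hs' : s = area b A C D + area b A B C := by
    simp only [hs, area, cross, inner_sub_right]; ring
  have hspos : 0 < s := by positivity
  set τ := area b A B D / s with hτ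
  have hτ0 : 0 < τ := by positivity
  have hτ1 : τ < 1 := by rw [hτ, div_lt_one hspos]; linarith
  set p := A + τ • (C - A) with hp
  have hpK : p ∈ K := by
    have := hK hA hC (a := 1 - τ) (b := τ) (by linarith) hτ0.le (by ring)
    convert this using 1
    rw [hp]; module
  have hpL : p ∈ L := by
    have hσ1 : area b A B C / s ≤ 1 := by rw [div_le_one hspos]; linarith
    have := hL hB hD (a := 1 - area b A B C / s) (b := area b A B C / s) (by linarith)
      (by positivity) (by ring)
    convert this using 1
    have key := cross_smul_eq b (C - A) (D - B) (B - A)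
    have e1 : cross b (C - A) (D - B) = s := by
      simp only [hs, area, cross, inner_sub_right]; ring
    have e2 : cross b (B - A) (D - B) = area b A B D := by
      simp only [area, cross, inner_sub_right]; ring
    have e3 : cross b (C - A) (B - A) = - area b A B C := by
      simp only [area, cross, inner_sub_right]; ring
    rw [e1, e2, e3] at key
    have key' : B - A = τ • (C - A) - (area b A B C / s) • (D - B) := by
      have : B - A = s⁻¹ • (s • (B - A)) := by rw [smul_smul, inv_mul_cancel₀ hspos.ne', one_smul]
      rw [this, key, smul_add, smul_smul, smul_smul, hτ, div_eq_inv_mul, div_eq_inv_mul]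
      module
    have : τ • (C - A) = B - A + (area b A B C / s) • (D - B) := by rw [key']; abel
    rw [hp, this]
    module
  have hv : ∀ x, cross b (C - A) (x - p) = cross b (C - A) (x - A) := by
    intro x
    have : x - p = (x - A) - τ • (C - A) := by rw [hp]; abel
    rw [this, cross_sub_right, cross_smul_right, cross_self]; ring
  rintro (h | ⟨p', hp', hbd, -⟩)
  · exact Set.disjoint_left.mp h hpK hpL
  have hpp' : p = p' := by
    have : p ∈ K ∩ L := ⟨hpK, hpL⟩
    rw [hp'] at this
    exact this
  subst hpp'
  have huniq : ∀ x, x ∈ K → x ∈ L → x = p := fun x hx hx' => by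
    have : x ∈ K ∩ L := ⟨hx, hx'⟩
    rw [hp'] at this
    exact this
  rcases hbd with hbd | hbd
  · have hnot := mt notMem_intrinsicFrontier_of_mem_intrinsicInterior (not_not.mpr hbd)
    have := mt (mem_intrinsicInterior_of_forall_exists hK hpK) hnot
    push Not at this
    -- If `p` is not relatively interior to `K`, some segment of `K` from a point `q` to `p` cannot
    -- be prolonged. As `p` lies inside the segment `AC`, this `q` is off the line `AC`.
    obtain ⟨q, hq, hqε⟩ := this
    have hcq : cross b (C - A) (q - p) ≠ 0 := by
      intro h0
      have hD' : cross b (C - A) (D - A) ≠ 0 := hACD.ne'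
      have key := cross_smul_eq b (C - A) (D - A) (q - p)
      rw [h0, zero_smul, add_zero] at key
      set r := cross b (q - p) (D - A) / cross b (C - A) (D - A) with hr
      have hqp : q - p = r • (C - A) := by
        have : q - p = (cross b (C - A) (D - A))⁻¹ • (cross b (C - A) (D - A) • (q - p)) := by
          rw [smul_smul, inv_mul_cancel₀ hD', one_smul]
        rw [this, key, smul_smul, hr, div_eq_inv_mul]
      set δ := min τ (1 - τ) with hδ
      have hδ0 : 0 < δ := lt_min hτ0 (by linarith)
      refine hqε (δ / (1 + |r|)) (by positivity) ?_
      have hle : |δ / (1 + |r|) * r| ≤ δ := by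
        rw [abs_mul, abs_of_pos (by positivity : 0 < δ / (1 + |r|)), div_mul_eq_mul_div,
          div_le_iff₀ (by positivity)]
        nlinarith [abs_nonneg r]
      rw [abs_le] at hle
      have h1 : δ ≤ τ := min_le_left _ _
      have h2 : δ ≤ 1 - τ := min_le_right _ _
      have := hK hA hC (a := 1 - (τ - δ / (1 + |r|) * r)) (b := τ - δ / (1 + |r|) * r)
        (by linarith) (by linarith) (by ring)
      convert this using 1
      rw [hqp, smul_smul, hp]
      module
    -- If `X` lies on the same side of `AC` as `q`, the segment from `p` to `X` starts inside the
    -- triangle `ACq` of `K`. Its points near `p` are then further common points of `K` and `L`.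
    have main : ∀ X ∈ L, 0 < cross b (C - A) (X - p) / cross b (C - A) (q - p) → False := by
      intro X hX hpos
      set σ := cross b (C - A) (X - p) / cross b (C - A) (q - p) with hσ
      set r := cross b (X - p) (q - p) / cross b (C - A) (q - p) with hr
      have key : X - p = σ • (q - p) + r • (C - A) := by
        have h := cross_smul_eq b (C - A) (q - p) (X - p)
        have : X - p = (cross b (C - A) (q - p))⁻¹ • (cross b (C - A) (q - p) • (X - p)) := by
          rw [smul_smul, inv_mul_cancel₀ hcq, one_smul]
        rw [this, h, smul_add, smul_smul, smul_smul, hσ, hr, div_eq_inv_mul, div_eq_inv_mul]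
        module
      have hXp : X ≠ p := by
        rintro rfl
        rw [hσ, sub_self] at hpos
        simp [cross] at hpos
      have hex : ∃ e ∈ K, ∃ t : ℝ, 0 ≤ t ∧ t • (e - p) = r • (C - A) := by
        rcases le_total 0 r with h | h
        · refine ⟨C, hC, r / (1 - τ), div_nonneg h (by linarith), ?_⟩
          have : C - p = (1 - τ) • (C - A) := by rw [hp]; module
          rw [this, smul_smul, div_mul_cancel₀ _ (by linarith)]
        · refine ⟨A, hA, -r / τ, div_nonneg (by linarith) hτ0.le, ?_⟩
          have : A - p = (-τ) • (C - A) := by rw [hp]; module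
          rw [this, smul_smul]
          congr 1
          field_simp
      obtain ⟨e, he, t, ht, het⟩ := hex
      set ε := 1 / (1 + σ + t) with hε
      have hε0 : 0 < ε := by positivity
      have hε1 : ε * (1 + σ + t) = 1 := by rw [hε]; field_simp
      have hmemK : p + ε • (X - p) ∈ K := by
        have := Convex.add_smul_sub_add_smul_sub_mem hK (a := ε * σ) (b := ε * t) hpK hq he
          (by positivity) (by positivity) (by nlinarith)
        convert this using 1
        rw [mul_smul ε t, het, key, smul_add, smul_smul]
        abel
      have hmemL : p + ε • (X - p) ∈ L := by
        have := hL hpL hX (a := 1 - ε) (b := ε) (by nlinarith) hε0.le (by ring)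
        convert this using 1
        module
      have h1 := huniq _ hmemK hmemL
      rw [add_eq_left, smul_eq_zero, sub_eq_zero] at h1
      rcases h1 with h1 | h1
      · exact hε0.ne' h1
      · exact hXp h1
    -- `B` and `D` lie on opposite sides of `AC`, so one of them is on the side of `q`.
    rcases lt_or_gt_of_ne hcq with h | h
    · refine main B hB (div_pos_of_neg_of_neg ?_ h)
      rw [hv, cross_comm]
      exact neg_neg_of_pos hABC
    · refine main D hD (div_pos ?_ h)
      rw [hv]
      exact hACD
  · rw [hbd] at hA hC
    rw [Set.mem_singleton_iff.mp hA, Set.mem_singleton_iff.mp hC] at hACD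
    simp [area, cross] at hACD

theorem disjoint_convexHull (φ : E →ₗ[ℝ] ℝ) {s s' : Set E} (t : ℝ) (h : ∀ x ∈ s, φ x ≤ t)
    (h' : ∀ x ∈ s', t < φ x) : Disjoint (convexHull ℝ s) (convexHull ℝ s') := by
  have h1 : convexHull ℝ s ⊆ {x | φ x ≤ t} :=
    convexHull_min h (convex_halfSpace_le φ.isLinear t)
  have h2 : convexHull ℝ s' ⊆ {x | t < φ x} :=
    convexHull_min h' (convex_halfSpace_gt φ.isLinear t)
  rw [Set.disjoint_left]
  intro x hx hx'
  have h3 : φ x ≤ t := h1 hx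
  have h4 : t < φ x := h2 hx'
  linarith

/-- An open half-plane together with one point of its boundary line is convex. -/
theorem convexHull_subset_pointed (φ : E →ₗ[ℝ] ℝ) {s : Set E} (h : ∀ x ∈ s, x = 0 ∨ 0 < φ x) :
    convexHull ℝ s ⊆ {x | x = 0 ∨ 0 < φ x} := by
  refine convexHull_min h ?_
  intro x hx y hy a c ha hc hac
  rcases eq_or_lt_of_le ha with rfl | ha
  · simpa [show c = 1 by linarith] using hy
  rcases eq_or_lt_of_le hc with rfl | hc
  · simpa [show a = 1 by linarith] using hx
  rcases hx with rfl | hx <;> rcases hy with rfl | hy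
  · left; simp
  · right; rw [smul_zero, zero_add, map_smul, smul_eq_mul]; positivity
  · right; rw [smul_zero, add_zero, map_smul, smul_eq_mul]; positivity
  · right; rw [map_add, map_smul, map_smul, smul_eq_mul, smul_eq_mul]; positivity

/-- A segment from another point `q` of `K` to `0` cannot continue past `0`, where `φ` becomes
negative; were `0` relatively interior, it could. -/
theorem zero_mem_relBoundary (φ : E →ₗ[ℝ] ℝ) {K : Set E} (h0 : (0 : E) ∈ K)
    (h : ∀ x ∈ K, x = 0 ∨ 0 < φ x) : (0 : E) ∈ relBoundary K := by
  by_cases hK : K = {0}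
  · exact Or.inr hK
  left
  obtain ⟨q, hq, hq0⟩ : ∃ q ∈ K, q ≠ 0 := by
    by_contra hc
    push Not at hc
    exact hK (Set.eq_singleton_iff_unique_mem.mpr ⟨h0, hc⟩)
  have hφ : 0 < φ q := (h q hq).resolve_left hq0
  rw [← intrinsicClosure_sdiff_intrinsicInterior]
  refine ⟨subset_intrinsicClosure h0, ?_⟩
  rintro ⟨y, hy, hy0⟩
  rw [mem_interior_iff_mem_nhds] at hy
  let f : ℝ → affineSpan ℝ K := fun t =>
    ⟨t • q, by
      simpa [AffineMap.lineMap_apply_module'] using AffineMap.lineMap_mem t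
        (subset_affineSpan ℝ K h0) (subset_affineSpan ℝ K hq)⟩
  have hf : Continuous f := Continuous.subtype_mk (by fun_prop) _
  have hf0 : f 0 = y := by
    apply Subtype.ext
    rw [hy0]
    simp [f]
  have hn : f ⁻¹' ((↑) ⁻¹' K) ∈ nhds (0 : ℝ) := by
    apply hf.continuousAt
    rwa [hf0]
  obtain ⟨ε, hε, hball⟩ := Metric.mem_nhds_iff.mp hn
  have hmem : f (-(ε / 2)) ∈ ((↑) ⁻¹' K : Set (affineSpan ℝ K)) := by
    apply hball
    rw [Metric.mem_ball, Real.dist_eq, sub_zero, abs_neg, abs_of_pos (by positivity)]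
    linarith
  have hmem' : -(ε / 2) • q ∈ K := hmem
  rcases h _ hmem' with h1 | h1
  · rw [smul_eq_zero] at h1
    rcases h1 with h1 | h1
    · linarith
    · exact hq0 h1
  · rw [map_smul, smul_eq_mul] at h1
    nlinarith

/-- The line `φ = 0` separates the two hulls except at `0`, which is an exposed point of both. -/
theorem hullsNoncrossing_of_touching (φ : E →ₗ[ℝ] ℝ) {s s' : Set E} (h0 : (0 : E) ∈ s)
    (h0' : (0 : E) ∈ s') (h : ∀ x ∈ s, x = 0 ∨ 0 < φ x) (h' : ∀ x ∈ s', x = 0 ∨ φ x < 0) :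
    HullsNoncrossing (convexHull ℝ s) (convexHull ℝ s') := by
  have h1 := convexHull_subset_pointed φ h
  have h2 := convexHull_subset_pointed (-φ) (s := s') fun x hx => by simpa using h' x hx
  have m1 := subset_convexHull ℝ s h0
  have m2 := subset_convexHull ℝ s' h0'
  refine Or.inr ⟨0, ?_, zero_mem_relBoundary φ m1 h1, zero_mem_relBoundary (-φ) m2 h2⟩
  refine Set.eq_singleton_iff_unique_mem.mpr ⟨⟨m1, m2⟩, ?_⟩
  rintro x ⟨hx, hx'⟩
  rcases h1 hx with h3 | h3
  · exact h3
  rcases h2 hx' with h4 | h4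
  · exact h4
  · rw [LinearMap.neg_apply] at h4
    linarith

/-- A convex set symmetric about the origin and one that contains the origin only cross trivially
if the former is a point. -/
theorem eq_zero_of_hullsNoncrossing [FiniteDimensional ℝ E] {K L : Set E} (hK : Convex ℝ K)
    (hneg : ∀ x ∈ K, -x ∈ K) (h0 : (0 : E) ∈ K) (h0' : (0 : E) ∈ L) (h : HullsNoncrossing K L) :
    K = {0} := by
  rcases h with h | ⟨p, hp, hbd, -⟩
  · exact absurd h0' (Set.disjoint_left.mp h h0)
  have : (0 : E) = p := by
    have : (0 : E) ∈ K ∩ L := ⟨h0, h0'⟩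
    rw [hp] at this
    exact this
  subst this
  rcases hbd with hbd | hbd
  · refine absurd hbd (notMem_intrinsicFrontier_of_mem_intrinsicInterior ?_)
    -- By symmetry every segment ending at `0` extends to the opposite of its other end.
    refine mem_intrinsicInterior_of_forall_exists hK h0 fun q hq => ⟨1, one_pos, ?_⟩
    simpa using hneg q hq
  · exact hbd

end Hulls

/-! ### Frames, the Coxeter plane, and the projection to a regular polygon. -/

section Frames

variable {V : Type*} [NormedAddCommGroup V] [InnerProductSpace ℝ V]

/-- A spanning set `{f i} ∪ {±g}` on which the isometry `c` acts like the rotation of a regular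
`2m`-gon together with an exchange of `±g`. -/
structure Frame (c : V ≃ₗᵢ[ℝ] V) (m : ℕ) (f : ℤ → V) (g : V) : Prop where
  three_le : 3 ≤ m
  map_f : ∀ i, c (f i) = f (i + 1)
  f_add : ∀ i, f (i + m) = -f i
  map_g : c g = -g
  g_ne : g ≠ 0
  inj : ∀ k : ℕ, 0 < k → k < 2 * m → f k ≠ f 0
  span : Submodule.span ℝ (Set.range f ∪ {g}) = ⊤
  pos : ∑ j ∈ Finset.range (2 * m), Real.cos (Real.pi * j / m) * ⟪f 0, f j⟫ ≠ 0

namespace Frame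

variable {c : V ≃ₗᵢ[ℝ] V} {m : ℕ} {f : ℤ → V} {g : V} (F : Frame c m f g)

include F

theorem m_pos : (0 : ℝ) < m := by
  have := F.three_le
  exact_mod_cast (by omega : 0 < m)

theorem f_add_two (i : ℤ) : f (i + 2 * m) = f i := by
  rw [two_mul, ← add_assoc, F.f_add, F.f_add, neg_neg]

theorem f_sub (i : ℤ) : f (i - m) = -f i := by
  have := F.f_add (i - m)
  rw [sub_add_cancel] at this
  rw [this, neg_neg]

theorem f_add_mul (i k : ℤ) : f (i + 2 * m * k) = f i := by
  induction k using Int.induction_on with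
  | zero => simp
  | succ k ih => rw [mul_add, mul_one, ← add_assoc, F.f_add_two, ih]
  | pred k ih => rw [← F.f_add_two, ← ih]; congr 1; ring

theorem f_eq_of_dvd {i j : ℤ} (h : (2 * m : ℤ) ∣ i - j) : f i = f j := by
  obtain ⟨k, hk⟩ := h
  rw [show i = j + 2 * m * k by linarith, F.f_add_mul]

/-- Every `f k` equals `f l` with `l` in a prescribed half-open interval of length `2m`. -/
theorem exists_rep (a k : ℤ) : ∃ l, a ≤ l ∧ l < a + 2 * m ∧ f k = f l := by
  have hm : (0 : ℤ) < 2 * m := by have := F.three_le; omega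
  refine ⟨a + (k - a) % (2 * m), ?_, ?_, F.f_eq_of_dvd ?_⟩
  · have := Int.emod_nonneg (k - a) hm.ne'; omega
  · have := Int.emod_lt_of_pos (k - a) hm; omega
  · rw [show k - (a + (k - a) % (2 * m)) = (k - a) - (k - a) % (2 * m) by ring]
    exact Int.dvd_self_sub_emod

theorem inv_f (i : ℤ) : c⁻¹ (f i) = f (i - 1) := by
  have h := F.map_f (i - 1)
  rw [sub_add_cancel] at h
  rw [← h]
  exact c.symm_apply_apply _

theorem inv_g : c⁻¹ g = -g := by
  have h := F.map_g
  have h2 : c⁻¹ (c g) = g := c.symm_apply_apply g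
  rw [h, map_neg] at h2
  rw [← h2, neg_neg, h2]

theorem pow_f (k : ℕ) (i : ℤ) : (c ^ k) (f i) = f (i + k) := by
  induction k with
  | zero => simp
  | succ k ih =>
    rw [pow_succ', LinearIsometryEquiv.coe_mul, Function.comp_apply, ih, F.map_f]
    congr 1; push_cast; ring

theorem pow_g (k : ℕ) : (c ^ (2 * k)) g = g := by
  induction k with
  | zero => simp
  | succ k ih =>
    rw [mul_add, mul_one, pow_succ', pow_succ']
    simp only [LinearIsometryEquiv.coe_mul, Function.comp_apply]
    rw [ih, F.map_g, map_neg, F.map_g, neg_neg]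

theorem ext_of_frame {w w' : V →ₗ[ℝ] V} (hf : ∀ i, w (f i) = w' (f i)) (hg : w g = w' g) :
    w = w' := by
  refine LinearMap.ext_on F.span ?_
  rintro x (⟨i, rfl⟩ | rfl)
  · exact hf i
  · exact hg

theorem orderOf_eq : orderOf c = 2 * m := by
  have h3 := F.three_le
  have h1 : c ^ (2 * m) = 1 := by
    have : ((c ^ (2 * m) : V ≃ₗᵢ[ℝ] V).toLinearEquiv : V →ₗ[ℝ] V) = LinearMap.id := by
      refine F.ext_of_frame (fun i => ?_) ?_
      · change (c ^ (2 * m)) (f i) = f i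
        rw [F.pow_f]
        push_cast
        exact F.f_add_two i
      · exact F.pow_g m
    ext x
    exact congrArg (fun φ : V →ₗ[ℝ] V => φ x) this
  refine (orderOf_eq_iff (by omega)).mpr ⟨h1, fun k hk hk0 hck => F.inj k hk0 hk ?_⟩
  have := F.pow_f k 0
  rw [hck, zero_add] at this
  exact this.symm

theorem mem_plane {v : V} : v ∈ coxeterPlane c ↔
    c v + c⁻¹ v = (2 * Real.cos (Real.pi / m)) • v := by
  have hm := F.m_pos
  have : 2 * Real.pi / (orderOf c : ℝ) = Real.pi / m := by
    rw [F.orderOf_eq]; push_cast; field_simp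
  rw [← this]
  rfl

/-- The sum telescopes to `f i - f (i + m)`, which is `2 • f i`. -/
theorem exists_resolvent_f (i : ℤ) :
    (2⁻¹ : ℝ) • ∑ q ∈ Finset.range m, f (i + q) -
      c ((2⁻¹ : ℝ) • ∑ q ∈ Finset.range m, f (i + q)) = f i := by
  rw [map_smul, map_sum, ← smul_sub, ← Finset.sum_sub_distrib]
  have : ∀ q ∈ Finset.range m, f (i + q) - c (f (i + q)) =
      (fun k : ℕ => f (i + k)) q - (fun k : ℕ => f (i + k)) (q + 1) := by
    intro q _
    simp only
    rw [F.map_f]; push_cast; rw [add_assoc]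
  rw [Finset.sum_congr rfl this, Finset.sum_range_sub', F.f_add]
  simp only [Nat.cast_zero, add_zero]
  module

theorem exists_resolvent [FiniteDimensional ℝ V] :
    ∃ Z : V →ₗ[ℝ] V, ∀ u, Z u - c (Z u) = u := by
  let D : V →ₗ[ℝ] V := LinearMap.id - c.toLinearEquiv.toLinearMap
  have hD : ∀ v, D v = v - c v := fun v => rfl
  have hs : LinearMap.range D = ⊤ := by
    rw [eq_top_iff, ← F.span, Submodule.span_le]
    rintro x (⟨i, rfl⟩ | hx)
    · exact ⟨_, F.exists_resolvent_f i⟩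
    · rw [Set.mem_singleton_iff] at hx
      subst hx
      refine ⟨(2⁻¹ : ℝ) • x, ?_⟩
      rw [hD, map_smul, F.map_g]
      module
  obtain ⟨Z, hZ⟩ := D.exists_rightInverse_of_surjective hs
  exact ⟨Z, fun u => congrArg (fun φ : V →ₗ[ℝ] V => φ u) hZ⟩

theorem cos_pos : 0 < Real.cos (Real.pi / m) := by
  have hm := F.m_pos
  have h3 : (3 : ℝ) ≤ m := by exact_mod_cast F.three_le
  refine Real.cos_pos_of_mem_Ioo ⟨?_, ?_⟩
  · have : 0 < Real.pi / m := by positivity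
    linarith [Real.pi_pos]
  · rw [div_lt_div_iff₀ hm two_pos]
    nlinarith [Real.pi_pos]

theorem sin_pos : 0 < Real.sin (Real.pi / m) := by
  have hm := F.m_pos
  refine Real.sin_pos_of_pos_of_lt_pi (by positivity) ?_
  refine div_lt_self Real.pi_pos (by exact_mod_cast (by have := F.three_le; omega : 1 < m))

theorem map_mem_plane {v : V} (hv : v ∈ coxeterPlane c) : c v ∈ coxeterPlane c := by
  rw [F.mem_plane] at hv ⊢
  rw [← map_smul, ← hv, map_add]
  congr 1
  exact (c.symm_apply_apply v).trans (c.apply_symm_apply v).symm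

theorem inv_mem_plane {v : V} (hv : v ∈ coxeterPlane c) : c⁻¹ v ∈ coxeterPlane c := by
  have h := F.mem_plane.mp hv
  have : c⁻¹ v = (2 * Real.cos (Real.pi / m)) • v - c v := by rw [← h]; abel
  rw [this]
  exact Submodule.sub_mem _ (Submodule.smul_mem _ _ hv) (F.map_mem_plane hv)

/-- The self-adjoint operator `c + c⁻¹` has the eigenvalue `-2` at `g` and the positive eigenvalue
`2 cos (π / m)` on the plane. -/
theorem inner_g {v : V} (hv : v ∈ coxeterPlane c) : ⟪g, v⟫ = 0 := by
  have h := F.mem_plane.mp hv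
  have h1 : ⟪g, c v⟫ = -⟪g, v⟫ := by
    have := c.inner_map_map g v
    rw [F.map_g, inner_neg_left] at this
    linarith
  have h2 : ⟪g, c⁻¹ v⟫ = -⟪g, v⟫ := by
    have := (c⁻¹ : V ≃ₗᵢ[ℝ] V).inner_map_map g v
    rw [F.inv_g, inner_neg_left] at this
    linarith
  have h3 := congrArg (fun x => ⟪g, x⟫) h
  simp only [inner_add_right, inner_smul_right, h1, h2] at h3
  have := F.cos_pos
  have h4 : (2 * Real.cos (Real.pi / m) + 2) * ⟪g, v⟫ = 0 := by linarith
  rcases mul_eq_zero.mp h4 with h4 | h4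
  · linarith
  · exact h4

theorem cos_periodic (j : ℤ) :
    Real.cos (Real.pi * ((j + 2 * m : ℤ) : ℝ) / m) = Real.cos (Real.pi * j / m) := by
  have hm := F.m_pos
  rw [← Real.cos_add_two_pi (Real.pi * j / m)]
  congr 1; push_cast; field_simp

/-- The Fourier component `∑ cos (π j / m) • f j` over one period lies in the Coxeter plane by the
addition theorem. The field `pos` of a frame says precisely that `f 0` is not orthogonal to it,
which keeps the polygon from collapsing to a point. -/
theorem exists_mem_plane : ∃ a ∈ coxeterPlane c, ⟪f 0, a⟫ ≠ 0 := by
  have hm := F.m_pos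
  have shift : ∀ H : ℤ → V, (∀ j, H (j + 2 * m) = H j) →
      ∑ j ∈ Finset.range (2 * m), H (j + 1) = ∑ j ∈ Finset.range (2 * m), H j := by
    intro H hH
    have h1 := Finset.sum_range_succ (fun j : ℕ => H j) (2 * m)
    have h2 := Finset.sum_range_succ' (fun j : ℕ => H j) (2 * m)
    have h3 : H ((2 * m : ℕ) : ℤ) = H 0 := by
      have := hH 0
      rw [zero_add] at this
      rw [← this]; push_cast; rfl
    rw [h1, h3] at h2
    have h4 := add_right_cancel h2
    rw [h4]
    push_cast
    rfl
  set a := ∑ j ∈ Finset.range (2 * m), Real.cos (Real.pi * ((j : ℤ) : ℝ) / m) • f j with ha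
  refine ⟨a, ?_, ?_⟩
  · have h1 : c a = ∑ j ∈ Finset.range (2 * m),
        Real.cos (Real.pi * (((j : ℤ) - 1 : ℤ) : ℝ) / m) • f j := by
      rw [← shift (fun j => Real.cos (Real.pi * ((j - 1 : ℤ) : ℝ) / m) • f j)]
      · rw [ha, map_sum]
        refine Finset.sum_congr rfl fun j _ => ?_
        rw [map_smul, F.map_f, add_sub_cancel_right]
      · intro j
        rw [F.f_add_two, show j + 2 * m - 1 = (j - 1) + 2 * m by ring, F.cos_periodic]
    have h2 : c⁻¹ a = ∑ j ∈ Finset.range (2 * m),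
        Real.cos (Real.pi * (((j : ℤ) + 1 : ℤ) : ℝ) / m) • f j := by
      have h3 := shift (fun j => Real.cos (Real.pi * ((j : ℤ) : ℝ) / m) • f (j - 1)) (by
        intro j
        rw [show j + 2 * m - 1 = (j - 1) + 2 * m by ring, F.f_add_two, F.cos_periodic])
      simp only [add_sub_cancel_right] at h3
      rw [h3, ha, map_sum]
      refine Finset.sum_congr rfl fun j _ => ?_
      rw [map_smul, F.inv_f]
    rw [F.mem_plane, h1, h2, ha, Finset.smul_sum, ← Finset.sum_add_distrib]
    refine Finset.sum_congr rfl fun j _ => ?_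
    rw [← add_smul, smul_smul]
    congr 1
    have e1 : Real.pi * (((j : ℤ) - 1 : ℤ) : ℝ) / m = Real.pi * ((j : ℤ) : ℝ) / m - Real.pi / m := by
      push_cast; field_simp
    have e2 : Real.pi * (((j : ℤ) + 1 : ℤ) : ℝ) / m = Real.pi * ((j : ℤ) : ℝ) / m + Real.pi / m := by
      push_cast; field_simp
    rw [e1, e2, Real.cos_sub, Real.cos_add]
    ring
  · rw [ha, inner_sum]
    simp only [inner_smul_right, Int.cast_natCast]
    exact F.pos

theorem cos_sub_eq_one {i j : ℤ} (hij : -(2 * m : ℤ) < i - j) (hij' : i - j < 2 * m)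
    (h : Real.cos (Real.pi * i / m - Real.pi * j / m) = 1) : i = j := by
  have hm := F.m_pos
  have e : Real.pi * i / m - Real.pi * j / m = Real.pi / m * ((i - j : ℤ) : ℝ) := by
    push_cast; field_simp
  have hpm : 0 < Real.pi / m := by positivity
  have e2 : 2 * Real.pi = Real.pi / m * (2 * m) := by field_simp
  have h1 : -(2 * m : ℝ) < ((i - j : ℤ) : ℝ) := by exact_mod_cast hij
  have h2 : ((i - j : ℤ) : ℝ) < (2 * m : ℝ) := by exact_mod_cast hij'
  rw [e, Real.cos_eq_one_iff_of_lt_of_lt (by nlinarith) (by nlinarith)] at h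
  rcases mul_eq_zero.mp h with h | h
  · exact absurd h hpm.ne'
  · have : i - j = 0 := by exact_mod_cast h
    omega

variable [FiniteDimensional ℝ V]

theorem map_starProjection (v : V) :
    (coxeterPlane c).starProjection (c v) = c ((coxeterPlane c).starProjection v) := by
  set P := coxeterPlane c
  refine (Submodule.eq_starProjection_of_mem_of_inner_eq_zero
    (F.map_mem_plane (Submodule.starProjection_apply_mem _ _)) fun w hw => ?_)
  have h := Submodule.starProjection_inner_eq_zero (K := P) v (c⁻¹ w) (F.inv_mem_plane hw)
  rw [← map_sub]
  have h2 : c (c⁻¹ w) = w := c.apply_symm_apply w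
  rw [← h2, c.inner_map_map]
  exact h

/-- The projection to the Coxeter plane kills `g` and maps the `f i` to the vertices of a regular
polygon. -/
theorem exists_basis : ∃ (b : OrthonormalBasis (Fin 2) ℝ (coxeterPlane c)) (r : ℝ), 0 < r ∧
    (∀ i : ℤ, (coxeterPlane c).orthogonalProjectionOnto (f i) =
      (r * Real.cos (Real.pi * i / m)) • b 0 + (r * Real.sin (Real.pi * i / m)) • b 1) ∧
    (coxeterPlane c).orthogonalProjectionOnto g = 0 := by
  set P := coxeterPlane c with hP
  have hm := F.m_pos
  set C := Real.cos (Real.pi / m) with hC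
  set S := Real.sin (Real.pi / m) with hS
  have hS0 : 0 < S := F.sin_pos
  have hCS : S ^ 2 + C ^ 2 = 1 := Real.sin_sq_add_cos_sq _
  have hg : P.orthogonalProjectionOnto g = 0 := by
    rw [Submodule.orthogonalProjectionOnto_eq_zero_iff, Submodule.mem_orthogonal']
    exact fun v hv => F.inner_g hv
  set p := P.starProjection (f 0) with hp
  have hpP : p ∈ P := Submodule.starProjection_apply_mem _ _
  have hp0 : p ≠ 0 := by
    intro h0
    obtain ⟨a, ha, hne⟩ := F.exists_mem_plane
    apply hne
    have := Submodule.starProjection_inner_eq_zero (K := P) (f 0) a ha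
    rwa [← hp, h0, sub_zero] at this
  set r := ‖p‖ with hr
  have hr0 : 0 < r := norm_pos_iff.mpr hp0
  set e := r⁻¹ • p with he
  have heP : e ∈ P := Submodule.smul_mem _ _ hpP
  have hre : r • e = p := by rw [he, smul_smul, mul_inv_cancel₀ hr0.ne', one_smul]
  have hee : ⟪e, e⟫ = 1 := by
    rw [he, inner_smul_left, inner_smul_right, real_inner_self_eq_norm_sq, ← hr]
    simp only [conj_trivial]; field_simp
  clear_value e
  have hce := F.mem_plane.mp heP
  have hinner : ⟪c e, e⟫ = C := by
    have h1 : ⟪c⁻¹ e, e⟫ = ⟪c e, e⟫ := by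
      have := c.inner_map_map (c⁻¹ e) e
      rw [show c (c⁻¹ e) = e from c.apply_symm_apply e] at this
      rw [← this, real_inner_comm]
    have h2 := congrArg (fun x => ⟪x, e⟫) hce
    simp only [inner_add_left, inner_smul_left, h1, hee, conj_trivial] at h2
    linarith
  have hcc : ⟪c e, c e⟫ = 1 := by rw [c.inner_map_map, hee]
  have hinner' : ⟪e, c e⟫ = C := by rw [real_inner_comm, hinner]
  -- `e` is the normalized projection of `f 0`; `e'` is its quarter turn, solved from `c e = C • e +
  -- S • e'`.
  set e' := S⁻¹ • (c e - C • e) with he'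
  have heP' : e' ∈ P := Submodule.smul_mem _ _
    (Submodule.sub_mem _ (F.map_mem_plane heP) (Submodule.smul_mem _ _ heP))
  have hee' : ⟪e, e'⟫ = 0 := by
    simp only [he', inner_smul_right, inner_sub_right, hinner', hee]; ring
  have he'e' : ⟪e', e'⟫ = 1 := by
    simp only [he', inner_smul_right, inner_smul_left, inner_sub_right, inner_sub_left, hinner',
      hinner, hee, hcc, conj_trivial]
    field_simp
    linarith
  clear_value e'
  have hc1 : c e = C • e + S • e' := by
    rw [he', smul_smul, mul_inv_cancel₀ hS0.ne', one_smul]; abel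
  -- The second column of the rotation follows from the first and from `c e + c⁻¹ e = 2 C • e`,
  -- applied after `c`.
  have hc2 : c e' = (-S) • e + C • e' := by
    have h1 : c (c e) + e = (2 * C) • c e := by
      rw [← map_smul, ← hce, map_add]
      congr 1
      exact (c.apply_symm_apply e).symm
    have h2 : c (c e) = (2 * C) • c e - e := by rw [← h1]; abel
    have h3 : c e' = S⁻¹ • ((2 * C) • c e - e - C • c e) := by
      rw [he', map_smul, map_sub, map_smul, h2]
    rw [h3, hc1]
    have h5 : (-S) • e + C • e' = S⁻¹ • (-(S ^ 2) • e + (S * C) • e') := by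
      rw [smul_add, smul_smul, smul_smul]
      congr 2 <;> field_simp
    have h6 : -(S ^ 2) = C ^ 2 - 1 := by linarith
    rw [h5, h6]
    congr 1
    module
  let vec : ℤ → V := fun i =>
    (r * Real.cos (Real.pi * i / m)) • e + (r * Real.sin (Real.pi * i / m)) • e'
  have hvec : ∀ i, c (vec i) = vec (i + 1) := by
    intro i
    have e1 : Real.pi * ((i + 1 : ℤ) : ℝ) / m = Real.pi * i / m + Real.pi / m := by
      push_cast; field_simp
    simp only [vec, map_add, map_smul, hc1, hc2, e1, Real.cos_add, Real.sin_add, ← hC, ← hS]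
    module
  have hstep : ∀ i, P.starProjection (f (i + 1)) = c (P.starProjection (f i)) := by
    intro i
    rw [← F.map_f, F.map_starProjection]
  have hproj : ∀ i, P.starProjection (f i) = vec i := by
    intro i
    induction i using Int.induction_on with
    | zero =>
      simp only [vec, Int.cast_zero, mul_zero, zero_div, Real.cos_zero, Real.sin_zero, zero_smul,
        add_zero, mul_one, hre]
      rfl
    | succ i ih => rw [hstep, ih, hvec]
    | pred i ih =>
      apply c.injective
      rw [← hstep, hvec, sub_add_cancel, ih]
  have hon : Orthonormal ℝ ![(⟨e, heP⟩ : P), ⟨e', heP'⟩] := by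
    have hee'' : ⟪e', e⟫ = 0 := by rw [real_inner_comm, hee']
    rw [orthonormal_iff_ite]
    intro i j
    fin_cases i <;> fin_cases j
    · exact hee
    · exact hee'
    · exact hee''
    · exact he'e'
  -- That the Coxeter plane is only two-dimensional comes from the frame: it is the projection of
  -- `V`, hence spanned by the projections of the `f i` and of `g`.
  have hsp : ⊤ ≤ Submodule.span ℝ (Set.range ![(⟨e, heP⟩ : P), ⟨e', heP'⟩]) := by
    rintro x -
    have hx : ∀ v ∈ (⊤ : Submodule ℝ V), P.orthogonalProjectionOnto v ∈
        Submodule.span ℝ (Set.range ![(⟨e, heP⟩ : P), ⟨e', heP'⟩]) := by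
      intro v hv
      rw [← F.span] at hv
      induction hv using Submodule.span_induction with
      | mem v hv =>
        rcases hv with ⟨i, rfl⟩ | hv
        · have : P.orthogonalProjectionOnto (f i) =
              (r * Real.cos (Real.pi * i / m)) • (⟨e, heP⟩ : P) +
                (r * Real.sin (Real.pi * i / m)) • ⟨e', heP'⟩ := Subtype.ext (hproj i)
          rw [this]
          exact Submodule.add_mem _
            (Submodule.smul_mem _ _ (Submodule.subset_span ⟨0, rfl⟩))
            (Submodule.smul_mem _ _ (Submodule.subset_span ⟨1, rfl⟩))
        · rw [Set.mem_singleton_iff] at hv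
          rw [hv, hg]; exact Submodule.zero_mem _
      | zero => rw [map_zero]; exact Submodule.zero_mem _
      | add y z _ _ hy hz => rw [map_add]; exact Submodule.add_mem _ hy hz
      | smul t y _ hy => rw [map_smul]; exact Submodule.smul_mem _ _ hy
    have := hx (x : V) trivial
    rwa [Submodule.orthogonalProjectionOnto_mem_subspace_eq_self] at this
  refine ⟨OrthonormalBasis.mk hon hsp, r, hr0, fun i => ?_, hg⟩
  rw [OrthonormalBasis.coe_mk]
  exact Subtype.ext (hproj i)

/-- The order of `c` is `2m`, and the vertices of the polygon are the projections of `f 0, …, f (2m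
- 1)`. Two projections coincide only if the cosine of the angle between them is `1`, hence only for
indices congruent modulo `2m`; the points over the center are `±g`. -/
theorem projects : ProjectsToPolygonAndTwoOrigins (coxeterPlane c)
    (Set.range f ∪ {g, -g}) (orderOf c) := by
  set P := coxeterPlane c
  obtain ⟨b, r, hr, hf, hg⟩ := F.exists_basis
  have hm := F.m_pos
  have ho' : (orderOf c : ℝ) = 2 * m := by rw [F.orderOf_eq]; push_cast; rfl
  have hb00 : ⟪b 0, b 0⟫ = 1 := by simp
  have hb11 : ⟪b 1, b 1⟫ = 1 := by simp
  have hb01 : ⟪b 0, b 1⟫ = 0 := b.orthonormal.2 (by simp)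
  have hb10 : ⟪b 1, b 0⟫ = 0 := b.orthonormal.2 (by simp)
  have hinn : ∀ i j : ℤ, ⟪P.orthogonalProjectionOnto (f i), P.orthogonalProjectionOnto (f j)⟫ =
      r ^ 2 * Real.cos (Real.pi * i / m - Real.pi * j / m) := by
    intro i j
    rw [hf, hf, Real.cos_sub]
    simp only [inner_add_left, inner_add_right, inner_smul_left, inner_smul_right, hb00, hb11,
      hb01, hb10, conj_trivial]
    ring
  have hne : ∀ i, P.orthogonalProjectionOnto (f i) ≠ 0 := by
    intro i h
    have := hinn i i
    rw [h, inner_zero_left, sub_self, Real.cos_zero] at this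
    have : 0 < r ^ 2 := by positivity
    linarith
  have hinj : ∀ i j : ℤ, P.orthogonalProjectionOnto (f i) = P.orthogonalProjectionOnto (f j) →
      f i = f j := by
    intro i j h
    obtain ⟨l, hl1, hl2, hl⟩ := F.exists_rep j i
    rw [hl] at h ⊢
    have h1 := hinn l j
    rw [h, hinn j j, sub_self, Real.cos_zero] at h1
    have : l = j := F.cos_sub_eq_one (by omega) (by omega) (mul_left_cancel₀ (by positivity) h1).symm
    rw [this]
  have hgn : g ≠ -g := fun h => F.g_ne (by
    have : (2 : ℝ) • g = 0 := by rw [two_smul]; nth_rewrite 2 [h]; abel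
    exact (smul_eq_zero.mp this).resolve_left two_ne_zero)
  refine ⟨b, r, hr, ?_, ?_, ?_, ?_⟩
  · have : {x ∈ Set.range f ∪ {g, -g} | P.orthogonalProjectionOnto x = 0} = {g, -g} := by
      ext x
      constructor
      · rintro ⟨⟨i, rfl⟩ | hx, h0⟩
        · exact absurd h0 (hne i)
        · exact hx
      · intro hx
        refine ⟨Or.inr hx, ?_⟩
        rcases hx with rfl | hx
        · exact hg
        · rw [Set.mem_singleton_iff.mp hx, map_neg, hg, neg_zero]
    rw [this, Set.ncard_pair hgn]
  · rintro x ⟨⟨i, rfl⟩ | hx, h0⟩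
    · obtain ⟨l, hl1, hl2, hl⟩ := F.exists_rep 0 i
      have ho := F.orderOf_eq
      refine ⟨⟨l.toNat, by rw [ho]; omega⟩, ?_⟩
      have e : 2 * Real.pi * (l.toNat : ℝ) / (orderOf c : ℝ) = Real.pi * l / m := by
        have : ((l.toNat : ℕ) : ℝ) = l := by exact_mod_cast Int.toNat_of_nonneg hl1
        rw [ho', this]; field_simp
      simp only
      rw [e, hl, hf]
    · exfalso
      rcases hx with rfl | hx
      · exact h0 hg
      · rw [Set.mem_singleton_iff.mp hx, map_neg, hg, neg_zero] at h0
        exact h0 rfl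
  · rintro x ⟨⟨i, rfl⟩ | hx, h0⟩ y ⟨⟨j, rfl⟩ | hy, h0'⟩ hxy
    · exact hinj i j hxy
    · exfalso
      rcases hy with rfl | hy
      · exact h0' hg
      · rw [Set.mem_singleton_iff.mp hy, map_neg, hg, neg_zero] at h0'
        exact h0' rfl
    all_goals
      exfalso
      rcases hx with rfl | hx
      · exact h0 hg
      · rw [Set.mem_singleton_iff.mp hx, map_neg, hg, neg_zero] at h0
        exact h0 rfl
  · rintro _ ⟨k, rfl⟩
    refine ⟨f (k : ℕ), ⟨Or.inl ⟨_, rfl⟩, hne _⟩, ?_⟩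
    have e : 2 * Real.pi * ((k : ℕ) : ℝ) / (orderOf c : ℝ) = Real.pi * ((k : ℕ) : ℤ) / m := by
      rw [ho']; push_cast; field_simp
    simp only
    rw [e, hf]

end Frame

end Frames

/-! ### Separating and crossing blocks whose points are vertices of the polygon or lie over its
center. -/

section PolygonHulls

variable {V : Type*} [NormedAddCommGroup V] [InnerProductSpace ℝ V] [FiniteDimensional ℝ V]

theorem cos_le_cos_of_mem {a x : ℝ} (ha : 0 ≤ a) (hax : a ≤ x) (hx : x ≤ 2 * Real.pi - a) :
    Real.cos x ≤ Real.cos a := by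
  rcases le_total x Real.pi with h | h
  · exact Real.cos_le_cos_of_nonneg_of_le_pi ha h hax
  · rw [← Real.cos_two_pi_sub x]
    exact Real.cos_le_cos_of_nonneg_of_le_pi ha (by linarith) (by linarith)

namespace Frame

variable {c : V ≃ₗᵢ[ℝ] V} {m : ℕ} {f : ℤ → V} {g : V} (F : Frame c m f g)

include F

/-- Scalar product with the unit vector at angle `γ`. -/
theorem exists_functional : ∃ r : ℝ, 0 < r ∧ ∀ γ : ℝ, ∃ φ : coxeterPlane c →ₗ[ℝ] ℝ,
    (∀ i : ℤ, φ ((coxeterPlane c).orthogonalProjectionOnto (f i)) =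
      r * Real.cos (Real.pi * i / m - γ)) ∧
    φ ((coxeterPlane c).orthogonalProjectionOnto g) = 0 := by
  obtain ⟨b, r, hr, hf, hg⟩ := F.exists_basis
  have hb00 : ⟪b 0, b 0⟫ = 1 := by simp
  have hb11 : ⟪b 1, b 1⟫ = 1 := by simp
  have hb01 : ⟪b 0, b 1⟫ = 0 := b.orthonormal.2 (by simp)
  have hb10 : ⟪b 1, b 0⟫ = 0 := b.orthonormal.2 (by simp)
  refine ⟨r, hr, fun γ => ⟨(innerₛₗ ℝ (Real.cos γ • b 0 + Real.sin γ • b 1)), fun i => ?_, ?_⟩⟩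
  · rw [innerₛₗ_apply_apply, hf, Real.cos_sub]
    simp only [inner_add_left, inner_add_right, inner_smul_left, inner_smul_right, hb00, hb11,
      hb01, hb10, conj_trivial]
    ring
  · rw [hg, map_zero]

/-- The separating line is the chord through the vertices `i` and `j`: the functional points to the
middle of the arc between them, and the threshold is its value at both ends. The center is on the
side of `B₁` exactly when `j ≤ i + m`. -/
theorem disjoint_blockHull {B₁ B₂ : Set V} {i j : ℤ} (hij : i < j) (hji : j ≤ i + 2 * m)
    (h₁ : ∀ x ∈ B₁, (∃ k, j ≤ k ∧ k ≤ i + 2 * m ∧ x = f k) ∨ ((x = g ∨ x = -g) ∧ j ≤ i + m))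
    (h₂ : ∀ x ∈ B₂, ∃ k, i < k ∧ k < j ∧ x = f k) :
    Disjoint (blockHull (coxeterPlane c) B₁) (blockHull (coxeterPlane c) B₂) := by
  obtain ⟨r, hr, H⟩ := F.exists_functional
  have hm := F.m_pos
  obtain ⟨φ, hφ, hφg⟩ := H (Real.pi * (i + j) / (2 * m))
  have hpm : 0 < Real.pi / (2 * m) := by positivity
  set u := Real.pi / (2 * m) with hu
  have e : ∀ k : ℤ, Real.pi * k / m - Real.pi * (i + j) / (2 * m) = u * (2 * k - i - j) := by
    intro k; rw [hu]; field_simp; ring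
  have e2 : Real.pi = u * (2 * m) := by rw [hu]; field_simp
  have hij' : (i : ℝ) < j := by exact_mod_cast hij
  have hji' : (j : ℝ) ≤ i + 2 * m := by exact_mod_cast hji
  refine disjoint_convexHull φ (r * Real.cos (u * (j - i))) ?_ ?_
  · rintro _ ⟨x, hx, rfl⟩
    rcases h₁ x hx with ⟨k, hk1, hk2, rfl⟩ | ⟨hx, hle⟩
    · have hk1' : (j : ℝ) ≤ k := by exact_mod_cast hk1
      have hk2' : (k : ℝ) ≤ i + 2 * m := by exact_mod_cast hk2
      rw [hφ, e]
      refine mul_le_mul_of_nonneg_left (cos_le_cos_of_mem ?_ ?_ ?_) hr.le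
      · nlinarith
      · nlinarith
      · nlinarith
    · have hle' : (j : ℝ) ≤ i + m := by exact_mod_cast hle
      have : φ ((coxeterPlane c).orthogonalProjectionOnto x) = 0 := by
        rcases hx with rfl | rfl
        · exact hφg
        · rw [map_neg, map_neg, hφg, neg_zero]
      rw [this]
      refine mul_nonneg hr.le (Real.cos_nonneg_of_mem_Icc ⟨?_, ?_⟩)
      · nlinarith
      · nlinarith
  · rintro _ ⟨x, hx, rfl⟩
    obtain ⟨k, hk1, hk2, rfl⟩ := h₂ x hx
    have hk1' : (i : ℝ) < k := by exact_mod_cast hk1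
    have hk2' : (k : ℝ) < j := by exact_mod_cast hk2
    rw [hφ, e]
    refine mul_lt_mul_of_pos_left ?_ hr
    rw [← Real.cos_abs (u * (2 * k - i - j))]
    refine Real.cos_lt_cos_of_nonneg_of_le_pi (abs_nonneg _) (by nlinarith) ?_
    rw [abs_mul, abs_of_pos hpm]
    refine mul_lt_mul_of_pos_left ?_ hpm
    rw [abs_lt]
    constructor <;> linarith

/-- A linear form on the Coxeter plane that is positive on half of the vertices. -/
theorem exists_half (a : ℤ) : ∃ φ : coxeterPlane c →ₗ[ℝ] ℝ,
    (∀ k, a ≤ k → k < a + m → 0 < φ ((coxeterPlane c).orthogonalProjectionOnto (f k))) ∧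
    φ ((coxeterPlane c).orthogonalProjectionOnto g) = 0 := by
  obtain ⟨r, hr, H⟩ := F.exists_functional
  have hm := F.m_pos
  obtain ⟨φ, hφ, hφg⟩ := H (Real.pi * (2 * a + m - 1) / (2 * m))
  refine ⟨φ, fun k hk1 hk2 => ?_, hφg⟩
  have hpm : 0 < Real.pi / (2 * m) := by positivity
  set u := Real.pi / (2 * m) with hu
  have e : Real.pi * k / m - Real.pi * (2 * a + m - 1) / (2 * m) =
    u * (2 * k - 2 * a - m + 1) := by rw [hu]; field_simp; ring
  have e2 : Real.pi = u * (2 * m) := by rw [hu]; field_simp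
  have h1 : (a : ℝ) ≤ k := by exact_mod_cast hk1
  have h2 : (k : ℝ) + 1 ≤ a + m := by exact_mod_cast hk2
  rw [hφ, e]
  refine mul_pos hr (Real.cos_pos_of_mem_Ioo ⟨?_, ?_⟩) <;> nlinarith

/-- The separating line passes through the center and misses all vertices; the vertices of `B₂` lie
strictly on one side. This covers an arc of `m` vertices, too long for the separation along a chord
when the center belongs to `B₁`. -/
theorem disjoint_blockHull_half {B₁ B₂ : Set V} (a : ℤ)
    (h₁ : ∀ x ∈ B₁, (∃ k, a + m ≤ k ∧ k < a + 2 * m ∧ x = f k) ∨ x = g ∨ x = -g)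
    (h₂ : ∀ x ∈ B₂, ∃ k, a ≤ k ∧ k < a + m ∧ x = f k) :
    Disjoint (blockHull (coxeterPlane c) B₁) (blockHull (coxeterPlane c) B₂) := by
  obtain ⟨φ, hφ, hφg⟩ := F.exists_half a
  refine disjoint_convexHull φ 0 ?_ ?_
  · rintro _ ⟨x, hx, rfl⟩
    rcases h₁ x hx with ⟨k, hk1, hk2, rfl⟩ | rfl | rfl
    · have := hφ (k - m) (by omega) (by omega)
      rw [F.f_sub, map_neg, map_neg] at this
      linarith
    · rw [hφg]
    · rw [map_neg, map_neg, hφg, neg_zero]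
  · rintro _ ⟨x, hx, rfl⟩
    obtain ⟨k, hk1, hk2, rfl⟩ := h₂ x hx
    exact hφ k hk1 hk2

theorem hullsNoncrossing_half {B₁ B₂ : Set V} (a : ℤ)
    (h₁ : ∀ x ∈ B₁, (∃ k, a ≤ k ∧ k < a + m ∧ x = f k) ∨ x = g ∨ x = -g)
    (h₂ : ∀ x ∈ B₂, (∃ k, a + m ≤ k ∧ k < a + 2 * m ∧ x = f k) ∨ x = g ∨ x = -g)
    (h₁' : g ∈ B₁ ∨ -g ∈ B₁) (h₂' : g ∈ B₂ ∨ -g ∈ B₂) :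
    HullsNoncrossing (blockHull (coxeterPlane c) B₁) (blockHull (coxeterPlane c) B₂) := by
  obtain ⟨φ, hφ, -⟩ := F.exists_half a
  obtain ⟨b, r, hr, hf, hg⟩ := F.exists_basis
  have hg' : (coxeterPlane c).orthogonalProjectionOnto (-g) = 0 := by rw [map_neg, hg, neg_zero]
  refine hullsNoncrossing_of_touching φ ?_ ?_ ?_ ?_
  · rcases h₁' with h | h
    · exact ⟨g, h, hg⟩
    · exact ⟨-g, h, hg'⟩
  · rcases h₂' with h | h
    · exact ⟨g, h, hg⟩
    · exact ⟨-g, h, hg'⟩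
  · rintro _ ⟨x, hx, rfl⟩
    rcases h₁ x hx with ⟨k, hk1, hk2, rfl⟩ | rfl | rfl
    · exact Or.inr (hφ k hk1 hk2)
    · exact Or.inl hg
    · exact Or.inl hg'
  · rintro _ ⟨x, hx, rfl⟩
    rcases h₂ x hx with ⟨k, hk1, hk2, rfl⟩ | rfl | rfl
    · have := hφ (k - m) (by omega) (by omega)
      rw [F.f_sub, map_neg, map_neg] at this
      exact Or.inr (by linarith)
    · exact Or.inl hg
    · exact Or.inl hg'

/-- Twice the oriented area of an inscribed triangle is `4 r ^ 2` times the product of the sines of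
half the central angles, hence positive for vertices in cyclic order. The unit `u = π / (2m)` is
half the angle between neighboring vertices. -/
theorem exists_area : ∃ b : OrthonormalBasis (Fin 2) ℝ (coxeterPlane c),
    (∀ i j k : ℤ, i < j → j < k → k < i + 2 * m →
      0 < area b ((coxeterPlane c).orthogonalProjectionOnto (f i))
        ((coxeterPlane c).orthogonalProjectionOnto (f j))
        ((coxeterPlane c).orthogonalProjectionOnto (f k))) ∧
    (∀ i j : ℤ, i < j → j < i + m →
      0 < area b 0 ((coxeterPlane c).orthogonalProjectionOnto (f i))
        ((coxeterPlane c).orthogonalProjectionOnto (f j))) ∧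
    (coxeterPlane c).orthogonalProjectionOnto g = 0 := by
  obtain ⟨b, r, hr, hf, hg⟩ := F.exists_basis
  have hb00 : ⟪b 0, b 0⟫ = 1 := by simp
  have hb11 : ⟪b 1, b 1⟫ = 1 := by simp
  have hb01 : ⟪b 0, b 1⟫ = 0 := b.orthonormal.2 (by simp)
  have hb10 : ⟪b 1, b 0⟫ = 0 := b.orthonormal.2 (by simp)
  have hm := F.m_pos
  have hpm : 0 < Real.pi / (2 * m) := by positivity
  set u := Real.pi / (2 * m) with hu
  have e : ∀ k : ℤ, Real.pi * k / m = 2 * (u * k) := by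
    intro k; rw [hu]; field_simp
  have e2 : Real.pi = u * (2 * m) := by rw [hu]; field_simp
  have hsin : ∀ i j : ℤ, i < j → j < i + 2 * m → 0 < Real.sin (u * j - u * i) := by
    intro i j hij hji
    have h1 : (i : ℝ) < j := by exact_mod_cast hij
    have h2 : (j : ℝ) < i + 2 * m := by exact_mod_cast hji
    refine Real.sin_pos_of_pos_of_lt_pi ?_ ?_ <;> nlinarith
  refine ⟨b, fun i j k hij hjk hki => ?_, fun i j hij hji => ?_, hg⟩
  · have key : area b ((coxeterPlane c).orthogonalProjectionOnto (f i))
        ((coxeterPlane c).orthogonalProjectionOnto (f j))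
        ((coxeterPlane c).orthogonalProjectionOnto (f k)) =
        4 * r ^ 2 * Real.sin (u * j - u * i) * Real.sin (u * k - u * j) *
          Real.sin (u * k - u * i) := by
      rw [hf, hf, hf]
      simp only [area, cross, inner_add_right, inner_sub_right, inner_smul_right, hb00, hb11,
        hb01, hb10, e]
      generalize u * (i : ℝ) = x
      generalize u * (j : ℝ) = y
      generalize u * (k : ℝ) = z
      rw [Real.sin_sub, Real.sin_sub, Real.sin_sub, Real.cos_two_mul, Real.cos_two_mul,
        Real.cos_two_mul, Real.sin_two_mul, Real.sin_two_mul, Real.sin_two_mul]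
      have hx := Real.sin_sq_add_cos_sq x
      have hy := Real.sin_sq_add_cos_sq y
      have hz := Real.sin_sq_add_cos_sq z
      generalize Real.sin x = sx at *
      generalize Real.sin y = sy at *
      generalize Real.sin z = sz at *
      generalize Real.cos x = cx at *
      generalize Real.cos y = cy at *
      generalize Real.cos z = cz at *
      have hx' : sx ^ 2 = 1 - cx ^ 2 := by linarith
      have hy' : sy ^ 2 = 1 - cy ^ 2 := by linarith
      have hz' : sz ^ 2 = 1 - cz ^ 2 := by linarith
      ring_nf
      simp only [hx', hy', hz']
      ring
    rw [key]
    have h1 := hsin i j hij (by omega)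
    have h2 := hsin j k hjk (by omega)
    have h3 := hsin i k (by omega) hki
    positivity
  · have key : area b 0 ((coxeterPlane c).orthogonalProjectionOnto (f i))
        ((coxeterPlane c).orthogonalProjectionOnto (f j)) =
        r ^ 2 * Real.sin (Real.pi * j / m - Real.pi * i / m) := by
      rw [hf, hf, Real.sin_sub]
      simp only [area, cross, sub_zero, inner_add_right, inner_smul_right, hb00, hb11, hb01, hb10]
      ring
    rw [key, e, e]
    have h1 : (i : ℝ) < j := by exact_mod_cast hij
    have h2 : (j : ℝ) < i + m := by exact_mod_cast hji
    refine mul_pos (by positivity) (Real.sin_pos_of_pos_of_lt_pi ?_ ?_) <;> nlinarith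

theorem not_hullsNoncrossing_chords {B₁ B₂ : Set V} {i j k l : ℤ} (hik : i < k) (hkj : k < j)
    (hjl : j < l) (hli : l < i + 2 * m) (hi : f i ∈ B₁) (hj : f j ∈ B₁) (hk : f k ∈ B₂)
    (hl : f l ∈ B₂) :
    ¬ HullsNoncrossing (blockHull (coxeterPlane c) B₁) (blockHull (coxeterPlane c) B₂) := by
  obtain ⟨b, h1, -, -⟩ := F.exists_area
  have mem : ∀ {x : V} {B : Set V}, x ∈ B → (coxeterPlane c).orthogonalProjectionOnto x ∈
    blockHull (coxeterPlane c) B := fun hx => subset_convexHull ℝ _ ⟨_, hx, rfl⟩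
  exact not_hullsNoncrossing b (convex_convexHull _ _) (convex_convexHull _ _) (mem hi) (mem hk)
    (mem hj) (mem hl) (h1 _ _ _ hkj hjl (by omega)) (h1 _ _ _ hik (by omega) hli)
    (h1 _ _ _ (by omega) hjl hli) (h1 _ _ _ hik hkj (by omega))

/-- The quadrilateral formed by the center and the vertices `k`, `i`, `l` is convex since the arc is
shorter than a half circle; its diagonals are the spoke to `f i` and the chord from `f k` to `f l`.
-/
theorem not_hullsNoncrossing_spoke {B₁ B₂ : Set V} {i k l : ℤ} (hki : k < i) (hil : i < l)
    (hlk : l < k + m) (hi : f i ∈ B₁) (hg : g ∈ B₁ ∨ -g ∈ B₁) (hk : f k ∈ B₂) (hl : f l ∈ B₂) :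
    ¬ HullsNoncrossing (blockHull (coxeterPlane c) B₁) (blockHull (coxeterPlane c) B₂) := by
  obtain ⟨b, h1, h2, h3⟩ := F.exists_area
  have mem : ∀ {x : V} {B : Set V}, x ∈ B → (coxeterPlane c).orthogonalProjectionOnto x ∈
    blockHull (coxeterPlane c) B := fun hx => subset_convexHull ℝ _ ⟨_, hx, rfl⟩
  have h0 : (0 : coxeterPlane c) ∈ blockHull (coxeterPlane c) B₁ := by
    rcases hg with hg | hg
    · have := mem hg
      rwa [h3] at this
    · have := mem hg
      rwa [map_neg, h3, neg_zero] at this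
  exact not_hullsNoncrossing b (convex_convexHull _ _) (convex_convexHull _ _) h0 (mem hk)
    (mem hi) (mem hl) (h1 _ _ _ hki hil (by have := F.three_le; omega)) (h2 _ _ (by omega) hlk)
    (h2 _ _ hil (by omega)) (h2 _ _ hki (by omega))

/-- A symmetric hull that contains a vertex has the center in its relative interior, so no other
block may contain the center. -/
theorem not_hullsNoncrossing_symmetric {B₁ B₂ : Set V} (hB : ∀ x ∈ B₁, -x ∈ B₁) {i : ℤ}
    (hi : f i ∈ B₁) (hg : g ∈ B₂ ∨ -g ∈ B₂) :
    ¬ HullsNoncrossing (blockHull (coxeterPlane c) B₁) (blockHull (coxeterPlane c) B₂) := by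
  obtain ⟨b, r, hr, hf, hg0⟩ := F.exists_basis
  have mem : ∀ {x : V} {B : Set V}, x ∈ B → (coxeterPlane c).orthogonalProjectionOnto x ∈
    blockHull (coxeterPlane c) B := fun hx => subset_convexHull ℝ _ ⟨_, hx, rfl⟩
  have hneg : ∀ x ∈ blockHull (coxeterPlane c) B₁, -x ∈ blockHull (coxeterPlane c) B₁ := by
    intro x hx
    have hsub : blockHull (coxeterPlane c) B₁ ⊆ -blockHull (coxeterPlane c) B₁ := by
      refine convexHull_min ?_ (convex_convexHull ℝ _).neg
      rintro _ ⟨y, hy, rfl⟩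
      rw [Set.mem_neg, ← map_neg]
      exact mem (hB y hy)
    exact hsub hx
  have h0 : (0 : coxeterPlane c) ∈ blockHull (coxeterPlane c) B₂ := by
    rcases hg with hg | hg
    · have := mem hg
      rwa [hg0] at this
    · have := mem hg
      rwa [map_neg, hg0, neg_zero] at this
  have hconv : Convex ℝ (blockHull (coxeterPlane c) B₁) := convex_convexHull ℝ _
  have h0' : (0 : coxeterPlane c) ∈ blockHull (coxeterPlane c) B₁ := by
    have := hconv (mem hi) (hneg _ (mem hi)) (a := 1 / 2) (b := 1 / 2)
      (by norm_num) (by norm_num) (by norm_num)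
    simpa using this
  intro h
  have hK := eq_zero_of_hullsNoncrossing hconv hneg h0' h0 h
  have hz := mem hi
  rw [hK, Set.mem_singleton_iff] at hz
  obtain ⟨φ, hφ, -⟩ := F.exists_half i
  have := hφ i le_rfl (by have := F.three_le; omega)
  rw [hz, map_zero] at this
  exact lt_irrefl _ this

end Frame

end PolygonHulls

/-! ### Frames of type `D`: points, roots, and the values of the form of `c`. -/

section TypeD

section Points

variable {W : Type*} [AddCommGroup W]

/-- The points `f i` and `±g`. -/
def pts (f : ℤ → W) (g : W) : Set W := Set.range f ∪ {g, -g}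

/-- The differences of two points that are neither equal nor opposite. -/
def diffs (f : ℤ → W) (g : W) : Set W :=
  {a | ∃ u ∈ pts f g, ∃ w ∈ pts f g, u ≠ w ∧ u ≠ -w ∧ a = u - w}

theorem f_mem_pts (f : ℤ → W) (g : W) (i : ℤ) : f i ∈ pts f g := Or.inl ⟨i, rfl⟩

theorem g_mem_pts (f : ℤ → W) (g : W) : g ∈ pts f g := Or.inr (Or.inl rfl)

theorem neg_g_mem_pts (f : ℤ → W) (g : W) : -g ∈ pts f g := Or.inr (Or.inr rfl)

theorem pts_cases {f : ℤ → W} {g x : W} (h : x ∈ pts f g) : (∃ i, x = f i) ∨ x = g ∨ x = -g := by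
  rcases h with ⟨i, rfl⟩ | rfl | h
  · exact Or.inl ⟨i, rfl⟩
  · exact Or.inr (Or.inl rfl)
  · exact Or.inr (Or.inr h)

end Points

variable {V : Type*} [NormedAddCommGroup V] [InnerProductSpace ℝ V]

theorem mem_orbitOf_self (G : Subgroup (V ≃ₗᵢ[ℝ] V)) (x : V) : x ∈ orbitOf G x :=
  ⟨1, G.one_mem, rfl⟩

theorem orbitOf_symm {G : Subgroup (V ≃ₗᵢ[ℝ] V)} {x y : V} (h : y ∈ orbitOf G x) :
    x ∈ orbitOf G y := by
  obtain ⟨w, hw, rfl⟩ := h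
  exact ⟨w⁻¹, G.inv_mem hw, w.symm_apply_apply x⟩

theorem orbitOf_trans {G : Subgroup (V ≃ₗᵢ[ℝ] V)} {x y z : V} (h : y ∈ orbitOf G x)
    (h' : z ∈ orbitOf G y) : z ∈ orbitOf G x := by
  obtain ⟨w, hw, rfl⟩ := h
  obtain ⟨w', hw', rfl⟩ := h'
  exact ⟨w' * w, G.mul_mem hw' hw, rfl⟩

theorem orbitOf_neg {G : Subgroup (V ≃ₗᵢ[ℝ] V)} {x y : V} (h : y ∈ orbitOf G x) :
    -y ∈ orbitOf G (-x) := by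
  obtain ⟨w, hw, rfl⟩ := h
  exact ⟨w, hw, map_neg w x⟩

theorem orbitOf_neg' {G : Subgroup (V ≃ₗᵢ[ℝ] V)} {x y : V} (h : -y ∈ orbitOf G x) :
    y ∈ orbitOf G (-x) := by
  simpa using orbitOf_neg h

theorem orbitOf_eq {G : Subgroup (V ≃ₗᵢ[ℝ] V)} {x y : V} (h : y ∈ orbitOf G x) :
    orbitOf G x = orbitOf G y := by
  ext z
  exact ⟨fun hz => orbitOf_trans (orbitOf_symm h) hz, fun hz => orbitOf_trans h hz⟩

theorem orbitOf_mono {G G' : Subgroup (V ≃ₗᵢ[ℝ] V)} (h : G ≤ G') {x y : V}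
    (hy : y ∈ orbitOf G x) : y ∈ orbitOf G' x := by
  obtain ⟨w, hw, rfl⟩ := hy
  exact ⟨w, h hw, rfl⟩

/-- Differences of points in an orbit are combinations of the roots that move points of the
orbit. -/
theorem sub_mem_span_of_mem_orbitOf {A : Set V} {x u u' : V} (hu : u ∈ orbitOf (reflGroup A) x)
    (hu' : u' ∈ orbitOf (reflGroup A) x) :
    u - u' ∈ Submodule.span ℝ
      {a | a ∈ A ∧ ∃ v ∈ orbitOf (reflGroup A) x, hyperplaneReflection a v ≠ v} := by
  set S := Submodule.span ℝ
      {a | a ∈ A ∧ ∃ v ∈ orbitOf (reflGroup A) x, hyperplaneReflection a v ≠ v}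
  have refl_mem : ∀ a ∈ A, ∀ v ∈ orbitOf (reflGroup A) x, v - hyperplaneReflection a v ∈ S := by
    intro a ha v hv
    by_cases h : hyperplaneReflection a v = v
    · rw [h, sub_self]; exact Submodule.zero_mem _
    · have h1 := sub_hyperplaneReflection_mem_span a v
      have h2 : Submodule.span ℝ {a} ≤ S := by
        rw [Submodule.span_singleton_le_iff_mem]
        exact Submodule.subset_span ⟨ha, v, hv, h⟩
      exact h2 h1
  have main : ∀ w ∈ reflGroup A, ∀ v ∈ orbitOf (reflGroup A) x, v - w v ∈ S := by
    intro w hw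
    have hw' := hw
    rw [reflGroup] at hw'
    induction hw' using Subgroup.closure_induction'' with
    | mem t ht =>
      obtain ⟨a, ha, rfl⟩ := ht
      exact refl_mem a ha
    | inv_mem t ht =>
      obtain ⟨a, ha, rfl⟩ := ht
      rw [hyperplaneReflection_inv]
      exact refl_mem a ha
    | one => intro v _; simp
    | mul s t hs' ht' hs ht =>
      intro v hv
      have h1 := ht ht' v hv
      have h2 := hs hs' (t v) (orbitOf_trans hv ⟨t, ht', rfl⟩)
      have : v - (s * t) v = (v - t v) + (t v - s (t v)) := by
        rw [LinearIsometryEquiv.coe_mul, Function.comp_apply]; abel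
      rw [this]
      exact Submodule.add_mem _ h1 h2
  obtain ⟨w, hw, rfl⟩ := orbitOf_trans (orbitOf_symm hu) hu'
  exact main w hw u hu

/-- A frame whose points are the vectors of an orthogonal basis and their opposites. -/
structure DFrame (c : V ≃ₗᵢ[ℝ] V) (m : ℕ) (f : ℤ → V) (g : V) (ρ : ℝ) : Prop extends
    Frame c m f g where
  rho_pos : 0 < ρ
  inner_f : ∀ i k : ℤ, i ≤ k → k < i + m → ⟪f i, f k⟫ = if k = i then ρ else 0
  inner_fg : ∀ i, ⟪f i, g⟫ = 0
  inner_gg : ⟪g, g⟫ = ρ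

/-- A maximal proper gap of a periodic set of integers. -/
theorem exists_gap {p : ℤ → Prop} {n : ℕ} (hn : 0 < n) (hper : ∀ k, p (k + n) ↔ p k)
    (hex : ∃ k, p k) {b : ℤ} (hb : ¬ p b) :
    ∃ i j, i < b ∧ b < j ∧ j ≤ i + n ∧ p i ∧ p j ∧ ∀ k, i < k → k < j → ¬ p k := by
  classical
  have hper' : ∀ k t : ℤ, p (k + n * t) ↔ p k := by
    intro k t
    induction t using Int.induction_on with
    | zero => simp
    | succ t ih => rw [mul_add, mul_one, ← add_assoc, hper, ih]
    | pred t ih => rw [← ih, ← hper (k + n * (-(t : ℤ) - 1))]; congr! 1; ring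
  obtain ⟨k, hk⟩ := hex
  have hn' : (0 : ℤ) < n := by exact_mod_cast hn
  have hrep : ∃ l, b ≤ l ∧ l < b + n ∧ p l := by
    refine ⟨b + (k - b) % n, ?_, ?_, ?_⟩
    · have := Int.emod_nonneg (k - b) hn'.ne'; omega
    · have := Int.emod_lt_of_pos (k - b) hn'; omega
    · have h1 := Int.emod_add_mul_ediv (k - b) n
      have h2 : b + (k - b) % n = k + n * (-((k - b) / n)) := by linarith
      rw [h2, hper']; exact hk
  obtain ⟨l, hl1, hl2, hl⟩ := hrep
  have hlb : l ≠ b := fun h => hb (h ▸ hl)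
  obtain ⟨j, ⟨hj1, hj2⟩, hj3⟩ := Int.exists_least_of_bdd (P := fun z => b < z ∧ p z)
    ⟨b, fun z hz => hz.1.le⟩ ⟨l, by omega, hl⟩
  obtain ⟨i, ⟨hi1, hi2⟩, hi3⟩ := Int.exists_greatest_of_bdd (P := fun z => z < b ∧ p z)
    ⟨b, fun z hz => hz.1.le⟩ ⟨l - n, by omega, by
      have := hper (l - n)
      rw [sub_add_cancel] at this
      exact this.mp hl⟩
  refine ⟨i, j, hi1, hj1, ?_, hi2, hj2, fun k hk1 hk2 hk => ?_⟩
  · refine hj3 _ ⟨?_, (hper i).mpr hi2⟩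
    have h1 : l - n ≤ i := hi3 (l - n) ⟨by omega, by
      have := hper (l - n)
      rw [sub_add_cancel] at this
      exact this.mp hl⟩
    have : i + n ≠ b := fun h => hb (h ▸ (hper i).mpr hi2)
    omega
  · rcases lt_trichotomy k b with h | h | h
    · have := hi3 k ⟨h, hk⟩; omega
    · exact hb (h ▸ hk)
    · have := hj3 k ⟨h, hk⟩; omega

namespace DFrame

variable {c : V ≃ₗᵢ[ℝ] V} {m : ℕ} {f : ℤ → V} {g : V} {ρ : ℝ} (D : DFrame c m f g ρ)

include D

theorem neg_mem {x : V} (hx : x ∈ pts f g) : -x ∈ pts f g := by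
  rcases pts_cases hx with ⟨i, rfl⟩ | rfl | rfl
  · rw [← D.f_add]; exact f_mem_pts f g _
  · exact neg_g_mem_pts f _
  · rw [neg_neg]; exact g_mem_pts f g

theorem inner_self {x : V} (hx : x ∈ pts f g) : ⟪x, x⟫ = ρ := by
  rcases pts_cases hx with ⟨i, rfl⟩ | rfl | rfl
  · rw [D.inner_f i i le_rfl (by have := D.three_le; omega), if_pos rfl]
  · exact D.inner_gg
  · rw [inner_neg_neg, D.inner_gg]

theorem inner_eq_zero {x y : V} (hx : x ∈ pts f g) (hy : y ∈ pts f g) (h : x ≠ y) (h' : x ≠ -y) :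
    ⟪x, y⟫ = 0 := by
  rcases pts_cases hx with ⟨i, rfl⟩ | hx <;> rcases pts_cases hy with ⟨k, rfl⟩ | hy
  · obtain ⟨l, h1, h2, h3⟩ := D.exists_rep i k
    rw [h3] at h h' ⊢
    rcases lt_or_ge l (i + m) with h4 | h4
    · rw [D.inner_f i l h1 h4, if_neg]
      rintro rfl; exact h rfl
    · have h5 := D.inner_f i (l - m) (by omega) (by omega)
      rw [D.f_sub, inner_neg_right, if_neg] at h5
      · linarith
      · intro h6
        apply h'
        rw [← h6, D.f_sub]
  · rcases hy with rfl | rfl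
    · exact D.inner_fg i
    · rw [inner_neg_right, D.inner_fg, neg_zero]
  · rcases hx with rfl | rfl
    · rw [real_inner_comm, D.inner_fg]
    · rw [real_inner_comm, inner_neg_right, D.inner_fg, neg_zero]
  · rcases hx with rfl | rfl <;> rcases hy with rfl | rfl <;> simp_all

theorem ne_neg {x : V} (hx : x ∈ pts f g) : x ≠ -x := by
  intro h
  have h1 := D.inner_self hx
  have h2 := D.rho_pos
  nth_rewrite 1 [h] at h1
  rw [inner_neg_left, D.inner_self hx] at h1
  linarith

theorem inner_diff {a : V} (ha : a ∈ diffs f g) : ⟪a, a⟫ = 2 * ρ := by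
  obtain ⟨u, hu, w, hw, h1, h2, rfl⟩ := ha
  have h3 := D.inner_eq_zero hu hw h1 h2
  have h4 : ⟪w, u⟫ = 0 := by rw [real_inner_comm, h3]
  simp only [inner_sub_left, inner_sub_right, h3, h4, D.inner_self hu, D.inner_self hw]
  ring

theorem diff_ne_zero {a : V} (ha : a ∈ diffs f g) : a ≠ 0 := by
  intro h
  have h1 := D.inner_diff ha
  have h2 := D.rho_pos
  rw [h, inner_zero_left] at h1
  linarith

/-- A reflection fixes a point or moves it to another point along its root. -/
theorem reflection_apply {a x : V} (ha : a ∈ diffs f g) (hx : x ∈ pts f g) :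
    hyperplaneReflection a x ∈ pts f g ∧ (hyperplaneReflection a x = x ∨
      x - hyperplaneReflection a x = a ∨ x - hyperplaneReflection a x = -a) := by
  obtain ⟨u, hu, w, hw, h1, h2, rfl⟩ := ha
  have h : ⟪u, u⟫ = ⟪w, w⟫ := by rw [D.inner_self hu, D.inner_self hw]
  by_cases c1 : x = u
  · rw [c1, hyperplaneReflection_swap h]
    exact ⟨hw, Or.inr (Or.inl rfl)⟩
  by_cases c2 : x = w
  · rw [c2, hyperplaneReflection_swap' h]
    exact ⟨hu, Or.inr (Or.inr (by abel))⟩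
  by_cases c3 : x = -u
  · rw [c3, map_neg, hyperplaneReflection_swap h]
    exact ⟨D.neg_mem hw, Or.inr (Or.inr (by abel))⟩
  by_cases c4 : x = -w
  · rw [c4, map_neg, hyperplaneReflection_swap' h]
    exact ⟨D.neg_mem hu, Or.inr (Or.inl (by abel))⟩
  · have : hyperplaneReflection (u - w) x = x := by
      apply hyperplaneReflection_of_inner_eq_zero
      rw [inner_sub_left, real_inner_comm, D.inner_eq_zero hx hu c1 c3, real_inner_comm,
        D.inner_eq_zero hx hw c2 c4, sub_zero]
    rw [this]
    exact ⟨hx, Or.inl rfl⟩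

theorem map_mem_pts {A : Set V} (hA : A ⊆ diffs f g) {w : V ≃ₗᵢ[ℝ] V} (hw : w ∈ reflGroup A)
    {x : V} (hx : x ∈ pts f g) : w x ∈ pts f g := by
  rw [reflGroup] at hw
  induction hw using Subgroup.closure_induction'' generalizing x with
  | mem t ht =>
    obtain ⟨a, ha, rfl⟩ := ht
    exact (D.reflection_apply (hA ha) hx).1
  | inv_mem t ht =>
    obtain ⟨a, ha, rfl⟩ := ht
    rw [hyperplaneReflection_inv]
    exact (D.reflection_apply (hA ha) hx).1
  | one => exact hx
  | mul s t _ _ hs ht => exact hs (ht hx)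

theorem orbitOf_subset {A : Set V} (hA : A ⊆ diffs f g) {x y : V} (hx : x ∈ pts f g)
    (hy : y ∈ orbitOf (reflGroup A) x) : y ∈ pts f g := by
  obtain ⟨w, hw, rfl⟩ := hy
  exact D.map_mem_pts hA hw hx

section Form

variable {Z : V →ₗ[ℝ] V} [FiniteDimensional ℝ V] (hZ : ∀ u, Z u - c (Z u) = u)

include hZ

/-- From `f l - c (f l) = f l - f (l + 1)` one gets `Z (f i - f j) = f i + ⋯ + f (j - 1)`, and these
vectors belong to an orthogonal family of `m` consecutive ones. -/
theorem form_chord {i j k : ℤ} (hij : i ≤ j) (hji : j ≤ i + m) (hik : i ≤ k) (hki : k < i + m) :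
    ⟪Z (f i - f j), f k⟫ = if k < j then ρ else 0 := by
  induction j, hij using Int.leInduction with
  | base => rw [sub_self, map_zero, inner_zero_left, if_neg (by omega)]
  | succ j hij ih =>
    have h1 : Z (f j - f (j + 1)) = f j := by
      apply resolvent_eq hZ
      rw [D.map_f]
    have h2 : f i - f (j + 1) = (f i - f j) + (f j - f (j + 1)) := by abel
    have h3 : ⟪f j, f k⟫ = if k = j then ρ else 0 := by
      rcases le_total j k with h | h
      · exact D.inner_f j k h (by omega)
      · rw [real_inner_comm, D.inner_f k j h (by omega)]
        simp only [eq_comm]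
    rw [h2, map_add, inner_add_left, ih (by omega), h1, h3]
    rcases lt_trichotomy k j with h | h | h
    · rw [if_pos h, if_neg (by omega), if_pos (by omega), add_zero]
    · rw [if_neg (by omega), if_pos h, if_pos (by omega), zero_add]
    · rw [if_neg (by omega), if_neg (by omega), if_neg (by omega), add_zero]

theorem resolvent_g : Z g = (2⁻¹ : ℝ) • g := by
  apply resolvent_eq hZ
  rw [map_smul, D.map_g]
  module

theorem form_g (v : V) : ⟪Z g, v⟫ = ⟪g, v⟫ / 2 := by
  rw [D.resolvent_g hZ, inner_smul_left, conj_trivial]; ring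

theorem form_fg (i : ℤ) : ⟪Z (f i), g⟫ = 0 := by
  have h := inner_add_inner_of_resolvent hZ (f i) g
  have h2 : ⟪g, f i⟫ = 0 := by rw [real_inner_comm, D.inner_fg]
  have h3 : ⟪f i, g⟫ = 0 := D.inner_fg i
  rw [D.form_g hZ, h2, h3] at h
  linarith

/-- The case `j = i + m` of `form_chord`, where `f i - f j = 2 • f i`. Thus `⟪Z (f i), ·⟫` only
tells on which side of a diameter a vertex lies. -/
theorem form_half {i k : ℤ} (hik : i ≤ k) (hki : k < i + m) : ⟪Z (f i), f k⟫ = ρ / 2 := by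
  have h := D.form_chord hZ (i := i) (j := i + m) (by omega) le_rfl hik hki
  rw [if_pos hki, D.f_add, sub_neg_eq_add, map_add, inner_add_left] at h
  linarith

theorem form_half' {i k : ℤ} (hik : i + m ≤ k) (hki : k < i + 2 * m) :
    ⟪Z (f i), f k⟫ = -(ρ / 2) := by
  have h := D.form_half hZ (i := i) (k := k - m) (by omega) (by omega)
  rw [D.f_sub, inner_neg_right] at h
  linarith

theorem form_ne_zero (i k : ℤ) : ⟪Z (f i), f k⟫ ≠ 0 := by
  obtain ⟨l, h1, h2, h3⟩ := D.exists_rep i k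
  have hρ := D.rho_pos
  rw [h3]
  rcases lt_or_ge l (i + m) with h | h
  · rw [D.form_half hZ h1 h]; linarith
  · rw [D.form_half' hZ h h2]; linarith

/-- For `j ≤ i + m` the chord has the value `ρ` at `f b`, on its short arc, and `0` or `-ρ` at `f
l`, outside it. -/
theorem form_crossing {i b j l : ℤ} (hib : i < b) (hbj : b < j) (hjl : j < l)
    (hli : l < i + 2 * m) : ⟪Z (f i - f j), f b - f l⟫ ≠ 0 := by
  have hρ := D.rho_pos
  have key : ∀ {i b j l : ℤ}, i < b → b < j → j < l → l < i + 2 * m → j ≤ i + m →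
      0 < ⟪Z (f i - f j), f b - f l⟫ := by
    intro i b j l hib hbj hjl hli hji
    rw [inner_sub_right, D.form_chord hZ (by omega) hji hib.le (by omega), if_pos hbj]
    rcases lt_or_ge l (i + m) with h | h
    · rw [D.form_chord hZ (by omega) hji (by omega) h, if_neg (by omega)]; linarith
    · have h1 := D.form_chord hZ (i := i) (j := j) (k := l - m) (by omega) hji (by omega)
        (by omega)
      rw [D.f_sub, inner_neg_right] at h1
      split_ifs at h1 <;> linarith
  rcases le_or_gt j (i + m) with h | h
  · exact (key hib hbj hjl hli h).ne'
  -- A chord longer than a half circle is read from its other end; this reverses the sign of both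
  -- differences.
  · have h1 := key (i := j) (b := l) (j := i + 2 * m) (l := b + 2 * m) hjl hli (by omega)
      (by omega) (by omega)
    rw [D.f_add_two, D.f_add_two, ← neg_sub (f i), ← neg_sub (f b), map_neg, inner_neg_neg] at h1
    exact h1.ne'

end Form

end DFrame

end TypeD

/-! ### Type `D`: what a factorization of `c` says about the position of blocks. -/

section TypeDNoncrossing

variable {V : Type*} [NormedAddCommGroup V] [InnerProductSpace ℝ V] [FiniteDimensional ℝ V]

omit [FiniteDimensional ℝ V] in
theorem map_eq_zero_of_mem_span (φ : V →ₗ[ℝ] ℝ) {A : Set V} (h : ∀ a ∈ A, φ a = 0) {y : V}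
    (hy : y ∈ Submodule.span ℝ A) : φ y = 0 := by
  have : Submodule.span ℝ A ≤ LinearMap.ker φ := Submodule.span_le.mpr h
  exact this hy

/-- A group generated by reflections together with a factorization of `c` of which the reflections
form an initial segment. -/
structure Factorization (c : V ≃ₗᵢ[ℝ] V) (R : Set V) (Z : V →ₗ[ℝ] V) (L₁ L₂ : List V) : Prop where
  resolvent : ∀ u, Z u - c (Z u) = u
  mem : ∀ a ∈ L₁ ++ L₂, a ∈ R
  prod : prodR (L₁ ++ L₂) = c
  length : (L₁ ++ L₂).length = Module.finrank ℝ V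

namespace DFrame

variable {c : V ≃ₗᵢ[ℝ] V} {m : ℕ} {f : ℤ → V} {g : V} {ρ : ℝ} (D : DFrame c m f g ρ)
  {Z : V →ₗ[ℝ] V} {L₁ L₂ : List V} (H : Factorization c (diffs f g) Z L₁ L₂)

include D H

theorem left_subset : {a | a ∈ L₁} ⊆ diffs f g := fun a ha =>
  H.mem a (List.mem_append.mpr (Or.inl ha))

/-- The form of `c` vanishes between the spans of different blocks. -/
theorem form_orbit {x y : V} (hx : x ∈ pts f g) (hy : y ∈ pts f g)
    (h : y ∉ orbitOf (reflGroup {a | a ∈ L₁}) x) (h' : -y ∉ orbitOf (reflGroup {a | a ∈ L₁}) x)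
    {u u' v v' : V} (hu : u ∈ orbitOf (reflGroup {a | a ∈ L₁}) x)
    (hu' : u' ∈ orbitOf (reflGroup {a | a ∈ L₁}) x)
    (hv : v ∈ orbitOf (reflGroup {a | a ∈ L₁}) y)
    (hv' : v' ∈ orbitOf (reflGroup {a | a ∈ L₁}) y) : ⟪Z (u - u'), v - v'⟫ = 0 := by
  have hA := D.left_subset H
  have hsub := sub_mem_span_of_mem_orbitOf hu hu'
  have hsub' := sub_mem_span_of_mem_orbitOf hv hv'
  have hpair := pairwise_of_prodR H.resolvent H.prod
    (listIndep_of_prodR H.resolvent H.prod H.length.le)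
  have : Std.Symm (fun a b : V => ⟪Z a, b⟫ = 0 ∨ ⟪Z b, a⟫ = 0) := ⟨fun _ _ h => h.symm⟩
  have hsymm := (hpair.imp (S := fun a b => ⟪Z a, b⟫ = 0 ∨ ⟪Z b, a⟫ = 0) fun h => Or.inl h).forall
  -- roots moving points of different blocks are orthogonal
  have key : ∀ a b, a ∈ L₁ → b ∈ L₁ →
      (∃ p ∈ orbitOf (reflGroup {a | a ∈ L₁}) x, hyperplaneReflection a p ≠ p) →
      (∃ q ∈ orbitOf (reflGroup {a | a ∈ L₁}) y, hyperplaneReflection b q ≠ q) →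
      ⟪Z a, b⟫ = 0 := by
    rintro a b ha hb ⟨p, hp, hap⟩ ⟨q, hq, hbq⟩
    have hp' : hyperplaneReflection a p ∈ orbitOf (reflGroup {a | a ∈ L₁}) x :=
      orbitOf_trans hp ⟨_, hyperplaneReflection_mem_reflGroup ha, rfl⟩
    have hq' : hyperplaneReflection b q ∈ orbitOf (reflGroup {a | a ∈ L₁}) y :=
      orbitOf_trans hq ⟨_, hyperplaneReflection_mem_reflGroup hb, rfl⟩
    have horth : ∀ s ∈ orbitOf (reflGroup {a | a ∈ L₁}) x,
        ∀ t ∈ orbitOf (reflGroup {a | a ∈ L₁}) y, ⟪s, t⟫ = 0 := by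
      intro s hs t ht
      refine D.inner_eq_zero (D.orbitOf_subset hA hx hs) (D.orbitOf_subset hA hy ht) ?_ ?_
      · rintro rfl
        exact h (orbitOf_trans hs (orbitOf_symm ht))
      · rintro rfl
        exact h' (orbitOf_trans hs (orbitOf_neg (orbitOf_symm ht)))
    have hpq : ⟪p - hyperplaneReflection a p, q - hyperplaneReflection b q⟫ = 0 := by
      simp only [inner_sub_left, inner_sub_right, horth _ hp _ hq, horth _ hp' _ hq,
        horth _ hp _ hq', horth _ hp' _ hq', sub_zero]
    have hab : ⟪a, b⟫ = 0 := by
      have h1 := (D.reflection_apply (hA ha) (D.orbitOf_subset hA hx hp)).2.resolve_left hap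
      have h2 := (D.reflection_apply (hA hb) (D.orbitOf_subset hA hy hq)).2.resolve_left hbq
      rcases h1 with h1 | h1 <;> rcases h2 with h2 | h2 <;> rw [h1, h2] at hpq <;>
        simpa using hpq
    have hne : a ≠ b := by
      rintro rfl
      have := D.inner_diff (hA ha)
      have := D.rho_pos
      linarith
    -- Triangularity gives the vanishing for one order of `a` and `b`; since the roots are
    -- orthogonal, the symmetrization gives it for the other.
    have h3 := inner_add_inner_of_resolvent H.resolvent a b
    rcases hsymm (List.mem_append.mpr (Or.inl ha)) (List.mem_append.mpr (Or.inl hb)) hne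
      with h4 | h4
    · exact h4
    · linarith
  refine map_eq_zero_of_mem_span (innerₛₗ ℝ (Z (u - u'))) ?_ hsub'
  rintro b ⟨hb, hbq⟩
  rw [innerₛₗ_apply_apply, real_inner_comm]
  refine map_eq_zero_of_mem_span ((innerₛₗ ℝ b).comp Z) ?_ hsub
  rintro a ⟨ha, hap⟩
  rw [LinearMap.comp_apply, innerₛₗ_apply_apply, real_inner_comm]
  exact key a b ha hb hap hbq

/-- A block that contains two opposite vertices contains `±g`. -/
theorem mem_orbitOf_of_neg_mem {i : ℤ} (h : -f i ∈ orbitOf (reflGroup {a | a ∈ L₁}) (f i)) :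
    g ∈ orbitOf (reflGroup {a | a ∈ L₁}) (f i) ∧
      -g ∈ orbitOf (reflGroup {a | a ∈ L₁}) (f i) := by
  have hA := D.left_subset H
  have hρ := D.rho_pos
  set W' := reflGroup {a | a ∈ L₁} with hW'
  have hpair := pairwise_of_prodR H.resolvent H.prod
    (listIndep_of_prodR H.resolvent H.prod H.length.le)
  rw [List.pairwise_append] at hpair
  have hsub := sub_mem_span_of_mem_orbitOf (mem_orbitOf_self _ _) h
  -- The difference of `f i` and `-f i` is in the span of roots of `L₁`, which come before those of
  -- `L₂`.
  have hfb : ∀ b ∈ L₂, ⟪Z (f i), b⟫ = 0 := by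
    intro b hb
    have h1 := map_eq_zero_of_mem_span ((innerₛₗ ℝ b).comp Z) (fun a ha => by
      rw [LinearMap.comp_apply, innerₛₗ_apply_apply, real_inner_comm]
      exact hpair.2.2 a ha.1 b hb) hsub
    rw [LinearMap.comp_apply, innerₛₗ_apply_apply, real_inner_comm, sub_neg_eq_add, map_add,
      inner_add_left] at h1
    linarith
  -- A root joining `±g` to a vertex has a nonzero value with `f i`, so the roots in `L₂` join
  -- vertices only.
  have hgb : ∀ b ∈ L₂, ⟪g, b⟫ = 0 := by
    intro b hb
    have hi := hfb b hb
    obtain ⟨u, hu, w, hw, h1, h2, rfl⟩ := H.mem b (List.mem_append.mpr (Or.inr hb))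
    have hgf : ∀ k, ⟪g, f k⟫ = 0 := fun k => by rw [real_inner_comm, D.inner_fg]
    have hfg := D.form_fg H.resolvent i
    rw [inner_sub_right] at hi ⊢
    rcases pts_cases hu with ⟨k, rfl⟩ | hu <;> rcases pts_cases hw with ⟨l, rfl⟩ | hw
    · rw [hgf, hgf, sub_zero]
    · exfalso
      have := D.form_ne_zero H.resolvent i k
      rcases hw with rfl | rfl
      · rw [hfg] at hi; exact this (by linarith)
      · rw [inner_neg_right, hfg] at hi; exact this (by linarith)
    · exfalso
      have := D.form_ne_zero H.resolvent i l
      rcases hu with rfl | rfl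
      · rw [hfg] at hi; exact this (by linarith)
      · rw [inner_neg_right, hfg] at hi; exact this (by linarith)
    · exfalso
      rcases hu with rfl | rfl <;> rcases hw with rfl | rfl <;> simp_all
  -- `L₂` fixes `g`, so `L₁` alone must account for `c g = -g`.
  have hxg : prodR L₁ g = -g := by
    rw [← D.map_g, ← H.prod, prodR_append_apply, prodR_apply_of_inner_eq_zero hgb]
  have hgg : -g ∈ orbitOf W' g :=
    ⟨prodR L₁, prodR_mem fun a ha => hyperplaneReflection_mem_reflGroup ha, hxg⟩
  obtain ⟨a, ha, hga⟩ : ∃ a ∈ L₁, ⟪g, a⟫ ≠ 0 := by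
    by_contra hcon
    push Not at hcon
    rw [prodR_apply_of_inner_eq_zero hcon] at hxg
    exact D.ne_neg (g_mem_pts f g) hxg
  obtain ⟨k, hk⟩ : ∃ k, f k ∈ orbitOf W' g := by
    have h1 := D.reflection_apply (hA ha) (g_mem_pts f g)
    have h2 : hyperplaneReflection a g ≠ g := fun h3 => hga (by
      rw [real_inner_comm]; exact inner_eq_zero_of_hyperplaneReflection_eq h3)
    rcases pts_cases h1.1 with ⟨k, hk⟩ | hk | hk
    · exact ⟨k, hk ▸ ⟨_, hyperplaneReflection_mem_reflGroup ha, rfl⟩⟩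
    · exact absurd hk h2
    · exfalso
      have h3 := h1.2.resolve_left h2
      have h4 := D.inner_diff (hA ha)
      have h5 := D.inner_gg
      rw [hk] at h3
      rcases h3 with h3 | h3
      · rw [← h3] at h4
        simp only [sub_neg_eq_add, inner_add_left, inner_add_right, h5] at h4
        linarith
      · rw [← neg_eq_iff_eq_neg] at h3
        rw [← h3] at h4
        simp only [sub_neg_eq_add, inner_neg_neg, inner_add_left, inner_add_right, h5] at h4
        linarith
  have hk' : -f k ∈ orbitOf W' g := orbitOf_trans hgg (orbitOf_neg hk)
  -- The block of `g` is symmetric and contains some `f k`. If it differed from the block of `f i`,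
  -- the form would vanish on `2 • f i` and `2 • f k`, whereas it never vanishes on two vertices.
  have hg : g ∈ orbitOf W' (f i) := by
    by_contra hcon
    have hcon' : -g ∉ orbitOf W' (f i) := fun h3 =>
      hcon (orbitOf_trans h (orbitOf_neg' h3))
    have h3 := D.form_orbit H (f_mem_pts f g i) (g_mem_pts f g) hcon hcon' (mem_orbitOf_self _ _) h
      hk hk'
    have h4 := D.form_ne_zero H.resolvent i k
    simp only [sub_neg_eq_add, map_add, inner_add_left, inner_add_right] at h3
    exact h4 (by linarith)
  exact ⟨hg, orbitOf_trans hg hgg⟩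

/-- Linear extension of `inner_resolvent_sub_prodR` to differences within a block. It locates the
block relative to the chord from `u` to its image under the prefix product. -/
theorem form_sub_prodR {x u v v' : V}
    (hv : v ∈ orbitOf (reflGroup {a | a ∈ L₁}) x) (hv' : v' ∈ orbitOf (reflGroup {a | a ∈ L₁}) x) :
    ⟪Z (u - prodR L₁ u), v - v'⟫ = ⟪u, v - v'⟫ := by
  have h1 := inner_resolvent_sub_prodR H.resolvent H.prod
    (listIndep_of_prodR H.resolvent H.prod H.length.le) u
  have h2 := map_eq_zero_of_mem_span (innerₛₗ ℝ (Z (u - prodR L₁ u) - u)) (fun a ha => by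
    rw [innerₛₗ_apply_apply, inner_sub_left, h1 a ha.1, sub_self])
    (sub_mem_span_of_mem_orbitOf hv hv')
  rw [innerₛₗ_apply_apply, inner_sub_left] at h2
  linarith

/-- The vertices in a block without opposite points lie in a half-open half circle. -/
theorem exists_half_of_f {x : V} (hx : x ∈ pts f g)
    (hneg : -x ∉ orbitOf (reflGroup {a | a ∈ L₁}) x)
    (hg : g ∉ orbitOf (reflGroup {a | a ∈ L₁}) x) (hg' : -g ∉ orbitOf (reflGroup {a | a ∈ L₁}) x) :
    ∃ a : ℤ, ∀ v ∈ orbitOf (reflGroup {a | a ∈ L₁}) x, ∃ k, a ≤ k ∧ k < a + m ∧ v = f k := by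
  have hA := D.left_subset H
  have hρ := D.rho_pos
  have hm := D.three_le
  set W' := reflGroup {a | a ∈ L₁} with hW'
  have hXW : prodR L₁ ∈ W' := prodR_mem fun a ha => hyperplaneReflection_mem_reflGroup ha
  have hf : ∀ v ∈ orbitOf W' x, ∃ k, v = f k := by
    intro v hv
    rcases pts_cases (D.orbitOf_subset hA hx hv) with h | rfl | rfl
    · exact h
    · exact absurd hv hg
    · exact absurd hv hg'
  have hno : ∀ v ∈ orbitOf W' x, -v ∉ orbitOf W' x := fun v hv hv' =>
    hneg (orbitOf_trans hv' (orbitOf_neg (orbitOf_symm hv)))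
  obtain ⟨i, rfl⟩ := hf x (mem_orbitOf_self _ _)
  -- The last vertex of the block on the half circle that starts at `f i`. Unless the block is a
  -- point, the wanted half circle starts at the image `f j` of this vertex under the prefix
  -- product.
  obtain ⟨k, ⟨hk1, hk2, hk⟩, hk3⟩ := Int.exists_greatest_of_bdd
    (P := fun z => i ≤ z ∧ z < i + m ∧ f z ∈ orbitOf W' (f i)) ⟨i + m, fun z hz => hz.2.1.le⟩
    ⟨i, le_rfl, by omega, mem_orbitOf_self _ _⟩
  have hX : prodR L₁ (f k) ∈ orbitOf W' (f i) := orbitOf_trans hk ⟨_, hXW, rfl⟩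
  by_cases hall : ∀ v ∈ orbitOf W' (f i), v = f k
  · exact ⟨k, fun v hv => ⟨k, le_rfl, by omega, hall v hv⟩⟩
  push Not at hall
  obtain ⟨v₀, hv₀, hv₀k⟩ := hall
  have hinner : ∀ v ∈ orbitOf W' (f i), v ≠ f k → ⟪f k, v⟫ = 0 := by
    intro v hv hvk
    refine D.inner_eq_zero (f_mem_pts f g k) (D.orbitOf_subset hA hx hv) (Ne.symm hvk) ?_
    intro h
    rw [h] at hk
    exact hno v hv hk
  have hkk : ⟪f k, f k⟫ = ρ := D.inner_self (f_mem_pts f g k)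
  obtain ⟨j₀, hj₀⟩ := hf _ hX
  obtain ⟨j, hj1, hj2, hj⟩ := D.exists_rep k j₀
  rw [hj] at hj₀
  -- All other points of the block have the same value, lower by `ρ` than that of `f k`; as the
  -- chord has a step function as its form, this confines them to an arc.
  have hform : ∀ v ∈ orbitOf W' (f i), v ≠ f k →
      ⟪Z (f k - f j), v⟫ = ⟪Z (f k - f j), f k⟫ - ρ := by
    intro v hv hvk
    have h1 := D.form_sub_prodR H (u := f k) hk hv
    rw [hj₀, inner_sub_right, inner_sub_right, hkk, hinner v hv hvk] at h1
    linarith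
  have hjB : f j ∈ orbitOf W' (f i) := hj₀ ▸ hX
  have hjk : j ≠ k := by
    rintro rfl
    have h1 := hform v₀ hv₀ hv₀k
    rw [sub_self, map_zero, inner_zero_left, inner_zero_left] at h1
    linarith
  have hjm : j ≠ k + m := by
    rintro rfl
    rw [D.f_add] at hjB
    exact hno _ hk hjB
  -- In the first case maximality of `k` forces `j > i + m`; then the value at `f i` is `-ρ` because
  -- `f (i + m)` is on the arc of the chord, while `hform` demands `0`.
  rcases lt_or_ge j (k + m) with hlt | hge
  · exfalso
    have hji : i + m < j := by
      rcases lt_trichotomy j (i + m) with h | h | h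
      · have := hk3 j ⟨by omega, h, hjB⟩
        omega
      · rw [h, D.f_add] at hjB
        exact absurd hjB hneg
      · exact h
    have hik : f i ≠ f k := by
      intro h
      have h1 := D.inner_f i k hk1 hk2
      rw [← h, if_neg (by omega)] at h1
      have h2 := D.inner_self (f_mem_pts f g i)
      linarith
    have h1 := hform (f i) (mem_orbitOf_self _ _) hik
    rw [D.form_chord H.resolvent (by omega) (by omega) le_rfl (by omega), if_pos (by omega)] at h1
    have h2 := D.form_chord H.resolvent (i := k) (j := j) (k := i + m) (by omega) (by omega)
      (by omega) (by omega)
    rw [if_pos hji, D.f_add, inner_neg_right] at h2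
    linarith
  · refine ⟨j, fun v hv => ?_⟩
    by_cases hvk : v = f k
    · exact ⟨k + 2 * m, by omega, by omega, by rw [hvk, D.f_add_two]⟩
    have h1 := hform v hv hvk
    -- The short arc of the chord runs from `j` to `k + 2m`. The value `ρ` required by `hform` is
    -- attained on it and not on the half circle from `j + m` on.
    have hflip : ∀ y, ⟪Z (f k - f j), y⟫ = -⟪Z (f j - f (k + 2 * m)), y⟫ := by
      intro y
      rw [D.f_add_two, ← neg_sub, map_neg, inner_neg_left]
    rw [hflip, hflip] at h1
    have h2 := D.form_chord H.resolvent (i := j) (j := k + 2 * m) (k := k + 2 * m) (by omega)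
      (by omega) (by omega) (by omega)
    rw [if_neg (by omega), D.f_add_two] at h2
    rw [D.f_add_two, h2] at h1
    obtain ⟨l₀, hl₀⟩ := hf v hv
    obtain ⟨l, hl1, hl2, hl⟩ := D.exists_rep j l₀
    rw [hl₀, hl] at h1
    rcases lt_or_ge l (j + m) with h3 | h3
    · exact ⟨l, hl1, h3, by rw [hl₀, hl]⟩
    · exfalso
      have h4 := D.form_chord H.resolvent (i := j) (j := k + 2 * m) (k := l - m) (by omega)
        (by omega) (by omega) (by omega)
      rw [D.f_sub, inner_neg_right, D.f_add_two] at h4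
      split_ifs at h4 <;> linarith

/-- The same for a block that contains `g` but not `-g`. -/
theorem exists_half_of_g (hneg : -g ∉ orbitOf (reflGroup {a | a ∈ L₁}) g) :
    ∃ a : ℤ, ∀ v ∈ orbitOf (reflGroup {a | a ∈ L₁}) g,
      (∃ k, a ≤ k ∧ k < a + m ∧ v = f k) ∨ v = g := by
  have hA := D.left_subset H
  have hρ := D.rho_pos
  set W' := reflGroup {a | a ∈ L₁} with hW'
  have hXW : prodR L₁ ∈ W' := prodR_mem fun a ha => hyperplaneReflection_mem_reflGroup ha
  have hf : ∀ v ∈ orbitOf W' g, (∃ k, v = f k) ∨ v = g := by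
    intro v hv
    rcases pts_cases (D.orbitOf_subset hA (g_mem_pts f g) hv) with h | rfl | rfl
    · exact Or.inl h
    · exact Or.inr rfl
    · exact absurd hv hneg
  by_cases hall : ∀ v ∈ orbitOf W' g, v = g
  · exact ⟨0, fun v hv => Or.inr (hall v hv)⟩
  push Not at hall
  obtain ⟨v₀, hv₀, hv₀g⟩ := hall
  have hgf : ∀ k, ⟪g, f k⟫ = 0 := fun k => by rw [real_inner_comm, D.inner_fg]
  -- With `prodR L₁ g = f i` the left side is `-ρ / 2` minus `⟪Z (f i), f k⟫`, so the latter is `ρ /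
  -- 2`, that is, `f k` is on the half circle starting at `f i`.
  have hform : ∀ k, f k ∈ orbitOf W' g → ⟪Z (g - prodR L₁ g), f k - g⟫ = -ρ := by
    intro k hk
    rw [D.form_sub_prodR H hk (mem_orbitOf_self _ _), inner_sub_right, hgf, D.inner_gg, zero_sub]
  obtain ⟨i, hi⟩ : ∃ i, prodR L₁ g = f i := by
    rcases hf (prodR L₁ g) ⟨_, hXW, rfl⟩ with h | h
    · exact h
    · exfalso
      obtain ⟨k, rfl⟩ := (hf v₀ hv₀).resolve_right hv₀g
      have h1 := hform k hv₀
      rw [h, sub_self, map_zero, inner_zero_left] at h1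
      linarith
  refine ⟨i, fun v hv => ?_⟩
  rcases hf v hv with ⟨k, rfl⟩ | rfl
  · left
    obtain ⟨l, hl1, hl2, hl⟩ := D.exists_rep i k
    refine ⟨l, hl1, ?_, hl⟩
    by_contra hcon
    have h1 := hform k hv
    rw [hi, hl, map_sub, inner_sub_left, D.form_g H.resolvent, inner_sub_right, inner_sub_right,
      hgf, D.inner_gg, D.form_fg H.resolvent, D.form_half' H.resolvent (by omega) hl2] at h1
    linarith
  · exact Or.inr rfl

end DFrame

end TypeDNoncrossing

/-! ### Type `D`: the diagram of a noncrossing subgroup is noncrossing. -/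

section TypeDNoncrossing

variable {V : Type*} [NormedAddCommGroup V] [InnerProductSpace ℝ V]

theorem HullsNoncrossing.symm {K L : Set V} (h : HullsNoncrossing K L) : HullsNoncrossing L K := by
  rcases h with h | ⟨p, h1, h2, h3⟩
  · exact Or.inl h.symm
  · exact Or.inr ⟨p, Set.inter_comm K L ▸ h1, h3, h2⟩

variable [FiniteDimensional ℝ V]

namespace DFrame

variable {c : V ≃ₗᵢ[ℝ] V} {m : ℕ} {f : ℤ → V} {g : V} {ρ : ℝ} (D : DFrame c m f g ρ)
  {Z : V →ₗ[ℝ] V} {L₁ L₂ : List V} (H : Factorization c (diffs f g) Z L₁ L₂)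

include D H

/-- The vertices of the two blocks fill opposite half circles, so the hulls share only the center.
This is the situation where touching in one point must be permitted. -/
theorem hullsNoncrossing_g (hg : -g ∉ orbitOf (reflGroup {a | a ∈ L₁}) g) :
    HullsNoncrossing (blockHull (coxeterPlane c) (orbitOf (reflGroup {a | a ∈ L₁}) g))
      (blockHull (coxeterPlane c) (orbitOf (reflGroup {a | a ∈ L₁}) (-g))) := by
  obtain ⟨a, ha⟩ := D.exists_half_of_g H hg
  refine D.hullsNoncrossing_half a (fun x hx => (ha x hx).imp_right Or.inl) (fun x hx => ?_)
    (Or.inl (mem_orbitOf_self _ _)) (Or.inr (mem_orbitOf_self _ _))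
  have hx' := orbitOf_neg hx
  rw [neg_neg] at hx'
  rcases ha _ hx' with ⟨k, h1, h2, h3⟩ | h
  · exact Or.inl ⟨k + m, by omega, by omega, by rw [D.f_add, ← h3, neg_neg]⟩
  · exact Or.inr (Or.inr (by rw [← h, neg_neg]))

theorem hullsNoncrossing_neg {x : V} (hx : x ∈ pts f g)
    (hneg : -x ∉ orbitOf (reflGroup {a | a ∈ L₁}) x) :
    HullsNoncrossing (blockHull (coxeterPlane c) (orbitOf (reflGroup {a | a ∈ L₁}) x))
      (blockHull (coxeterPlane c) (orbitOf (reflGroup {a | a ∈ L₁}) (-x))) := by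
  have hno : ∀ v ∈ orbitOf (reflGroup {a | a ∈ L₁}) x,
      -v ∉ orbitOf (reflGroup {a | a ∈ L₁}) x := fun v hv hv' =>
    hneg (orbitOf_trans hv' (orbitOf_neg (orbitOf_symm hv)))
  by_cases hg : g ∈ orbitOf (reflGroup {a | a ∈ L₁}) x
  · rw [orbitOf_eq hg, orbitOf_eq (orbitOf_neg hg)]
    exact D.hullsNoncrossing_g H fun h => hno g hg (orbitOf_trans hg h)
  by_cases hg' : -g ∈ orbitOf (reflGroup {a | a ∈ L₁}) x
  · rw [orbitOf_eq hg', orbitOf_eq (orbitOf_neg' hg')]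
    refine (D.hullsNoncrossing_g H fun h => hg ?_).symm
    have := orbitOf_neg h
    rw [neg_neg] at this
    exact orbitOf_trans hg' this
  obtain ⟨a, ha⟩ := D.exists_half_of_f H hx hneg hg hg'
  refine Or.inl (D.disjoint_blockHull_half a (fun v hv => Or.inl ?_) ha).symm
  have hv' := orbitOf_neg hv
  rw [neg_neg] at hv'
  obtain ⟨k, h1, h2, h3⟩ := ha _ hv'
  exact ⟨k + m, by omega, by omega, by rw [D.f_add, ← h3, neg_neg]⟩

/-- Consider the gap of the block of `x` around a vertex of the block of `y`. A vertex of `y` beyond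
this gap would give two crossing chords, on which the form is nonzero, against `form_orbit`. So the
chord closing the gap separates the blocks. -/
theorem disjoint_of_no_g {x y : V} (hx : x ∈ pts f g) (hy : y ∈ pts f g)
    (h : y ∉ orbitOf (reflGroup {a | a ∈ L₁}) x) (h' : -y ∉ orbitOf (reflGroup {a | a ∈ L₁}) x)
    (hxg : ∀ v ∈ orbitOf (reflGroup {a | a ∈ L₁}) x, ∃ k, v = f k)
    (hyg : ∀ v ∈ orbitOf (reflGroup {a | a ∈ L₁}) y, ∃ k, v = f k) :
    Disjoint (blockHull (coxeterPlane c) (orbitOf (reflGroup {a | a ∈ L₁}) x))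
      (blockHull (coxeterPlane c) (orbitOf (reflGroup {a | a ∈ L₁}) y)) := by
  have hm := D.three_le
  obtain ⟨i₀, hi₀⟩ := hxg x (mem_orbitOf_self _ _)
  obtain ⟨b, hb⟩ := hyg y (mem_orbitOf_self _ _)
  have hdis : ∀ v ∈ orbitOf (reflGroup {a | a ∈ L₁}) y,
      v ∉ orbitOf (reflGroup {a | a ∈ L₁}) x := fun v hv hv' =>
    h (orbitOf_trans hv' (orbitOf_symm hv))
  obtain ⟨i, j, hib, hbj, hji, hi, hj, hgap⟩ := exists_gap (n := 2 * m)
    (p := fun k => f k ∈ orbitOf (reflGroup {a | a ∈ L₁}) x) (b := b) (by omega)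
    (fun k => by push_cast; rw [D.f_add_two]) ⟨i₀, hi₀ ▸ mem_orbitOf_self _ _⟩
    (fun hcon => h (hb ▸ hcon))
  push_cast at hji
  refine D.disjoint_blockHull (i := i) (j := j) (by omega) hji (fun v hv => ?_) (fun v hv => ?_)
  · obtain ⟨k, hk⟩ := hxg v hv
    obtain ⟨l, hl1, hl2, hl⟩ := D.exists_rep (i + 1) k
    refine Or.inl ⟨l, ?_, by omega, by rw [hk, hl]⟩
    by_contra hcon
    exact hgap l (by omega) (by omega) (by rw [← hl, ← hk]; exact hv)
  · obtain ⟨k, hk⟩ := hyg v hv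
    obtain ⟨l, hl1, hl2, hl⟩ := D.exists_rep i k
    rw [hk, hl] at hv ⊢
    have hli : l ≠ i := fun e => hdis _ hv (e ▸ hi)
    have hlj : l ≠ j := fun e => hdis _ hv (e ▸ hj)
    refine ⟨l, by omega, ?_, rfl⟩
    by_contra hcon
    exact D.form_crossing H.resolvent hib hbj (by omega : j < l) hl2
      (D.form_orbit H hx hy h h' hi hj (hb ▸ mem_orbitOf_self _ _) hv)

/-- Together with `±g` each vertex `f s` of the block of `x`, or of its opposite, yields a spoke,
and `⟪Z (f s), ·⟫` is constant on the block of `y`: that block is on one side of each such diameter.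
Gaps are taken in the union of the block of `x` and its opposite, which has period `m`, so the
closing chord leaves the center on the side of `x`. -/
theorem disjoint_of_g {x y : V} (hx : x ∈ pts f g) (hy : y ∈ pts f g)
    (h : y ∉ orbitOf (reflGroup {a | a ∈ L₁}) x) (h' : -y ∉ orbitOf (reflGroup {a | a ∈ L₁}) x)
    (hg : g ∈ orbitOf (reflGroup {a | a ∈ L₁}) x ∨ -g ∈ orbitOf (reflGroup {a | a ∈ L₁}) x) :
    Disjoint (blockHull (coxeterPlane c) (orbitOf (reflGroup {a | a ∈ L₁}) x))
      (blockHull (coxeterPlane c) (orbitOf (reflGroup {a | a ∈ L₁}) y)) := by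
  have hm := D.three_le
  have hρ := D.rho_pos
  have hdis : ∀ v ∈ orbitOf (reflGroup {a | a ∈ L₁}) y,
      v ∉ orbitOf (reflGroup {a | a ∈ L₁}) x := fun v hv hv' =>
    h (orbitOf_trans hv' (orbitOf_symm hv))
  have hdis' : ∀ v ∈ orbitOf (reflGroup {a | a ∈ L₁}) y,
      -v ∉ orbitOf (reflGroup {a | a ∈ L₁}) x := fun v hv hv' =>
    h' (orbitOf_trans hv' (orbitOf_neg (orbitOf_symm hv)))
  have hgy : g ∉ orbitOf (reflGroup {a | a ∈ L₁}) y ∧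
      -g ∉ orbitOf (reflGroup {a | a ∈ L₁}) y := by
    refine ⟨fun hcon => ?_, fun hcon => ?_⟩
    · exact hg.elim (hdis _ hcon) (hdis' _ hcon)
    · exact hg.elim (fun h => hdis' _ hcon (by rwa [neg_neg])) (hdis _ hcon)
  have hyg : ∀ v ∈ orbitOf (reflGroup {a | a ∈ L₁}) y, ∃ k, v = f k := by
    intro v hv
    rcases pts_cases (D.orbitOf_subset (D.left_subset H) hy hv) with hk | rfl | rfl
    · exact hk
    · exact absurd hv hgy.1
    · exact absurd hv hgy.2
  obtain ⟨b, hb⟩ := hyg y (mem_orbitOf_self _ _)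
  have hby : f b ∈ orbitOf (reflGroup {a | a ∈ L₁}) y := hb ▸ mem_orbitOf_self _ _
  by_cases hex : ∃ i₀, f i₀ ∈ orbitOf (reflGroup {a | a ∈ L₁}) x
  · obtain ⟨i₀, hi₀⟩ := hex
    obtain ⟨i, j, hib, hbj, hji, hi, hj, hgap⟩ := exists_gap (n := m)
      (p := fun k => f k ∈ orbitOf (reflGroup {a | a ∈ L₁}) x ∨
        -f k ∈ orbitOf (reflGroup {a | a ∈ L₁}) x) (b := b) (by omega)
      (fun k => by rw [D.f_add, neg_neg, or_comm]) ⟨i₀, Or.inl hi₀⟩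
      (fun hcon => hcon.elim (hdis _ hby) (hdis' _ hby))
    -- `form_orbit` applies to the difference of `±f s` and `±g`; the part of `g` drops out since `Z
    -- g` is orthogonal to the vertices.
    have hform : ∀ s l, (f s ∈ orbitOf (reflGroup {a | a ∈ L₁}) x ∨
        -f s ∈ orbitOf (reflGroup {a | a ∈ L₁}) x) → f l ∈ orbitOf (reflGroup {a | a ∈ L₁}) y →
        ⟪Z (f s), f b⟫ = ⟪Z (f s), f l⟫ := by
      intro s l hs hl
      have hgf : ∀ k, ⟪g, f k⟫ = 0 := fun k => by rw [real_inner_comm, D.inner_fg]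
      rcases hs with hs | hs <;> rcases hg with hg | hg <;>
      · have := D.form_orbit H hx hy h h' hs hg hby hl
        simp only [inner_sub_left, inner_sub_right, map_sub, map_neg, inner_neg_left,
          D.form_g H.resolvent, hgf] at this
        linarith
    refine D.disjoint_blockHull (i := i) (j := j) (by omega) (by omega) (fun v hv => ?_)
      (fun v hv => ?_)
    · rcases pts_cases (D.orbitOf_subset (D.left_subset H) hx hv) with ⟨k, hk⟩ | hk
      · obtain ⟨l, hl1, hl2, hl⟩ := D.exists_rep (i + 1) k
        refine Or.inl ⟨l, ?_, by omega, by rw [hk, hl]⟩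
        by_contra hcon
        exact hgap l (by omega) (by omega) (Or.inl (by rw [← hl, ← hk]; exact hv))
      · exact Or.inr ⟨hk, hji⟩
    · obtain ⟨k, hk⟩ := hyg v hv
      obtain ⟨l, hl1, hl2, hl⟩ := D.exists_rep i k
      rw [hk, hl] at hv ⊢
      have hli : l ≠ i := fun e => hi.elim (hdis _ (e ▸ hv)) (hdis' _ (e ▸ hv))
      have h1 : l < i + m := by
        by_contra hcon
        have h2 := hform i l hi hv
        rw [D.form_half H.resolvent hib.le (by omega),
          D.form_half' H.resolvent (by omega) hl2] at h2
        linarith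
      refine ⟨l, by omega, ?_, rfl⟩
      by_contra hcon
      have h2 := hform (j - m) l (by rw [D.f_sub, neg_neg, or_comm]; exact hj) hv
      rw [D.form_half H.resolvent (by omega) (by omega),
        D.form_half' H.resolvent (by omega) (by omega)] at h2
      linarith
  · push Not at hex
    have hneg : -y ∉ orbitOf (reflGroup {a | a ∈ L₁}) y := by
      intro hcon
      rw [hb] at hcon
      exact hgy.1 (hb ▸ (D.mem_orbitOf_of_neg_mem H hcon).1)
    obtain ⟨a, ha⟩ := D.exists_half_of_f H hy hneg hgy.1 hgy.2
    refine D.disjoint_blockHull_half a (fun v hv => Or.inr ?_) ha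
    rcases pts_cases (D.orbitOf_subset (D.left_subset H) hx hv) with ⟨k, hk⟩ | hk
    · exact absurd (hk ▸ hv) (hex k)
    · exact hk

theorem diagramNoncrossing :
    DiagramNoncrossing (coxeterPlane c) (pts f g) (reflGroup {a | a ∈ L₁}) := by
  intro x hx y hy hxy
  have h : y ∉ orbitOf (reflGroup {a | a ∈ L₁}) x := fun hcon => hxy (orbitOf_eq hcon)
  by_cases h' : -y ∈ orbitOf (reflGroup {a | a ∈ L₁}) x
  · have h1 : orbitOf (reflGroup {a | a ∈ L₁}) y = orbitOf (reflGroup {a | a ∈ L₁}) (-x) :=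
      (orbitOf_eq (orbitOf_neg' h')).symm
    rw [h1]
    refine D.hullsNoncrossing_neg H hx fun hcon => hxy ?_
    rw [h1]
    exact orbitOf_eq hcon
  have hf : ∀ {z}, z ∈ pts f g → ¬ (g ∈ orbitOf (reflGroup {a | a ∈ L₁}) z ∨
      -g ∈ orbitOf (reflGroup {a | a ∈ L₁}) z) →
      ∀ v ∈ orbitOf (reflGroup {a | a ∈ L₁}) z, ∃ k, v = f k := by
    intro z hz hcon v hv
    push Not at hcon
    rcases pts_cases (D.orbitOf_subset (D.left_subset H) hz hv) with hk | rfl | rfl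
    · exact hk
    · exact absurd hv hcon.1
    · exact absurd hv hcon.2
  by_cases hgx : g ∈ orbitOf (reflGroup {a | a ∈ L₁}) x ∨
      -g ∈ orbitOf (reflGroup {a | a ∈ L₁}) x
  · exact Or.inl (D.disjoint_of_g H hx hy h h' hgx)
  by_cases hgy : g ∈ orbitOf (reflGroup {a | a ∈ L₁}) y ∨
      -g ∈ orbitOf (reflGroup {a | a ∈ L₁}) y
  · refine Or.inl (D.disjoint_of_g H hy hx (fun hcon => h (orbitOf_symm hcon))
      (fun hcon => h' ?_) hgy).symm
    exact orbitOf_symm (orbitOf_neg' hcon)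
  · exact Or.inl (D.disjoint_of_no_g H hx hy h h' (hf hx hgx) (hf hy hgy))

end DFrame

end TypeDNoncrossing

/-! ### The reflection group of type `D`: reflections, sign changes, reflection length. -/

section TypeDGroup

variable {V : Type*} [NormedAddCommGroup V] [InnerProductSpace ℝ V]

theorem reflection_ne_neg_of_diff {a x : V} (h : x - hyperplaneReflection a x = a ∨
    x - hyperplaneReflection a x = -a) :
    hyperplaneReflection (x - hyperplaneReflection a x) = hyperplaneReflection a := by
  rcases h with h | h
  · rw [h]
  · rw [h, hyperplaneReflection_neg]

namespace DFrame

variable {c : V ≃ₗᵢ[ℝ] V} {m : ℕ} {f : ℤ → V} {g : V} {ρ : ℝ} (D : DFrame c m f g ρ)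

include D

theorem reflection_sub_apply {u v x : V} (hu : u ∈ pts f g) (hv : v ∈ pts f g) (hx : x ∈ pts f g)
    (h1 : x ≠ u) (h2 : x ≠ -u) (h3 : x ≠ v) (h4 : x ≠ -v) :
    hyperplaneReflection (u - v) x = x := by
  apply hyperplaneReflection_of_inner_eq_zero
  rw [inner_sub_left, real_inner_comm, D.inner_eq_zero hx hu h1 h2, real_inner_comm,
    D.inner_eq_zero hx hv h3 h4, sub_zero]

/-- A conjugation-invariant set of elements of a group generated by reflections contains the
reflections that exchange two points of an orbit, if it contains the generators. -/
theorem hyperplaneReflection_sub_mem' {A : Set V} (hA : A ⊆ diffs f g) {C : Set (V ≃ₗᵢ[ℝ] V)}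
    (hC : ∀ t ∈ C, t ∈ reflGroup A) (hconj : ∀ w ∈ reflGroup A, ∀ t ∈ C, w * t * w⁻¹ ∈ C)
    (hAC : ∀ a ∈ A, hyperplaneReflection a ∈ C) {u v : V} (hu : u ∈ pts f g)
    (hv : v ∈ orbitOf (reflGroup A) u) :
    v = u ∨ (v = -u ∧ ∃ a ∈ pts f g, a ≠ u ∧ a ≠ -u ∧ hyperplaneReflection (u - a) ∈ C ∧
      hyperplaneReflection (u + a) ∈ C) ∨
      (v ≠ u ∧ v ≠ -u ∧ hyperplaneReflection (u - v) ∈ C) := by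
  have hρ := D.rho_pos
  have hconj' : ∀ a b : V, hyperplaneReflection a ∈ C → hyperplaneReflection b ∈ C →
      hyperplaneReflection (hyperplaneReflection a b) ∈ C := by
    intro a b ha hb
    rw [← hyperplaneReflection_conj]
    exact hconj _ (hC _ ha) _ hb
  -- The trichotomy is transported by one generator at a time. Its middle case has to carry a
  -- witness, since the difference of `u` and `-u` is not a root.
  have step : ∀ a ∈ A, ∀ v ∈ pts f g, (v = u ∨ (v = -u ∧ ∃ a ∈ pts f g, a ≠ u ∧ a ≠ -u ∧
      hyperplaneReflection (u - a) ∈ C ∧ hyperplaneReflection (u + a) ∈ C) ∨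
      (v ≠ u ∧ v ≠ -u ∧ hyperplaneReflection (u - v) ∈ C)) →
      (hyperplaneReflection a v = u ∨ (hyperplaneReflection a v = -u ∧ ∃ a ∈ pts f g, a ≠ u ∧
        a ≠ -u ∧ hyperplaneReflection (u - a) ∈ C ∧ hyperplaneReflection (u + a) ∈ C) ∨
      (hyperplaneReflection a v ≠ u ∧ hyperplaneReflection a v ≠ -u ∧
        hyperplaneReflection (u - hyperplaneReflection a v) ∈ C)) := by
    intro a ha v hv hQ
    obtain ⟨hv', h⟩ := D.reflection_apply (hA ha) hv
    rcases h with h | h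
    · rw [h]; exact hQ
    have hs : hyperplaneReflection (v - hyperplaneReflection a v) ∈ C := by
      rw [reflection_ne_neg_of_diff h]; exact hAC a ha
    have hn : ⟪v - hyperplaneReflection a v, v - hyperplaneReflection a v⟫ = 2 * ρ := by
      rcases h with h | h
      · rw [h, D.inner_diff (hA ha)]
      · rw [h, inner_neg_neg, D.inner_diff (hA ha)]
    clear h
    set v' := hyperplaneReflection a v
    clear_value v'
    have hne : v' ≠ v := by
      rintro rfl
      rw [sub_self, inner_zero_left] at hn
      linarith
    have hne' : v' ≠ -v := by
      rintro rfl
      have := D.inner_self hv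
      simp only [sub_neg_eq_add, inner_add_left, inner_add_right, this] at hn
      linarith
    by_cases e1 : v' = u
    · exact Or.inl e1
    rcases hQ with rfl | ⟨rfl, b, hb, hb1, hb2, hb3, hb4⟩ | ⟨hQ1, hQ2, hQ3⟩
    · exact Or.inr (Or.inr ⟨hne, hne', hs⟩)
    · rw [neg_neg] at hne'
      refine Or.inr (Or.inr ⟨e1, hne, ?_⟩)
      by_cases e2 : v' = b
      · rw [e2]; exact hb3
      by_cases e3 : v' = -b
      · rw [e3, sub_neg_eq_add]; exact hb4
      -- The reflections in `u + b` and `u - b` compose to a change of the signs of `u` and `b`,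
      -- which takes the root `-u - v'` to `u - v'`.
      have h1 := hconj' _ _ hb3 (hconj' _ _ hb4 hs)
      have hbb : -b ∈ pts f g := D.neg_mem hb
      have huu : ⟪u, u⟫ = ⟪-b, -b⟫ := by rw [D.inner_self hu, D.inner_self hbb]
      have huu' : ⟪u, u⟫ = ⟪b, b⟫ := by rw [D.inner_self hu, D.inner_self hb]
      have h2 : hyperplaneReflection (u - b) (hyperplaneReflection (u + b) (-u - v')) =
          u - v' := by
        rw [map_sub, map_neg, ← sub_neg_eq_add u b, hyperplaneReflection_swap huu,
          D.reflection_sub_apply hu hbb hv' e1 hne e3 (by rwa [neg_neg]), neg_neg, map_sub,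
          hyperplaneReflection_swap' huu', D.reflection_sub_apply hu hb hv' e1 hne e2 e3]
      rwa [h2] at h1
    · by_cases e2 : v' = -u
      · refine Or.inr (Or.inl ⟨e2, v, hv, hQ1, hQ2, hQ3, ?_⟩)
        rwa [e2, sub_neg_eq_add, add_comm] at hs
      · refine Or.inr (Or.inr ⟨e1, e2, ?_⟩)
        have h1 := hconj' _ _ hs hQ3
        rwa [map_sub, hyperplaneReflection_swap (by rw [D.inner_self hv, D.inner_self hv']),
          D.reflection_sub_apply hv hv' hu (Ne.symm hQ1) (fun h => hQ2 (by rw [h, neg_neg]))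
            (Ne.symm e1) (fun h => e2 (by rw [h, neg_neg]))] at h1
  obtain ⟨w, hw, rfl⟩ := hv
  have main : ∀ w ∈ reflGroup A, ∀ v ∈ pts f g, (v = u ∨ (v = -u ∧ ∃ a ∈ pts f g, a ≠ u ∧
      a ≠ -u ∧ hyperplaneReflection (u - a) ∈ C ∧ hyperplaneReflection (u + a) ∈ C) ∨
      (v ≠ u ∧ v ≠ -u ∧ hyperplaneReflection (u - v) ∈ C)) →
      (w v = u ∨ (w v = -u ∧ ∃ a ∈ pts f g, a ≠ u ∧
        a ≠ -u ∧ hyperplaneReflection (u - a) ∈ C ∧ hyperplaneReflection (u + a) ∈ C) ∨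
      (w v ≠ u ∧ w v ≠ -u ∧ hyperplaneReflection (u - w v) ∈ C)) := by
    intro w hw
    have hw' := hw
    rw [reflGroup] at hw'
    induction hw' using Subgroup.closure_induction'' with
    | mem t ht =>
      obtain ⟨a, ha, rfl⟩ := ht
      exact step a ha
    | inv_mem t ht =>
      obtain ⟨a, ha, rfl⟩ := ht
      rw [hyperplaneReflection_inv]
      exact step a ha
    | one => exact fun v _ h => h
    | mul s t hs' ht' hs ht =>
      intro v hv h
      exact hs hs' _ (D.map_mem_pts hA ht' hv) (ht ht' v hv h)
  exact main w hw u hu (Or.inl rfl)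

theorem hyperplaneReflection_sub_mem {A : Set V} (hA : A ⊆ diffs f g) {u v : V}
    (hu : u ∈ pts f g) (hv : v ∈ orbitOf (reflGroup A) u) (h : v ≠ u) (h' : v ≠ -u) :
    hyperplaneReflection (u - v) ∈ reflGroup A := by
  rcases D.hyperplaneReflection_sub_mem' hA (C := reflGroup A) (fun t ht => ht)
    (fun w hw t ht => mul_mem (mul_mem hw ht) (inv_mem hw))
    (fun a ha => hyperplaneReflection_mem_reflGroup ha) hu hv with h1 | h1 | h1
  · exact absurd h1 h
  · exact absurd h1.1 h'
  · exact h1.2.2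

/-- A change of sign needs a partner, namely the witness in the trichotomy. Hence a symmetric block
is never just a pair of opposite points. -/
theorem exists_mem_orbitOf_of_neg_mem {A : Set V} (hA : A ⊆ diffs f g) {u : V}
    (hu : u ∈ pts f g) (hv : -u ∈ orbitOf (reflGroup A) u) :
    ∃ a ∈ orbitOf (reflGroup A) u, a ≠ u ∧ a ≠ -u := by
  rcases D.hyperplaneReflection_sub_mem' hA (C := reflGroup A) (fun t ht => ht)
    (fun w hw t ht => mul_mem (mul_mem hw ht) (inv_mem hw))
    (fun a ha => hyperplaneReflection_mem_reflGroup ha) hu hv with h1 | h1 | h1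
  · exact absurd h1.symm (D.ne_neg hu)
  · obtain ⟨-, a, ha, h2, h3, h4, -⟩ := h1
    exact ⟨a, ⟨_, h4, hyperplaneReflection_swap (by rw [D.inner_self hu, D.inner_self ha])⟩,
      h2, h3⟩
  · exact absurd rfl h1.2.1

/-- Groups generated by reflections are determined by their orbits. -/
theorem reflGroup_le_of_orbitOf {A B : Set V} (hA : A ⊆ diffs f g) (hB : B ⊆ diffs f g)
    (h : ∀ x ∈ pts f g, ∀ y ∈ orbitOf (reflGroup A) x, y ∈ orbitOf (reflGroup B) x) :
    reflGroup A ≤ reflGroup B := by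
  rw [reflGroup, Subgroup.closure_le]
  rintro _ ⟨a, ha, rfl⟩
  obtain ⟨u, hu, v, hv, h1, h2, rfl⟩ := hA ha
  have h3 : v ∈ orbitOf (reflGroup A) u := ⟨_, hyperplaneReflection_mem_reflGroup ha,
    hyperplaneReflection_swap (by rw [D.inner_self hu, D.inner_self hv])⟩
  exact D.hyperplaneReflection_sub_mem hB hu (h u hu v h3) (Ne.symm h1)
    (fun h => h2 (by rw [h, neg_neg]))

/-- The points `f 0, …, f (m - 1), g`. -/
theorem exists_index {x : V} (hx : x ∈ pts f g) : ∃ j : Option (Fin m),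
    x = j.elim g (fun i => f i) ∨ x = -j.elim g (fun i => f i) := by
  rcases pts_cases hx with ⟨i, rfl⟩ | h
  · obtain ⟨l, h1, h2, h3⟩ := D.exists_rep 0 i
    rcases lt_or_ge l m with h | h
    · refine ⟨some ⟨l.toNat, by omega⟩, Or.inl ?_⟩
      rw [h3]
      simp only [Option.elim_some]
      congr 1; omega
    · refine ⟨some ⟨(l - m).toNat, by omega⟩, Or.inr ?_⟩
      rw [h3]
      simp only [Option.elim_some]
      rw [← D.f_add]
      congr 1; omega
  · exact ⟨none, h⟩

theorem index_mem_pts (j : Option (Fin m)) : j.elim g (fun i => f i) ∈ pts f g := by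
  cases j with
  | none => exact g_mem_pts f g
  | some i => exact f_mem_pts f g _

theorem inner_index (j k : Option (Fin m)) :
    ⟪j.elim g (fun i => f i), k.elim g (fun i => f i)⟫ = if j = k then ρ else 0 := by
  have hf : ∀ i k : Fin m, i ≤ k → ⟪f i, f k⟫ = if i = k then ρ else 0 := by
    intro i k h
    have h1 := D.inner_f i k (by omega) (by omega)
    rw [h1]
    simp only [Nat.cast_inj, Fin.ext_iff, eq_comm]
  cases j with
  | none =>
    cases k with
    | none => simpa using D.inner_gg
    | some k => simpa [real_inner_comm] using D.inner_fg k
  | some i =>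
    cases k with
    | none => simpa using D.inner_fg i
    | some k =>
      simp only [Option.elim_some, Option.some.injEq]
      rcases le_total i k with h | h
      · exact hf i k h
      · rw [real_inner_comm, hf k i h]
        simp only [eq_comm]

/-- A reflection exchanges two basis vectors and changes both signs or neither. The invariance of
this product records that every group element makes an even number of sign changes. -/
theorem prod_inner_map {w : V ≃ₗᵢ[ℝ] V} (hw : w ∈ reflGroup (diffs f g)) (y : V) :
    ∏ j : Option (Fin m), ⟪w (j.elim g (fun i => f i)), y⟫ =
      ∏ j : Option (Fin m), ⟪j.elim g (fun i => f i), y⟫ := by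
  set e : Option (Fin m) → V := fun j => j.elim g (fun i => f i) with he
  change ∏ j, ⟪w (e j), y⟫ = ∏ j, ⟪e j, y⟫
  have step : ∀ a ∈ diffs f g, ∀ y, ∏ j, ⟪hyperplaneReflection a (e j), y⟫ = ∏ j, ⟪e j, y⟫ := by
    rintro _ ⟨u, hu, v, hv, h1, h2, rfl⟩ y
    have huv : ⟪u, u⟫ = ⟪v, v⟫ := by rw [D.inner_self hu, D.inner_self hv]
    obtain ⟨k, hk⟩ := D.exists_index hu
    obtain ⟨l, hl⟩ := D.exists_index hv
    change u = e k ∨ u = -e k at hk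
    change v = e l ∨ v = -e l at hl
    have hkl : l ≠ k := by
      rintro rfl
      rcases hk with rfl | rfl <;> rcases hl with rfl | rfl <;> simp_all
    have hl' : l ∈ Finset.univ.erase k := Finset.mem_erase.mpr ⟨hkl, Finset.mem_univ _⟩
    rw [← Finset.mul_prod_erase _ _ (Finset.mem_univ k), ← Finset.mul_prod_erase _ _ hl',
      ← Finset.mul_prod_erase _ _ (Finset.mem_univ k), ← Finset.mul_prod_erase _ _ hl',
      ← mul_assoc, ← mul_assoc]
    congr 1
    · have h3 := hyperplaneReflection_swap huv
      have h4 := hyperplaneReflection_swap' huv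
      rcases hk with rfl | rfl <;> rcases hl with rfl | rfl
      · rw [h3, h4, mul_comm]
      · rw [map_neg, neg_eq_iff_eq_neg] at h4
        rw [h3, h4, inner_neg_left, inner_neg_left]; ring
      · rw [map_neg, neg_eq_iff_eq_neg] at h3
        rw [h3, h4, inner_neg_left, inner_neg_left]; ring
      · rw [map_neg, neg_inj] at h3 h4
        rw [h3, h4, mul_comm]
    · refine Finset.prod_congr rfl fun j hj => ?_
      rw [Finset.mem_erase, Finset.mem_erase] at hj
      have hz : ∀ i, j ≠ i → ⟪e i, e j⟫ = 0 := fun i hi => by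
        rw [D.inner_index, if_neg (Ne.symm hi)]
      rw [hyperplaneReflection_of_inner_eq_zero]
      rw [inner_sub_left]
      rcases hk with rfl | rfl <;> rcases hl with rfl | rfl <;>
        simp only [inner_neg_left, hz k hj.2.1, hz l hj.1] <;> simp
  rw [reflGroup] at hw
  induction hw using Subgroup.closure_induction'' generalizing y with
  | mem t ht =>
    obtain ⟨a, ha, rfl⟩ := ht
    exact step a ha y
  | inv_mem t ht =>
    obtain ⟨a, ha, rfl⟩ := ht
    rw [hyperplaneReflection_inv]
    exact step a ha y
  | one => rfl
  | mul s t _ _ hs ht =>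
    have h1 : ∀ x, ⟪(s * t) x, y⟫ = ⟪t x, s⁻¹ y⟫ := by
      intro x
      rw [← s.inner_map_map (t x)]
      congr 1
      exact (s.apply_symm_apply y).symm
    have h2 : ∀ x, ⟪s x, y⟫ = ⟪x, s⁻¹ y⟫ := by
      intro x
      rw [← s.inner_map_map x]
      congr 1
      exact (s.apply_symm_apply y).symm
    simp only [h1]
    rw [ht, ← hs y]
    simp only [h2]

/-- Every nontrivial element of the group has a root among the differences `z - w z`. -/
theorem exists_root {w : V ≃ₗᵢ[ℝ] V} (hw : w ∈ reflGroup (diffs f g)) (h : w ≠ 1) :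
    ∃ z, z - w z ∈ diffs f g := by
  have hρ := D.rho_pos
  by_cases hall : ∀ u ∈ pts f g, w u = u ∨ w u = -u
  · set e : Option (Fin m) → V := fun j => j.elim g (fun i => f i) with he
    have hsign : ∀ j, w (e j) = e j ∨ w (e j) = -e j := fun j => hall _ (D.index_mem_pts j)
    have hin : ∀ j, ⟪e j, ∑ k, e k⟫ = ρ := by
      intro j
      rw [inner_sum, Finset.sum_congr rfl fun k _ => D.inner_index j k]
      simp
    obtain ⟨k, hk⟩ : ∃ k, w (e k) = -e k := by
      by_contra hcon
      push Not at hcon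
      apply h
      have hfix : ∀ u ∈ pts f g, w u = u := by
        intro u hu
        obtain ⟨j, rfl | rfl⟩ := D.exists_index hu
        · exact (hsign j).resolve_right (hcon j)
        · rw [map_neg]
          congr 1
          exact (hsign j).resolve_right (hcon j)
      have : (w.toLinearEquiv : V →ₗ[ℝ] V) = LinearMap.id :=
        D.ext_of_frame (fun i => hfix _ (f_mem_pts f g i)) (hfix _ (g_mem_pts f g))
      ext x
      exact congrArg (fun φ : V →ₗ[ℝ] V => φ x) this
    -- Paired with the sum of the basis all factors are `ρ`; a single sign change would negate the
    -- product.
    obtain ⟨l, hlk, hl⟩ : ∃ l, l ≠ k ∧ w (e l) = -e l := by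
      by_contra hcon
      push Not at hcon
      have h1 := D.prod_inner_map hw (∑ k, e k)
      change ∏ j, ⟪w (e j), ∑ k, e k⟫ = ∏ j, ⟪e j, ∑ k, e k⟫ at h1
      rw [← Finset.mul_prod_erase _ _ (Finset.mem_univ k),
        ← Finset.mul_prod_erase _ _ (Finset.mem_univ k),
        Finset.prod_congr rfl (fun j hj => by
          rw [(hsign j).resolve_right (hcon j (Finset.mem_erase.mp hj).1)]), hk,
        Finset.prod_congr rfl (fun j _ => hin j), inner_neg_left, hin] at h1
      simp only [Finset.prod_const] at h1
      have h2 : 0 < ρ ^ (Finset.univ.erase k).card := pow_pos hρ _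
      nlinarith [mul_pos hρ h2]
    have h0 : ⟪e k, e l⟫ = 0 := by rw [D.inner_index, if_neg (Ne.symm hlk)]
    have hkk : ⟪e k, e k⟫ = ρ := by rw [D.inner_index, if_pos rfl]
    have hkl : ∀ s : ℝ, e k ≠ s • e l := by
      intro s hs
      have h3 := hkk
      nth_rewrite 2 [hs] at h3
      rw [inner_smul_right, h0, mul_zero] at h3
      linarith
    -- `w` negates `e k - e l`, so half of this vector is displaced by the root itself.
    refine ⟨(2⁻¹ : ℝ) • (e k - e l), e k, D.index_mem_pts k, e l, D.index_mem_pts l, ?_, ?_, ?_⟩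
    · intro hcon; exact hkl 1 (by rw [hcon, one_smul])
    · intro hcon; exact hkl (-1) (by rw [hcon, neg_one_smul])
    · rw [map_smul, map_sub, hk, hl]; module
  · push Not at hall
    obtain ⟨u, hu, h1, h2⟩ := hall
    exact ⟨u, u, hu, w u, D.map_mem_pts subset_rfl hw hu, Ne.symm h1,
      fun h => h2 (neg_eq_iff_eq_neg.mpr h).symm, rfl⟩

/-- Carter's bound, by induction on the codimension of `F`. The reflection in a root `z - w z`
returns `w z` to `z` and keeps everything fixed by `w`, so one more letter enlarges the fixed space
by `z`. -/
theorem exists_word [FiniteDimensional ℝ V] {w : V ≃ₗᵢ[ℝ] V} (hw : w ∈ reflGroup (diffs f g))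
    (F : Submodule ℝ V) (hF : ∀ v ∈ F, w v = v) :
    ∃ L : List V, (∀ a ∈ L, a ∈ diffs f g) ∧ prodR L = w ∧
      L.length + Module.finrank ℝ F ≤ Module.finrank ℝ V := by
  induction hk : Module.finrank ℝ V - Module.finrank ℝ F using Nat.strong_induction_on
    generalizing w F with
  | h k ih =>
  by_cases h1 : w = 1
  · exact ⟨[], by simp, by rw [prodR_nil, h1], by simpa using Submodule.finrank_le F⟩
  obtain ⟨z, hz⟩ := D.exists_root hw h1
  set t := hyperplaneReflection (z - w z) with ht
  have htG : t ∈ reflGroup (diffs f g) := hyperplaneReflection_mem_reflGroup hz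
  have hzF : z ∉ F := fun h => D.diff_ne_zero hz (by rw [hF z h, sub_self])
  have hlt : F < F ⊔ Submodule.span ℝ {z} := by
    refine lt_of_le_of_ne le_sup_left fun h => hzF ?_
    rw [h]
    exact Submodule.mem_sup_right (Submodule.mem_span_singleton_self z)
  have hrank := Submodule.finrank_lt_finrank_of_lt hlt
  have hle := Submodule.finrank_le (F ⊔ Submodule.span ℝ {z})
  have hfix : ∀ v ∈ F ⊔ Submodule.span ℝ {z}, (t * w) v = v := by
    intro v hv
    obtain ⟨y, hy, y', hy', rfl⟩ := Submodule.mem_sup.mp hv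
    obtain ⟨s, rfl⟩ := Submodule.mem_span_singleton.mp hy'
    have e1 : t y = y := by
      apply hyperplaneReflection_of_inner_eq_zero
      have := w.inner_map_map z y
      rw [hF y hy] at this
      rw [inner_sub_left, this, sub_self]
    have e2 : t (w z) = z := hyperplaneReflection_swap' (w.inner_map_map z z).symm
    rw [LinearIsometryEquiv.coe_mul, Function.comp_apply, map_add, map_add, hF y hy, e1, map_smul,
      map_smul, e2]
  obtain ⟨L, hL1, hL2, hL3⟩ := ih _ (by omega) (mul_mem htG hw) _ hfix rfl
  refine ⟨(z - w z) :: L, ?_, ?_, ?_⟩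
  · intro a ha
    rcases List.mem_cons.mp ha with rfl | ha
    · exact hz
    · exact hL1 a ha
  · rw [prodR_cons, hL2, ← ht, ← mul_assoc, ht, hyperplaneReflection_mul_self, one_mul]
  · rw [List.length_cons]; omega

end DFrame

end TypeDGroup

/-! ### Type `D`: the form of `c` vanishes between the blocks of a noncrossing diagram. -/

section TypeDDiagram

variable {V : Type*} [NormedAddCommGroup V] [InnerProductSpace ℝ V] [FiniteDimensional ℝ V]

namespace DFrame

variable {c : V ≃ₗᵢ[ℝ] V} {m : ℕ} {f : ℤ → V} {g : V} {ρ : ℝ} (D : DFrame c m f g ρ)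
  {A : Set V} (hA : A ⊆ diffs f g)
  (hN : DiagramNoncrossing (coxeterPlane c) (pts f g) (reflGroup A))

include D hA hN

theorem not_crossing {x y : V} (hx : x ∈ pts f g) (hy : y ∈ pts f g)
    (hxy : y ∉ orbitOf (reflGroup A) x) {i j k l : ℤ} (hik : i < k) (hkj : k < j) (hjl : j < l)
    (hli : l < i + 2 * m) (hi : f i ∈ orbitOf (reflGroup A) x)
    (hj : f j ∈ orbitOf (reflGroup A) x) (hk : f k ∈ orbitOf (reflGroup A) y)
    (hl : f l ∈ orbitOf (reflGroup A) y) : False :=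
  D.not_hullsNoncrossing_chords hik hkj hjl hli hi hj hk hl
    (hN x hx y hy fun h => hxy (h ▸ mem_orbitOf_self _ _))

/-- Opposite vertices make the whole block symmetric, and a symmetric block with a vertex crosses
any other block over the center. -/
theorem g_mem_orbitOf {x : V} (hx : x ∈ pts f g) {i : ℤ} (hi : f i ∈ orbitOf (reflGroup A) x)
    (hi' : -f i ∈ orbitOf (reflGroup A) x) :
    g ∈ orbitOf (reflGroup A) x ∧ -g ∈ orbitOf (reflGroup A) x := by
  have hneg : ∀ v ∈ orbitOf (reflGroup A) x, -v ∈ orbitOf (reflGroup A) x := fun v hv =>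
    orbitOf_trans hi' (orbitOf_neg (orbitOf_trans (orbitOf_symm hi) hv))
  have hg : g ∈ orbitOf (reflGroup A) x := by
    by_contra hcon
    exact D.not_hullsNoncrossing_symmetric hneg hi (Or.inl (mem_orbitOf_self _ g))
      (hN x hx g (g_mem_pts f g) fun h => hcon (h ▸ mem_orbitOf_self _ _))
  exact ⟨hg, hneg _ hg⟩

/-- Take the gap around the antipode of a vertex of the block. If it were shorter than a half
circle, the chord closing it would cross a chord of the opposite block. -/
theorem exists_half_of_diagram {x : V} (hx : x ∈ pts f g)
    (hno : ∀ v ∈ orbitOf (reflGroup A) x, -v ∉ orbitOf (reflGroup A) x) :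
    ∃ a : ℤ, ∀ k, f k ∈ orbitOf (reflGroup A) x → ∃ l, a ≤ l ∧ l < a + m ∧ f k = f l := by
  have hm := D.three_le
  by_cases hex : ∃ k, f k ∈ orbitOf (reflGroup A) x
  swap
  · exact ⟨0, fun k hk => absurd ⟨k, hk⟩ hex⟩
  obtain ⟨i₀, hi₀⟩ := hex
  obtain ⟨i, j, hib, hbj, hji, hi, hj, hgap⟩ := exists_gap (n := 2 * m)
    (p := fun k => f k ∈ orbitOf (reflGroup A) x) (b := i₀ + m) (by omega)
    (fun k => by push_cast; rw [D.f_add_two]) ⟨i₀, hi₀⟩ (by rw [D.f_add]; exact hno _ hi₀)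
  push_cast at hji
  have hrep : ∀ k, f k ∈ orbitOf (reflGroup A) x → ∃ l, j ≤ l ∧ l ≤ i + 2 * m ∧ f k = f l := by
    intro k hk
    obtain ⟨l, hl1, hl2, hl⟩ := D.exists_rep (i + 1) k
    refine ⟨l, ?_, by omega, hl⟩
    by_contra hcon
    exact hgap l (by omega) (by omega) (hl ▸ hk)
  by_cases hlt : i + m < j
  · exact ⟨j, fun k hk => (hrep k hk).imp fun l h => ⟨h.1, by omega, h.2.2⟩⟩
  exfalso
  have hne : j ≠ i + m := by
    rintro rfl
    rw [D.f_add] at hj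
    exact hno _ hi hj
  have hneg : ∀ k, f k ∈ orbitOf (reflGroup A) x → f (k + m) ∈ orbitOf (reflGroup A) (-x) := by
    intro k hk
    rw [D.f_add]
    exact orbitOf_neg hk
  exact D.not_crossing hA hN hx (D.neg_mem hx) (hno x (mem_orbitOf_self _ _)) hib hbj
    (by omega : j < i + m) (by omega) hi hj (hneg _ hi₀) (hneg _ hi)

/-- On the vertices, `⟪Z (f i - f j), ·⟫` is `ρ` on the arc from `i` to `j`, `-ρ` on the opposite
arc, and `0` elsewhere. The block of `y` crosses neither the chord nor the opposite chord, so all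
its vertices have the same value. -/
theorem form_eq_zero_of_short {x y : V} (hx : x ∈ pts f g) (hy : y ∈ pts f g)
    (h : y ∉ orbitOf (reflGroup A) x) (h' : -y ∉ orbitOf (reflGroup A) x)
    (hg : g ∉ orbitOf (reflGroup A) x) {Z : V →ₗ[ℝ] V} (hZ : ∀ u, Z u - c (Z u) = u)
    {i j b l : ℤ} (hij : i ≤ j) (hji : j ≤ i + m)
    (hi : f i ∈ orbitOf (reflGroup A) x) (hj : f j ∈ orbitOf (reflGroup A) x)
    (hb : f b ∈ orbitOf (reflGroup A) y) (hl : f l ∈ orbitOf (reflGroup A) y) :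
    ⟪Z (f i - f j), f b - f l⟫ = 0 := by
  have hm := D.three_le
  have hdis : ∀ v ∈ orbitOf (reflGroup A) x, v ∉ orbitOf (reflGroup A) y := fun v hv hv' =>
    h (orbitOf_trans hv (orbitOf_symm hv'))
  have hdis' : ∀ v ∈ orbitOf (reflGroup A) x, -v ∉ orbitOf (reflGroup A) y := fun v hv hv' =>
    h' (orbitOf_trans hv (by simpa using orbitOf_neg (orbitOf_symm hv')))
  have hneg : ∀ k, f k ∈ orbitOf (reflGroup A) x → f (k + m) ∈ orbitOf (reflGroup A) (-x) := by
    intro k hk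
    rw [D.f_add]
    exact orbitOf_neg hk
  have hyx : y ∉ orbitOf (reflGroup A) (-x) := fun hcon => h' (by simpa using orbitOf_neg hcon)
  rcases hij.eq_or_lt with rfl | hij
  · rw [sub_self, map_zero, inner_zero_left]
  rcases hji.eq_or_lt with rfl | hji
  · rw [D.f_add] at hj
    exact absurd (D.g_mem_orbitOf hA hN hx hi hj).1 hg
  obtain ⟨b', hb1, hb2, hb3⟩ := D.exists_rep i b
  obtain ⟨l', hl1, hl2, hl3⟩ := D.exists_rep i l
  rw [hb3] at hb ⊢
  rw [hl3] at hl ⊢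
  clear hb3 hl3 b l
  have hval : ∀ k, i ≤ k → k < i + 2 * m → ⟪Z (f i - f j), f k⟫ =
      if k < j then ρ else if k < i + m then 0 else if k < j + m then -ρ else 0 := by
    intro k hk1 hk2
    by_cases hk3 : k < i + m
    · rw [D.form_chord hZ hij.le hji.le hk1 hk3]
      simp only [hk3, if_true]
    · have h1 := D.form_chord hZ (i := i) (j := j) (k := k - m) (by omega) (by omega) (by omega)
        (by omega)
      rw [D.f_sub, inner_neg_right] at h1
      rw [if_neg (by omega), if_neg hk3]
      split_ifs at h1 ⊢ with h2 h3 h3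
      · linarith
      · omega
      · omega
      · linarith
  have hne : ∀ k, f k ∈ orbitOf (reflGroup A) y → k ≠ i ∧ k ≠ j ∧ k ≠ i + m ∧ k ≠ j + m := by
    intro k hk
    refine ⟨?_, ?_, ?_, ?_⟩ <;> rintro rfl
    · exact hdis _ hi hk
    · exact hdis _ hj hk
    · rw [D.f_add] at hk; exact hdis' _ hi hk
    · rw [D.f_add] at hk; exact hdis' _ hj hk
  have cross₁ : ∀ b l, i ≤ b → b < j → j ≤ l → l < i + 2 * m → f b ∈ orbitOf (reflGroup A) y →
      f l ∈ orbitOf (reflGroup A) y → False := by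
    intro b l h1 h2 h3 h4 hb hl
    have := hne b hb
    have := hne l hl
    exact D.not_crossing hA hN hx hy h (by omega : i < b) h2 (by omega : j < l) h4 hi hj hb hl
  have cross₂ : ∀ b l, i + m ≤ b → b < j + m → i ≤ l → l < i + 2 * m → ¬ (i + m ≤ l ∧ l < j + m) →
      f b ∈ orbitOf (reflGroup A) y → f l ∈ orbitOf (reflGroup A) y → False := by
    intro b l h1 h2 h3 h4 h5 hb hl
    have := hne b hb
    have := hne l hl
    rcases lt_or_ge l (j + m) with h6 | h6
    · refine D.not_crossing hA hN (D.neg_mem hx) hy hyx (by omega : i + m < b) h2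
        (by omega : j + m < l + 2 * m) (by omega) (hneg _ hi) (hneg _ hj) hb ?_
      rw [D.f_add_two]; exact hl
    · exact D.not_crossing hA hN (D.neg_mem hx) hy hyx (by omega : i + m < b) h2
        (by omega : j + m < l) (by omega) (hneg _ hi) (hneg _ hj) hb hl
  rw [inner_sub_right, hval _ hb1 hb2, hval _ hl1 hl2, sub_eq_zero]
  by_cases c1 : b' < j
  · have c2 : l' < j := by
      by_contra c2
      exact cross₁ b' l' hb1 c1 (by omega) hl2 hb hl
    rw [if_pos c1, if_pos c2]
  have c2 : ¬ l' < j := fun c2 => cross₁ l' b' hl1 c2 (by omega) hb2 hl hb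
  rw [if_neg c1, if_neg c2]
  by_cases c3 : i + m ≤ b' ∧ b' < j + m
  · have c4 : i + m ≤ l' ∧ l' < j + m := by
      by_contra c4
      exact cross₂ b' l' c3.1 c3.2 hl1 hl2 c4 hb hl
    split_ifs <;> first | rfl | omega
  · have c4 : ¬ (i + m ≤ l' ∧ l' < j + m) := fun c4 =>
      cross₂ l' b' c4.1 c4.2 hb1 hb2 c3 hl hb
    split_ifs <;> first | rfl | omega

/-- The form of `c` vanishes between the spans of noncrossing blocks. -/
theorem form_eq_zero_of_not_g {x y : V} (hx : x ∈ pts f g) (hy : y ∈ pts f g)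
    (h : y ∉ orbitOf (reflGroup A) x) (h' : -y ∉ orbitOf (reflGroup A) x)
    (hg : g ∉ orbitOf (reflGroup A) y) (hg' : -g ∉ orbitOf (reflGroup A) y)
    {Z : V →ₗ[ℝ] V} (hZ : ∀ u, Z u - c (Z u) = u) {u u' v v' : V}
    (hu : u ∈ orbitOf (reflGroup A) x) (hu' : u' ∈ orbitOf (reflGroup A) x)
    (hv : v ∈ orbitOf (reflGroup A) y) (hv' : v' ∈ orbitOf (reflGroup A) y) :
    ⟪Z (u - u'), v - v'⟫ = 0 := by
  have hm := D.three_le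
  have hdis : ∀ v ∈ orbitOf (reflGroup A) x, v ∉ orbitOf (reflGroup A) y := fun v hv hv' =>
    h (orbitOf_trans hv (orbitOf_symm hv'))
  have hdis' : ∀ v ∈ orbitOf (reflGroup A) x, -v ∉ orbitOf (reflGroup A) y := fun v hv hv' =>
    h' (orbitOf_trans hv (by simpa using orbitOf_neg (orbitOf_symm hv')))
  have hyx : y ∉ orbitOf (reflGroup A) (-x) := fun hcon => h' (by simpa using orbitOf_neg hcon)
  have hyf : ∀ v ∈ orbitOf (reflGroup A) y, ∃ k, v = f k := by
    intro v hv
    rcases pts_cases (D.orbitOf_subset hA hy hv) with hk | rfl | rfl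
    · exact hk
    · exact absurd hv hg
    · exact absurd hv hg'
  obtain ⟨b, rfl⟩ := hyf v hv
  obtain ⟨l, rfl⟩ := hyf v' hv'
  by_cases hgx : g ∈ orbitOf (reflGroup A) x ∨ -g ∈ orbitOf (reflGroup A) x
  -- If the block of `x` lies over the center, the form vanishes already for its single points: the
  -- diameter through a vertex `f i` consists of a spoke of the block and one of its opposite, and
  -- the block of `y` stays on one side.
  · have key : ∀ u ∈ orbitOf (reflGroup A) x, ⟪Z u, f b - f l⟫ = 0 := by
      intro u hu
      have hgf : ∀ k, ⟪g, f k⟫ = 0 := fun k => by rw [real_inner_comm, D.inner_fg]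
      rcases pts_cases (D.orbitOf_subset hA hx hu) with ⟨i, rfl⟩ | rfl | rfl
      · have hi' : f (i + m) ∈ orbitOf (reflGroup A) (-x) := by
          rw [D.f_add]; exact orbitOf_neg hu
        have hgx' : g ∈ orbitOf (reflGroup A) (-x) ∨ -g ∈ orbitOf (reflGroup A) (-x) :=
          hgx.symm.imp orbitOf_neg' orbitOf_neg
        have main : ∀ b l, i ≤ b → b < i + m → i + m ≤ l → l < i + 2 * m →
            f b ∈ orbitOf (reflGroup A) y → f l ∈ orbitOf (reflGroup A) y → False := by
          intro b l h1 h2 h3 h4 hb hl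
          have hb1 : b ≠ i := by rintro rfl; exact hdis _ hu hb
          have hl1 : l ≠ i + m := by
            rintro rfl; rw [D.f_add] at hl; exact hdis' _ hu hl
          -- According to the side on which the chord from `f b` to `f l` passes the center, it
          -- crosses the spoke to `f (i + m)` or the spoke to `f i`; a chord through the center
          -- would force `g` into the block of `y`.
          rcases lt_trichotomy l (b + m) with h5 | h5 | h5
          · exact D.not_hullsNoncrossing_spoke (by omega : b < i + m) (by omega : i + m < l) h5 hi'
              hgx' hb hl (hN _ (D.neg_mem hx) _ hy fun h => hyx (h ▸ mem_orbitOf_self _ _))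
          · rw [h5, D.f_add] at hl
            exact hg (D.g_mem_orbitOf hA hN hy hb hl).1
          · refine D.not_hullsNoncrossing_spoke (by omega : l - 2 * m < i) (by omega : i < b)
              (by omega) hu hgx ?_ hb (hN _ hx _ hy fun h' => h (h' ▸ mem_orbitOf_self _ _))
            rw [← D.f_add_two, sub_add_cancel]; exact hl
        obtain ⟨b', hb1, hb2, hb3⟩ := D.exists_rep i b
        obtain ⟨l', hl1, hl2, hl3⟩ := D.exists_rep i l
        rw [hb3] at hv ⊢
        rw [hl3] at hv' ⊢
        rw [inner_sub_right, sub_eq_zero]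
        rcases lt_or_ge b' (i + m) with c1 | c1 <;> rcases lt_or_ge l' (i + m) with c2 | c2
        · rw [D.form_half hZ hb1 c1, D.form_half hZ hl1 c2]
        · exact (main b' l' hb1 c1 c2 hl2 hv hv').elim
        · exact (main l' b' hl1 c2 c1 hb2 hv' hv).elim
        · rw [D.form_half' hZ c1 hb2, D.form_half' hZ c2 hl2]
      · rw [D.form_g hZ, inner_sub_right, hgf, hgf, sub_zero, zero_div]
      · rw [map_neg, inner_neg_left, D.form_g hZ, inner_sub_right, hgf, hgf, sub_zero, zero_div,
          neg_zero]
    rw [map_sub, inner_sub_left, key u hu, key u' hu', sub_zero]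
  · push Not at hgx
    have hxf : ∀ v ∈ orbitOf (reflGroup A) x, ∃ k, v = f k := by
      intro v hv
      rcases pts_cases (D.orbitOf_subset hA hx hv) with hk | rfl | rfl
      · exact hk
      · exact absurd hv hgx.1
      · exact absurd hv hgx.2
    obtain ⟨i, rfl⟩ := hxf u hu
    obtain ⟨j₀, rfl⟩ := hxf u' hu'
    obtain ⟨j, hj1, hj2, hj⟩ := D.exists_rep i j₀
    rw [hj] at hu' ⊢
    rcases le_or_gt j (i + m) with h1 | h1
    · exact D.form_eq_zero_of_short hA hN hx hy h h' hgx.1 hZ hj1 h1 hu hu' hv hv'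
    · have h2 := D.form_eq_zero_of_short hA hN hx hy h h' hgx.1 hZ (i := j) (j := i + 2 * m)
        (by omega) (by omega) hu' (by rw [D.f_add_two]; exact hu) hv hv'
      rw [D.f_add_two, ← neg_sub, map_neg, inner_neg_left] at h2
      linarith

/-- If the block of `y` contains `±g`, that of `x` does not, and the roles can be exchanged: the
blocks are orthogonal, so the form is alternating between them. -/
theorem form_eq_zero {x y : V} (hx : x ∈ pts f g) (hy : y ∈ pts f g)
    (h : y ∉ orbitOf (reflGroup A) x) (h' : -y ∉ orbitOf (reflGroup A) x)
    {Z : V →ₗ[ℝ] V} (hZ : ∀ u, Z u - c (Z u) = u) {u u' v v' : V}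
    (hu : u ∈ orbitOf (reflGroup A) x) (hu' : u' ∈ orbitOf (reflGroup A) x)
    (hv : v ∈ orbitOf (reflGroup A) y) (hv' : v' ∈ orbitOf (reflGroup A) y) :
    ⟪Z (u - u'), v - v'⟫ = 0 := by
  have hdis : ∀ v ∈ orbitOf (reflGroup A) x, v ∉ orbitOf (reflGroup A) y := fun v hv hv' =>
    h (orbitOf_trans hv (orbitOf_symm hv'))
  have hdis' : ∀ v ∈ orbitOf (reflGroup A) x, -v ∉ orbitOf (reflGroup A) y := fun v hv hv' =>
    h' (orbitOf_trans hv (by simpa using orbitOf_neg (orbitOf_symm hv')))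
  by_cases hg : g ∈ orbitOf (reflGroup A) y ∨ -g ∈ orbitOf (reflGroup A) y
  · have hgx : g ∉ orbitOf (reflGroup A) x ∧ -g ∉ orbitOf (reflGroup A) x := by
      refine ⟨fun hc => ?_, fun hc => ?_⟩
      · exact hg.elim (hdis _ hc) (hdis' _ hc)
      · exact hg.elim (fun h => hdis' _ hc (by rwa [neg_neg])) (hdis _ hc)
    have h1 := D.form_eq_zero_of_not_g hA hN hy hx (fun hc => h (orbitOf_symm hc))
      (fun hc => h' (orbitOf_symm (orbitOf_neg' hc))) hgx.1 hgx.2 hZ hv hv' hu hu'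
    have h2 := inner_add_inner_of_resolvent hZ (u - u') (v - v')
    have horth : ∀ s ∈ orbitOf (reflGroup A) x, ∀ t ∈ orbitOf (reflGroup A) y, ⟪s, t⟫ = 0 := by
      intro s hs t ht
      refine D.inner_eq_zero (D.orbitOf_subset hA hx hs) (D.orbitOf_subset hA hy ht) ?_ ?_
      · rintro rfl; exact hdis _ hs ht
      · rintro rfl; exact hdis' _ hs (by rwa [neg_neg])
    have h3 : ⟪u - u', v - v'⟫ = 0 := by
      simp only [inner_sub_left, inner_sub_right, horth _ hu _ hv, horth _ hu _ hv',
        horth _ hu' _ hv, horth _ hu' _ hv', sub_zero]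
    rw [h1, h3, add_zero] at h2
    exact h2
  · push Not at hg
    exact D.form_eq_zero_of_not_g hA hN hx hy h h' hg.1 hg.2 hZ hu hu' hv hv'

end DFrame

end TypeDDiagram

/-! ### Type `D`: a noncrossing diagram yields a triangular list of roots. -/

section TypeDLists

variable {V : Type*} [NormedAddCommGroup V] [InnerProductSpace ℝ V]

/-- The roots in `L` exchange points of the block of `x`, connect the block, and are pairwise
orthogonal for the form given by `Z`. -/
structure BlockList (Z : V →ₗ[ℝ] V) (G : Subgroup (V ≃ₗᵢ[ℝ] V)) (x : V) (L : List V) : Prop where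
  mem : ∀ a ∈ L, ∃ u ∈ orbitOf G x, ∃ v ∈ orbitOf G x, u ≠ v ∧ u ≠ -v ∧ a = u - v
  pairwise : L.Pairwise fun a b => ⟪Z a, b⟫ = 0
  connected : ∀ y ∈ orbitOf G x, y ∈ orbitOf (reflGroup {a | a ∈ L}) x

theorem BlockList.neg {Z : V →ₗ[ℝ] V} {G : Subgroup (V ≃ₗᵢ[ℝ] V)} {x : V} {L : List V}
    (h : BlockList Z G (-x) L) : BlockList Z G x L where
  mem a ha := by
    obtain ⟨u, hu, v, hv, h1, h2, rfl⟩ := h.mem a ha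
    refine ⟨-v, by simpa using orbitOf_neg hv, -u, by simpa using orbitOf_neg hu, ?_, ?_, by abel⟩
    · exact fun h => h1 (neg_inj.mp h).symm
    · rw [neg_neg]; exact fun h => h2 h.symm
  pairwise := h.pairwise
  connected y hy := by simpa using orbitOf_neg (h.connected _ (orbitOf_neg hy))

theorem exists_sorted (p : ℤ → Prop) (a : ℤ) (m : ℕ) :
    ∃ ks : List ℤ, ks.Pairwise (· < ·) ∧ ∀ k, k ∈ ks ↔ a ≤ k ∧ k < a + m ∧ p k := by
  classical
  refine ⟨((List.range m).map fun i : ℕ => a + i).filter (fun k => p k), ?_, fun k => ?_⟩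
  · refine List.Pairwise.filter _ (List.Pairwise.map _ (fun i j h => ?_) List.pairwise_lt_range)
    omega
  · simp only [List.mem_filter, List.mem_map, List.mem_range, decide_eq_true_eq]
    constructor
    · rintro ⟨⟨i, hi, rfl⟩, h⟩
      exact ⟨by omega, by omega, h⟩
    · rintro ⟨h1, h2, h3⟩
      exact ⟨⟨(k - a).toNat, by omega, by omega⟩, h3⟩

theorem mem_orbitOf_of_sub {L : List V} {u v : V} (h : u - v ∈ L) (huv : ⟪u, u⟫ = ⟪v, v⟫) :
    v ∈ orbitOf (reflGroup {a | a ∈ L}) u :=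
  ⟨_, hyperplaneReflection_mem_reflGroup h, hyperplaneReflection_swap huv⟩

theorem reflGroup_mono {A B : Set V} (h : A ⊆ B) : reflGroup A ≤ reflGroup B :=
  Subgroup.closure_mono (Set.image_mono h)

variable [FiniteDimensional ℝ V]

namespace DFrame

variable {c : V ≃ₗᵢ[ℝ] V} {m : ℕ} {f : ℤ → V} {g : V} {ρ : ℝ} (D : DFrame c m f g ρ)
  {Z : V →ₗ[ℝ] V} (hZ : ∀ u, Z u - c (Z u) = u)

include D

omit [FiniteDimensional ℝ V] in
theorem f_ne {s t : ℤ} (hst : s < t) (hts : t < s + m) : f s ≠ f t ∧ f s ≠ -f t := by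
  have h1 := D.inner_f s t hst.le hts
  rw [if_neg hst.ne'] at h1
  have h2 : ⟪f s, f s⟫ = ρ := D.inner_self (f_mem_pts f g s)
  have h3 := D.rho_pos
  refine ⟨fun h => ?_, fun h => ?_⟩
  · rw [← h] at h1; linarith
  · rw [h, inner_neg_neg] at h2
    rw [h, inner_neg_left] at h1
    linarith

omit [FiniteDimensional ℝ V] in
theorem f_ne_g (s : ℤ) : f s ≠ g ∧ f s ≠ -g := by
  have h1 := D.inner_fg s
  have h2 := D.inner_gg
  have h3 := D.rho_pos
  refine ⟨fun h => ?_, fun h => ?_⟩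
  · rw [h] at h1; linarith
  · rw [h, inner_neg_left] at h1; linarith

include hZ

/-- The roots are the differences of successive vertices. The vector `Z (f k - f k')` involves only
vertices before `k'`, so within a half circle it is orthogonal to all later ones. -/
theorem exists_chain (ks : List ℤ) (k : ℤ) (hks : (k :: ks).Pairwise (· < ·))
    (hlt : ∀ l ∈ ks, l < k + m) : ∃ L : List V,
      (∀ a ∈ L, ∃ s ∈ k :: ks, ∃ t ∈ k :: ks, s < t ∧ a = f s - f t) ∧
      (L.Pairwise fun a b => ⟪Z a, b⟫ = 0) ∧
      ∀ l ∈ k :: ks, f l ∈ orbitOf (reflGroup {a | a ∈ L}) (f k) := by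
  induction ks generalizing k with
  | nil =>
    refine ⟨[], by simp, List.Pairwise.nil, fun l hl => ?_⟩
    rw [List.mem_singleton.mp hl]
    exact mem_orbitOf_self _ _
  | cons k' ks ih =>
    rw [List.pairwise_cons] at hks
    have hk' := hks.1 k' List.mem_cons_self
    obtain ⟨L, h1, h2, h3⟩ := ih k' hks.2 (fun l hl => by
      have := hlt l (List.mem_cons_of_mem _ hl); omega)
    have hle : ∀ l ∈ k' :: ks, k' ≤ l := by
      intro l hl
      rcases List.mem_cons.mp hl with rfl | hl
      · exact le_rfl
      · exact ((List.pairwise_cons.mp hks.2).1 l hl).le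
    refine ⟨(f k - f k') :: L, ?_, ?_, ?_⟩
    · intro a ha
      rcases List.mem_cons.mp ha with rfl | ha
      · exact ⟨k, List.mem_cons_self, k', List.mem_cons_of_mem _ List.mem_cons_self, hk', rfl⟩
      · obtain ⟨s, hs, t, ht, h⟩ := h1 a ha
        exact ⟨s, List.mem_cons_of_mem _ hs, t, List.mem_cons_of_mem _ ht, h⟩
    · refine List.pairwise_cons.mpr ⟨fun a ha => ?_, h2⟩
      obtain ⟨s, hs, t, ht, hst, rfl⟩ := h1 a ha
      have hz : ∀ l ∈ k' :: ks, ⟪Z (f k - f k'), f l⟫ = 0 := by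
        intro l hl
        have h4 := hle l hl
        have h5 := hlt l hl
        have h6 := hlt k' List.mem_cons_self
        rw [D.form_chord hZ hk'.le h6.le (by omega) h5, if_neg (by omega)]
      rw [inner_sub_right, hz s hs, hz t ht, sub_zero]
    · have hstep : f k' ∈ orbitOf (reflGroup {a | a ∈ (f k - f k') :: L}) (f k) :=
        mem_orbitOf_of_sub List.mem_cons_self
          (by rw [D.inner_self (f_mem_pts f g k), D.inner_self (f_mem_pts f g k')])
      intro l hl
      rcases List.mem_cons.mp hl with rfl | hl
      · exact mem_orbitOf_self _ _
      · exact orbitOf_trans hstep (orbitOf_mono (reflGroup_mono fun a ha =>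
          List.mem_cons_of_mem _ ha) (h3 l hl))

variable {A : Set V} (hA : A ⊆ diffs f g)
  (hN : DiagramNoncrossing (coxeterPlane c) (pts f g) (reflGroup A))

include hA hN

/-- A symmetric block spans a system of type `D`: the chain of its vertices in one half circle,
preceded by `f k + g` and `f k - g` for the first vertex. Here `⟪Z (f k), ·⟫` is constant on the
chain, and in `⟪Z (f k + g), f k - g⟫` the two halves of `ρ` cancel. -/
theorem exists_blockList_symmetric {x : V} (hx : x ∈ pts f g) {v : V}
    (hv : v ∈ orbitOf (reflGroup A) x) (hv' : -v ∈ orbitOf (reflGroup A) x) :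
    ∃ L, BlockList Z (reflGroup A) x L := by
  have hm := D.three_le
  have hneg : ∀ w ∈ orbitOf (reflGroup A) x, -w ∈ orbitOf (reflGroup A) x := fun w hw =>
    orbitOf_trans hv' (orbitOf_neg (orbitOf_trans (orbitOf_symm hv) hw))
  obtain ⟨i, hi⟩ : ∃ i, f i ∈ orbitOf (reflGroup A) x := by
    have hvp := D.orbitOf_subset hA hx hv
    obtain ⟨a, ha, ha1, ha2⟩ := D.exists_mem_orbitOf_of_neg_mem hA hvp
      (orbitOf_trans (orbitOf_symm hv) hv')
    have hax := orbitOf_trans hv ha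
    rcases pts_cases hvp with ⟨i, rfl⟩ | hvg
    · exact ⟨i, hv⟩
    rcases pts_cases (D.orbitOf_subset hA hx hax) with ⟨i, rfl⟩ | hag
    · exact ⟨i, hax⟩
    rcases hvg with rfl | rfl <;> rcases hag with rfl | rfl <;> simp_all
  obtain ⟨hg, hg'⟩ := D.g_mem_orbitOf hA hN hx hi (hneg _ hi)
  obtain ⟨ks, hks1, hks2⟩ := exists_sorted (fun k => f k ∈ orbitOf (reflGroup A) x) 0 m
  have hrep : ∀ k, f k ∈ orbitOf (reflGroup A) x → ∃ l ∈ ks, f k = f l ∨ f k = -f l := by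
    intro k hk
    obtain ⟨l, h1, h2, h3⟩ := D.exists_rep 0 k
    rcases lt_or_ge l m with h | h
    · exact ⟨l, (hks2 l).mpr ⟨h1, by omega, h3 ▸ hk⟩, Or.inl h3⟩
    · have h4 := D.f_sub l
      refine ⟨l - m, (hks2 _).mpr ⟨by omega, by omega, ?_⟩, Or.inr (by rw [h4, neg_neg, h3])⟩
      rw [h4, ← h3]
      exact hneg _ hk
  obtain ⟨l₀, hl₀, -⟩ := hrep i hi
  cases ks with
  | nil => simp at hl₀
  | cons k ks =>
  have hkx := ((hks2 k).mp List.mem_cons_self)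
  have hle : ∀ l ∈ k :: ks, k ≤ l := by
    intro l hl
    rcases List.mem_cons.mp hl with rfl | hl
    · exact le_rfl
    · exact ((List.pairwise_cons.mp hks1).1 l hl).le
  have hlt : ∀ l ∈ k :: ks, l < k + m := by
    intro l hl
    have := ((hks2 l).mp hl).2.1
    omega
  obtain ⟨L, hL1, hL2, hL3⟩ := D.exists_chain hZ ks k hks1
    (fun l hl => hlt l (List.mem_cons_of_mem _ hl))
  have hkg := D.f_ne_g k
  have hgf : ∀ k, ⟪g, f k⟫ = 0 := fun k => by rw [real_inner_comm, D.inner_fg]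
  have hform : ∀ s : ℝ, ∀ a ∈ L, ⟪Z (f k + s • g), a⟫ = 0 := by
    intro r a ha
    obtain ⟨s, hs, t, ht, hst, rfl⟩ := hL1 a ha
    rw [map_add, map_smul, inner_add_left, inner_smul_left, D.form_g hZ, inner_sub_right,
      D.form_half hZ (hle s hs) (hlt s hs), D.form_half hZ (hle t ht) (hlt t ht), inner_sub_right,
      hgf, hgf]
    simp
  have hfg : ⟪f k, f k⟫ = ⟪g, g⟫ := by rw [D.inner_self (f_mem_pts f g k), D.inner_gg]
  refine ⟨(f k - -g) :: (f k - g) :: L, ?_, ?_, ?_⟩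
  · intro a ha
    rcases List.mem_cons.mp ha with rfl | ha
    · exact ⟨_, hkx.2.2, _, hg', hkg.2, by rw [neg_neg]; exact hkg.1, rfl⟩
    rcases List.mem_cons.mp ha with rfl | ha
    · exact ⟨_, hkx.2.2, _, hg, hkg.1, hkg.2, rfl⟩
    obtain ⟨s, hs, t, ht, hst, rfl⟩ := hL1 a ha
    have h1 := D.f_ne hst (by have := hle s hs; have := hlt t ht; omega)
    exact ⟨_, ((hks2 s).mp hs).2.2, _, ((hks2 t).mp ht).2.2, h1.1, h1.2, rfl⟩
  · refine List.pairwise_cons.mpr ⟨fun a ha => ?_, List.pairwise_cons.mpr ⟨fun a ha => ?_, hL2⟩⟩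
    · rcases List.mem_cons.mp ha with rfl | ha
      · simp only [sub_neg_eq_add, map_add, inner_add_left, inner_sub_right, D.form_fg hZ,
          D.form_g hZ, hgf, D.inner_gg, D.form_half hZ le_rfl (by omega : k < k + m)]
        ring
      · have := hform 1 a ha
        rwa [one_smul, ← sub_neg_eq_add] at this
    · have := hform (-1) a ha
      rwa [neg_one_smul, ← sub_eq_add_neg] at this
  · have hK : ∀ l ∈ k :: ks,
        f l ∈ orbitOf (reflGroup {a | a ∈ (f k - -g) :: (f k - g) :: L}) (f k) := fun l hl =>
      orbitOf_mono (reflGroup_mono fun a ha =>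
        List.mem_cons_of_mem _ (List.mem_cons_of_mem _ ha)) (hL3 l hl)
    have hKg : g ∈ orbitOf (reflGroup {a | a ∈ (f k - -g) :: (f k - g) :: L}) (f k) :=
      mem_orbitOf_of_sub (List.mem_cons_of_mem _ List.mem_cons_self) hfg
    have hKg' : -g ∈ orbitOf (reflGroup {a | a ∈ (f k - -g) :: (f k - g) :: L}) (f k) :=
      mem_orbitOf_of_sub List.mem_cons_self (by rw [inner_neg_neg, hfg])
    have hKk : -f k ∈ orbitOf (reflGroup {a | a ∈ (f k - -g) :: (f k - g) :: L}) (f k) :=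
      orbitOf_trans hKg (orbitOf_symm (orbitOf_neg' hKg'))
    have hall : ∀ y ∈ orbitOf (reflGroup A) x,
        y ∈ orbitOf (reflGroup {a | a ∈ (f k - -g) :: (f k - g) :: L}) (f k) := by
      intro y hy
      rcases pts_cases (D.orbitOf_subset hA hx hy) with ⟨j, rfl⟩ | rfl | rfl
      · obtain ⟨l, hl, h | h⟩ := hrep j hy
        · rw [h]; exact hK l hl
        · rw [h]; exact orbitOf_trans hKk (orbitOf_neg (hK l hl))
      · exact hKg
      · exact hKg'
    intro y hy
    exact orbitOf_trans (orbitOf_symm (hall x (mem_orbitOf_self _ _))) (hall y hy)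

/-- Without opposite points the vertices fit into a half circle and form a chain. If `g` is in the
block, the root `f k - g` goes in front: `⟪Z (f k), ·⟫` is constant along the chain and `⟪Z g, ·⟫`
is zero. -/
theorem exists_blockList_half {x : V} (hx : x ∈ pts f g)
    (hno : ∀ v ∈ orbitOf (reflGroup A) x, -v ∉ orbitOf (reflGroup A) x)
    (hg' : -g ∉ orbitOf (reflGroup A) x) : ∃ L, BlockList Z (reflGroup A) x L := by
  have hm := D.three_le
  obtain ⟨a, ha⟩ := D.exists_half_of_diagram hA hN hx hno
  obtain ⟨ks, hks1, hks2⟩ := exists_sorted (fun k => f k ∈ orbitOf (reflGroup A) x) a m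
  have hrep : ∀ k, f k ∈ orbitOf (reflGroup A) x → ∃ l ∈ ks, f k = f l := by
    intro k hk
    obtain ⟨l, h1, h2, h3⟩ := ha k hk
    exact ⟨l, (hks2 l).mpr ⟨h1, h2, h3 ▸ hk⟩, h3⟩
  cases ks with
  | nil =>
    refine ⟨[], by simp, List.Pairwise.nil, ?_⟩
    have hall : ∀ y ∈ orbitOf (reflGroup A) x, y = g := by
      intro y hy
      rcases pts_cases (D.orbitOf_subset hA hx hy) with ⟨j, rfl⟩ | rfl | rfl
      · obtain ⟨l, hl, -⟩ := hrep j hy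
        simp at hl
      · rfl
      · exact absurd hy hg'
    intro y hy
    rw [hall y hy, hall x (mem_orbitOf_self _ _)]
    exact mem_orbitOf_self _ _
  | cons k ks =>
  have hkx := ((hks2 k).mp List.mem_cons_self)
  have hle : ∀ l ∈ k :: ks, k ≤ l := by
    intro l hl
    rcases List.mem_cons.mp hl with rfl | hl
    · exact le_rfl
    · exact ((List.pairwise_cons.mp hks1).1 l hl).le
  have hlt : ∀ l ∈ k :: ks, l < k + m := by
    intro l hl
    have := ((hks2 l).mp hl).2.1
    omega
  obtain ⟨L, hL1, hL2, hL3⟩ := D.exists_chain hZ ks k hks1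
    (fun l hl => hlt l (List.mem_cons_of_mem _ hl))
  have hLmem : ∀ a ∈ L, ∃ u ∈ orbitOf (reflGroup A) x, ∃ v ∈ orbitOf (reflGroup A) x,
      u ≠ v ∧ u ≠ -v ∧ a = u - v := by
    intro a ha
    obtain ⟨s, hs, t, ht, hst, rfl⟩ := hL1 a ha
    have h1 := D.f_ne hst (by have := hle s hs; have := hlt t ht; omega)
    exact ⟨_, ((hks2 s).mp hs).2.2, _, ((hks2 t).mp ht).2.2, h1.1, h1.2, rfl⟩
  have hkg := D.f_ne_g k
  by_cases hg : g ∈ orbitOf (reflGroup A) x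
  · refine ⟨(f k - g) :: L, ?_, ?_, ?_⟩
    · intro a ha
      rcases List.mem_cons.mp ha with rfl | ha
      · exact ⟨_, hkx.2.2, _, hg, hkg.1, hkg.2, rfl⟩
      · exact hLmem a ha
    · refine List.pairwise_cons.mpr ⟨fun a ha => ?_, hL2⟩
      obtain ⟨s, hs, t, ht, hst, rfl⟩ := hL1 a ha
      have hgf : ∀ k, ⟪g, f k⟫ = 0 := fun k => by rw [real_inner_comm, D.inner_fg]
      rw [map_sub, inner_sub_left, D.form_g hZ, inner_sub_right, inner_sub_right, hgf, hgf,
        D.form_half hZ (hle s hs) (hlt s hs), D.form_half hZ (hle t ht) (hlt t ht)]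
      ring
    · have hall : ∀ y ∈ orbitOf (reflGroup A) x,
          y ∈ orbitOf (reflGroup {a | a ∈ (f k - g) :: L}) (f k) := by
        intro y hy
        rcases pts_cases (D.orbitOf_subset hA hx hy) with ⟨j, rfl⟩ | rfl | rfl
        · obtain ⟨l, hl, h⟩ := hrep j hy
          rw [h]
          exact orbitOf_mono (reflGroup_mono fun a ha => List.mem_cons_of_mem _ ha) (hL3 l hl)
        · exact mem_orbitOf_of_sub List.mem_cons_self
            (by rw [D.inner_self (f_mem_pts f y k), D.inner_gg])
        · exact absurd hy hg'
      intro y hy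
      exact orbitOf_trans (orbitOf_symm (hall x (mem_orbitOf_self _ _))) (hall y hy)
  · refine ⟨L, hLmem, hL2, ?_⟩
    have hall : ∀ y ∈ orbitOf (reflGroup A) x,
        y ∈ orbitOf (reflGroup {a | a ∈ L}) (f k) := by
      intro y hy
      rcases pts_cases (D.orbitOf_subset hA hx hy) with ⟨j, rfl⟩ | rfl | rfl
      · obtain ⟨l, hl, h⟩ := hrep j hy
        rw [h]
        exact hL3 l hl
      · exact absurd hy hg
      · exact absurd hy hg'
    intro y hy
    exact orbitOf_trans (orbitOf_symm (hall x (mem_orbitOf_self _ _))) (hall y hy)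

theorem exists_blockList {x : V} (hx : x ∈ pts f g) : ∃ L, BlockList Z (reflGroup A) x L := by
  by_cases hsym : ∃ v ∈ orbitOf (reflGroup A) x, -v ∈ orbitOf (reflGroup A) x
  · obtain ⟨v, hv, hv'⟩ := hsym
    exact D.exists_blockList_symmetric hZ hA hN hx hv hv'
  push Not at hsym
  by_cases hg : -g ∈ orbitOf (reflGroup A) x
  · obtain ⟨L, hL⟩ := D.exists_blockList_half hZ hA hN (D.neg_mem hx)
      (fun v hv hv' => hsym (-v) (by simpa using orbitOf_neg hv) (by simpa using orbitOf_neg hv'))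
      (fun h => hsym _ hg (by simpa using orbitOf_neg h))
    exact ⟨L, hL.neg⟩
  · exact D.exists_blockList_half hZ hA hN hx hsym hg

/-- One list is used for each pair of opposite blocks, because a root moves both blocks at once. The
lists are orthogonal to each other for the form, so their order is immaterial. -/
theorem exists_list_of_diagram (P : List V) (hP : ∀ x ∈ P, x ∈ pts f g) : ∃ L : List V,
    (∀ a ∈ L, ∃ x ∈ P, ∃ u ∈ orbitOf (reflGroup A) x, ∃ v ∈ orbitOf (reflGroup A) x,
      u ≠ v ∧ u ≠ -v ∧ a = u - v) ∧
    (L.Pairwise fun a b => ⟪Z a, b⟫ = 0) ∧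
    ∀ x ∈ P, ∀ y ∈ orbitOf (reflGroup A) x, y ∈ orbitOf (reflGroup {a | a ∈ L}) x := by
  induction P with
  | nil => exact ⟨[], by simp, List.Pairwise.nil, by simp⟩
  | cons p P ih =>
    obtain ⟨L, h1, h2, h3⟩ := ih fun x hx => hP x (List.mem_cons_of_mem _ hx)
    by_cases hex : ∃ x ∈ P, p ∈ orbitOf (reflGroup A) x ∨ -p ∈ orbitOf (reflGroup A) x
    · refine ⟨L, fun a ha => ?_, h2, fun x hx y hy => ?_⟩
      · obtain ⟨x, hx, h⟩ := h1 a ha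
        exact ⟨x, List.mem_cons_of_mem _ hx, h⟩
      · rcases List.mem_cons.mp hx with rfl | hx
        · obtain ⟨z, hz, h | h⟩ := hex
          · exact orbitOf_trans (orbitOf_symm (h3 z hz _ h)) (h3 z hz _ (orbitOf_trans h hy))
          · have h4 := orbitOf_trans (orbitOf_symm (h3 z hz _ h))
              (h3 z hz _ (orbitOf_trans h (orbitOf_neg hy)))
            simpa using orbitOf_neg h4
        · exact h3 x hx y hy
    · push Not at hex
      have hp := hP p List.mem_cons_self
      obtain ⟨L', hL'⟩ := D.exists_blockList hZ hA hN hp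
      refine ⟨L' ++ L, fun a ha => ?_, ?_, fun x hx y hy => ?_⟩
      · rcases List.mem_append.mp ha with ha | ha
        · exact ⟨p, List.mem_cons_self, hL'.mem a ha⟩
        · obtain ⟨x, hx, h⟩ := h1 a ha
          exact ⟨x, List.mem_cons_of_mem _ hx, h⟩
      · refine List.pairwise_append.mpr ⟨hL'.pairwise, h2, fun a ha b hb => ?_⟩
        obtain ⟨u, hu, v, hv, -, -, rfl⟩ := hL'.mem a ha
        obtain ⟨x, hx, u', hu', v', hv', -, -, rfl⟩ := h1 b hb
        have h4 := hex x hx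
        exact D.form_eq_zero hA hN hp (hP x (List.mem_cons_of_mem _ hx))
          (fun hc => h4.1 (orbitOf_symm hc)) (fun hc => h4.2 (orbitOf_symm (orbitOf_neg' hc))) hZ
          hu hv hu' hv'
      · rcases List.mem_cons.mp hx with rfl | hx
        · exact orbitOf_mono (reflGroup_mono fun a ha => List.mem_append_left _ ha)
            (hL'.connected y hy)
        · exact orbitOf_mono (reflGroup_mono fun a ha => List.mem_append_right _ ha)
            (h3 x hx y hy)

/-- The triangular list has the same orbits as `A` and therefore generates the same group;
triangularity makes it an initial segment of a factorization of `c`. -/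
theorem isNoncrossing_of_diagram (hc : c ∈ reflGroup (diffs f g)) :
    IsNoncrossing (hyperplaneReflection '' diffs f g) c (reflGroup A) := by
  have hm := D.three_le
  obtain ⟨L, h1, h2, h3⟩ := D.exists_list_of_diagram hZ hA hN
    (g :: -g :: (List.range (2 * m)).map fun i : ℕ => f i) (by
      intro x hx
      simp only [List.mem_cons, List.mem_map] at hx
      rcases hx with rfl | rfl | ⟨i, -, rfl⟩
      · exact g_mem_pts f x
      · exact neg_g_mem_pts f g
      · exact f_mem_pts f g _)
  have hP : ∀ x ∈ pts f g, x ∈ g :: -g :: (List.range (2 * m)).map fun i : ℕ => f i := by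
    intro x hx
    rcases pts_cases hx with ⟨i, rfl⟩ | rfl | rfl
    · obtain ⟨l, hl1, hl2, hl⟩ := D.exists_rep 0 i
      refine List.mem_cons_of_mem _ (List.mem_cons_of_mem _ (List.mem_map.mpr
        ⟨l.toNat, List.mem_range.mpr (by omega), ?_⟩))
      rw [hl]; congr 1; omega
    · simp
    · simp
  have hLp : ∀ a ∈ L, ∃ u ∈ pts f g, ∃ v ∈ orbitOf (reflGroup A) u,
      u ≠ v ∧ u ≠ -v ∧ a = u - v := by
    intro a ha
    obtain ⟨x, hx, u, hu, v, hv, h⟩ := h1 a ha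
    have hx' : x ∈ pts f g := by
      simp only [List.mem_cons, List.mem_map] at hx
      rcases hx with rfl | rfl | ⟨i, -, rfl⟩
      · exact g_mem_pts f x
      · exact neg_g_mem_pts f g
      · exact f_mem_pts f g _
    exact ⟨u, D.orbitOf_subset hA hx' hu, v, orbitOf_trans (orbitOf_symm hu) hv, h⟩
  have hLd : {a | a ∈ L} ⊆ diffs f g := by
    intro a ha
    obtain ⟨u, hu, v, hv, h4, h5, rfl⟩ := hLp a ha
    exact ⟨u, hu, v, D.orbitOf_subset hA hu hv, h4, h5, rfl⟩
  have heq : reflGroup A = reflGroup {a | a ∈ L} := by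
    refine le_antisymm (D.reflGroup_le_of_orbitOf hA hLd fun x hx y hy => h3 x (hP x hx) y hy) ?_
    rw [reflGroup, Subgroup.closure_le]
    rintro _ ⟨a, ha, rfl⟩
    obtain ⟨u, hu, v, hv, h4, h5, rfl⟩ := hLp a ha
    exact D.hyperplaneReflection_sub_mem hA hu hv h4.symm
      (fun h => h5 (by rw [h, neg_neg]))
  rw [heq]
  exact isNoncrossing_of_pairwise rfl hZ hc (fun a ha => hyperplaneReflection_mem_reflGroup ha)
    (fun a ha => D.diff_ne_zero ha) (fun w hw F hF => D.exists_word hw F hF) hLd h2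

omit hZ hA hN in
/-- The noncrossing criterion for a frame of type `D`. -/
theorem isNoncrossing_iff (hc : c ∈ reflGroup (diffs f g)) (hA : A ⊆ diffs f g) :
    IsNoncrossing (hyperplaneReflection '' diffs f g) c (reflGroup A) ↔
      DiagramNoncrossing (coxeterPlane c) (pts f g) (reflGroup A) := by
  obtain ⟨Z, hZ⟩ := D.exists_resolvent
  refine ⟨fun h => ?_, fun h => D.isNoncrossing_of_diagram hZ hA h hc⟩
  obtain ⟨L, hL1, hL2, hL3⟩ := D.exists_word hc ⊥ fun v hv => by
    rw [(Submodule.mem_bot ℝ).mp hv, map_zero]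
  obtain ⟨L₁, L₂, h1, h2, h3, h4⟩ := exists_lists_of_isNoncrossing rfl hZ ⟨L, hL1, hL2, by omega⟩ h
  rw [h4]
  exact D.diagramNoncrossing ⟨hZ, h1, h2, h3⟩

end DFrame

end TypeDLists

/-! ### Simple systems and the two half products of a bipartition. -/

namespace SimpleSystem

variable {V : Type*} [NormedAddCommGroup V] [InnerProductSpace ℝ V]
  {ι : Type*} {M : CoxeterMatrix ι} (Δ : SimpleSystem M V)

theorem inner_root_self (i : ι) : ⟪Δ.root i, Δ.root i⟫ = 1 := by
  rw [Δ.inner_root, M.diagonal]; simp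

theorem group_eq : Δ.group = reflGroup (Set.range Δ.root) := by
  rw [group, reflGroup, ← Set.range_comp]
  rfl

theorem simpleReflection_mem (i : ι) : Δ.simpleReflection i ∈ Δ.group :=
  Subgroup.subset_closure ⟨i, rfl⟩

theorem reflections_eq : Δ.reflections =
    hyperplaneReflection '' {a | ∃ w ∈ Δ.group, ∃ i, a = w (Δ.root i)} := by
  ext t
  constructor
  · rintro ⟨w, hw, i, rfl⟩
    exact ⟨w (Δ.root i), ⟨w, hw, i, rfl⟩, (hyperplaneReflection_conj _ _).symm⟩
  · rintro ⟨_, ⟨w, hw, i, rfl⟩, rfl⟩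
    exact ⟨w, hw, i, (hyperplaneReflection_conj _ _).symm⟩

theorem reflections_subset {t : V ≃ₗᵢ[ℝ] V} (ht : t ∈ Δ.reflections) : t ∈ Δ.group := by
  obtain ⟨w, hw, i, rfl⟩ := ht
  exact mul_mem (mul_mem hw (Δ.simpleReflection_mem i)) (inv_mem hw)

theorem conj_mem_reflections {w t : V ≃ₗᵢ[ℝ] V} (hw : w ∈ Δ.group) (ht : t ∈ Δ.reflections) :
    w * t * w⁻¹ ∈ Δ.reflections := by
  obtain ⟨w', hw', i, rfl⟩ := ht
  exact ⟨w * w', mul_mem hw hw', i, by simp only [mul_inv_rev, mul_assoc]⟩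

theorem IsParabolic.exists_eq {Δ : SimpleSystem M V} {W' : Subgroup (V ≃ₗᵢ[ℝ] V)}
    (h : Δ.IsParabolic W') : ∃ w ∈ Δ.group, ∃ J : Set ι,
      W' = reflGroup ((fun i => w (Δ.root i)) '' J) := by
  obtain ⟨w, hw, J, rfl⟩ := h
  refine ⟨w, hw, J, ?_⟩
  rw [MonoidHom.map_closure, reflGroup, Set.image_image, Set.image_image]
  congr 1
  refine Set.image_congr fun i _ => ?_
  exact hyperplaneReflection_conj _ _

variable [Fintype ι] {ε : ι → Bool} (hε : IsBipartition M ε) (b : Bool)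

omit [Fintype ι] in
theorem inner_root_of_bipartition (hε : IsBipartition M ε) {i j : ι} (hij : i ≠ j)
    (h : ε i = ε j) : ⟪Δ.root i, Δ.root j⟫ = 0 := by
  rw [Δ.inner_root, hε i j hij h]; simp

theorem halfProduct_mem : Δ.halfProduct hε b ∈ Δ.group :=
  Subgroup.noncommProd_mem _ _ fun i _ => Δ.simpleReflection_mem i

theorem coxeterElement_mem : Δ.coxeterElement hε ∈ Δ.group :=
  mul_mem (Δ.halfProduct_mem hε _) (Δ.halfProduct_mem hε _)

theorem halfProduct_of_inner_eq_zero {x : V} (h : ∀ i, ε i = b → ⟪Δ.root i, x⟫ = 0) :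
    Δ.halfProduct hε b x = x := by
  refine Finset.noncommProd_induction _ _ _ (fun w : V ≃ₗᵢ[ℝ] V => w x = x) ?_ rfl ?_
  · intro w w' h1 h2
    rw [LinearIsometryEquiv.coe_mul, Function.comp_apply, h2, h1]
  · intro i hi
    exact hyperplaneReflection_of_inner_eq_zero (h i (by simpa using hi))

theorem halfProduct_root {i : ι} (hi : ε i = b) :
    Δ.halfProduct hε b (Δ.root i) = -Δ.root i := by
  classical
  have hmem : i ∈ ({j | ε j = b} : Finset ι) := by simpa using hi
  have hmul := Finset.mul_noncommProd_erase ({j | ε j = b} : Finset ι) hmem Δ.simpleReflection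
    (fun i hi j hj hij => by
      have hi' : ε i = b := by simpa using hi
      have hj' : ε j = b := by simpa using hj
      exact Δ.commute_simpleReflection (hε i j hij (hi'.trans hj'.symm)))
  change (Finset.noncommProd {j | ε j = b} Δ.simpleReflection _) (Δ.root i) = _
  rw [← hmul, LinearIsometryEquiv.coe_mul, Function.comp_apply]
  have h : ∀ (s : Finset ι) comm, (∀ j ∈ s, j ≠ i ∧ ε j = b) →
      (s.noncommProd Δ.simpleReflection comm) (Δ.root i) = Δ.root i := by
    intro s comm hs
    refine Finset.noncommProd_induction _ _ _ (fun w : V ≃ₗᵢ[ℝ] V => w (Δ.root i) = Δ.root i) ?_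
      rfl ?_
    · intro w w' h1 h2
      rw [LinearIsometryEquiv.coe_mul, Function.comp_apply, h2, h1]
    · intro j hj
      exact hyperplaneReflection_of_inner_eq_zero
        (Δ.inner_root_of_bipartition hε (hs j hj).1 ((hs j hj).2.trans hi.symm))
  exact (congrArg (Δ.simpleReflection i) (h _ _ fun j hj => by simpa using hj)).trans
    (hyperplaneReflection_self _)

/-- The half products exchange points whose difference is a combination of the roots and whose
sum is orthogonal to them. -/
theorem halfProduct_apply {x y : V}
    (h : x - y ∈ Submodule.span ℝ {a | ∃ i, ε i = b ∧ Δ.root i = a})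
    (h' : ∀ i, ε i = b → ⟪Δ.root i, x + y⟫ = 0) : Δ.halfProduct hε b x = y := by
  have h1 : Δ.halfProduct hε b (x - y) = -(x - y) := by
    generalize x - y = z at h
    induction h using Submodule.span_induction with
    | mem a ha =>
      obtain ⟨i, hi, rfl⟩ := ha
      exact Δ.halfProduct_root hε b hi
    | zero => simp
    | add u v _ _ hu hv => rw [map_add, hu, hv, neg_add]
    | smul r u _ hu => rw [map_smul, hu, smul_neg]
  have h2 := Δ.halfProduct_of_inner_eq_zero hε b h'
  have h3 : x = (2⁻¹ : ℝ) • (x - y) + (2⁻¹ : ℝ) • (x + y) := by module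
  rw [h3, map_add, map_smul, map_smul, h1, h2]
  module

theorem halfProduct_mul_self : Δ.halfProduct hε b * Δ.halfProduct hε b = 1 := by
  have h1 : Δ.halfProduct hε b * Δ.halfProduct hε b =
      Finset.noncommProd {i | ε i = b} (fun i => Δ.simpleReflection i * Δ.simpleReflection i)
        (fun i _ j _ _ => by
          simp only [Function.onFun, simpleReflection, hyperplaneReflection_mul_self]
          exact Commute.one_left _) :=
    (Finset.noncommProd_mul_distrib _ _ _ _ (fun i hi j hj hij => by
      have hi' : ε i = b := by simpa using hi
      have hj' : ε j = b := by simpa using hj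
      exact Δ.commute_simpleReflection (hε i j hij (hi'.trans hj'.symm)))).symm
  rw [h1]
  refine Finset.noncommProd_induction _ _ _ (fun w : V ≃ₗᵢ[ℝ] V => w = 1) ?_ rfl ?_
  · rintro w w' rfl rfl; rfl
  · intro i _
    exact hyperplaneReflection_mul_self _

end SimpleSystem

/-! ### Frames obtained from a product of two involutions. -/

section InvolutionFrames

variable {V : Type*} [NormedAddCommGroup V] [InnerProductSpace ℝ V]

theorem DFrame.of_inner {c : V ≃ₗᵢ[ℝ] V} {m : ℕ} {f : ℤ → V} {g : V} {ρ : ℝ} (hm : 3 ≤ m)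
    (map_f : ∀ i, c (f i) = f (i + 1)) (f_add : ∀ i, f (i + m) = -f i) (map_g : c g = -g)
    (rho_pos : 0 < ρ)
    (inner_f : ∀ i k : ℤ, i ≤ k → k < i + m → ⟪f i, f k⟫ = if k = i then ρ else 0)
    (inner_fg : ∀ i, ⟪f i, g⟫ = 0) (inner_gg : ⟪g, g⟫ = ρ)
    (span : Submodule.span ℝ (Set.range f ∪ {g}) = ⊤) : DFrame c m f g ρ where
  three_le := hm
  map_f := map_f
  f_add := f_add
  map_g := map_g
  g_ne := by
    rintro rfl
    rw [inner_zero_left] at inner_gg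
    linarith
  inj := by
    have h0 := inner_f 0 0 le_rfl (by omega)
    rw [if_pos rfl] at h0
    intro k hk hk' h
    rcases lt_or_ge k m with hkm | hkm
    · have h1 := inner_f 0 k (by omega) (by omega)
      rw [h, h0, if_neg (by omega)] at h1
      linarith
    · have h1 := inner_f 0 (k - m) (by omega) (by omega)
      have h2 := f_add (k - m)
      rw [sub_add_cancel] at h2
      rw [← neg_eq_iff_eq_neg] at h2
      rw [← h2, h, inner_neg_right, h0] at h1
      split_ifs at h1 <;> linarith
  span := span
  pos := by
    have hm' : (0 : ℝ) < m := by exact_mod_cast (by omega : 0 < m)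
    -- Only `j = 0` and `j = m` contribute, and at `j = m` the signs of the cosine and of `f m = -f
    -- 0` cancel; the sum is `2ρ`.
    have h1 : ∀ j ∈ Finset.range (2 * m), Real.cos (Real.pi * j / m) * ⟪f 0, f j⟫ =
        (if j = 0 then ρ else 0) + (if j = m then ρ else 0) := by
      intro j hj
      rw [Finset.mem_range] at hj
      rcases lt_or_ge j m with hjm | hjm
      · rw [inner_f 0 j (by omega) (by omega), if_neg (by omega : ¬ j = m)]
        rcases Nat.eq_zero_or_pos j with rfl | h
        · simp
        · rw [if_neg (by omega), if_neg (by omega)]; simp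
      · have h2 := f_add (j - m)
        rw [sub_add_cancel] at h2
        rw [h2, inner_neg_right, inner_f 0 (j - m) (by omega) (by omega),
          if_neg (by omega : ¬ j = 0)]
        rcases hjm.eq_or_lt with rfl | h
        · rw [if_pos (by omega), if_pos rfl, mul_div_assoc, div_self hm'.ne', mul_one,
            Real.cos_pi]
          ring
        · rw [if_neg (by omega), if_neg (by omega)]; simp
    rw [Finset.sum_congr rfl h1, Finset.sum_add_distrib, Finset.sum_ite_eq', Finset.sum_ite_eq',
      if_pos (by simp; omega), if_pos (by simp; omega)]
    linarith
  rho_pos := rho_pos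
  inner_f := inner_f
  inner_fg := inner_fg
  inner_gg := inner_gg

/-- The inverse runs through the polygon backwards. It is needed since exchanging the classes of the
bipartition inverts the Coxeter element. -/
theorem DFrame.inv {c : V ≃ₗᵢ[ℝ] V} {m : ℕ} {f : ℤ → V} {g : V} {ρ : ℝ}
    (D : DFrame c m f g ρ) : DFrame c⁻¹ m (fun i => f (-i)) g ρ := by
  refine DFrame.of_inner D.three_le (fun i => ?_) (fun i => ?_) D.inv_g D.rho_pos
    (fun i k h1 h2 => ?_) (fun i => D.inner_fg _) D.inner_gg ?_
  · rw [D.inv_f, neg_add, sub_eq_add_neg]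
  · rw [neg_add, ← sub_eq_add_neg, D.f_sub]
  · rw [real_inner_comm, D.inner_f _ _ (by omega) (by omega)]
    congr 1
    rw [neg_inj]
    exact propext eq_comm
  · rw [← D.span]
    congr 2
    exact (Equiv.neg ℤ).surjective.range_comp f

/-- Positions of the basis vectors along a zigzag. -/
def zigzag (k : ℕ) : ℤ := if Even k then -(k / 2 : ℕ) else ((k + 1) / 2 : ℕ)

theorem zigzag_succ_of_even {k : ℕ} (h : Even k) : zigzag (k + 1) = 1 - zigzag k := by
  have h' : ¬ Even (k + 1) := by rw [Nat.even_add_one]; exact not_not.mpr h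
  rw [zigzag, zigzag, if_neg h', if_pos h]
  obtain ⟨p, rfl⟩ := h
  omega

theorem zigzag_succ_of_odd {k : ℕ} (h : ¬ Even k) : zigzag (k + 1) = -zigzag k := by
  have h' : Even (k + 1) := by rw [Nat.even_add_one]; exact h
  rw [zigzag, zigzag, if_pos h', if_neg h]

theorem exists_zigzag {m : ℕ} {j : ℤ} (h1 : -((m - 1 : ℕ) / 2 : ℕ) ≤ j)
    (h2 : j < m - ((m - 1 : ℕ) / 2 : ℕ)) : ∃ k < m, zigzag k = j := by
  rcases lt_or_ge 0 j with h | h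
  · refine ⟨(2 * j - 1).toNat, by omega, ?_⟩
    rw [zigzag, if_neg]
    · omega
    · rw [Nat.not_even_iff]; omega
  · refine ⟨(-2 * j).toNat, by omega, ?_⟩
    rw [zigzag, if_pos]
    · omega
    · rw [Nat.even_iff]; omega

/-- The frame of a product of two involutions that exchange consecutive vectors of an orthogonal
basis. -/
theorem exists_dframe {σ τ : V ≃ₗᵢ[ℝ] V} (hσ : σ * σ = 1) (hτ : τ * τ = 1) {E : ℕ → V} {m : ℕ}
    {ρ : ℝ} (hm : 3 ≤ m) (h0 : τ (E 0) = E 0)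
    (heven : ∀ k, k + 2 ≤ m → Even k → σ (E k) = E (k + 1))
    (hodd : ∀ k, k + 2 ≤ m → ¬ Even k → τ (E k) = E (k + 1))
    (hlast : (if Even (m - 1) then σ else τ) (E (m - 1)) = -E (m - 1))
    (hg : (σ * τ) (E m) = -E m) (hρ : 0 < ρ)
    (hin : ∀ j k, j ≤ m → k ≤ m → ⟪E j, E k⟫ = if j = k then ρ else 0)
    (hspan : Submodule.span ℝ (E '' {k | k ≤ m}) = ⊤) :
    ∃ f, DFrame (σ * τ) m f (E m) ρ ∧ (∀ k < m, ∃ i, f i = E k) ∧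
      ∀ i, ∃ k < m, f i = E k ∨ f i = -E k := by
  set c := σ * τ with hc
  have hσ' : σ⁻¹ = σ := inv_eq_of_mul_eq_one_left hσ
  have hτ' : τ⁻¹ = τ := inv_eq_of_mul_eq_one_left hτ
  let f : ℤ → V := fun i => (c ^ i) (E 0)
  have hadd : ∀ i j : ℤ, (c ^ i) (f j) = f (i + j) := by
    intro i j
    change (c ^ i) ((c ^ j) (E 0)) = (c ^ (i + j)) (E 0)
    rw [zpow_add, LinearIsometryEquiv.coe_mul, Function.comp_apply]
  -- The involutions invert `c`. Hence `τ` acts on the indices by `i ↦ -i` and `σ` by `i ↦ 1 - i`,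
  -- and applying them alternately to the index `0` produces the zigzag.
  have hτc : ∀ i : ℤ, τ * c ^ i = c ^ (-i) * τ := by
    have h1 : τ * c * τ⁻¹ = c⁻¹ := by
      rw [hc, mul_inv_rev, hσ', hτ', ← mul_assoc, mul_assoc, hτ, mul_one]
    intro i
    rw [zpow_neg, ← inv_zpow, ← h1, conj_zpow, inv_mul_cancel_right]
  have hτf : ∀ i, τ (f i) = f (-i) := by
    intro i
    have := congrArg (fun w : V ≃ₗᵢ[ℝ] V => w (E 0)) (hτc i)
    simp only [LinearIsometryEquiv.coe_mul, Function.comp_apply, h0] at this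
    exact this
  have hσf : ∀ i, σ (f i) = f (1 - i) := by
    intro i
    have h1 : σ = c * τ := by rw [hc, mul_assoc, hτ, mul_one]
    rw [h1, LinearIsometryEquiv.coe_mul, Function.comp_apply, hτf, sub_eq_add_neg, ← hadd 1,
      zpow_one]
  have hz : ∀ k < m, f (zigzag k) = E k := by
    intro k
    induction k with
    | zero => intro _; rfl
    | succ k ih =>
      intro hk
      by_cases h : Even k
      · rw [zigzag_succ_of_even h, ← hσf, ih (by omega), heven k (by omega) h]
      · rw [zigzag_succ_of_odd h, ← hτf, ih (by omega), hodd k (by omega) h]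
  -- The involution that is next in turn leads to the following zigzag position and negates `E (m -
  -- 1)` at the same time. The two positions are at distance `m`, whence `f (i + m) = -f i`.
  have hflip : f (zigzag m) = -f (zigzag (m - 1)) := by
    have hm1 : m = (m - 1) + 1 := by omega
    rw [hz (m - 1) (by omega), ← hlast]
    by_cases h : Even (m - 1)
    · rw [if_pos h, ← hz (m - 1) (by omega), hσf, ← zigzag_succ_of_even h, ← hm1]
    · rw [if_neg h, ← hz (m - 1) (by omega), hτf, ← zigzag_succ_of_odd h, ← hm1]
  have hshift : ∀ i j t : ℤ, f i = -f j → f (t + i) = -f (t + j) := by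
    intro i j t h
    rw [← hadd, h, map_neg, hadd]
  have f_add : ∀ i, f (i + m) = -f i := by
    intro i
    rcases Nat.even_or_odd' (m - 1) with ⟨p, hp | hp⟩
    · have e1 : zigzag (m - 1) = -p := by
        rw [zigzag, if_pos (hp ▸ even_two_mul p)]; omega
      have e2 : zigzag m = p + 1 := by
        rw [zigzag, if_neg (by rw [Nat.not_even_iff]; omega)]; omega
      have := hshift _ _ (i + p) hflip
      rw [e1, e2] at this
      rw [show i + (m : ℤ) = i + p + (p + 1) by omega, this]
      congr 2; ring
    · have e1 : zigzag (m - 1) = p + 1 := by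
        rw [zigzag, if_neg (by rw [Nat.not_even_iff]; omega)]; omega
      have e2 : zigzag m = -(p + 1) := by
        rw [zigzag, if_pos (by rw [Nat.even_iff]; omega)]; omega
      have := hshift _ _ (i + (p + 1)) hflip
      rw [e1, e2] at this
      rw [eq_neg_iff_add_eq_zero, add_comm, ← eq_neg_iff_add_eq_zero,
        show i + (m : ℤ) = i + (p + 1) + (p + 1) by omega, ← this]
      congr 1; ring
  -- The zigzag positions of `E 0, …, E (m - 1)` are the `m` consecutive integers from `lo` on;
  -- powers of `c` move any window of length `m` there.
  set lo : ℤ := -((m - 1 : ℕ) / 2 : ℕ) with hlo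
  have hrange : ∀ j, lo ≤ j → j < lo + m → ∃ k < m, zigzag k = j := fun j h1 h2 =>
    exists_zigzag (m := m) h1 (by omega)
  have hinner : ∀ i k : ℤ, i ≤ k → k < i + m → ⟪f i, f k⟫ = if k = i then ρ else 0 := by
    intro i k h1 h2
    obtain ⟨a, ha, hza⟩ := hrange lo le_rfl (by omega)
    obtain ⟨b, hb, hzb⟩ := hrange (lo + (k - i)) (by omega) (by omega)
    have e1 : f i = (c ^ (i - lo)) (E a) := by
      rw [← hz a ha, hadd, hza]; congr 1; ring
    have e2 : f k = (c ^ (i - lo)) (E b) := by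
      rw [← hz b hb, hadd, hzb]; congr 1; ring
    rw [e1, e2, LinearIsometryEquiv.inner_map_map, hin a b ha.le hb.le]
    congr 1
    refine propext ⟨fun h => ?_, fun h => ?_⟩
    · rw [h, hzb] at hza; omega
    · have : zigzag a = zigzag b := by rw [hza, hzb, h]; ring
      simp only [zigzag] at this
      split_ifs at this with c1 c2 c2
      · rw [Nat.even_iff] at c1 c2; omega
      · rw [Nat.even_iff] at c1 c2; omega
      · rw [Nat.even_iff] at c1 c2; omega
      · rw [Nat.even_iff] at c1 c2; omega
  have hfE : ∀ i, ∃ k < m, f i = E k ∨ f i = -E k := by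
    have hsucc : ∀ i : ℤ, (∃ k < m, f i = E k ∨ f i = -E k) ↔
        ∃ k < m, f (i + m) = E k ∨ f (i + m) = -E k := by
      intro i
      rw [f_add]
      refine exists_congr fun k => and_congr_right fun _ => ?_
      rw [neg_inj, neg_eq_iff_eq_neg, or_comm]
    have hmul : ∀ i t : ℤ, (∃ k < m, f i = E k ∨ f i = -E k) ↔
        ∃ k < m, f (i + m * t) = E k ∨ f (i + m * t) = -E k := by
      intro i t
      induction t using Int.induction_on with
      | zero => simp
      | succ t ih => rw [ih, hsucc, mul_add, mul_one, ← add_assoc]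
      | pred t ih =>
        rw [ih, hsucc (i + m * (-(t : ℤ) - 1))]
        rw [show i + m * (-(t : ℤ) - 1) + m = i + m * -(t : ℤ) by ring]
    intro i
    have h1 := Int.emod_nonneg (i - lo) (by omega : (m : ℤ) ≠ 0)
    have h2 := Int.emod_lt_of_pos (i - lo) (by omega : (0 : ℤ) < m)
    have h3 := Int.emod_add_mul_ediv (i - lo) m
    obtain ⟨k, hk, hzk⟩ := hrange (lo + (i - lo) % m) (by omega) (by omega)
    have h4 := (hmul (lo + (i - lo) % m) ((i - lo) / m)).mp ⟨k, hk, Or.inl (hzk ▸ hz k hk)⟩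
    rwa [show lo + (i - lo) % m + m * ((i - lo) / m) = i by linarith] at h4
  refine ⟨f, DFrame.of_inner hm (fun i => ?_) f_add hg hρ hinner (fun i => ?_) ?_ ?_,
    fun k hk => ⟨_, hz k hk⟩, hfE⟩
  · have := hadd 1 i
    rwa [zpow_one, add_comm] at this
  · obtain ⟨k, hk, h | h⟩ := hfE i
    · rw [h, hin k m hk.le le_rfl, if_neg hk.ne]
    · rw [h, inner_neg_left, hin k m hk.le le_rfl, if_neg hk.ne, neg_zero]
  · rw [hin m m le_rfl le_rfl, if_pos rfl]
  · rw [eq_top_iff, ← hspan]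
    refine Submodule.span_mono ?_
    rintro _ ⟨k, hk, rfl⟩
    rcases (show k ≤ m from hk).eq_or_lt with rfl | hk
    · exact Or.inr rfl
    · exact Or.inl ⟨_, hz k hk⟩

end InvolutionFrames

/-! ### An orthogonal basis from the simple roots of type `D`. -/

section TypeDRoots

variable {V : Type*} [NormedAddCommGroup V] [InnerProductSpace ℝ V]

theorem iff_of_ite_not {p q : Prop} [Decidable p] [Decidable q] {s : Bool}
    (h : (if p then s else !s) = if q then s else !s) : p ↔ q := by
  by_cases hp : p <;> by_cases hq : q <;> simp_all

/-- Inner products of the simple roots of type `D` on the nodes `0, …, m`. -/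
def typeDInner (m j k : ℕ) : ℝ :=
  if j = k then 1
  else if (j + 1 = k ∧ k < m) ∨ (k + 1 = j ∧ j < m) ∨ (j + 2 = k ∧ k = m) ∨ (k + 2 = j ∧ j = m)
    then -1 / 2
  else 0

/-- The orthogonal basis, in reverse order, of which the roots are sums and differences. -/
def revAxis (m : ℕ) (R : ℕ → V) : ℕ → V
  | 0 => (2⁻¹ : ℝ) • (R m - R (m - 1))
  | j + 1 => R (m - 1 - j) + revAxis m R j

/-- The orthogonal basis of which the roots are sums and differences. -/
def axis (m : ℕ) (R : ℕ → V) (k : ℕ) : V := revAxis m R (m - k)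

variable {m : ℕ} {R : ℕ → V}

theorem axis_last : axis m R m = (2⁻¹ : ℝ) • (R m - R (m - 1)) := by
  rw [axis, Nat.sub_self, revAxis]

theorem axis_eq {k : ℕ} (hk : k < m) : axis m R k = R k + axis m R (k + 1) := by
  rw [axis, axis, show m - k = (m - (k + 1)) + 1 by omega, revAxis]
  congr 2; omega

theorem root_last (hm : 3 ≤ m) : R m = axis m R (m - 1) + axis m R m := by
  have h := axis_eq (R := R) (show m - 1 < m by omega)
  rw [Nat.sub_add_cancel (by omega), axis_last] at h
  rw [h, axis_last]
  module

theorem inner_root_axis (hm : 3 ≤ m)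
    (hR : ∀ j k, j ≤ m → k ≤ m → ⟪R j, R k⟫ = typeDInner m j k) (k l : ℕ) (hk : k ≤ m)
    (hl : l ≤ m) : ⟪R k, axis m R l⟫ =
      if k = m then (if l + 1 = m ∨ l = m then 1 / 2 else 0)
      else if l = k then 1 / 2 else if l = k + 1 then -1 / 2 else 0 := by
  induction hl using Nat.decreasingInduction with
  | self =>
    rw [axis_last, inner_smul_right, inner_sub_right, hR k m hk le_rfl,
      hR k (m - 1) hk (by omega), typeDInner, typeDInner]
    split_ifs <;> first | omega | norm_num
  | of_succ l hl ih =>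
    rw [axis_eq hl, inner_add_right, ih, hR k l hk (by omega), typeDInner]
    split_ifs <;> first | omega | norm_num

theorem inner_axis (hm : 3 ≤ m)
    (hR : ∀ j k, j ≤ m → k ≤ m → ⟪R j, R k⟫ = typeDInner m j k) (k l : ℕ) (hk : k ≤ m)
    (hl : l ≤ m) : ⟪axis m R k, axis m R l⟫ = if k = l then 1 / 2 else 0 := by
  induction hk using Nat.decreasingInduction with
  | self =>
    rw [axis_last, inner_smul_left, inner_sub_left, inner_root_axis hm hR m l le_rfl hl,
      inner_root_axis hm hR (m - 1) l (by omega) hl, conj_trivial]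
    split_ifs <;> first | omega | norm_num
  | of_succ k hk ih =>
    rw [axis_eq hk, inner_add_left, ih, inner_root_axis hm hR k l hk.le hl]
    split_ifs <;> first | omega | norm_num

theorem span_axis (hm : 3 ≤ m) (hR : Submodule.span ℝ (R '' {k | k ≤ m}) = ⊤) :
    Submodule.span ℝ (axis m R '' {k | k ≤ m}) = ⊤ := by
  have hmem : ∀ k, k ≤ m → axis m R k ∈ Submodule.span ℝ (axis m R '' {k | k ≤ m}) :=
    fun k hk => Submodule.subset_span ⟨k, hk, rfl⟩
  rw [eq_top_iff, ← hR, Submodule.span_le]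
  rintro _ ⟨k, hk, rfl⟩
  rcases (show k ≤ m from hk).eq_or_lt with rfl | hk
  · rw [root_last (R := R) hm]
    exact Submodule.add_mem _ (hmem _ (by omega)) (hmem _ le_rfl)
  · have : R k = axis m R k - axis m R (k + 1) := by rw [axis_eq hk]; abel
    rw [this]
    exact Submodule.sub_mem _ (hmem _ hk.le) (hmem _ hk)

end TypeDRoots

/-! ### The bipartite Coxeter element of type `D` and its frame. -/

namespace SimpleSystem

variable {V : Type*} [NormedAddCommGroup V] [InnerProductSpace ℝ V]
  {ι : Type*} {M : CoxeterMatrix ι} (Δ : SimpleSystem M V) {m : ℕ} (e : ι ≃ Fin (m + 1))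

/-- The root of the node with number `k`. -/
def nodeRoot (k : ℕ) : V := Δ.root (e.symm (Fin.ofNat (m + 1) k))

theorem root_eq_nodeRoot (i : ι) : Δ.root i = Δ.nodeRoot e (e i) := by
  rw [nodeRoot, Fin.ofNat_eq_cast, Fin.cast_val_eq_self, Equiv.symm_apply_apply]

theorem span_nodeRoot : Submodule.span ℝ (Δ.nodeRoot e '' {k | k ≤ m}) = ⊤ := by
  rw [eq_top_iff, ← Δ.span_root]
  refine Submodule.span_mono ?_
  rintro _ ⟨i, rfl⟩
  exact ⟨e i, Nat.lt_succ_iff.mp (e i).isLt, (Δ.root_eq_nodeRoot e i).symm⟩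

variable {e} (hM : M.reindex e = typeD (m + 1))

include hM

theorem coxeterMatrix_apply {j k : ℕ} (hj : j ≤ m) (hk : k ≤ m) :
    M (e.symm (Fin.ofNat (m + 1) j)) (e.symm (Fin.ofNat (m + 1) k)) =
      if j = k then 1
      else if (j + 1 = k ∧ k < m) ∨ (k + 1 = j ∧ j < m) ∨ (j + 2 = k ∧ k = m) ∨ (k + 2 = j ∧ j = m)
        then 3
      else 2 := by
  have h1 : M (e.symm (Fin.ofNat (m + 1) j)) (e.symm (Fin.ofNat (m + 1) k)) =
      (M.reindex e) (Fin.ofNat (m + 1) j) (Fin.ofNat (m + 1) k) := rfl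
  have hj' : ((Fin.ofNat (m + 1) j : Fin (m + 1)) : ℕ) = j := Nat.mod_eq_of_lt (by omega)
  have hk' : ((Fin.ofNat (m + 1) k : Fin (m + 1)) : ℕ) = k := Nat.mod_eq_of_lt (by omega)
  rw [h1, hM]
  change (if (Fin.ofNat (m + 1) j) = (Fin.ofNat (m + 1) k) then 1 else
    if _ then 3 else 2) = _
  simp only [Fin.ext_iff, hj', hk']
  grind

theorem inner_nodeRoot (j k : ℕ) (hj : j ≤ m) (hk : k ≤ m) :
    ⟪Δ.nodeRoot e j, Δ.nodeRoot e k⟫ = typeDInner m j k := by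
  rw [nodeRoot, nodeRoot, Δ.inner_root, coxeterMatrix_apply hM hj hk, typeDInner]
  split_ifs
  · simp
  · rw [Nat.cast_ofNat, Real.cos_pi_div_three]; norm_num
  · simp

variable {ε : ι → Bool} (hε : IsBipartition M ε)

omit hM in
/-- The sign of the node with number `k`. -/
def nodeSign (e : ι ≃ Fin (m + 1)) (ε : ι → Bool) (k : ℕ) : Bool :=
  ε (e.symm (Fin.ofNat (m + 1) k))

include hε

theorem nodeSign_ne {j k : ℕ} (hj : j ≤ m) (hk : k ≤ m)
    (h : (j + 1 = k ∧ k < m) ∨ (j + 2 = k ∧ k = m)) :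
    nodeSign e ε k = !nodeSign e ε j := by
  by_contra hcon
  have h1 : ε (e.symm (Fin.ofNat (m + 1) j)) = ε (e.symm (Fin.ofNat (m + 1) k)) := by
    simp only [nodeSign] at hcon
    cases h1 : ε (e.symm (Fin.ofNat (m + 1) j)) <;>
      cases h2 : ε (e.symm (Fin.ofNat (m + 1) k)) <;> simp_all
  have h2 := coxeterMatrix_apply hM hj hk
  have h3 : e.symm (Fin.ofNat (m + 1) j) ≠ e.symm (Fin.ofNat (m + 1) k) := by
    intro h3
    rw [h3, M.diagonal] at h2
    split_ifs at h2 <;> omega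
  rw [hε _ _ h3 h1] at h2
  split_ifs at h2 <;> omega

/-- Signs alternate along the path. The last node has the sign of node `m - 1`, as both are joined
to node `m - 2`. -/
theorem nodeSign_eq (hm : 3 ≤ m) (k : ℕ) (hk : k ≤ m) : nodeSign e ε k =
    if Even (if k = m then m - 1 else k) then nodeSign e ε 0 else !nodeSign e ε 0 := by
  have key : ∀ k, k < m → nodeSign e ε k =
      if Even k then nodeSign e ε 0 else !nodeSign e ε 0 := by
    intro k
    induction k with
    | zero => intro _; simp
    | succ k ih =>
      intro hk
      rw [nodeSign_ne hM hε (by omega : k ≤ m) hk.le (Or.inl ⟨rfl, hk⟩), ih (by omega)]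
      simp only [Nat.even_add_one]
      by_cases h : Even k <;> simp [h]
  rcases hk.eq_or_lt with rfl | hk
  · rw [if_pos rfl, nodeSign_ne hM hε (by omega : k - 2 ≤ k) le_rfl (Or.inr ⟨by omega, rfl⟩),
      key _ (by omega)]
    have : Even (k - 1) ↔ ¬ Even (k - 2) := by
      rw [← Nat.even_add_one]
      congr! 1; omega
    by_cases h : Even (k - 2) <;> simp [h, this]
  · rw [if_neg hk.ne, key k hk]

variable [Fintype ι]

theorem halfProduct_axis {b : Bool} {x y : V}
    (h : x - y ∈ Submodule.span ℝ {a | ∃ k ≤ m, nodeSign e ε k = b ∧ Δ.nodeRoot e k = a})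
    (h' : ∀ k ≤ m, nodeSign e ε k = b → ⟪Δ.nodeRoot e k, x + y⟫ = 0) :
    Δ.halfProduct hε b x = y := by
  refine Δ.halfProduct_apply hε b (Submodule.span_mono ?_ h) fun i hi => ?_
  · rintro _ ⟨k, hk, hb, rfl⟩
    exact ⟨_, hb, rfl⟩
  · rw [Δ.root_eq_nodeRoot e]
    refine h' _ (Nat.lt_succ_iff.mp (e i).isLt) ?_
    rw [nodeSign, Fin.ofNat_eq_cast, Fin.cast_val_eq_self, Equiv.symm_apply_apply, hi]

/-- The half product of the class of node `0` exchanges consecutive axes from even positions, and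
the other one from odd positions. The class of the two last nodes contains the reflections in the
sum and the difference of the last two axes, so it negates both of these axes. -/
theorem exists_dframe_mul (hm : 3 ≤ m) :
    ∃ f, DFrame (Δ.halfProduct hε (nodeSign e ε 0) * Δ.halfProduct hε (!nodeSign e ε 0)) m f
      (axis m (Δ.nodeRoot e) m) (1 / 2) ∧ (∀ k < m, ∃ i, f i = axis m (Δ.nodeRoot e) k) ∧
      ∀ i, ∃ k < m, f i = axis m (Δ.nodeRoot e) k ∨ f i = -axis m (Δ.nodeRoot e) k := by
  set E := axis m (Δ.nodeRoot e) with hE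
  set s := nodeSign e ε 0 with hs
  have hsign : ∀ k ≤ m, nodeSign e ε k = if Even (if k = m then m - 1 else k) then s else !s :=
    nodeSign_eq hM hε hm
  have hRE : ∀ k l, k ≤ m → l ≤ m → ⟪Δ.nodeRoot e k, E l⟫ =
      if k = m then (if l + 1 = m ∨ l = m then 1 / 2 else 0)
      else if l = k then 1 / 2 else if l = k + 1 then -1 / 2 else 0 :=
    inner_root_axis hm (Δ.inner_nodeRoot hM)
  have hsub : ∀ k < m, Δ.nodeRoot e k = E k - E (k + 1) := by
    intro k hk
    rw [hE, axis_eq hk]; abel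
  have hlast : Δ.nodeRoot e m = E (m - 1) + E m := root_last hm
  have hpen : Δ.nodeRoot e (m - 1) = E (m - 1) - E m := by
    rw [hsub _ (by omega), Nat.sub_add_cancel (by omega)]
  have hmem : ∀ k ≤ m, Δ.nodeRoot e k ∈ Submodule.span ℝ
      {a | ∃ k' ≤ m, nodeSign e ε k' = nodeSign e ε k ∧ Δ.nodeRoot e k' = a} :=
    fun k hk => Submodule.subset_span ⟨k, hk, rfl, rfl⟩
  have hsgn : nodeSign e ε m = nodeSign e ε (m - 1) := by
    rw [hsign m le_rfl, hsign (m - 1) (by omega), if_pos (rfl : m = m), if_neg (by omega : m - 1 ≠ m)]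
  have step : ∀ k, k + 2 ≤ m → Δ.halfProduct hε (nodeSign e ε k) (E k) = E (k + 1) := by
    intro k hk
    refine Δ.halfProduct_axis hM hε ?_ fun j hj hjk => ?_
    · rw [← hsub k (by omega)]; exact hmem k (by omega)
    · rw [hsign j hj, hsign k (by omega), if_neg (by omega : k ≠ m)] at hjk
      rw [inner_add_right, hRE j k hj (by omega), hRE j (k + 1) hj (by omega)]
      have hpar := iff_of_ite_not hjk
      rw [Nat.even_iff, Nat.even_iff] at hpar
      split_ifs at hpar ⊢ <;> first | omega | norm_num
  have hneg : ∀ l, m ≤ l + 1 → l ≤ m → Δ.halfProduct hε (nodeSign e ε (m - 1)) (E l) = -E l := by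
    intro l hl1 hl2
    refine Δ.halfProduct_axis hM hε ?_ fun j hj hjk => by rw [add_neg_cancel, inner_zero_right]
    have h1 := hmem m le_rfl
    rw [hsgn] at h1
    have h2 := hmem (m - 1) (by omega)
    rcases (show l = m ∨ l = m - 1 by omega) with rfl | rfl
    · convert Submodule.sub_mem _ h1 h2 using 1
      rw [hlast, hpen]; abel
    · convert Submodule.add_mem _ h1 h2 using 1
      rw [hlast, hpen]; abel
  have hfix : ∀ b, b ≠ nodeSign e ε (m - 1) → Δ.halfProduct hε b (E m) = E m := by
    intro b hb
    refine Δ.halfProduct_axis hM hε (by rw [sub_self]; exact Submodule.zero_mem _)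
      fun j hj hjb => ?_
    have h1 : j ≠ m := by rintro rfl; exact hb (hjb.symm.trans hsgn)
    have h2 : j ≠ m - 1 := by rintro rfl; exact hb hjb.symm
    rw [inner_add_right, hRE j m hj le_rfl, if_neg h1, if_neg (by omega), if_neg (by omega),
      add_zero]
  have hs1 : nodeSign e ε (m - 1) = if Even (m - 1) then s else !s := by
    rw [hsign (m - 1) (by omega), if_neg (by omega : m - 1 ≠ m)]
  refine exists_dframe (Δ.halfProduct_mul_self hε _) (Δ.halfProduct_mul_self hε _) hm ?_ ?_ ?_ ?_ ?_
    (by norm_num) (inner_axis hm (Δ.inner_nodeRoot hM)) (span_axis hm (Δ.span_nodeRoot e))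
  · refine Δ.halfProduct_axis hM hε (by rw [sub_self]; exact Submodule.zero_mem _)
      fun j hj hjb => ?_
    have h1 : j ≠ 0 := by rintro rfl; rw [← hs] at hjb; exact absurd hjb (by simp)
    rw [inner_add_right, hRE j 0 hj (by omega)]
    split_ifs <;> first | contradiction | omega | norm_num
  · intro k hk hev
    have := step k hk
    rwa [hsign k (by omega), if_neg (by omega : k ≠ m), if_pos hev] at this
  · intro k hk hodd
    have := step k hk
    rwa [hsign k (by omega), if_neg (by omega : k ≠ m), if_neg hodd] at this
  · have := hneg (m - 1) (by omega) (by omega)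
    rw [hs1] at this
    split_ifs at this ⊢ <;> exact this
  · have h1 := hneg m (by omega) le_rfl
    have h2 := hfix (!nodeSign e ε (m - 1)) (by cases nodeSign e ε (m - 1) <;> simp)
    rw [hs1] at h1 h2
    rw [LinearIsometryEquiv.coe_mul, Function.comp_apply]
    split_ifs at h1 h2
    · rw [h2, h1]
    · rw [Bool.not_not] at h2
      rw [h1, map_neg, h2]

/-- The Coxeter element of a root system of type `D` has a frame. -/
theorem exists_dframe_coxeterElement (hm : 3 ≤ m) :
    ∃ f, DFrame (Δ.coxeterElement hε) m f (axis m (Δ.nodeRoot e) m) (1 / 2) ∧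
      (∀ k ≤ m, axis m (Δ.nodeRoot e) k ∈ pts f (axis m (Δ.nodeRoot e) m)) ∧
      ∀ x ∈ pts f (axis m (Δ.nodeRoot e) m), ∃ k ≤ m, x = axis m (Δ.nodeRoot e) k ∨
        x = -axis m (Δ.nodeRoot e) k := by
  obtain ⟨f, D, h1, h2⟩ := Δ.exists_dframe_mul hM hε hm
  have key : ∀ f' : ℤ → V, Set.range f' = Set.range f →
      (∀ k ≤ m, axis m (Δ.nodeRoot e) k ∈ pts f' (axis m (Δ.nodeRoot e) m)) ∧
      ∀ x ∈ pts f' (axis m (Δ.nodeRoot e) m), ∃ k ≤ m, x = axis m (Δ.nodeRoot e) k ∨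
        x = -axis m (Δ.nodeRoot e) k := by
    intro f' hf'
    rw [pts, hf']
    refine ⟨fun k hk => ?_, fun x hx => ?_⟩
    · rcases hk.eq_or_lt with rfl | hk
      · exact g_mem_pts f _
      · obtain ⟨i, hi⟩ := h1 k hk
        rw [← hi]
        exact f_mem_pts f _ i
    · rcases pts_cases hx with ⟨i, rfl⟩ | hx
      · obtain ⟨k, hk, h⟩ := h2 i
        exact ⟨k, hk.le, h⟩
      · exact ⟨m, le_rfl, hx⟩
  cases hs : nodeSign e ε 0 with
  | false =>
    rw [hs] at D
    exact ⟨f, D, key f rfl⟩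
  | true =>
    rw [hs] at D
    -- Here the class of node `0` is the one of sign `+`, so the frame at hand belongs to the
    -- inverse of `c_- c_+`.
    have D' := D.inv
    rw [mul_inv_rev, inv_eq_of_mul_eq_one_left (Δ.halfProduct_mul_self hε _),
      inv_eq_of_mul_eq_one_left (Δ.halfProduct_mul_self hε _)] at D'
    exact ⟨_, D', key _ ((Equiv.neg ℤ).surjective.range_comp f)⟩

end SimpleSystem

/-! ### Lower bounds for orbits in type `D` by orthogonal functions. -/

section SmallOrbits

variable {V : Type*} [NormedAddCommGroup V] [InnerProductSpace ℝ V]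

/-- Nonzero pairwise orthogonal functions on a finite set are at most as many as its points. -/
theorem card_le_of_orthogonal {o κ : Type*} [Fintype o] [Fintype κ] (φ : κ → o → ℝ)
    (h0 : ∀ i, ∃ u, φ i u ≠ 0) (h : ∀ i j, i ≠ j → ∑ u, φ i u * φ j u = 0) :
    Fintype.card κ ≤ Fintype.card o := by
  have hli : LinearIndependent ℝ fun i => (WithLp.toLp 2 (φ i) : EuclideanSpace ℝ o) := by
    refine linearIndependent_of_ne_zero_of_inner_eq_zero (fun i hi => ?_) fun i j hij => ?_
    · obtain ⟨u, hu⟩ := h0 i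
      exact hu (congrArg (fun x : EuclideanSpace ℝ o => x u) hi)
    · change ⟪(WithLp.toLp 2 (φ i) : EuclideanSpace ℝ o), WithLp.toLp 2 (φ j)⟫ = 0
      rw [PiLp.inner_apply]
      simp only [RCLike.inner_apply, conj_trivial]
      rw [← h j i (Ne.symm hij)]
  have := hli.fintype_card_le_finrank
  rwa [finrank_euclideanSpace] at this

theorem sum_orbitOf_map {G : Subgroup (V ≃ₗᵢ[ℝ] V)} {v : V} [Fintype (orbitOf G v)]
    {w : V ≃ₗᵢ[ℝ] V} (hw : w ∈ G) (F : V → ℝ) :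
    ∑ u : orbitOf G v, F (w u) = ∑ u : orbitOf G v, F u := by
  let E : orbitOf G v ≃ orbitOf G v :=
    { toFun := fun u => ⟨w u, orbitOf_trans u.2 ⟨w, hw, rfl⟩⟩
      invFun := fun u => ⟨w⁻¹ u, orbitOf_trans u.2 ⟨w⁻¹, inv_mem hw, rfl⟩⟩
      left_inv := fun u => Subtype.ext (w.symm_apply_apply u)
      right_inv := fun u => Subtype.ext (w.apply_symm_apply u) }
  exact Equiv.sum_comp E fun u : orbitOf G v => F u

theorem sum_orbitOf_eq_zero {G : Subgroup (V ≃ₗᵢ[ℝ] V)} {v : V} [Fintype (orbitOf G v)]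
    {w : V ≃ₗᵢ[ℝ] V} (hw : w ∈ G) {F : V → ℝ} (hF : ∀ u, F (w u) = -F u) :
    ∑ u : orbitOf G v, F u = 0 := by
  have h := sum_orbitOf_map (v := v) hw F
  simp only [hF, Finset.sum_neg_distrib] at h
  linarith

namespace DFrame

variable {c : V ≃ₗᵢ[ℝ] V} {m : ℕ} {f : ℤ → V} {g : V} {ρ : ℝ} (D : DFrame c m f g ρ)

/-- The basis of a frame. -/
def basisVec (f : ℤ → V) (g : V) (j : Option (Fin m)) : V := j.elim g fun i => f i

include D

theorem inner_basisVec (j k : Option (Fin m)) :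
    ⟪basisVec f g j, basisVec f g k⟫ = if j = k then ρ else 0 :=
  D.inner_index j k

theorem basisVec_mem (j : Option (Fin m)) : basisVec f g j ∈ pts f g := D.index_mem_pts j

theorem exists_basisVec {x : V} (hx : x ∈ pts f g) :
    ∃ j : Option (Fin m), x = basisVec f g j ∨ x = -basisVec f g j :=
  D.exists_index hx

theorem basisVec_ne {a b : Option (Fin m)} (hab : a ≠ b) :
    basisVec f g a ≠ basisVec f g b ∧ basisVec f g a ≠ -basisVec f g b := by
  have h1 := D.inner_basisVec a b
  rw [if_neg hab] at h1
  have h2 := D.inner_self (D.basisVec_mem b)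
  have h3 := D.rho_pos
  refine ⟨fun h => ?_, fun h => ?_⟩
  · rw [h] at h1; linarith
  · rw [h, inner_neg_left] at h1; linarith

theorem exists_perm (σ : Equiv.Perm (Option (Fin m))) :
    ∃ w ∈ reflGroup (diffs f g), ∀ j, w (basisVec f g j) = basisVec f g (σ j) := by
  induction σ using Equiv.Perm.swap_induction_on with
  | one => exact ⟨1, one_mem _, fun j => rfl⟩
  | swap_mul σ a b hab ih =>
    obtain ⟨w, hw, h⟩ := ih
    have hne := D.basisVec_ne hab
    refine ⟨hyperplaneReflection (basisVec f g a - basisVec f g b) * w, mul_mem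
      (hyperplaneReflection_mem_reflGroup ⟨_, D.basisVec_mem a, _, D.basisVec_mem b, hne.1, hne.2,
        rfl⟩) hw, fun j => ?_⟩
    rw [LinearIsometryEquiv.coe_mul, Function.comp_apply, h, Equiv.Perm.mul_apply]
    have h1 : ⟪basisVec f g a, basisVec f g a⟫ = ⟪basisVec f g b, basisVec f g b⟫ := by
      rw [D.inner_self (D.basisVec_mem a), D.inner_self (D.basisVec_mem b)]
    by_cases ha : σ j = a
    · rw [ha, Equiv.swap_apply_left, hyperplaneReflection_swap h1]
    by_cases hb : σ j = b
    · rw [hb, Equiv.swap_apply_right, hyperplaneReflection_swap' h1]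
    rw [Equiv.swap_apply_of_ne_of_ne ha hb, D.reflection_sub_apply (D.basisVec_mem a)
      (D.basisVec_mem b) (D.basisVec_mem _) (D.basisVec_ne ha).1 (D.basisVec_ne ha).2
      (D.basisVec_ne hb).1 (D.basisVec_ne hb).2]

/-- The change of two signs. -/
theorem exists_flip {a b : Option (Fin m)} (hab : a ≠ b) :
    ∃ w ∈ reflGroup (diffs f g), ∀ p u, ⟪w u, basisVec f g p⟫ =
      ((if p = a then -1 else 1) * (if p = b then -1 else 1)) * ⟪u, basisVec f g p⟫ := by
  have hne := D.basisVec_ne hab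
  have hbm := D.neg_mem (D.basisVec_mem b)
  have h1 : ⟪basisVec f g a, basisVec f g a⟫ = ⟪basisVec f g b, basisVec f g b⟫ := by
    rw [D.inner_self (D.basisVec_mem a), D.inner_self (D.basisVec_mem b)]
  have h2 : ⟪basisVec f g a, basisVec f g a⟫ = ⟪-basisVec f g b, -basisVec f g b⟫ := by
    rw [inner_neg_neg, h1]
  set w := hyperplaneReflection (basisVec f g a - basisVec f g b) *
    hyperplaneReflection (basisVec f g a - -basisVec f g b) with hw
  have hwG : w ∈ reflGroup (diffs f g) := mul_mem
    (hyperplaneReflection_mem_reflGroup ⟨_, D.basisVec_mem a, _, D.basisVec_mem b, hne.1, hne.2,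
      rfl⟩)
    (hyperplaneReflection_mem_reflGroup ⟨_, D.basisVec_mem a, _, hbm, hne.2,
      by rw [neg_neg]; exact hne.1, rfl⟩)
  have hwp : ∀ p, w (basisVec f g p) =
      ((if p = a then -1 else 1) * (if p = b then -1 else 1) : ℝ) • basisVec f g p := by
    intro p
    rw [hw, LinearIsometryEquiv.coe_mul, Function.comp_apply]
    by_cases ha : p = a
    · rw [ha, hyperplaneReflection_swap h2, map_neg, hyperplaneReflection_swap' h1, if_pos rfl,
        if_neg hab]
      simp
    by_cases hb : p = b
    · have h3 := hyperplaneReflection_swap' h2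
      rw [map_neg, neg_eq_iff_eq_neg] at h3
      rw [hb, h3, map_neg, hyperplaneReflection_swap h1, if_pos rfl, if_neg (Ne.symm hab)]
      simp
    rw [if_neg ha, if_neg hb, D.reflection_sub_apply (D.basisVec_mem a) hbm (D.basisVec_mem p)
      (D.basisVec_ne ha).1 (D.basisVec_ne ha).2 (D.basisVec_ne hb).2
      (by rw [neg_neg]; exact (D.basisVec_ne hb).1),
      D.reflection_sub_apply (D.basisVec_mem a)
      (D.basisVec_mem b) (D.basisVec_mem p) (D.basisVec_ne ha).1 (D.basisVec_ne ha).2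
      (D.basisVec_ne hb).1 (D.basisVec_ne hb).2]
    simp
  refine ⟨w, hwG, fun p u => ?_⟩
  have h3 := w.inner_map_map u (basisVec f g p)
  rw [hwp, inner_smul_right] at h3
  rw [← h3, ← mul_assoc]
  split_ifs <;> simp

/-- Products of coordinates. -/
theorem prod_flip {a b : Option (Fin m)} (hab : a ≠ b) :
    ∃ w ∈ reflGroup (diffs f g), ∀ (S : Finset (Option (Fin m))) u,
      ∏ p ∈ S, ⟪w u, basisVec f g p⟫ =
      ((if a ∈ S then -1 else 1) * (if b ∈ S then -1 else 1)) *
        ∏ p ∈ S, ⟪u, basisVec f g p⟫ := by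
  obtain ⟨w, hw, h⟩ := D.exists_flip hab
  refine ⟨w, hw, fun S u => ?_⟩
  rw [Finset.prod_congr rfl fun p _ => h p u, Finset.prod_mul_distrib, Finset.prod_mul_distrib,
    Finset.prod_ite_eq', Finset.prod_ite_eq']

/-- The group permutes the basis arbitrarily, so two nonzero coordinates can be carried to any two
positions. -/
theorem exists_prod_ne_zero {v : V} {p q : Option (Fin m)} (hpq : p ≠ q)
    (hp : ⟪v, basisVec f g p⟫ ≠ 0) (hq : ⟪v, basisVec f g q⟫ ≠ 0) {S : Finset (Option (Fin m))}
    (hS : S.card ≤ 2) :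
    ∃ u ∈ orbitOf (reflGroup (diffs f g)) v, ∏ p ∈ S, ⟪u, basisVec f g p⟫ ≠ 0 := by
  have hm := D.three_le
  obtain ⟨t, hSt, ht⟩ := Finset.exists_superset_card_eq hS (by simp; omega)
  obtain ⟨a, b, hab, rfl⟩ := Finset.card_eq_two.mp ht
  have hq' : Equiv.swap p a q ≠ a := by
    intro h
    have h1 := Equiv.swap_apply_left p a
    exact hpq ((Equiv.swap p a).injective (h1.trans h.symm))
  obtain ⟨w, hw, h⟩ := D.exists_perm (Equiv.swap (Equiv.swap p a q) b * Equiv.swap p a)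
  have ha : w (basisVec f g p) = basisVec f g a := by
    rw [h, Equiv.Perm.mul_apply, Equiv.swap_apply_left,
      Equiv.swap_apply_of_ne_of_ne (Ne.symm hq') hab]
  have hb : w (basisVec f g q) = basisVec f g b := by
    rw [h, Equiv.Perm.mul_apply, Equiv.swap_apply_left]
  refine ⟨w v, ⟨w, hw, rfl⟩, Finset.prod_ne_zero_iff.mpr fun r hr => ?_⟩
  rcases Finset.mem_insert.mp (hSt hr) with rfl | hr
  · rw [← ha, w.inner_map_map]; exact hp
  · rw [Finset.mem_singleton.mp hr, ← hb, w.inner_map_map]; exact hq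

/-- Changing the signs of a coordinate in the symmetric difference and of one outside it negates the
product of the two monomials. If the symmetric difference is everything, there is no such change. -/
theorem sum_prod_eq_zero {v : V} [Fintype (orbitOf (reflGroup (diffs f g)) v)]
    {S S' : Finset (Option (Fin m))} (hne : S ≠ S') (hu : symmDiff S S' ≠ Finset.univ) :
    ∑ u : orbitOf (reflGroup (diffs f g)) v, (∏ p ∈ S, ⟪(u : V), basisVec f g p⟫) *
      ∏ p ∈ S', ⟪(u : V), basisVec f g p⟫ = 0 := by
  obtain ⟨a, ha⟩ : (symmDiff S S').Nonempty := by
    rw [Finset.nonempty_iff_ne_empty]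
    intro h
    exact hne (symmDiff_eq_bot.mp h)
  obtain ⟨b, hb⟩ : ∃ b, b ∉ symmDiff S S' := by
    by_contra hcon
    push Not at hcon
    exact hu (Finset.eq_univ_iff_forall.mpr hcon)
  have hab : a ≠ b := fun h => hb (h ▸ ha)
  obtain ⟨w, hw, h⟩ := D.prod_flip hab
  refine sum_orbitOf_eq_zero hw (F := fun u => (∏ p ∈ S, ⟪u, basisVec f g p⟫) *
      ∏ p ∈ S', ⟪u, basisVec f g p⟫) fun u => ?_
  rw [h, h]
  rw [Finset.mem_symmDiff] at ha hb
  by_cases h1 : a ∈ S <;> by_cases h2 : a ∈ S' <;> by_cases h3 : b ∈ S <;> by_cases h4 : b ∈ S' <;>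
    simp_all

theorem eq_sum_basisVec (v : V) :
    v = ∑ j : Option (Fin m), (⟪v, basisVec f g j⟫ / ρ) • basisVec f g j := by
  have hρ := D.rho_pos
  rw [← sub_eq_zero]
  set y := v - ∑ j : Option (Fin m), (⟪v, basisVec f g j⟫ / ρ) • basisVec f g j with hy
  have h1 : ∀ k : Option (Fin m), ⟪y, basisVec f g k⟫ = 0 := by
    intro k
    rw [hy, inner_sub_left, sum_inner]
    simp only [inner_smul_left, conj_trivial, D.inner_basisVec, mul_ite, mul_zero,
      Finset.sum_ite_eq', Finset.mem_univ, if_true]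
    field_simp
    ring
  have h2 : ∀ x ∈ pts f g, ⟪y, x⟫ = 0 := by
    intro x hx
    obtain ⟨j, rfl | rfl⟩ := D.exists_basisVec hx
    · exact h1 j
    · rw [inner_neg_right, h1, neg_zero]
  have h3 : innerₛₗ ℝ y = 0 := by
    refine LinearMap.ext_on D.span ?_
    rintro x (⟨i, rfl⟩ | rfl)
    · exact h2 _ (f_mem_pts f g i)
    · exact h2 _ (g_mem_pts f x)
  have h4 := congrArg (fun φ : V →ₗ[ℝ] ℝ => φ y) h3
  exact inner_self_eq_zero.mp h4

theorem encard_pts_le : (pts f g).encard ≤ ((m + 1) * 2 : ℕ) := by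
  have h : pts f g ⊆ (fun p : Option (Fin m) × Bool =>
      if p.2 then basisVec f g p.1 else -basisVec f g p.1) '' Set.univ := by
    intro x hx
    obtain ⟨j, rfl | rfl⟩ := D.exists_basisVec hx
    · exact ⟨(j, true), trivial, rfl⟩
    · exact ⟨(j, false), trivial, rfl⟩
  refine (Set.encard_le_encard h).trans ((Set.encard_image_le _ _).trans ?_)
  rw [Set.encard_univ, ENat.card_eq_coe_fintype_card]
  simp

theorem sum_prod_sq_sub_eq_zero {v : V} [Fintype (orbitOf (reflGroup (diffs f g)) v)]
    {S : Finset (Option (Fin m))} (hne : S.Nonempty) (hu : S ≠ Finset.univ) (μ : ℝ) :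
    ∑ u : orbitOf (reflGroup (diffs f g)) v, (⟪(u : V), g⟫ ^ 2 - μ) *
      ∏ p ∈ S, ⟪(u : V), basisVec f g p⟫ = 0 := by
  obtain ⟨a, ha⟩ := hne
  obtain ⟨b, hb⟩ : ∃ b, b ∉ S := by
    by_contra hcon
    push Not at hcon
    exact hu (Finset.eq_univ_iff_forall.mpr hcon)
  have hab : a ≠ b := fun h => hb (h ▸ ha)
  obtain ⟨w, hw, h⟩ := D.prod_flip hab
  refine sum_orbitOf_eq_zero hw (F := fun u => (⟪u, g⟫ ^ 2 - μ) *
      ∏ p ∈ S, ⟪u, basisVec f g p⟫) fun u => ?_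
  have h1 := h {none} u
  rw [Finset.prod_singleton, Finset.prod_singleton] at h1
  change ⟪w u, g⟫ = _ * ⟪u, g⟫ at h1
  have h2 : ⟪w u, g⟫ ^ 2 = ⟪u, g⟫ ^ 2 := by
    rw [h1]
    split_ifs <;> ring
  rw [h, h2, if_pos ha, if_neg hb]
  ring

/-- Squarefree monomials of degrees one and two are nonzero pairwise orthogonal functions on the
orbit: symmetric differences have at most four of the `m + 1 ≥ 5` coordinates. Their number `(m + 1)
+ (m + 1) m / 2` exceeds `2 (m + 1)`. -/
theorem card_lt_of_two_lt {v : V} [Fintype (orbitOf (reflGroup (diffs f g)) v)]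
    {p q : Option (Fin m)} (hpq : p ≠ q)
    (hp : ⟪v, basisVec f g p⟫ ≠ 0) (hq : ⟪v, basisVec f g q⟫ ≠ 0) (hm : 4 ≤ m) :
    (m + 1) * 2 < Fintype.card (orbitOf (reflGroup (diffs f g)) v) := by
  set 𝒮 : Finset (Finset (Option (Fin m))) :=
    Finset.powersetCard 1 Finset.univ ∪ Finset.powersetCard 2 Finset.univ with h𝒮
  have hcard : ∀ S ∈ 𝒮, S.card ≤ 2 := by
    intro S hS
    rw [h𝒮, Finset.mem_union, Finset.mem_powersetCard, Finset.mem_powersetCard] at hS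
    omega
  have h𝒮c : (m + 1) * 2 < 𝒮.card := by
    rw [h𝒮, Finset.card_union_of_disjoint
      (Finset.pairwise_disjoint_powersetCard _ (by norm_num : (1 : ℕ) ≠ 2)),
      Finset.card_powersetCard, Finset.card_powersetCard, Finset.card_univ, Fintype.card_option,
      Fintype.card_fin, Nat.choose_one_right, Nat.choose_two_right, Nat.add_sub_cancel]
    have h1 : (m + 1) * 4 ≤ (m + 1) * m := Nat.mul_le_mul_left _ hm
    omega
  refine h𝒮c.trans_le ?_
  rw [← Fintype.card_coe]
  refine card_le_of_orthogonal (fun (S : 𝒮) (u : orbitOf (reflGroup (diffs f g)) v) =>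
    ∏ p ∈ S.1, ⟪(u : V), basisVec f g p⟫) (fun S => ?_) fun S S' hne => ?_
  · obtain ⟨u, hu, h⟩ := D.exists_prod_ne_zero hpq hp hq (hcard S.1 S.2)
    exact ⟨⟨u, hu⟩, h⟩
  · refine D.sum_prod_eq_zero (fun h => hne (Subtype.ext h)) fun h => ?_
    have h1 := congrArg Finset.card h
    rw [Finset.card_univ, Fintype.card_option, Fintype.card_fin] at h1
    have h2 : (symmDiff S.1 S'.1).card ≤ S.1.card + S'.1.card := by
      refine (Finset.card_le_card ?_).trans (Finset.card_union_le _ _)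
      exact symmDiff_le_sup
    have := hcard _ S.2
    have := hcard _ S'.2
    omega

/-- In type `D₄` there are orbits of eight points other than the frame, those of the half spin
weights. The functions on the orbit leave no other possibility: all coordinates have the same
square. -/
theorem inner_sq_of_card_le {v : V} [Fintype (orbitOf (reflGroup (diffs f g)) v)]
    {p q : Option (Fin m)} (hpq : p ≠ q)
    (hp : ⟪v, basisVec f g p⟫ ≠ 0) (hq : ⟪v, basisVec f g q⟫ ≠ 0) (hm : m = 3)
    (hc : Fintype.card (orbitOf (reflGroup (diffs f g)) v) ≤ 8) :
    ∀ x ∈ pts f g, 4 * ⟪v, x⟫ ^ 2 = ρ * ⟪v, v⟫ := by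
  subst hm
  have hρ := D.rho_pos
  have hv : v ∈ orbitOf (reflGroup (diffs f g)) v := mem_orbitOf_self _ _
  have hc0 : 0 < Fintype.card (orbitOf (reflGroup (diffs f g)) v) := Fintype.card_pos_iff.mpr ⟨⟨v, hv⟩⟩
  set μ := (∑ u : orbitOf (reflGroup (diffs f g)) v, ⟪(u : V), g⟫ ^ 2) /
    Fintype.card (orbitOf (reflGroup (diffs f g)) v) with hμ
  -- The constant, the four linear monomials and the three quadratic ones involving `g`: eight
  -- functions, no two of which multiply up to the full monomial in four coordinates, modulo
  -- squares.
  set 𝒮 : Finset (Finset (Option (Fin 3))) :=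
    Finset.univ.filter fun S => S.card ≤ 1 ∨ (S.card = 2 ∧ none ∈ S) with h𝒮
  have h𝒮c : 𝒮.card = 8 := by decide
  have h𝒮u : ∀ S ∈ 𝒮, ∀ S' ∈ 𝒮, symmDiff S S' ≠ Finset.univ := by decide
  have hcard : ∀ S ∈ 𝒮, S.card ≤ 2 := by decide
  have hconst : ∀ u ∈ orbitOf (reflGroup (diffs f g)) v, ⟪u, g⟫ ^ 2 = μ := by
    by_contra hcon
    push Not at hcon
    obtain ⟨u₀, hu₀, hne₀⟩ := hcon
    have hsum : ∑ u : orbitOf (reflGroup (diffs f g)) v, (⟪(u : V), g⟫ ^ 2 - μ) = 0 := by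
      rw [Finset.sum_sub_distrib, Finset.sum_const, Finset.card_univ, nsmul_eq_mul, hμ]
      field_simp
      ring
    have h0 : ∀ S ∈ 𝒮, ∑ u : orbitOf (reflGroup (diffs f g)) v, (⟪(u : V), g⟫ ^ 2 - μ) *
        ∏ p ∈ S, ⟪(u : V), basisVec f g p⟫ = 0 := by
      intro S hS
      rcases S.eq_empty_or_nonempty with rfl | hSn
      · simp only [Finset.prod_empty, mul_one]; exact hsum
      · refine D.sum_prod_sq_sub_eq_zero hSn (fun h => ?_) μ
        have h1 := hcard S hS
        rw [h] at h1
        simp at h1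
    -- The deviation of `⟪u, g⟫ ^ 2` from its mean `μ` would be a ninth orthogonal function on at
    -- most eight points.
    have := card_le_of_orthogonal (fun (i : Option 𝒮) (u : orbitOf (reflGroup (diffs f g)) v) =>
      i.elim (⟪(u : V), g⟫ ^ 2 - μ) fun S => ∏ p ∈ S.1, ⟪(u : V), basisVec f g p⟫)
      (fun i => by
        cases i with
        | none => exact ⟨⟨u₀, hu₀⟩, sub_ne_zero.mpr hne₀⟩
        | some S =>
          obtain ⟨u, hu, h⟩ := D.exists_prod_ne_zero hpq hp hq (hcard S.1 S.2)
          exact ⟨⟨u, hu⟩, h⟩)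
      (fun i j hij => by
        cases i with
        | none =>
          cases j with
          | none => exact absurd rfl hij
          | some S => exact h0 S.1 S.2
        | some S =>
          cases j with
          | none => simpa only [Option.elim, mul_comm] using h0 S.1 S.2
          | some S' =>
            exact D.sum_prod_eq_zero (fun h => hij (congrArg some (Subtype.ext h)))
              (h𝒮u _ S.2 _ S'.2))
    rw [Fintype.card_option, Fintype.card_coe, h𝒮c] at this
    omega
  have hall : ∀ j : Option (Fin 3), ⟪v, basisVec f g j⟫ ^ 2 = μ := by
    intro j
    obtain ⟨w, hw, h⟩ := D.exists_perm (Equiv.swap j none)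
    have h1 := hconst (w v) ⟨w, hw, rfl⟩
    have h2 : w (basisVec f g j) = g := by rw [h, Equiv.swap_apply_left]; rfl
    rwa [← h2, w.inner_map_map] at h1
  have hvv : ⟪v, v⟫ = 4 * μ / ρ := by
    have h1 := congrArg (fun x => ⟪v, x⟫) (D.eq_sum_basisVec v)
    simp only [inner_sum, inner_smul_right] at h1
    rw [h1, Finset.sum_congr rfl fun j _ => by rw [div_mul_eq_mul_div, ← sq, hall j],
      Finset.sum_const, Finset.card_univ, Fintype.card_option, Fintype.card_fin]
    simp only [nsmul_eq_mul]
    push_cast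
    ring
  intro x hx
  rw [hvv]
  field_simp
  obtain ⟨j, rfl | rfl⟩ := D.exists_basisVec hx
  · rw [hall]
  · rw [inner_neg_right, neg_sq, hall]

/-- Vectors with a small orbit. -/
theorem exists_eq_smul_of_encard_le {v : V}
    (hc : (orbitOf (reflGroup (diffs f g)) v).encard ≤ ((m + 1) * 2 : ℕ)) :
    (∃ t : ℝ, ∃ x ∈ pts f g, v = t • x) ∨
      (m = 3 ∧ ∀ x ∈ pts f g, 4 * ⟪v, x⟫ ^ 2 = ρ * ⟪v, v⟫) := by
  have hfin : (orbitOf (reflGroup (diffs f g)) v).Finite := Set.finite_of_encard_le_coe hc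
  have := hfin.fintype
  rw [Set.encard_eq_coe_toFinset_card, Set.toFinset_card] at hc
  have hc' : Fintype.card (orbitOf (reflGroup (diffs f g)) v) ≤ (m + 1) * 2 := by exact_mod_cast hc
  by_cases hex : ∃ p q : Option (Fin m), p ≠ q ∧ ⟪v, basisVec f g p⟫ ≠ 0 ∧
      ⟪v, basisVec f g q⟫ ≠ 0
  · obtain ⟨p, q, hpq, hp, hq⟩ := hex
    right
    have hm : m = 3 := by
      by_contra hm
      have := D.card_lt_of_two_lt hpq hp hq (by have := D.three_le; omega)
      omega
    exact ⟨hm, D.inner_sq_of_card_le hpq hp hq hm (by subst hm; exact hc')⟩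
  · left
    push Not at hex
    by_cases h0 : ∃ p : Option (Fin m), ⟪v, basisVec f g p⟫ ≠ 0
    · obtain ⟨p, hp⟩ := h0
      refine ⟨⟪v, basisVec f g p⟫ / ρ, _, D.basisVec_mem p, ?_⟩
      nth_rewrite 1 [D.eq_sum_basisVec v]
      refine Finset.sum_eq_single p (fun q _ hq => ?_) (by simp)
      rw [hex p q (Ne.symm hq) hp, zero_div, zero_smul]
    · push Not at h0
      refine ⟨0, g, g_mem_pts f g, ?_⟩
      rw [D.eq_sum_basisVec v]
      simp [h0]

end DFrame

end SmallOrbits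

/-! ### Scaling of frames, and the theorem in type `D`. -/

section TypeDMain

variable {V : Type*} [NormedAddCommGroup V] [InnerProductSpace ℝ V]

theorem orbitOf_smul (G : Subgroup (V ≃ₗᵢ[ℝ] V)) (t : ℝ) (x : V) :
    orbitOf G (t • x) = (fun y => t • y) '' orbitOf G x := by
  ext y
  constructor
  · rintro ⟨w, hw, rfl⟩
    exact ⟨w x, ⟨w, hw, rfl⟩, (map_smul w t x).symm⟩
  · rintro ⟨_, ⟨w, hw, rfl⟩, rfl⟩
    exact ⟨w, hw, map_smul w t x⟩

theorem pts_smul (f : ℤ → V) (g : V) (t : ℝ) :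
    pts (fun i => t • f i) (t • g) = (fun y => t • y) '' pts f g := by
  rw [pts, pts, Set.image_union, Set.image_pair, ← Set.range_comp, smul_neg]
  rfl

theorem diffs_smul (f : ℤ → V) (g : V) {t : ℝ} (ht : t ≠ 0) :
    diffs (fun i => t • f i) (t • g) = (fun y => t • y) '' diffs f g := by
  ext a
  constructor
  · rintro ⟨u, hu, w, hw, h1, h2, rfl⟩
    rw [pts_smul] at hu hw
    obtain ⟨u, hu, rfl⟩ := hu
    obtain ⟨w, hw, rfl⟩ := hw
    exact ⟨u - w, ⟨u, hu, w, hw, fun h => h1 (by rw [h]), fun h => h2 (by simp only [h, smul_neg]),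
      rfl⟩, smul_sub t u w⟩
  · rintro ⟨_, ⟨u, hu, w, hw, h1, h2, rfl⟩, rfl⟩
    refine ⟨t • u, ?_, t • w, ?_, fun h => h1 ?_, fun h => h2 ?_, smul_sub t u w⟩
    · rw [pts_smul]; exact ⟨u, hu, rfl⟩
    · rw [pts_smul]; exact ⟨w, hw, rfl⟩
    · exact smul_right_injective V ht h
    · rw [← smul_neg] at h
      exact smul_right_injective V ht h

theorem image_hyperplaneReflection_smul (A : Set V) {t : ℝ} (ht : t ≠ 0) :
    hyperplaneReflection '' ((fun y => t • y) '' A) = hyperplaneReflection '' A := by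
  rw [Set.image_image]
  exact Set.image_congr fun a _ => hyperplaneReflection_smul ht a

theorem DFrame.smul {c : V ≃ₗᵢ[ℝ] V} {m : ℕ} {f : ℤ → V} {g : V} {ρ : ℝ}
    (D : DFrame c m f g ρ) {t : ℝ} (ht : t ≠ 0) :
    DFrame c m (fun i => t • f i) (t • g) (t ^ 2 * ρ) := by
  have hin : ∀ x y : V, ⟪t • x, t • y⟫ = t ^ 2 * ⟪x, y⟫ := by
    intro x y
    rw [inner_smul_left, inner_smul_right, conj_trivial]; ring
  refine DFrame.of_inner D.three_le (fun i => ?_) (fun i => ?_) ?_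
    (mul_pos (by positivity) D.rho_pos) (fun i k h1 h2 => ?_) (fun i => ?_) ?_ ?_
  · rw [map_smul, D.map_f]
  · rw [D.f_add, smul_neg]
  · rw [map_smul, D.map_g, smul_neg]
  · rw [hin, D.inner_f i k h1 h2, mul_ite, mul_zero]
  · rw [hin, D.inner_fg, mul_zero]
  · rw [hin, D.inner_gg]
  · rw [eq_top_iff, ← D.span, Submodule.span_le]
    have : ∀ x, t • x ∈ Submodule.span ℝ (Set.range (fun i => t • f i) ∪ {t • g}) →
        x ∈ Submodule.span ℝ (Set.range (fun i => t • f i) ∪ {t • g}) := by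
      intro x hx
      have := Submodule.smul_mem _ t⁻¹ hx
      rwa [smul_smul, inv_mul_cancel₀ ht, one_smul] at this
    rintro x (⟨i, rfl⟩ | rfl)
    · exact this _ (Submodule.subset_span (Or.inl ⟨i, rfl⟩))
    · exact this _ (Submodule.subset_span (Or.inr rfl))

end TypeDMain

namespace SimpleSystem

variable {V : Type*} [NormedAddCommGroup V] [InnerProductSpace ℝ V]
  {ι : Type*} {M : CoxeterMatrix ι} (Δ : SimpleSystem M V)

section

variable {c : V ≃ₗᵢ[ℝ] V} {m : ℕ} {f : ℤ → V} {g : V} {ρ : ℝ} (D : DFrame c m f g ρ)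
  (hroot : ∀ i, Δ.root i ∈ diffs f g)

include D hroot

theorem map_mem_pts {w : V ≃ₗᵢ[ℝ] V} (hw : w ∈ Δ.group) {x : V} (hx : x ∈ pts f g) :
    w x ∈ pts f g := by
  rw [Δ.group_eq] at hw
  exact D.map_mem_pts (Set.range_subset_iff.mpr hroot) hw hx

theorem map_root_mem {w : V ≃ₗᵢ[ℝ] V} (hw : w ∈ Δ.group) (i : ι) : w (Δ.root i) ∈ diffs f g := by
  obtain ⟨u, hu, v, hv, h1, h2, h3⟩ := hroot i
  refine ⟨w u, Δ.map_mem_pts D hroot hw hu, w v, Δ.map_mem_pts D hroot hw hv,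
    fun h => h1 (w.injective h), fun h => h2 (w.injective ?_), ?_⟩
  · rw [h, map_neg]
  · rw [h3, map_sub]

variable (htrans : ∀ x ∈ pts f g, ∀ y ∈ pts f g, y ∈ orbitOf Δ.group x)

include htrans

theorem orbitOf_eq_pts {x : V} (hx : x ∈ pts f g) : orbitOf Δ.group x = pts f g := by
  refine Set.Subset.antisymm ?_ fun y hy => htrans x hx y hy
  rintro _ ⟨w, hw, rfl⟩
  exact Δ.map_mem_pts D hroot hw hx

/-- By transitivity any two points are in one orbit. The trichotomy `hyperplaneReflection_sub_mem'`,
applied to the conjugation-invariant set of conjugates of simple reflections, shows that the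
reflection exchanging two nonopposite points is such a conjugate. -/
theorem reflections_eq_diffs : Δ.reflections = hyperplaneReflection '' diffs f g := by
  refine Set.Subset.antisymm ?_ ?_
  · rw [Δ.reflections_eq]
    refine Set.image_mono ?_
    rintro _ ⟨w, hw, i, rfl⟩
    exact Δ.map_root_mem D hroot hw i
  · rintro _ ⟨_, ⟨u, hu, v, hv, h1, h2, rfl⟩, rfl⟩
    have h3 := htrans u hu v hv
    rw [Δ.group_eq] at h3
    rcases D.hyperplaneReflection_sub_mem' (Set.range_subset_iff.mpr hroot) (C := Δ.reflections)
      (fun t ht => by rw [← Δ.group_eq]; exact Δ.reflections_subset ht)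
      (fun w hw t ht => Δ.conj_mem_reflections (by rw [Δ.group_eq]; exact hw) ht)
      (by
        rintro _ ⟨i, rfl⟩
        exact ⟨1, one_mem _, i, by rw [one_mul, inv_one, mul_one]; rfl⟩) hu h3 with h | h | h
    · exact absurd h.symm h1
    · exact absurd (by rw [h.1, neg_neg]) h2
    · exact h.2.2

theorem group_eq_diffs : Δ.group = reflGroup (diffs f g) := by
  refine le_antisymm ?_ ?_
  · rw [Δ.group_eq]
    exact reflGroup_mono (Set.range_subset_iff.mpr hroot)
  · rw [reflGroup, ← Δ.reflections_eq_diffs D hroot htrans, Subgroup.closure_le]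
    exact fun t ht => Δ.reflections_subset ht

end

variable [FiniteDimensional ℝ V]

/-- The theorem for an orbit that is a multiple of the points of a frame. -/
theorem main_of_dframe {c : V ≃ₗᵢ[ℝ] V} {m : ℕ} {f : ℤ → V} {g : V} {ρ : ℝ}
    (D : DFrame c m f g ρ) (hroot : ∀ i, Δ.root i ∈ diffs f g)
    (htrans : ∀ x ∈ pts f g, ∀ y ∈ pts f g, y ∈ orbitOf Δ.group x) (hc : c ∈ Δ.group)
    {t : ℝ} (ht : t ≠ 0) {x : V} (hx : x ∈ pts f g) :
    ProjectsToPolygonAndTwoOrigins (coxeterPlane c) (orbitOf Δ.group (t • x)) (orderOf c) ∧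
      ∀ W' : Subgroup (V ≃ₗᵢ[ℝ] V), Δ.IsParabolic W' →
        (IsNoncrossing Δ.reflections c W' ↔
          DiagramNoncrossing (coxeterPlane c) (orbitOf Δ.group (t • x)) W') := by
  have ho : orbitOf Δ.group (t • x) = pts (fun i => t • f i) (t • g) := by
    rw [orbitOf_smul, Δ.orbitOf_eq_pts D hroot htrans hx, pts_smul]
  have hT : Δ.reflections = hyperplaneReflection '' diffs (fun i => t • f i) (t • g) := by
    rw [diffs_smul f g ht, image_hyperplaneReflection_smul _ ht,
      Δ.reflections_eq_diffs D hroot htrans]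
  rw [ho, hT]
  refine ⟨(D.smul ht).projects, fun W' hW' => ?_⟩
  obtain ⟨w, hw, J, rfl⟩ := hW'.exists_eq
  have hA : reflGroup ((fun i => w (Δ.root i)) '' J) =
      reflGroup ((fun y => t • y) '' ((fun i => w (Δ.root i)) '' J)) := by
    rw [reflGroup, reflGroup, image_hyperplaneReflection_smul _ ht]
  rw [hA]
  refine (D.smul ht).isNoncrossing_iff ?_ ?_
  · rw [reflGroup, diffs_smul f g ht, image_hyperplaneReflection_smul _ ht, ← reflGroup,
      ← Δ.group_eq_diffs D hroot htrans]
    exact hc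
  · rw [diffs_smul f g ht]
    refine Set.image_mono ?_
    rintro _ ⟨i, -, rfl⟩
    exact Δ.map_root_mem D hroot hw i

variable {m : ℕ} {e : ι ≃ Fin (m + 1)} (hM : M.reindex e = typeD (m + 1)) {ε : ι → Bool}
  (hε : IsBipartition M ε)

include hM

omit [FiniteDimensional ℝ V] in
theorem root_mem_diffs (hm : 3 ≤ m) {c : V ≃ₗᵢ[ℝ] V} {f : ℤ → V} {ρ : ℝ}
    (D : DFrame c m f (axis m (Δ.nodeRoot e) m) ρ)
    (hE : ∀ k ≤ m, axis m (Δ.nodeRoot e) k ∈ pts f (axis m (Δ.nodeRoot e) m)) (i : ι) :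
    Δ.root i ∈ diffs f (axis m (Δ.nodeRoot e) m) := by
  have hne : ∀ j k, j ≤ m → k ≤ m → j ≠ k → axis m (Δ.nodeRoot e) j ≠ axis m (Δ.nodeRoot e) k ∧
      axis m (Δ.nodeRoot e) j ≠ -axis m (Δ.nodeRoot e) k := by
    intro j k hj hk hjk
    have h1 := inner_axis hm (Δ.inner_nodeRoot hM) j k hj hk
    have h2 := inner_axis hm (Δ.inner_nodeRoot hM) j j hj hj
    rw [if_neg hjk] at h1
    rw [if_pos rfl] at h2
    refine ⟨fun h => ?_, fun h => ?_⟩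
    · rw [← h, h2] at h1; norm_num at h1
    · rw [← neg_eq_iff_eq_neg] at h
      rw [← h, inner_neg_right, h2] at h1; norm_num at h1
  rw [Δ.root_eq_nodeRoot e]
  have hk : (e i : ℕ) ≤ m := Nat.lt_succ_iff.mp (e i).isLt
  rcases hk.eq_or_lt with hk | hk
  · have h1 := hne (m - 1) m (by omega) le_rfl (by omega)
    refine ⟨_, hE (m - 1) (by omega), _, D.neg_mem (hE m le_rfl), h1.2,
      by rw [neg_neg]; exact h1.1, ?_⟩
    rw [hk, sub_neg_eq_add, root_last (R := Δ.nodeRoot e) hm]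
  · have h1 := hne (e i) (e i + 1) hk.le hk (by omega)
    refine ⟨_, hE _ hk.le, _, hE _ hk, h1.1, h1.2, ?_⟩
    rw [eq_sub_iff_add_eq, ← axis_eq hk]

omit [FiniteDimensional ℝ V] in
-- The nodes of the path lead from the first axis to all others, and the last node takes axis `m -
-- 1` to the negative of axis `m`, which joins the orbits of an axis and its negative.
theorem orbitOf_pts (hm : 3 ≤ m) {f : ℤ → V}
    (hE : ∀ x ∈ pts f (axis m (Δ.nodeRoot e) m), ∃ k ≤ m, x = axis m (Δ.nodeRoot e) k ∨
      x = -axis m (Δ.nodeRoot e) k) {x y : V} (hx : x ∈ pts f (axis m (Δ.nodeRoot e) m))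
    (hy : y ∈ pts f (axis m (Δ.nodeRoot e) m)) : y ∈ orbitOf Δ.group x := by
  have hself : ∀ k ≤ m, ⟪axis m (Δ.nodeRoot e) k, axis m (Δ.nodeRoot e) k⟫ = 1 / 2 := fun k hk => by
    rw [inner_axis hm (Δ.inner_nodeRoot hM) k k hk hk, if_pos rfl]
  have h0 : ∀ k ≤ m, axis m (Δ.nodeRoot e) k ∈ orbitOf Δ.group (axis m (Δ.nodeRoot e) 0) := by
    intro k
    induction k with
    | zero => intro _; exact mem_orbitOf_self _ _
    | succ k ih =>
      intro hk
      refine orbitOf_trans (ih (by omega)) ⟨_, Δ.simpleReflection_mem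
        (e.symm (Fin.ofNat (m + 1) k)), ?_⟩
      change hyperplaneReflection (Δ.nodeRoot e k) _ = _
      have h1 : Δ.nodeRoot e k = axis m (Δ.nodeRoot e) k - axis m (Δ.nodeRoot e) (k + 1) := by
        rw [axis_eq hk]; abel
      rw [h1, hyperplaneReflection_swap (by rw [hself k (by omega), hself _ hk])]
  have hlast : -axis m (Δ.nodeRoot e) m ∈ orbitOf Δ.group (axis m (Δ.nodeRoot e) (m - 1)) := by
    refine ⟨_, Δ.simpleReflection_mem (e.symm (Fin.ofNat (m + 1) m)), ?_⟩
    change hyperplaneReflection (Δ.nodeRoot e m) _ = _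
    have h1 : Δ.nodeRoot e m = axis m (Δ.nodeRoot e) (m - 1) - -axis m (Δ.nodeRoot e) m := by
      rw [sub_neg_eq_add, ← root_last (R := Δ.nodeRoot e) hm]
    rw [h1, hyperplaneReflection_swap
      (by rw [inner_neg_neg, hself _ (by omega), hself _ le_rfl])]
  have hneg : -axis m (Δ.nodeRoot e) 0 ∈ orbitOf Δ.group (axis m (Δ.nodeRoot e) 0) :=
    orbitOf_trans (orbitOf_trans (h0 (m - 1) (by omega)) hlast)
      (orbitOf_symm (orbitOf_neg (h0 m le_rfl)))
  have hall : ∀ z ∈ pts f (axis m (Δ.nodeRoot e) m),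
      z ∈ orbitOf Δ.group (axis m (Δ.nodeRoot e) 0) := by
    intro z hz
    obtain ⟨k, hk, rfl | rfl⟩ := hE z hz
    · exact h0 k hk
    · exact orbitOf_trans hneg (orbitOf_neg (h0 k hk))
  exact orbitOf_trans (orbitOf_symm (hall x hx)) (hall y hy)

variable [Fintype ι]

/-- The theorem for type `D`, given a vector of a smallest orbit that is not a half spin weight. -/
theorem main_or_inner_sq (hm : 3 ≤ m) {v : V} (hv : v ≠ 0)
    (hmin : ∀ u : V, u ≠ 0 → (orbitOf Δ.group v).encard ≤ (orbitOf Δ.group u).encard) :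
    (ProjectsToPolygonAndTwoOrigins (coxeterPlane (Δ.coxeterElement hε)) (orbitOf Δ.group v)
        (orderOf (Δ.coxeterElement hε)) ∧
      ∀ W' : Subgroup (V ≃ₗᵢ[ℝ] V), Δ.IsParabolic W' →
        (IsNoncrossing Δ.reflections (Δ.coxeterElement hε) W' ↔
          DiagramNoncrossing (coxeterPlane (Δ.coxeterElement hε)) (orbitOf Δ.group v) W')) ∨
    (m = 3 ∧ ∀ k ≤ m, 4 * ⟪v, axis m (Δ.nodeRoot e) k⟫ ^ 2 = 1 / 2 * ⟪v, v⟫) := by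
  obtain ⟨f, D, h1, h2⟩ := Δ.exists_dframe_coxeterElement hM hε hm
  have hroot := Δ.root_mem_diffs hM hm D h1
  have htrans : ∀ x ∈ pts f (axis m (Δ.nodeRoot e) m), ∀ y ∈ pts f (axis m (Δ.nodeRoot e) m),
      y ∈ orbitOf Δ.group x := fun x hx y hy => Δ.orbitOf_pts hM hm h2 hx hy
  have hle : (orbitOf Δ.group v).encard ≤ ((m + 1) * 2 : ℕ) := by
    refine (hmin _ D.g_ne).trans ?_
    rw [Δ.orbitOf_eq_pts D hroot htrans (g_mem_pts f _)]
    exact D.encard_pts_le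
  rw [Δ.group_eq_diffs D hroot htrans] at hle
  rcases D.exists_eq_smul_of_encard_le hle with ⟨t, x, hx, rfl⟩ | ⟨h3, h4⟩
  · left
    refine Δ.main_of_dframe D hroot htrans (Δ.coxeterElement_mem hε) (fun h => hv ?_) hx
    rw [h, zero_smul]
  · exact Or.inr ⟨h3, fun k hk => h4 _ (h1 k hk)⟩

omit hM [Fintype ι] [FiniteDimensional ℝ V] in
theorem axis_zero (R : ℕ → V) : axis 3 R 0 = R 0 + R 1 + (2⁻¹ : ℝ) • (R 2 + R 3) ∧
    axis 3 R 1 = R 1 + (2⁻¹ : ℝ) • (R 2 + R 3) ∧ axis 3 R 2 = (2⁻¹ : ℝ) • (R 2 + R 3) ∧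
    axis 3 R 3 = (2⁻¹ : ℝ) • (R 3 - R 2) := by
  have h3 : axis 3 R 3 = (2⁻¹ : ℝ) • (R 3 - R 2) := axis_last
  have h2 : axis 3 R 2 = (2⁻¹ : ℝ) • (R 2 + R 3) := by
    rw [axis_eq (by norm_num), h3]; module
  have h1 : axis 3 R 1 = R 1 + (2⁻¹ : ℝ) • (R 2 + R 3) := by
    rw [axis_eq (by norm_num), h2]
  refine ⟨?_, h1, h2, h3⟩
  rw [axis_eq (by norm_num), h1, add_assoc]

omit hM in
theorem main_of_isTypeD (hM : IsTypeD M) {v : V} (hv : v ≠ 0)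
    (hmin : ∀ u : V, u ≠ 0 → (orbitOf Δ.group v).encard ≤ (orbitOf Δ.group u).encard) :
    ProjectsToPolygonAndTwoOrigins (coxeterPlane (Δ.coxeterElement hε)) (orbitOf Δ.group v)
        (orderOf (Δ.coxeterElement hε)) ∧
      ∀ W' : Subgroup (V ≃ₗᵢ[ℝ] V), Δ.IsParabolic W' →
        (IsNoncrossing Δ.reflections (Δ.coxeterElement hε) W' ↔
          DiagramNoncrossing (coxeterPlane (Δ.coxeterElement hε)) (orbitOf Δ.group v) W') := by
  obtain ⟨n, hn, e, hM⟩ := hM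
  obtain ⟨m, rfl⟩ : ∃ m, n = m + 1 := ⟨n - 1, by omega⟩
  rcases Δ.main_or_inner_sq hM hε (by omega) hv hmin with h | ⟨rfl, h⟩
  · exact h
  -- Triality: in `D₄` the node `1` is the center, so exchanging node `0` with another end is a
  -- diagram automorphism and gives a second and a third frame.
  have hM' : ∀ k : Fin 4, k = 2 ∨ k = 3 →
      M.reindex (e.trans (Equiv.swap 0 k)) = typeD (3 + 1) := by
    intro k hk
    have h1 : M.reindex (e.trans (Equiv.swap 0 k)) = (M.reindex e).reindex (Equiv.swap 0 k) := rfl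
    rw [h1, hM]
    clear h1
    rcases hk with rfl | rfl <;> ext i j <;> fin_cases i <;> fin_cases j <;> rfl
  rcases Δ.main_or_inner_sq (hM' 2 (Or.inl rfl)) hε (by omega) hv hmin with h' | ⟨-, h'⟩
  · exact h'
  rcases Δ.main_or_inner_sq (hM' 3 (Or.inr rfl)) hε (by omega) hv hmin with h'' | ⟨-, h''⟩
  · exact h''
  exfalso
  have hvv : 0 < ⟪v, v⟫ := real_inner_self_pos.mpr hv
  have e0 := h 0 (by omega)
  have e1 := h 1 (by omega)
  have e2 := h 2 (by omega)
  have e3 := h 3 (by omega)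
  have e4 := h' 0 (by omega)
  have e5 := h'' 0 (by omega)
  rw [(axis_zero _).1] at e0 e4 e5
  rw [(axis_zero _).2.1] at e1
  rw [(axis_zero _).2.2.1] at e2
  rw [(axis_zero _).2.2.2] at e3
  have r0 : Δ.nodeRoot (e.trans (Equiv.swap 0 2)) 0 = Δ.nodeRoot e 2 := rfl
  have r1 : Δ.nodeRoot (e.trans (Equiv.swap 0 2)) 1 = Δ.nodeRoot e 1 := rfl
  have r2 : Δ.nodeRoot (e.trans (Equiv.swap 0 2)) 2 = Δ.nodeRoot e 0 := rfl
  have r3 : Δ.nodeRoot (e.trans (Equiv.swap 0 2)) 3 = Δ.nodeRoot e 3 := rfl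
  have s0 : Δ.nodeRoot (e.trans (Equiv.swap 0 3)) 0 = Δ.nodeRoot e 3 := rfl
  have s1 : Δ.nodeRoot (e.trans (Equiv.swap 0 3)) 1 = Δ.nodeRoot e 1 := rfl
  have s2 : Δ.nodeRoot (e.trans (Equiv.swap 0 3)) 2 = Δ.nodeRoot e 2 := rfl
  have s3 : Δ.nodeRoot (e.trans (Equiv.swap 0 3)) 3 = Δ.nodeRoot e 0 := rfl
  rw [r0, r1, r2, r3] at e4
  rw [s0, s1, s2, s3] at e5
  simp only [inner_add_right, inner_sub_right, inner_smul_right] at e0 e1 e2 e3 e4 e5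
  generalize ⟪v, v⟫ = κ at *
  obtain ⟨x0, hx0⟩ : ∃ x, x = ⟪v, Δ.nodeRoot e 0⟫ + ⟪v, Δ.nodeRoot e 1⟫ +
    2⁻¹ * (⟪v, Δ.nodeRoot e 2⟫ + ⟪v, Δ.nodeRoot e 3⟫) := ⟨_, rfl⟩
  obtain ⟨x1, hx1⟩ : ∃ x, x = ⟪v, Δ.nodeRoot e 1⟫ +
    2⁻¹ * (⟪v, Δ.nodeRoot e 2⟫ + ⟪v, Δ.nodeRoot e 3⟫) := ⟨_, rfl⟩
  obtain ⟨x2, hx2⟩ : ∃ x, x = 2⁻¹ * (⟪v, Δ.nodeRoot e 2⟫ + ⟪v, Δ.nodeRoot e 3⟫) := ⟨_, rfl⟩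
  obtain ⟨x3, hx3⟩ : ∃ x, x = 2⁻¹ * (⟪v, Δ.nodeRoot e 3⟫ - ⟪v, Δ.nodeRoot e 2⟫) := ⟨_, rfl⟩
  rw [← hx0] at e0
  rw [← hx1] at e1
  rw [← hx2] at e2
  rw [← hx3] at e3
  rw [show ⟪v, Δ.nodeRoot e 2⟫ + ⟪v, Δ.nodeRoot e 1⟫ + 2⁻¹ * (⟪v, Δ.nodeRoot e 0⟫ +
    ⟪v, Δ.nodeRoot e 3⟫) = 2⁻¹ * (x0 + x1 + x2 - x3) by linarith] at e4
  rw [show ⟪v, Δ.nodeRoot e 3⟫ + ⟪v, Δ.nodeRoot e 1⟫ + 2⁻¹ * (⟪v, Δ.nodeRoot e 2⟫ +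
    ⟪v, Δ.nodeRoot e 0⟫) = 2⁻¹ * (x0 + x1 + x2 + x3) by linarith] at e5
  clear hx0 hx1 hx2 hx3
  -- If `v` were exceptional for all three frames, its coordinates would be `±a` with `a ≠ 0`, and
  -- both sums `x0 + x1 + x2 ± x3` would be `±2a`. But these sums differ by `±2a`.
  have q1 : x1 = x0 ∨ x1 = -x0 := sq_eq_sq_iff_eq_or_eq_neg.mp (by linarith)
  have q2 : x2 = x0 ∨ x2 = -x0 := sq_eq_sq_iff_eq_or_eq_neg.mp (by linarith)
  have q3 : x3 = x0 ∨ x3 = -x0 := sq_eq_sq_iff_eq_or_eq_neg.mp (by linarith)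
  rcases q1 with rfl | rfl <;> rcases q2 with rfl | rfl <;> rcases q3 with rfl | rfl <;>
    ring_nf at e0 e4 e5 <;> linarith

end SimpleSystem

/-! ### The vertices of the icosahedron -/

section IcosahedronLabels

/-- The action of the `i`-th power of the Coxeter element of `H₃` on the labels `0, …, 11` of the
vertices of the icosahedron: `0, …, 9` form a decagon in the Coxeter plane, and `10` and `11` lie
above its center. -/
def rot (i p : ℕ) : ℕ := if p < 10 then (p + i) % 10 else if i % 2 = 0 then p else 21 - p

/-- The action of the reflection with index `t = 3 i + k`, which is the conjugate of the simple
reflection `k` by the `i`-th power of the Coxeter element; the labels `refl t p` are listed as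
hexadecimal digits, starting with the last one. -/
def refl (t p : ℕ) : ℕ :=
  (([0x839b7564a201, 0xba1234567890, 0x382a4657b910, 0x49a8675b3120, 0xba3456789012,
    0x94b5768a0213, 0x59786a4231b, 0xba5678901234, 0x506879b1324a, 0x61897b5342a0,
    0xba7890123456, 0x16980a2435b7, 0x2708a6453b19, 0xba9012345678, 0x7291b3546a80] : List ℕ).getD t 0) / 16 ^ p % 16

/-- The action of a word in two reflections. -/
def wordAct (k t : ℕ) (l : List Bool) (p : ℕ) : ℕ :=
  l.foldr (fun b q => refl (if b then k else t) q) p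

/-- Words for the elements of a dihedral group of order at most `10`. -/
def dihedralWords : List (List Bool) :=
  [[], [true], [false], [true, false], [false, true], [true, false, true], [false, true, false],
    [true, false, true, false], [false, true, false, true], [true, false, true, false, true]]

/-- The orbit of a label under the group generated by two reflections, as a sum of powers of `2`. -/
def labelOrbit (k t p : ℕ) : ℕ :=
  dihedralWords.foldr (fun l m => 2 ^ wordAct k t l p ||| m) 0

/-- This certifies that the ten words already produce whole orbits. -/
def LabelOrbitClosed (k t : ℕ) : Prop :=
  ∀ p < 12, ∀ q < 12, (labelOrbit k t p).testBit q = true →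
    (labelOrbit k t p).testBit (refl k q) = true ∧ (labelOrbit k t p).testBit (refl t q) = true

instance (k t : ℕ) : Decidable (LabelOrbitClosed k t) := by
  unfold LabelOrbitClosed; infer_instance

/-- The reflection with index `t` lies in the group generated by those with indices `k`, `s`. -/
def IsWord (k s t : ℕ) : Prop := ∃ l ∈ dihedralWords, ∀ p < 12, refl t p = wordAct k s l p

instance (k s t : ℕ) : Decidable (IsWord k s t) := by unfold IsWord; infer_instance

/-- The product of three reflections is the Coxeter element. -/
def IsFactorization (s t d : ℕ) : Prop := ∀ p < 12, refl s (refl t (refl d p)) = rot 1 p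

instance (s t d : ℕ) : Decidable (IsFactorization s t d) := by
  unfold IsFactorization; infer_instance

/-- The labels from `lo` to `lo + n`. -/
def arc (lo n : ℕ) : ℕ := (2 ^ (n + 1) - 1) * 2 ^ lo % 1024 ||| (2 ^ (n + 1) - 1) * 2 ^ lo / 1024

/-- `A` lies in an arc, and `B` on the other side of it. -/
def ArcSeparated (A B : ℕ) : Prop :=
  -- The last clause concerns the center: an arc of at most four steps lies in an open half circle
  -- and leaves the center to `B`; for a longer one `B` must not contain the labels `10` and `11`,
  -- which are the bits from `1024` on.
  ∃ lo < 10, A.testBit lo = true ∧ ∃ n < 9, A &&& arc lo n = A ∧ B &&& arc lo n = 0 ∧ (n < 5 ∨ B < 1024)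

instance (A B : ℕ) : Decidable (ArcSeparated A B) := by
  unfold ArcSeparated; infer_instance

/-- `A` and `B` both contain one of `10` and `11`, and lie on two sides of the center. -/
def CenterSeparated (A B : ℕ) : Prop :=
  1024 ≤ A ∧ 1024 ≤ B ∧ ∃ lo < 10, A % 1024 &&& arc lo 4 = A % 1024 ∧ B &&& arc lo 4 = 0

instance (A B : ℕ) : Decidable (CenterSeparated A B) := by
  unfold CenterSeparated; infer_instance

/-- Any two different orbits of the group generated by two reflections are separated. -/
def OrbitsSeparated (k t : ℕ) : Prop :=
  ∀ p < 12, ∀ q < p, (labelOrbit k t p).testBit q = true ∨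
    ArcSeparated (labelOrbit k t p) (labelOrbit k t q) ∨
    ArcSeparated (labelOrbit k t q) (labelOrbit k t p) ∨
    CenterSeparated (labelOrbit k t p) (labelOrbit k t q)

instance (k t : ℕ) : Decidable (OrbitsSeparated k t) := by
  unfold OrbitsSeparated; infer_instance

/-- Two points of a block and two points of another one form crossing chords. -/
def ChordCrossing (k t : ℕ) : Prop :=
  ∃ i < 10, ∃ j < 10, (labelOrbit k t i).testBit ((i + j) % 10) = true ∧ ∃ l < j, 0 < l ∧
    (labelOrbit k t i).testBit ((i + l) % 10) = false ∧ ∃ n < 10, j < n ∧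
    (labelOrbit k t ((i + l) % 10)).testBit ((i + n) % 10) = true

instance (k t : ℕ) : Decidable (ChordCrossing k t) := by
  unfold ChordCrossing; infer_instance

/-- A chord of a block separates a point of another block from the center, which belongs to the
latter block. -/
def SpokeCrossing (k t : ℕ) : Prop :=
  ∃ i < 10, ∃ n < 5, (labelOrbit k t i).testBit ((i + n) % 10) = true ∧ ∃ l < n, 0 < l ∧
    (labelOrbit k t i).testBit ((i + l) % 10) = false ∧ 1024 ≤ labelOrbit k t ((i + l) % 10)

instance (k t : ℕ) : Decidable (SpokeCrossing k t) := by
  unfold SpokeCrossing; infer_instance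

theorem rot_lt : ∀ i < 11, ∀ p < 12, rot i p < 12 := by decide +kernel

theorem refl_lt : ∀ t < 15, ∀ p < 12, refl t p < 12 := by decide +kernel

theorem rot_rot : ∀ i < 11, ∀ p < 12, rot i (rot (10 - i) p) = p := by decide +kernel

/-- Conjugation by the Coxeter element raises the index of a reflection by three; this is what
reduces the finite checks to the three first indices. -/
theorem refl_rot : ∀ t < 15, ∀ p < 12, refl ((t + 3) % 15) (rot 1 p) = rot 1 (refl t p) := by
  decide +kernel

theorem exists_conj : ∀ k < 3, ∀ t < 15, ∃ s < 15, ∀ p < 12,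
    refl k (refl t (refl k p)) = refl s p := by decide +kernel

theorem labelOrbit_closed : ∀ k < 3, ∀ t < 15, LabelOrbitClosed k t := by
  decide +kernel

theorem arc_testBit : ∀ lo < 10, ∀ n < 9, ∀ q < 12,
    (arc lo n).testBit q = true ↔ q < 10 ∧ (q + 10 - lo) % 10 ≤ n := by
  decide +kernel

theorem exists_isFactorization : ∀ k < 3, ∃ t < 15, ∃ d < 15, IsFactorization k t d := by
  decide +kernel

/-- The finite part of one direction in type `H₃`, for subgroups of rank one and two whose first
reflection has been rotated to one of three. -/
theorem orbitsSeparated : ∀ k < 3, ∀ t < 15, (t = k ∨ ∃ d < 15, IsFactorization k t d) →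
    OrbitsSeparated k t := by
  decide +kernel

/-- The finite part of the other direction. Two given reflections need not begin a factorization of
the Coxeter element themselves, but `k` and another reflection `y` of the same dihedral group may;
otherwise there is a visible crossing. -/
theorem isFactorization_or_crossing : ∀ k < 3, ∀ t < 15, t = k ∨
    (∃ y < 15, (∃ d < 15, IsFactorization k y d) ∧ IsWord k t y ∧ IsWord k y t) ∨
    ChordCrossing k t ∨ SpokeCrossing k t := by
  decide +kernel

/-- The scalar product of two vertices is proportional to `gramRat + √5 * gramSqrt`. -/
def gramRat (p q : ℕ) : ℤ :=
  if p < 10 ∧ q < 10 then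
    ([0, 1, 1, -1, -1, 0, -1, -1, 1, 1] : List ℤ).getD ((q + 10 - p) % 10) 0
  else if p < 10 ∨ q < 10 then (-1) ^ (p + q) else 0

def gramSqrt (p q : ℕ) : ℤ :=
  if p < 10 ∧ q < 10 then if p = q then 1 else if (q + 10 - p) % 10 = 5 then -1 else 0
  else if p < 10 ∨ q < 10 then 0 else (-1) ^ (p + q)

theorem gram_rot : ∀ p < 12, ∀ q < 12, gramRat (rot 1 p) (rot 1 q) = gramRat p q ∧
    gramSqrt (rot 1 p) (rot 1 q) = gramSqrt p q := by decide +kernel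

theorem gram_comm : ∀ p < 12, ∀ q < 12, gramRat p q = gramRat q p ∧
    gramSqrt p q = gramSqrt q p := by decide +kernel

theorem gram_self : ∀ p < 12, gramRat p p = 0 ∧ gramSqrt p p = 1 := by decide +kernel

theorem gram_le : ∀ p < 12, ∀ q < 12, p ≠ q → gramRat p q ≤ 1 ∧ gramSqrt p q ≤ 0 := by
  decide +kernel

/-- The reflection with index `t` exchanges the adjacent vertices `edgeLeft t`, `edgeRight t`. -/
def edgeLeft (t : ℕ) : ℕ := rot (t / 3) (([0, 1, 3] : List ℕ).getD (t % 3) 0)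

def edgeRight (t : ℕ) : ℕ := rot (t / 3) (([1, 9, 11] : List ℕ).getD (t % 3) 0)

theorem edge_lt : ∀ t < 15, edgeLeft t < 12 ∧ edgeRight t < 12 ∧
    gramRat (edgeLeft t) (edgeRight t) = 1 ∧ gramSqrt (edgeLeft t) (edgeRight t) = 0 := by
  decide +kernel

/-- The reflection formula for scalar products of vertices, with denominators cleared by `1 / (√5 -
1) = (√5 + 1) / 4` and split into its rational part and its coefficient of `√5`. -/
theorem gram_refl : ∀ t < 15, ∀ p < 12, ∀ q < 12,
    4 * (gramRat p q - gramRat (refl t p) q) =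
      (gramRat (edgeLeft t) p - gramRat (edgeRight t) p +
        5 * (gramSqrt (edgeLeft t) p - gramSqrt (edgeRight t) p)) *
          (gramRat (edgeLeft t) q - gramRat (edgeRight t) q) +
      5 * (gramRat (edgeLeft t) p - gramRat (edgeRight t) p +
        (gramSqrt (edgeLeft t) p - gramSqrt (edgeRight t) p)) *
          (gramSqrt (edgeLeft t) q - gramSqrt (edgeRight t) q) ∧
    4 * (gramSqrt p q - gramSqrt (refl t p) q) =
      (gramRat (edgeLeft t) p - gramRat (edgeRight t) p +
        5 * (gramSqrt (edgeLeft t) p - gramSqrt (edgeRight t) p)) *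
          (gramSqrt (edgeLeft t) q - gramSqrt (edgeRight t) q) +
      (gramRat (edgeLeft t) p - gramRat (edgeRight t) p +
        (gramSqrt (edgeLeft t) p - gramSqrt (edgeRight t) p)) *
          (gramRat (edgeLeft t) q - gramRat (edgeRight t) q) := by
  decide +kernel

end IcosahedronLabels

/-! ### Icosahedral frames and their fifteen reflections. -/

section Icosahedron

variable {V : Type*} [NormedAddCommGroup V] [InnerProductSpace ℝ V]

/-- The points of a frame, labelled by `0, …, 11`. -/
def vertex {W : Type*} [AddCommGroup W] (f : ℤ → W) (g : W) (p : ℕ) : W :=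
  if p < 10 then f p else if p = 10 then g else -g

/-- A vector orthogonal to the mirror of the reflection with index `t`. -/
def icosaRoot (f : ℤ → V) (g : V) (t : ℕ) : V :=
  vertex f g (edgeLeft t) - vertex f g (edgeRight t)

/-- A frame whose points are the vertices of an icosahedron. -/
structure IcosaFrame (c : V ≃ₗᵢ[ℝ] V) (f : ℤ → V) (g : V) (ρ : ℝ) : Prop where
  map_f : ∀ i, c (f i) = f (i + 1)
  f_add : ∀ i, f (i + 5) = -f i
  map_g : c g = -g
  rho_pos : 0 < ρ
  inner_zero : ⟪f 0, f 0⟫ = √5 * ρ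
  inner_one : ⟪f 0, f 1⟫ = ρ
  inner_two : ⟪f 0, f 2⟫ = ρ
  inner_fg : ⟪f 0, g⟫ = ρ
  inner_gg : ⟪g, g⟫ = √5 * ρ
  span : Submodule.span ℝ (Set.range f ∪ {g}) = ⊤

namespace IcosaFrame

variable {c : V ≃ₗᵢ[ℝ] V} {f : ℤ → V} {g : V} {ρ : ℝ} (D : IcosaFrame c f g ρ)

include D

theorem map_vertex : ∀ p < 12, c (vertex f g p) = vertex f g (rot 1 p) := by
  intro p hp
  rcases lt_or_ge p 10 with h | h
  · have hr : rot 1 p = (p + 1) % 10 := if_pos h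
    rw [vertex, vertex, if_pos h, D.map_f, hr, if_pos (Nat.mod_lt _ (by norm_num))]
    rcases eq_or_ne p 9 with rfl | h9
    · have h1 := D.f_add 5
      have h2 := D.f_add 0
      norm_num at h1 h2 ⊢
      rw [h1, h2, neg_neg]
    · rw [Nat.mod_eq_of_lt (by omega)]
      push_cast
      rfl
  · interval_cases p
    · change c g = -g
      exact D.map_g
    · change c (-g) = g
      rw [map_neg, D.map_g, neg_neg]

theorem inner_shift (i j : ℤ) : ⟪f (i + 1), f (j + 1)⟫ = ⟪f i, f j⟫ := by
  rw [← D.map_f, ← D.map_f, c.inner_map_map]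

theorem inner_vertex_zero : ∀ q < 12,
    ⟪f 0, vertex f g q⟫ = ρ * (gramRat 0 q + gramSqrt 0 q * √5) := by
  have h1 := D.inner_shift (-1) 0
  have h2 := D.inner_shift (-2) 0
  have h2' := D.inner_shift (-1) 1
  have h3 := D.f_add (-2)
  have h4 := D.f_add (-1)
  have h5 := D.f_add 0
  have h6 := D.f_add 1
  have h7 := D.f_add 2
  have h8 := D.f_add 3
  have h9 := D.f_add 4
  norm_num at h1 h2 h2' h3 h4 h5 h6 h7 h8 h9
  have i4 : ⟪f 0, f 4⟫ = -ρ := by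
    rw [h4, inner_neg_right, real_inner_comm, ← h1, D.inner_one]
  have i3 : ⟪f 0, f 3⟫ = -ρ := by
    rw [h3, inner_neg_right, real_inner_comm, ← h2, ← h2', D.inner_two]
  have i0 := D.inner_zero
  rw [real_inner_self_eq_norm_sq] at i0
  intro q hq
  interval_cases q <;> simp [vertex, gramRat, gramSqrt, i0, D.inner_one, D.inner_two,
    D.inner_fg, i3, i4, h5, h6, h7, h8, h9, mul_comm]

theorem inner_vertex : ∀ p < 12, ∀ q < 12,
    ⟪vertex f g p, vertex f g q⟫ = ρ * (gramRat p q + gramSqrt p q * √5) := by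
  have h1 : ∀ p < 10, ∀ q < 12,
      ⟪vertex f g p, vertex f g q⟫ = ρ * (gramRat p q + gramSqrt p q * √5) := by
    intro p hp
    induction p with
    | zero => exact D.inner_vertex_zero
    | succ p ih =>
      intro q hq
      have hq' := rot_rot 1 (by norm_num) q hq
      have hlt := rot_lt 9 (by norm_num) q hq
      have h2 := gram_rot p (by omega) _ hlt
      have hp' : rot 1 p = p + 1 := (if_pos (by omega)).trans (Nat.mod_eq_of_lt hp)
      rw [show 10 - 1 = 9 from rfl] at hq'
      rw [hq', hp'] at h2
      rw [h2.1, h2.2, ← ih (by omega) _ hlt, ← hp', ← hq', ← D.map_vertex _ (by omega),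
        ← D.map_vertex _ hlt, c.inner_map_map, hq']
  intro p hp q hq
  rcases lt_or_ge p 10 with h | h
  · exact h1 p h q hq
  · rcases lt_or_ge q 10 with h' | h'
    · rw [real_inner_comm, h1 q h' p hp, (gram_comm p hp q hq).1, (gram_comm p hp q hq).2]
    · have i0 := D.inner_gg
      rw [real_inner_self_eq_norm_sq] at i0
      interval_cases p <;> interval_cases q <;> simp [vertex, gramRat, gramSqrt, i0, mul_comm]

omit D in
theorem one_lt_sqrt_five : 1 < √5 := by
  rw [Real.lt_sqrt (by norm_num)]; norm_num

/-- Different vertices have a scalar product of at most `ρ`, which is less than the square `√5 * ρ`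
of their length. -/
theorem vertex_injective {p q : ℕ} (hp : p < 12) (hq : q < 12)
    (h : vertex f g p = vertex f g q) : p = q := by
  by_contra hpq
  have h1 := D.inner_vertex p hp q hq
  rw [← h, D.inner_vertex p hp p hp, (gram_self p hp).1, (gram_self p hp).2] at h1
  have h2 := mul_left_cancel₀ D.rho_pos.ne' h1
  have h3 : (gramRat p q : ℝ) ≤ 1 := by exact_mod_cast (gram_le p hp q hq hpq).1
  have h4 : (gramSqrt p q : ℝ) ≤ 0 := by exact_mod_cast (gram_le p hp q hq hpq).2
  push_cast at h2
  nlinarith [one_lt_sqrt_five]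

theorem f_eq_vertex (i : ℤ) : ∃ p < 10, f i = vertex f g p ∧ (10 : ℤ) ∣ i - p := by
  have h1 : ∀ i, f (i + 10) = f i := fun i => by
    rw [show i + 10 = i + 5 + 5 by ring, D.f_add, D.f_add, neg_neg]
  have h2 : ∀ i k, f (i + 10 * k) = f i := by
    intro i k
    induction k using Int.induction_on with
    | zero => simp
    | succ k ih => rw [mul_add, mul_one, ← add_assoc, h1, ih]
    | pred k ih => rw [← h1, ← ih]; congr 1; ring
  have h3 := Int.emod_nonneg i (by norm_num : (10 : ℤ) ≠ 0)
  have h4 := Int.emod_lt_of_pos i (by norm_num : (0 : ℤ) < 10)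
  refine ⟨(i % 10).toNat, by omega, ?_, by omega⟩
  rw [vertex, if_pos (by omega), Int.toNat_of_nonneg h3]
  conv_lhs => rw [← Int.emod_add_mul_ediv i 10]
  exact h2 _ _

theorem mem_pts {x : V} : x ∈ pts f g ↔ ∃ p < 12, x = vertex f g p := by
  constructor
  · rintro (⟨i, rfl⟩ | h)
    · obtain ⟨p, hp, h, -⟩ := D.f_eq_vertex i
      exact ⟨p, by omega, h⟩
    · rcases h with rfl | h
      · exact ⟨10, by norm_num, rfl⟩
      · exact ⟨11, by norm_num, h⟩
  · rintro ⟨p, hp, rfl⟩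
    rw [vertex]
    split_ifs
    · exact Or.inl ⟨_, rfl⟩
    · exact Or.inr (Or.inl rfl)
    · exact Or.inr (Or.inr rfl)

theorem ext {w w' : V ≃ₗᵢ[ℝ] V} (h : ∀ p < 12, w (vertex f g p) = w' (vertex f g p)) : w = w' := by
  have h1 : (w.toLinearEquiv : V →ₗ[ℝ] V) = w'.toLinearEquiv := by
    refine LinearMap.ext_on D.span ?_
    rintro x (⟨i, rfl⟩ | rfl)
    · obtain ⟨p, hp, hi, -⟩ := D.f_eq_vertex i
      rw [hi]
      exact h p (by omega)
    · exact h 10 (by norm_num)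
  ext x
  exact congrArg (fun φ : V →ₗ[ℝ] V => φ x) h1

theorem eq_zero_of_inner {x : V} (h : ∀ p < 12, ⟪x, vertex f g p⟫ = 0) : x = 0 := by
  have h1 : (innerₛₗ ℝ x : V →ₗ[ℝ] ℝ) = 0 := by
    refine LinearMap.ext_on D.span ?_
    rintro y (⟨i, rfl⟩ | rfl)
    · obtain ⟨p, hp, hi, -⟩ := D.f_eq_vertex i
      rw [hi]
      exact h p (by omega)
    · exact h 10 (by norm_num)
  exact inner_self_eq_zero.mp (congrArg (fun φ : V →ₗ[ℝ] ℝ => φ x) h1)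

theorem inner_icosaRoot {t p : ℕ} (ht : t < 15) (hp : p < 12) :
    ⟪icosaRoot f g t, vertex f g p⟫ = ρ * ((gramRat (edgeLeft t) p - gramRat (edgeRight t) p) +
      (gramSqrt (edgeLeft t) p - gramSqrt (edgeRight t) p) * √5) := by
  obtain ⟨h1, h2, -⟩ := edge_lt t ht
  rw [icosaRoot, inner_sub_left, D.inner_vertex _ h1 _ hp, D.inner_vertex _ h2 _ hp]
  ring

theorem inner_icosaRoot_self {t : ℕ} (ht : t < 15) :
    ⟪icosaRoot f g t, icosaRoot f g t⟫ = ρ * (2 * (√5 - 1)) := by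
  obtain ⟨h1, h2, h3, h4⟩ := edge_lt t ht
  have h5 := gram_comm _ h1 _ h2
  conv_lhs => enter [3]; rw [icosaRoot]
  rw [inner_sub_right, D.inner_icosaRoot ht h1, D.inner_icosaRoot ht h2, (gram_self _ h1).1,
    (gram_self _ h1).2, (gram_self _ h2).1, (gram_self _ h2).2, ← h5.1, ← h5.2, h3, h4]
  push_cast
  ring

/-- Both sides have the same scalar products with the spanning set of vertices; this is the integer
identity `gram_refl`. -/
theorem refl_vertex {t p : ℕ} (ht : t < 15) (hp : p < 12) :
    hyperplaneReflection (icosaRoot f g t) (vertex f g p) = vertex f g (refl t p) := by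
  have h5 : √5 * √5 = 5 := Real.mul_self_sqrt (by norm_num)
  have h1 := one_lt_sqrt_five
  have hρ := D.rho_pos
  rw [← sub_eq_zero]
  refine D.eq_zero_of_inner fun q hq => ?_
  obtain ⟨e1, e2⟩ := gram_refl t ht p hp q hq
  rw [hyperplaneReflection_eq, D.inner_icosaRoot_self ht, inner_sub_left, inner_sub_left,
    inner_smul_left, D.inner_icosaRoot ht hp, D.inner_icosaRoot ht hq,
    D.inner_vertex p hp q hq, D.inner_vertex _ (refl_lt t ht p hp) q hq, conj_trivial]
  have e1' := congrArg (fun z : ℤ => (z : ℝ)) e1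
  have e2' := congrArg (fun z : ℤ => (z : ℝ)) e2
  push_cast at e1' e2'
  generalize (gramRat (edgeLeft t) p : ℝ) = x1 at *
  generalize (gramRat (edgeRight t) p : ℝ) = x2 at *
  generalize (gramSqrt (edgeLeft t) p : ℝ) = x3 at *
  generalize (gramSqrt (edgeRight t) p : ℝ) = x4 at *
  generalize (gramRat (edgeLeft t) q : ℝ) = y1 at *
  generalize (gramRat (edgeRight t) q : ℝ) = y2 at *
  generalize (gramSqrt (edgeLeft t) q : ℝ) = y3 at *
  generalize (gramSqrt (edgeRight t) q : ℝ) = y4 at *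
  generalize √5 = s at *
  have h6 : s - 1 ≠ 0 := by linarith
  have h7 : 2 * (ρ * (x1 - x2 + (x3 - x4) * s)) / (ρ * (2 * (s - 1))) =
      (x1 - x2 + (x3 - x4) * s) * (s + 1) / 4 := by
    rw [div_eq_div_iff (by positivity) (by norm_num)]
    linear_combination (-2 * ρ * (x1 - x2 + (x3 - x4) * s)) * h5
  rw [h7]
  linear_combination ρ / 4 * e1' + ρ / 4 * s * e2' - ρ / 4 * ((x3 - x4) * (y1 - y2) +
    (x1 - x2 + (x3 - x4)) * (y3 - y4) + s * (x3 - x4) * (y3 - y4)) * h5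

theorem icosaRoot_ne {t : ℕ} (ht : t < 15) : icosaRoot f g t ≠ 0 := by
  intro h
  have h1 := D.inner_icosaRoot_self ht
  rw [h, inner_zero_left] at h1
  have := D.rho_pos
  have := one_lt_sqrt_five
  have : 0 < ρ * (2 * (√5 - 1)) := by apply mul_pos <;> linarith
  linarith

/-- The frame that starts at the next point. -/
theorem shift : IcosaFrame c (fun i => f (i + 1)) (-g) ρ where
  map_f i := D.map_f _
  f_add i := by rw [add_right_comm, D.f_add]
  map_g := by rw [map_neg, D.map_g]
  rho_pos := D.rho_pos
  inner_zero := by rw [D.inner_shift, D.inner_zero]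
  inner_one := (D.inner_shift 0 1).trans D.inner_one
  inner_two := (D.inner_shift 0 2).trans D.inner_two
  inner_fg := by
    rw [← D.map_f, ← D.map_g, c.inner_map_map, D.inner_fg]
  inner_gg := by rw [inner_neg_neg, D.inner_gg]
  span := by
    rw [eq_top_iff, ← D.span, Submodule.span_le]
    rintro x (⟨i, rfl⟩ | rfl)
    · refine Submodule.subset_span (Or.inl ⟨i - 1, ?_⟩)
      simp only [sub_add_cancel]
    · have := Submodule.neg_mem _ (Submodule.subset_span (R := ℝ)
        (s := Set.range (fun i => f (i + 1)) ∪ {-x}) (Or.inr rfl))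
      rwa [neg_neg] at this

theorem vertex_shift : ∀ p < 12, vertex (fun i => f (i + 1)) (-g) p = vertex f g (rot 1 p) := by
  intro p hp
  rw [← D.map_vertex p hp, vertex, vertex]
  split_ifs
  · rw [D.map_f]
  · rw [D.map_g]
  · rw [map_neg, D.map_g]

theorem pts_shift : pts (fun i => f (i + 1)) (-g) = pts f g := by
  ext x
  rw [D.mem_pts, D.shift.mem_pts]
  constructor
  · rintro ⟨p, hp, rfl⟩
    exact ⟨_, rot_lt 1 (by norm_num) p hp, D.vertex_shift p hp⟩
  · rintro ⟨p, hp, rfl⟩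
    refine ⟨_, rot_lt 9 (by norm_num) p hp, ?_⟩
    rw [D.vertex_shift _ (rot_lt 9 (by norm_num) p hp), rot_rot 1 (by norm_num) p hp]

theorem reflection_shift {t : ℕ} (ht : t < 15) :
    hyperplaneReflection (icosaRoot (fun i => f (i + 1)) (-g) t) =
      hyperplaneReflection (icosaRoot f g ((t + 3) % 15)) := by
  refine D.shift.ext fun p hp => ?_
  rw [D.shift.refl_vertex ht hp, D.vertex_shift _ (refl_lt t ht p hp), D.vertex_shift p hp,
    D.refl_vertex (Nat.mod_lt _ (by norm_num)) (rot_lt 1 (by norm_num) p hp), refl_rot t ht p hp]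

theorem toFrame : Frame c 5 f g where
  three_le := by norm_num
  map_f := D.map_f
  f_add i := by exact_mod_cast D.f_add i
  map_g := D.map_g
  g_ne := by
    intro h
    have h1 := D.inner_gg
    rw [h, inner_zero_left] at h1
    have := mul_pos (lt_trans one_pos one_lt_sqrt_five) D.rho_pos
    linarith
  inj := by
    intro k hk hk' h
    have h1 : vertex f g k = vertex f g 0 := by
      rw [vertex, vertex, if_pos hk', if_pos (by norm_num), h]; rfl
    have := D.vertex_injective (by omega) (by norm_num) h1
    omega
  span := D.span
  pos := by
    have hρ := D.rho_pos
    have hs := one_lt_sqrt_five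
    refine (Finset.sum_pos' (fun j hj => ?_) ⟨0, by simp, ?_⟩).ne'
    · have hj : j < 10 := by simpa using hj
      have hp : 0 < Real.pi := Real.pi_pos
      have h1 := D.inner_vertex_zero j (by omega)
      rw [vertex, if_pos hj] at h1
      rw [h1]
      -- Every summand is nonnegative: the cosine and `⟪f 0, f j⟫` are both nonnegative for `j` in
      -- `0, 1, 2, 8, 9` and both nonpositive for the other indices.
      have hc : (j ≤ 2 ∨ 8 ≤ j) ∧ 0 ≤ Real.cos (Real.pi * j / (5 : ℕ)) ∨
          (3 ≤ j ∧ j ≤ 7) ∧ Real.cos (Real.pi * j / (5 : ℕ)) ≤ 0 := by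
        push_cast
        rcases le_or_gt j 2 with h2 | h2
        · have : (j : ℝ) ≤ 2 := by exact_mod_cast h2
          have : (0 : ℝ) ≤ j := by positivity
          exact Or.inl ⟨Or.inl h2, Real.cos_nonneg_of_mem_Icc ⟨by nlinarith, by nlinarith⟩⟩
        rcases le_or_gt j 7 with h7 | h7
        · have : (j : ℝ) ≤ 7 := by exact_mod_cast h7
          have : (3 : ℝ) ≤ j := by exact_mod_cast h2
          exact Or.inr ⟨⟨h2, h7⟩, Real.cos_nonpos_of_pi_div_two_le_of_le (by nlinarith)
            (by nlinarith)⟩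
        · have : (j : ℝ) ≤ 9 := by exact_mod_cast (by omega : j ≤ 9)
          have : (8 : ℝ) ≤ j := by exact_mod_cast h7
          rw [← Real.cos_two_pi_sub]
          exact Or.inl ⟨Or.inr h7, Real.cos_nonneg_of_mem_Icc ⟨by nlinarith, by nlinarith⟩⟩
      rcases hc with ⟨h2, hc⟩ | ⟨h2, hc⟩
      · refine mul_nonneg hc (mul_nonneg hρ.le ?_)
        rcases h2 with h2 | h2 <;> interval_cases j <;> simp [gramRat, gramSqrt]
      · refine mul_nonneg_of_nonpos_of_nonpos hc (mul_nonpos_of_nonneg_of_nonpos hρ.le ?_)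
        obtain ⟨h2, h3⟩ := h2
        interval_cases j <;> simp [gramRat, gramSqrt]
    · have h1 := D.inner_zero
      have : 0 < √5 * ρ := mul_pos (lt_trans one_pos one_lt_sqrt_five) D.rho_pos
      simp only [Nat.cast_zero, mul_zero, zero_div, Real.cos_zero, one_mul]
      linarith

end IcosaFrame

end Icosahedron

/-! ### From computations with labels to blocks and their hulls. -/

theorem testBit_labelOrbit {k t p q : ℕ} :
    (labelOrbit k t p).testBit q = true ↔ ∃ l ∈ dihedralWords, wordAct k t l p = q := by
  rw [labelOrbit]
  induction dihedralWords with
  | nil => simp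
  | cons l L ih =>
    rw [List.foldr_cons, Nat.testBit_or, Bool.or_eq_true, ih, Nat.testBit_two_pow]
    simp

theorem wordAct_lt {k t : ℕ} (hk : k < 15) (ht : t < 15) (l : List Bool) {p : ℕ} (hp : p < 12) :
    wordAct k t l p < 12 := by
  induction l with
  | nil => exact hp
  | cons b l ih =>
    refine refl_lt _ ?_ _ ih
    split_ifs <;> assumption

theorem testBit_arc_of_and_eq {A lo n r : ℕ} (hlo : lo < 10) (hn : n < 9) (hr : r < 12)
    (h : A &&& arc lo n = A) (hA : A.testBit r = true) : r < 10 ∧ (r + 10 - lo) % 10 ≤ n := by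
  rw [← h, Nat.testBit_and, Bool.and_eq_true] at hA
  exact (arc_testBit lo hlo n hn r hr).mp hA.2

theorem lt_of_and_arc_eq_zero {B lo n r : ℕ} (hlo : lo < 10) (hn : n < 9) (hr : r < 10)
    (h : B &&& arc lo n = 0) (hB : B.testBit r = true) : n < (r + 10 - lo) % 10 := by
  by_contra hlt
  have h1 : (B &&& arc lo n).testBit r = true := by
    rw [Nat.testBit_and, hB, (arc_testBit lo hlo n hn r (by omega)).mpr ⟨hr, by omega⟩]; rfl
  rw [h, Nat.zero_testBit] at h1
  exact Bool.false_ne_true h1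

theorem vertex_cases {W : Type*} [AddCommGroup W] {f : ℤ → W} {g : W} {r : ℕ} (h : ¬ r < 10) :
    vertex f g r = g ∨ vertex f g r = -g := by
  rw [vertex, if_neg h]
  split_ifs
  · exact Or.inl rfl
  · exact Or.inr rfl

section Hulls

variable {V : Type*} [NormedAddCommGroup V] [InnerProductSpace ℝ V]

theorem hullsNoncrossing_singleton (x y : V) :
    HullsNoncrossing (convexHull ℝ {x}) (convexHull ℝ {y}) := by
  rw [convexHull_singleton, convexHull_singleton]
  rcases eq_or_ne x y with rfl | h
  · exact Or.inr ⟨x, Set.inter_self _, Or.inr rfl, Or.inr rfl⟩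
  · exact Or.inl (Set.disjoint_singleton.mpr h)

theorem orbitOf_reflGroup_subset {A : Set V} {S : Set V}
    (hS : ∀ a ∈ A, ∀ x ∈ S, hyperplaneReflection a x ∈ S) {x : V} (hx : x ∈ S) :
    orbitOf (reflGroup A) x ⊆ S := by
  rintro _ ⟨w, hw, rfl⟩
  rw [reflGroup] at hw
  revert x
  induction hw using Subgroup.closure_induction'' with
  | mem t ht =>
    obtain ⟨a, ha, rfl⟩ := ht
    exact fun hx => hS a ha _ hx
  | inv_mem t ht =>
    obtain ⟨a, ha, rfl⟩ := ht
    rw [hyperplaneReflection_inv]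
    exact fun hx => hS a ha _ hx
  | one => exact fun hx => hx
  | mul s t _ _ hs ht => exact fun hx => hs (ht hx)

end Hulls

namespace IcosaFrame

variable {V : Type*} [NormedAddCommGroup V] [InnerProductSpace ℝ V]
  {c : V ≃ₗᵢ[ℝ] V} {f : ℤ → V} {g : V} {ρ : ℝ} (D : IcosaFrame c f g ρ)

section Orbits

include D

theorem exists_wordAct {k t : ℕ} (hk : k < 15) (ht : t < 15) (l : List Bool) :
    ∃ w ∈ reflGroup {icosaRoot f g k, icosaRoot f g t},
      ∀ p < 12, w (vertex f g p) = vertex f g (wordAct k t l p) := by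
  induction l with
  | nil => exact ⟨1, one_mem _, fun p _ => rfl⟩
  | cons b l ih =>
    obtain ⟨w, hw, h⟩ := ih
    refine ⟨hyperplaneReflection (icosaRoot f g (if b then k else t)) * w, mul_mem ?_ hw,
      fun p hp => ?_⟩
    · refine hyperplaneReflection_mem_reflGroup ?_
      cases b <;> simp
    · have hb : (if b then k else t) < 15 := by split_ifs <;> assumption
      rw [LinearIsometryEquiv.coe_mul, Function.comp_apply, h p hp,
        D.refl_vertex hb (wordAct_lt hk ht l hp)]
      rfl

theorem mem_orbitOf {k t p q : ℕ} (hk : k < 15) (ht : t < 15) (hp : p < 12)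
    (h : (labelOrbit k t p).testBit q = true) :
    vertex f g q ∈ orbitOf (reflGroup {icosaRoot f g k, icosaRoot f g t}) (vertex f g p) := by
  obtain ⟨l, -, rfl⟩ := testBit_labelOrbit.mp h
  obtain ⟨w, hw, h⟩ := D.exists_wordAct hk ht l
  exact ⟨w, hw, h p hp⟩

theorem exists_of_mem_orbitOf {k t p : ℕ} (hk : k < 3) (ht : t < 15) (hp : p < 12) {x : V}
    (hx : x ∈ orbitOf (reflGroup {icosaRoot f g k, icosaRoot f g t}) (vertex f g p)) :
    ∃ q < 12, (labelOrbit k t p).testBit q = true ∧ x = vertex f g q := by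
  refine orbitOf_reflGroup_subset
    (S := {x | ∃ q < 12, (labelOrbit k t p).testBit q = true ∧ x = vertex f g q}) ?_ ?_ hx
  · rintro a ha _ ⟨q, hq, h, rfl⟩
    have h1 := labelOrbit_closed k hk t ht p hp q hq h
    rcases ha with rfl | rfl
    · exact ⟨_, refl_lt k (by omega) q hq, h1.1, D.refl_vertex (by omega) hq⟩
    · exact ⟨_, refl_lt t ht q hq, h1.2, D.refl_vertex ht hq⟩
  · exact ⟨p, hp, testBit_labelOrbit.mpr ⟨[], by simp [dihedralWords], rfl⟩, rfl⟩

theorem mem_orbitOf_iff {k t p q : ℕ} (hk : k < 3) (ht : t < 15) (hp : p < 12) (hq : q < 12) :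
    vertex f g q ∈ orbitOf (reflGroup {icosaRoot f g k, icosaRoot f g t}) (vertex f g p) ↔
      (labelOrbit k t p).testBit q = true := by
  refine ⟨fun h => ?_, D.mem_orbitOf (by omega) ht hp⟩
  obtain ⟨q', hq', h1, h2⟩ := D.exists_of_mem_orbitOf hk ht hp h
  rwa [D.vertex_injective hq hq' h2]

theorem exists_f_eq_vertex {r lo : ℕ} (hr : r < 10) (hlo : lo < 10) :
    ∃ k : ℤ, k = lo + ((r + 10 - lo) % 10 : ℕ) ∧ vertex f g r = f k := by
  have hv : vertex f g r = f r := if_pos hr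
  rcases le_or_gt lo r with h | h
  · refine ⟨r, by omega, hv⟩
  · refine ⟨r + 2 * (5 : ℕ), by omega, ?_⟩
    rw [hv, D.toFrame.f_add_two]

theorem vertex_mod {i : ℕ} (hi : i < 20) : vertex f g (i % 10) = f i := by
  rw [vertex, if_pos (Nat.mod_lt _ (by norm_num))]
  rcases lt_or_ge i 10 with h | h
  · rw [Nat.mod_eq_of_lt h]
  · rw [← D.toFrame.f_add_two]
    congr 1
    omega

theorem exists_g_mem {k t p : ℕ} (hk : k < 15) (ht : t < 15) (hp : p < 12)
    (h : 1024 ≤ labelOrbit k t p) :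
    g ∈ orbitOf (reflGroup {icosaRoot f g k, icosaRoot f g t}) (vertex f g p) ∨
      -g ∈ orbitOf (reflGroup {icosaRoot f g k, icosaRoot f g t}) (vertex f g p) := by
  obtain ⟨r, hr, h1⟩ := Nat.exists_ge_and_testBit_of_ge_two_pow (n := 10) h
  have h2 := D.mem_orbitOf hk ht hp h1
  rcases vertex_cases (f := f) (g := g) (not_lt.mpr hr) with h3 | h3 <;> rw [h3] at h2
  · exact Or.inl h2
  · exact Or.inr h2

end Orbits

variable [FiniteDimensional ℝ V]

section Separation

include D

theorem hullsNoncrossing_of_arcSeparated {k t p q : ℕ} (hk : k < 3) (ht : t < 15) (hp : p < 12)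
    (hq : q < 12) (h : ArcSeparated (labelOrbit k t p) (labelOrbit k t q)) :
    HullsNoncrossing (blockHull (coxeterPlane c)
        (orbitOf (reflGroup {icosaRoot f g k, icosaRoot f g t}) (vertex f g p)))
      (blockHull (coxeterPlane c)
        (orbitOf (reflGroup {icosaRoot f g k, icosaRoot f g t}) (vertex f g q))) := by
  obtain ⟨lo, hlo, -, n, hn, h1, h2, h3⟩ := h
  have hA : ∀ x ∈ orbitOf (reflGroup {icosaRoot f g k, icosaRoot f g t}) (vertex f g p),
      ∃ i : ℤ, lo ≤ i ∧ i ≤ lo + n ∧ x = f i := by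
    intro x hx
    obtain ⟨r, hr, hr1, rfl⟩ := D.exists_of_mem_orbitOf hk ht hp hx
    obtain ⟨hr2, hr3⟩ := testBit_arc_of_and_eq hlo hn hr h1 hr1
    obtain ⟨i, hi, hi'⟩ := D.exists_f_eq_vertex hr2 hlo
    exact ⟨i, by omega, by omega, hi'⟩
  have hB : ∀ x ∈ orbitOf (reflGroup {icosaRoot f g k, icosaRoot f g t}) (vertex f g q),
      (∃ i : ℤ, lo + n < i ∧ i < lo + 10 ∧ x = f i) ∨ ((x = g ∨ x = -g) ∧ n < 5) := by
    intro x hx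
    obtain ⟨r, hr, hr1, rfl⟩ := D.exists_of_mem_orbitOf hk ht hq hx
    rcases lt_or_ge r 10 with hr2 | hr2
    · have hr3 := lt_of_and_arc_eq_zero hlo hn hr2 h2 hr1
      obtain ⟨i, hi, hi'⟩ := D.exists_f_eq_vertex hr2 hlo
      exact Or.inl ⟨i, by omega, by omega, hi'⟩
    · refine Or.inr ⟨vertex_cases (not_lt.mpr hr2), h3.resolve_right fun hlt => ?_⟩
      have := Nat.ge_two_pow_of_testBit hr1
      have := Nat.pow_le_pow_right (by norm_num : 0 < 2) hr2
      omega
  -- For `n = 4` the arc has five vertices, and the chord joining its outer neighbors passes the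
  -- center on the wrong side; a line through the center is used instead. Shorter arcs allow
  -- separation along that chord, and for longer ones `B` avoids the center.
  rcases eq_or_ne n 4 with rfl | hn4
  · refine Or.inl (D.toFrame.disjoint_blockHull_half lo (fun x hx => ?_) fun x hx => ?_).symm
    · rcases hB x hx with ⟨i, hi1, hi2, rfl⟩ | ⟨hg, -⟩
      · exact Or.inl ⟨i, by omega, by omega, rfl⟩
      · exact Or.inr hg
    · obtain ⟨i, hi1, hi2, rfl⟩ := hA x hx
      exact ⟨i, hi1, by omega, rfl⟩
  · refine Or.inl (D.toFrame.disjoint_blockHull (i := lo - 1) (j := lo + n + 1) (by omega)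
      (by omega) (fun x hx => ?_) fun x hx => ?_).symm
    · rcases hB x hx with ⟨i, hi1, hi2, rfl⟩ | ⟨hg, h5⟩
      · exact Or.inl ⟨i, by omega, by omega, rfl⟩
      · exact Or.inr ⟨hg, by omega⟩
    · obtain ⟨i, hi1, hi2, rfl⟩ := hA x hx
      exact ⟨i, by omega, by omega, rfl⟩

theorem hullsNoncrossing_of_centerSeparated {k t p q : ℕ} (hk : k < 3) (ht : t < 15)
    (hp : p < 12) (hq : q < 12) (h : CenterSeparated (labelOrbit k t p) (labelOrbit k t q)) :
    HullsNoncrossing (blockHull (coxeterPlane c)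
        (orbitOf (reflGroup {icosaRoot f g k, icosaRoot f g t}) (vertex f g p)))
      (blockHull (coxeterPlane c)
        (orbitOf (reflGroup {icosaRoot f g k, icosaRoot f g t}) (vertex f g q))) := by
  obtain ⟨hp1, hq1, lo, hlo, h1, h2⟩ := h
  refine D.toFrame.hullsNoncrossing_half lo (fun x hx => ?_) (fun x hx => ?_)
    (D.exists_g_mem (by omega) ht hp hp1) (D.exists_g_mem (by omega) ht hq hq1)
  · obtain ⟨r, hr, hr1, rfl⟩ := D.exists_of_mem_orbitOf hk ht hp hx
    rcases lt_or_ge r 10 with hr2 | hr2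
    · have hr3 : (labelOrbit k t p % 2 ^ 10).testBit r = true := by
        rw [Nat.testBit_mod_two_pow, hr1]; simpa using hr2
      obtain ⟨-, hr4⟩ := testBit_arc_of_and_eq hlo (by norm_num) hr h1 hr3
      obtain ⟨i, hi, hi'⟩ := D.exists_f_eq_vertex hr2 hlo
      exact Or.inl ⟨i, by omega, by omega, hi'⟩
    · exact Or.inr (vertex_cases (not_lt.mpr hr2))
  · obtain ⟨r, hr, hr1, rfl⟩ := D.exists_of_mem_orbitOf hk ht hq hx
    rcases lt_or_ge r 10 with hr2 | hr2
    · have hr3 := lt_of_and_arc_eq_zero hlo (by norm_num) hr2 h2 hr1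
      obtain ⟨i, hi, hi'⟩ := D.exists_f_eq_vertex hr2 hlo
      exact Or.inl ⟨i, by omega, by omega, hi'⟩
    · exact Or.inr (vertex_cases (not_lt.mpr hr2))

theorem diagramNoncrossing_of_orbitsSeparated {k t : ℕ} (hk : k < 3) (ht : t < 15)
    (h : OrbitsSeparated k t) :
    DiagramNoncrossing (coxeterPlane c) (pts f g)
      (reflGroup {icosaRoot f g k, icosaRoot f g t}) := by
  have key : ∀ p < 12, ∀ q < p,
      orbitOf (reflGroup {icosaRoot f g k, icosaRoot f g t}) (vertex f g p) ≠
        orbitOf (reflGroup {icosaRoot f g k, icosaRoot f g t}) (vertex f g q) →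
      HullsNoncrossing (blockHull (coxeterPlane c)
        (orbitOf (reflGroup {icosaRoot f g k, icosaRoot f g t}) (vertex f g p)))
      (blockHull (coxeterPlane c)
        (orbitOf (reflGroup {icosaRoot f g k, icosaRoot f g t}) (vertex f g q))) := by
    intro p hp q hq hne
    rcases h p hp q hq with h | h | h | h
    · exact absurd (orbitOf_eq (D.mem_orbitOf (by omega) ht hp h)) hne
    · exact D.hullsNoncrossing_of_arcSeparated hk ht hp (by omega) h
    · exact (D.hullsNoncrossing_of_arcSeparated hk ht (by omega) hp h).symm
    · exact D.hullsNoncrossing_of_centerSeparated hk ht hp (by omega) h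
  intro x hx y hy hne
  obtain ⟨p, hp, rfl⟩ := D.mem_pts.mp hx
  obtain ⟨q, hq, rfl⟩ := D.mem_pts.mp hy
  rcases lt_trichotomy q p with h1 | rfl | h1
  · exact key p hp q h1 hne
  · exact absurd rfl hne
  · exact (key q hq p h1 hne.symm).symm

omit [FiniteDimensional ℝ V] in
theorem orbitOf_ne {k t p q : ℕ} (hk : k < 3) (ht : t < 15) (hp : p < 12) (hq : q < 12)
    (h : (labelOrbit k t p).testBit q = false) :
    orbitOf (reflGroup {icosaRoot f g k, icosaRoot f g t}) (vertex f g p) ≠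
      orbitOf (reflGroup {icosaRoot f g k, icosaRoot f g t}) (vertex f g q) := by
  intro he
  have h1 := mem_orbitOf_self (reflGroup {icosaRoot f g k, icosaRoot f g t}) (vertex f g q)
  rw [← he, D.mem_orbitOf_iff hk ht hp hq, h] at h1
  exact Bool.false_ne_true h1

theorem not_diagramNoncrossing_of_chordCrossing {k t : ℕ} (hk : k < 3) (ht : t < 15)
    (h : ChordCrossing k t) :
    ¬ DiagramNoncrossing (coxeterPlane c) (pts f g)
      (reflGroup {icosaRoot f g k, icosaRoot f g t}) := by
  obtain ⟨i, hi, j, hj, h1, l, hl, hl0, h2, n, hn, hjn, h3⟩ := h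
  have hlt : ∀ a, a % 10 < 12 := fun a => (Nat.mod_lt a (by norm_num)).trans (by norm_num)
  intro hD
  refine D.toFrame.not_hullsNoncrossing_chords (i := i) (k := i + l) (j := i + j) (l := i + n)
    (by omega) (by omega) (by omega) (by omega) ?_ ?_ ?_ ?_
    (hD (vertex f g i) (D.mem_pts.mpr ⟨i, by omega, rfl⟩) (vertex f g ((i + l) % 10))
    (D.mem_pts.mpr ⟨_, hlt _, rfl⟩) (D.orbitOf_ne hk ht (by omega) (hlt _) h2))
  · rw [vertex, if_pos hi]
    exact mem_orbitOf_self _ _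
  · have := D.mem_orbitOf (by omega) ht (by omega) h1
    rw [D.vertex_mod (by omega)] at this
    exact_mod_cast this
  · rw [D.vertex_mod (by omega)]
    exact_mod_cast mem_orbitOf_self _ _
  · have := D.mem_orbitOf (by omega) ht (hlt _) h3
    rw [D.vertex_mod (i := i + n) (by omega)] at this
    exact_mod_cast this

theorem not_diagramNoncrossing_of_spokeCrossing {k t : ℕ} (hk : k < 3) (ht : t < 15)
    (h : SpokeCrossing k t) :
    ¬ DiagramNoncrossing (coxeterPlane c) (pts f g)
      (reflGroup {icosaRoot f g k, icosaRoot f g t}) := by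
  obtain ⟨i, hi, n, hn, h1, l, hl, hl0, h2, h3⟩ := h
  have hlt : ∀ a, a % 10 < 12 := fun a => (Nat.mod_lt a (by norm_num)).trans (by norm_num)
  intro hD
  refine D.toFrame.not_hullsNoncrossing_spoke (k := i) (i := i + l) (l := i + n)
    (by omega) (by omega) (by omega) ?_ (D.exists_g_mem (by omega) ht (hlt _) h3) ?_ ?_
    (hD (vertex f g ((i + l) % 10)) (D.mem_pts.mpr ⟨_, hlt _, rfl⟩) (vertex f g i)
    (D.mem_pts.mpr ⟨i, by omega, rfl⟩) (D.orbitOf_ne hk ht (by omega) (hlt _) h2).symm)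
  · rw [D.vertex_mod (by omega)]
    exact_mod_cast mem_orbitOf_self _ _
  · rw [vertex, if_pos hi]
    exact mem_orbitOf_self _ _
  · have := D.mem_orbitOf (by omega) ht (by omega) h1
    rw [D.vertex_mod (by omega)] at this
    exact_mod_cast this

end Separation

end IcosaFrame

/-! ### The noncrossing criterion for the icosahedron. -/

section IcosahedronNoncrossing

variable {V : Type*} [NormedAddCommGroup V] [InnerProductSpace ℝ V]

/-- The vectors `icosaRoot f g t`, one for each of the fifteen reflections. -/
def icosaRoots (f : ℤ → V) (g : V) : Set V := {a | ∃ t < 15, a = icosaRoot f g t}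

theorem reflGroup_pair {a b a' b' : V} (h : hyperplaneReflection a = hyperplaneReflection a')
    (h' : hyperplaneReflection b = hyperplaneReflection b') :
    reflGroup {a, b} = reflGroup {a', b'} := by
  rw [reflGroup, reflGroup, Set.image_pair, Set.image_pair, h, h']

/-- The blocks of the trivial group are noncrossing. -/
theorem diagramNoncrossing_bot [FiniteDimensional ℝ V] (P : Submodule ℝ V) (o : Set V) :
    DiagramNoncrossing P o ⊥ := by
  intro x _ y _ _
  have h : ∀ z : V, orbitOf (⊥ : Subgroup (V ≃ₗᵢ[ℝ] V)) z = {z} := by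
    intro z
    ext u
    constructor
    · rintro ⟨w, hw, rfl⟩
      rw [Subgroup.mem_bot.mp hw]; rfl
    · rintro rfl
      exact mem_orbitOf_self _ _
  rw [h, h, blockHull, blockHull, Set.image_singleton, Set.image_singleton]
  exact hullsNoncrossing_singleton _ _

theorem reflGroup_nil : reflGroup {a : V | a ∈ ([] : List V)} = ⊥ := by
  rw [reflGroup]
  simp

namespace IcosaFrame

variable {c : V ≃ₗᵢ[ℝ] V} {f : ℤ → V} {g : V} {ρ : ℝ}

section Factorizations

variable (D : IcosaFrame c f g ρ)

include D

theorem prodR_eq_iff {s t d : ℕ} (hs : s < 15) (ht : t < 15) (hd : d < 15) :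
    prodR [icosaRoot f g s, icosaRoot f g t, icosaRoot f g d] = c ↔ IsFactorization s t d := by
  have h1 : ∀ p < 12, prodR [icosaRoot f g s, icosaRoot f g t, icosaRoot f g d] (vertex f g p) =
      vertex f g (refl s (refl t (refl d p))) := by
    intro p hp
    rw [prodR_cons_apply, prodR_cons_apply, prodR_cons_apply]
    have h0 : prodR ([] : List V) (vertex f g p) = vertex f g p := rfl
    rw [h0, D.refl_vertex hd hp, D.refl_vertex ht (refl_lt d hd p hp),
      D.refl_vertex hs (refl_lt t ht _ (refl_lt d hd p hp))]
  constructor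
  · intro h p hp
    have h2 := h1 p hp
    rw [h, D.map_vertex p hp] at h2
    exact (D.vertex_injective (rot_lt 1 (by norm_num) p hp)
      (refl_lt s hs _ (refl_lt t ht _ (refl_lt d hd p hp))) h2).symm
  · intro h
    refine D.ext fun p hp => ?_
    rw [h1 p hp, h p hp, D.map_vertex p hp]

theorem exists_prodR {k : ℕ} (hk : k < 3) : ∃ t < 15, ∃ d < 15,
    prodR [icosaRoot f g k, icosaRoot f g t, icosaRoot f g d] = c := by
  obtain ⟨t, ht, d, hd, h⟩ := exists_isFactorization k hk
  exact ⟨t, ht, d, hd, (D.prodR_eq_iff (by omega) ht hd).mpr h⟩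

/-- A factorization of `c` into three reflections bounds the dimension from above. From below, `f 0
+ g`, `f 0 - g` and a root orthogonal to both are nonzero and pairwise orthogonal. -/
theorem finrank_eq [FiniteDimensional ℝ V] : Module.finrank ℝ V = 3 := by
  refine le_antisymm ?_ ?_
  · obtain ⟨Z, hZ⟩ := D.toFrame.exists_resolvent
    obtain ⟨t, -, d, -, h⟩ := D.exists_prodR (k := 0) (by norm_num)
    exact finrank_le_length_of_prodR hZ h
  · have h0 := D.inner_icosaRoot (t := 1) (p := 0) (by norm_num) (by norm_num)
    have hg := D.inner_icosaRoot (t := 1) (p := 10) (by norm_num) (by norm_num)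
    have e0 : gramRat (edgeLeft 1) 0 - gramRat (edgeRight 1) 0 = 0 ∧
      gramSqrt (edgeLeft 1) 0 - gramSqrt (edgeRight 1) 0 = 0 ∧
      gramRat (edgeLeft 1) 10 - gramRat (edgeRight 1) 10 = 0 ∧
      gramSqrt (edgeLeft 1) 10 - gramSqrt (edgeRight 1) 10 = 0 := by decide +kernel
    have hr := D.icosaRoot_ne (t := 1) (by norm_num)
    have e1 : (gramRat (edgeLeft 1) 0 : ℝ) - gramRat (edgeRight 1) 0 = 0 := by
      exact_mod_cast e0.1
    have e2 : (gramSqrt (edgeLeft 1) 0 : ℝ) - gramSqrt (edgeRight 1) 0 = 0 := by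
      exact_mod_cast e0.2.1
    have e3 : (gramRat (edgeLeft 1) 10 : ℝ) - gramRat (edgeRight 1) 10 = 0 := by
      exact_mod_cast e0.2.2.1
    have e4 : (gramSqrt (edgeLeft 1) 10 : ℝ) - gramSqrt (edgeRight 1) 10 = 0 := by
      exact_mod_cast e0.2.2.2
    rw [e1, e2, zero_mul, add_zero, mul_zero] at h0
    rw [e3, e4, zero_mul, add_zero, mul_zero] at hg
    change ⟪icosaRoot f g 1, f 0⟫ = 0 at h0
    change ⟪icosaRoot f g 1, g⟫ = 0 at hg
    have hfg : ⟪g, f 0⟫ = ρ := by rw [real_inner_comm, D.inner_fg]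
    have hρ := D.rho_pos
    have hs := one_lt_sqrt_five
    have hli : LinearIndependent ℝ ![icosaRoot f g 1, f 0 + g, f 0 - g] := by
      refine linearIndependent_of_ne_zero_of_inner_eq_zero ?_ ?_
      · intro i
        fin_cases i
        · exact hr
        · intro h
          change f 0 + g = 0 at h
          have h1 := congrArg (fun x => ⟪f 0, x⟫) h
          simp only [inner_add_right, inner_zero_right, D.inner_zero, D.inner_fg] at h1
          nlinarith
        · intro h
          change f 0 - g = 0 at h
          have h1 := congrArg (fun x => ⟪f 0, x⟫) h
          simp only [inner_sub_right, inner_zero_right, D.inner_zero, D.inner_fg] at h1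
          nlinarith
      · have h1 : ⟪icosaRoot f g 1, f 0 + g⟫ = 0 := by rw [inner_add_right, h0, hg, add_zero]
        have h2 : ⟪icosaRoot f g 1, f 0 - g⟫ = 0 := by rw [inner_sub_right, h0, hg, sub_zero]
        have h3 : ⟪f 0 + g, f 0 - g⟫ = 0 := by
          simp only [inner_add_left, inner_sub_right, D.inner_zero, D.inner_fg, D.inner_gg, hfg]
          ring
        intro i j hij
        fin_cases i <;> fin_cases j <;> first | exact absurd rfl hij | assumption |
          (rw [real_inner_comm]; assumption)
    simpa using hli.fintype_card_le_finrank

theorem image_icosaRoots_shift :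
    hyperplaneReflection '' icosaRoots (fun i => f (i + 1)) (-g) =
      hyperplaneReflection '' icosaRoots f g := by
  ext w
  constructor
  · rintro ⟨_, ⟨t, ht, rfl⟩, rfl⟩
    exact ⟨_, ⟨_, Nat.mod_lt _ (by norm_num), rfl⟩, (D.reflection_shift ht).symm⟩
  · rintro ⟨_, ⟨t, ht, rfl⟩, rfl⟩
    refine ⟨_, ⟨(t + 12) % 15, Nat.mod_lt _ (by norm_num), rfl⟩, ?_⟩
    rw [D.reflection_shift (Nat.mod_lt _ (by norm_num)), show ((t + 12) % 15 + 3) % 15 = t by omega]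

theorem word_mem {k s t : ℕ} (hk : k < 15) (hs : s < 15) (ht : t < 15) (h : IsWord k s t) :
    hyperplaneReflection (icosaRoot f g t) ∈ reflGroup {icosaRoot f g k, icosaRoot f g s} := by
  obtain ⟨l, -, h⟩ := h
  obtain ⟨w, hw, h'⟩ := D.exists_wordAct hk hs l
  have : hyperplaneReflection (icosaRoot f g t) = w := D.ext fun p hp => by
    rw [D.refl_vertex ht hp, h p hp, h' p hp]
  rwa [this]

theorem reflGroup_le_of_isWord {k s t : ℕ} (hk : k < 15) (hs : s < 15) (ht : t < 15)
    (h : IsWord k s t) : reflGroup {icosaRoot f g k, icosaRoot f g t} ≤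
      reflGroup {icosaRoot f g k, icosaRoot f g s} := by
  rw [reflGroup, Subgroup.closure_le]
  rintro _ ⟨a, rfl | rfl, rfl⟩
  · exact hyperplaneReflection_mem_reflGroup (Or.inl rfl)
  · exact D.word_mem hk hs ht h

variable [FiniteDimensional ℝ V]

theorem diagramNoncrossing_pair_of_lt {k t : ℕ} (hk : k < 3) (ht : t < 15)
    (h : t = k ∨ ∃ d < 15, prodR [icosaRoot f g k, icosaRoot f g t, icosaRoot f g d] = c) :
    DiagramNoncrossing (coxeterPlane c) (pts f g)
      (reflGroup {icosaRoot f g k, icosaRoot f g t}) := by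
  refine D.diagramNoncrossing_of_orbitsSeparated hk ht (orbitsSeparated k hk t ht ?_)
  refine h.imp_right ?_
  rintro ⟨d, hd, h⟩
  exact ⟨d, hd, (D.prodR_eq_iff (by omega) ht hd).mp h⟩

theorem isNoncrossing_of_prodR {L₁ L₂ : List V} (hR : ∀ a ∈ L₁ ++ L₂, a ∈ icosaRoots f g)
    (hc : prodR (L₁ ++ L₂) = c) (hn : (L₁ ++ L₂).length ≤ 3) :
    IsNoncrossing (hyperplaneReflection '' icosaRoots f g) c (reflGroup {a | a ∈ L₁}) := by
  obtain ⟨Z, hZ⟩ := D.toFrame.exists_resolvent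
  refine isNoncrossing_of_lists rfl hZ hR hc ?_
  rwa [D.finrank_eq]

theorem isNoncrossing_pair_of_lt {k t : ℕ} (hk : k < 3) (ht : t < 15)
    (h : DiagramNoncrossing (coxeterPlane c) (pts f g)
      (reflGroup {icosaRoot f g k, icosaRoot f g t})) :
    IsNoncrossing (hyperplaneReflection '' icosaRoots f g) c
      (reflGroup {icosaRoot f g k, icosaRoot f g t}) := by
  have hR : ∀ {s y d}, s < 15 → y < 15 → d < 15 →
      ∀ a ∈ [icosaRoot f g s, icosaRoot f g y, icosaRoot f g d], a ∈ icosaRoots f g := by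
    intro s y d hs hy hd a ha
    simp only [List.mem_cons, List.not_mem_nil, or_false] at ha
    rcases ha with rfl | rfl | rfl
    exacts [⟨s, hs, rfl⟩, ⟨y, hy, rfl⟩, ⟨d, hd, rfl⟩]
  rcases isFactorization_or_crossing k hk t ht with rfl | ⟨y, hy, ⟨d, hd, h1⟩, h2, h3⟩ | h1 | h1
  · obtain ⟨y, hy, d, hd, h1⟩ := D.exists_prodR hk
    have := D.isNoncrossing_of_prodR (L₁ := [icosaRoot f g t])
      (L₂ := [icosaRoot f g y, icosaRoot f g d]) (hR ht hy hd) h1 le_rfl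
    have he : ({a | a ∈ [icosaRoot f g t]} : Set V) = {icosaRoot f g t, icosaRoot f g t} := by
      ext; simp
    rwa [he] at this
  · have := D.isNoncrossing_of_prodR (L₁ := [icosaRoot f g k, icosaRoot f g y])
      (L₂ := [icosaRoot f g d]) (hR (by omega) hy hd)
      ((D.prodR_eq_iff (by omega) hy hd).mpr h1) le_rfl
    have he : ({a | a ∈ [icosaRoot f g k, icosaRoot f g y]} : Set V) =
        {icosaRoot f g k, icosaRoot f g y} := by
      ext; simp
    rw [he] at this
    rwa [le_antisymm (D.reflGroup_le_of_isWord (by omega) hy ht h3)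
      (D.reflGroup_le_of_isWord (by omega) ht hy h2)]
  · exact absurd h (D.not_diagramNoncrossing_of_chordCrossing hk ht h1)
  · exact absurd h (D.not_diagramNoncrossing_of_spokeCrossing hk ht h1)

omit [FiniteDimensional ℝ V] in
/-- The frame that starts at another point gives the same reflections. -/
theorem exists_shift (n : ℕ) : ∃ f' g', IcosaFrame c f' g' ρ ∧ pts f' g' = pts f g ∧
    hyperplaneReflection '' icosaRoots f' g' = hyperplaneReflection '' icosaRoots f g ∧
    ∀ t < 15, hyperplaneReflection (icosaRoot f' g' t) =
      hyperplaneReflection (icosaRoot f g ((t + 3 * n) % 15)) := by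
  induction n with
  | zero =>
    refine ⟨f, g, D, rfl, rfl, fun t ht => ?_⟩
    rw [mul_zero, add_zero, Nat.mod_eq_of_lt ht]
  | succ n ih =>
    obtain ⟨f', g', D', h1, h2, h3⟩ := ih
    refine ⟨_, _, D'.shift, D'.pts_shift.trans h1, D'.image_icosaRoots_shift.trans h2,
      fun t ht => ?_⟩
    rw [D'.reflection_shift ht, h3 _ (Nat.mod_lt _ (by norm_num)),
      show ((t + 3) % 15 + 3 * n) % 15 = (t + 3 * (n + 1)) % 15 by omega]

/-- Shifting the frame `s / 3` times lowers the index of the first reflection to `s % 3`, without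
changing the points or the Coxeter element. -/
theorem diagramNoncrossing_pair {s t : ℕ} (hs : s < 15) (ht : t < 15)
    (h : t = s ∨ ∃ d < 15, prodR [icosaRoot f g s, icosaRoot f g t, icosaRoot f g d] = c) :
    DiagramNoncrossing (coxeterPlane c) (pts f g)
      (reflGroup {icosaRoot f g s, icosaRoot f g t}) := by
  obtain ⟨f', g', D', h1, h2, h3⟩ := D.exists_shift (s / 3)
  have e : ∀ u < 15, hyperplaneReflection (icosaRoot f g u) =
      hyperplaneReflection (icosaRoot f' g' ((u + 15 - 3 * (s / 3)) % 15)) := by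
    intro u hu
    rw [h3 _ (Nat.mod_lt _ (by norm_num)),
      show ((u + 15 - 3 * (s / 3)) % 15 + 3 * (s / 3)) % 15 = u by omega]
  rw [← h1, reflGroup_pair (e s hs) (e t ht)]
  refine D'.diagramNoncrossing_pair_of_lt (by omega) (Nat.mod_lt _ (by norm_num)) ?_
  rcases h with rfl | ⟨d, hd, h⟩
  · exact Or.inl rfl
  · refine Or.inr ⟨(d + 15 - 3 * (s / 3)) % 15, Nat.mod_lt _ (by norm_num), ?_⟩
    rw [← h]
    simp only [prodR, List.map_cons, List.map_nil]
    rw [← e s hs, ← e t ht, ← e d hd]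

theorem isNoncrossing_pair {s t : ℕ} (hs : s < 15) (ht : t < 15)
    (h : DiagramNoncrossing (coxeterPlane c) (pts f g)
      (reflGroup {icosaRoot f g s, icosaRoot f g t})) :
    IsNoncrossing (hyperplaneReflection '' icosaRoots f g) c
      (reflGroup {icosaRoot f g s, icosaRoot f g t}) := by
  obtain ⟨f', g', D', h1, h2, h3⟩ := D.exists_shift (s / 3)
  have e : ∀ u < 15, hyperplaneReflection (icosaRoot f g u) =
      hyperplaneReflection (icosaRoot f' g' ((u + 15 - 3 * (s / 3)) % 15)) := by
    intro u hu
    rw [h3 _ (Nat.mod_lt _ (by norm_num)),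
      show ((u + 15 - 3 * (s / 3)) % 15 + 3 * (s / 3)) % 15 = u by omega]
  rw [← h1, reflGroup_pair (e s hs) (e t ht)] at h
  rw [← h2, reflGroup_pair (e s hs) (e t ht)]
  exact D'.isNoncrossing_pair_of_lt (by omega) (Nat.mod_lt _ (by norm_num)) h

omit [FiniteDimensional ℝ V] in
/-- A factorization of the Coxeter element generates a transitive group. -/
theorem mem_orbitOf_of_prodR {L : List V} (hR : ∀ a ∈ L, a ∈ icosaRoots f g) (hc : prodR L = c)
    {x : V} (hx : x ∈ pts f g) : x ∈ orbitOf (reflGroup {a | a ∈ L}) (f 0) := by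
  have hcG : c ∈ reflGroup {a | a ∈ L} := by
    rw [← hc]
    exact prodR_mem fun a ha => hyperplaneReflection_mem_reflGroup ha
  have hsucc : ∀ i, f (i + 1) ∈ orbitOf (reflGroup {a | a ∈ L}) (f i) := fun i =>
    ⟨c, hcG, D.map_f i⟩
  have hf : ∀ i, f i ∈ orbitOf (reflGroup {a | a ∈ L}) (f 0) := by
    intro i
    induction i using Int.induction_on with
    | zero => exact mem_orbitOf_self _ _
    | succ i ih => exact orbitOf_trans ih (hsucc _)
    | pred i ih =>
      have := hsucc (-i - 1)
      rw [sub_add_cancel] at this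
      exact orbitOf_trans ih (orbitOf_symm this)
  -- Since `c g = -g`, some letter moves `g`. No reflection exchanges `g` and `-g`, so this letter
  -- takes `g` to a vertex of the decagon, on which powers of `c` are transitive.
  have hmove : ∃ a ∈ L, hyperplaneReflection a g ≠ g := by
    by_contra! hfix
    have h1 : ∀ L' : List V, (∀ a ∈ L', a ∈ L) → prodR L' g = g := by
      intro L' hL'
      induction L' with
      | nil => rfl
      | cons a L' ih =>
        rw [prodR_cons_apply, ih fun b hb => hL' b (List.mem_cons_of_mem a hb),
          hfix a (hL' a List.mem_cons_self)]
    have h2 := h1 L fun a ha => ha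
    rw [hc, D.map_g] at h2
    have h3 : (2 : ℝ) • g = 0 := by
      rw [two_smul]
      nth_rewrite 1 [← h2]
      exact neg_add_cancel g
    exact D.toFrame.g_ne ((smul_eq_zero.mp h3).resolve_left two_ne_zero)
  have hg : g ∈ orbitOf (reflGroup {a | a ∈ L}) (f 0) := by
    obtain ⟨a, ha, hag⟩ := hmove
    have hw := hyperplaneReflection_mem_reflGroup (A := {a | a ∈ L}) ha
    obtain ⟨t, ht, rfl⟩ := hR a ha
    have h1 : ∀ t < 15, refl t 10 = 10 ∨ refl t 10 < 10 := by decide +kernel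
    have h2 := D.refl_vertex ht (p := 10) (by norm_num)
    rcases h1 t ht with h3 | h3
    · rw [h3] at h2
      exact absurd h2 hag
    · have h4 : vertex f g (refl t 10) = f (refl t 10) := if_pos h3
      rw [h4] at h2
      exact orbitOf_trans (hf _) (orbitOf_symm ⟨_, hw, h2⟩)
  rcases pts_cases hx with ⟨i, rfl⟩ | rfl | rfl
  · exact hf i
  · exact hg
  · exact orbitOf_trans hg ⟨c, hcG, D.map_g⟩

/-- The prefix has at most three letters. Lengths one and two are the finite checks; for length
three there is only one block, and for length zero all blocks are points. -/
theorem diagramNoncrossing_of_isNoncrossing {W' : Subgroup (V ≃ₗᵢ[ℝ] V)}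
    (h : IsNoncrossing (hyperplaneReflection '' icosaRoots f g) c W') :
    DiagramNoncrossing (coxeterPlane c) (pts f g) W' := by
  obtain ⟨Z, hZ⟩ := D.toFrame.exists_resolvent
  obtain ⟨y, hy, d, hd, h1⟩ := D.exists_prodR (k := 0) (by norm_num)
  obtain ⟨L₁, L₂, hR, hc, hn, rfl⟩ := exists_lists_of_isNoncrossing rfl hZ
    ⟨[icosaRoot f g 0, icosaRoot f g y, icosaRoot f g d], by
      intro a ha
      simp only [List.mem_cons, List.not_mem_nil, or_false] at ha
      rcases ha with rfl | rfl | rfl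
      exacts [⟨0, by norm_num, rfl⟩, ⟨y, hy, rfl⟩, ⟨d, hd, rfl⟩], h1, by
      rw [D.finrank_eq]; exact le_rfl⟩ h
  rw [D.finrank_eq, List.length_append] at hn
  rcases L₁ with _ | ⟨a, _ | ⟨b, _ | ⟨d', L₁⟩⟩⟩
  · rw [reflGroup_nil]
    exact diagramNoncrossing_bot _ _
  · obtain ⟨t, ht, rfl⟩ := hR a (by simp)
    have he : ({a | a ∈ [icosaRoot f g t]} : Set V) = {icosaRoot f g t, icosaRoot f g t} := by
      ext; simp
    rw [he]
    exact D.diagramNoncrossing_pair ht ht (Or.inl rfl)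
  · obtain ⟨d, rfl⟩ : ∃ d, L₂ = [d] := List.length_eq_one_iff.mp (by simp at hn; omega)
    obtain ⟨s, hs, rfl⟩ := hR a (by simp)
    obtain ⟨t, ht, rfl⟩ := hR b (by simp)
    obtain ⟨d, hd, rfl⟩ := hR d (by simp)
    have he : ({a | a ∈ [icosaRoot f g s, icosaRoot f g t]} : Set V) =
        {icosaRoot f g s, icosaRoot f g t} := by
      ext; simp
    rw [he]
    exact D.diagramNoncrossing_pair hs ht (Or.inr ⟨d, hd, hc⟩)
  · obtain rfl : L₂ = [] := List.length_eq_zero_iff.mp (by simp at hn; omega)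
    rw [List.append_nil] at hR hc
    intro x hx y hy hne
    exact absurd ((orbitOf_eq (D.mem_orbitOf_of_prodR hR hc hx)).symm.trans
      (orbitOf_eq (D.mem_orbitOf_of_prodR hR hc hy))) hne

theorem isNoncrossing_bot :
    IsNoncrossing (hyperplaneReflection '' icosaRoots f g) c ⊥ := by
  obtain ⟨y, hy, d, hd, h1⟩ := D.exists_prodR (k := 0) (by norm_num)
  rw [← reflGroup_nil]
  refine D.isNoncrossing_of_prodR (L₁ := [])
    (L₂ := [icosaRoot f g 0, icosaRoot f g y, icosaRoot f g d]) ?_ h1 le_rfl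
  intro a ha
  simp only [List.nil_append, List.mem_cons, List.not_mem_nil, or_false] at ha
  rcases ha with rfl | rfl | rfl
  exacts [⟨0, by norm_num, rfl⟩, ⟨y, hy, rfl⟩, ⟨d, hd, rfl⟩]

omit [FiniteDimensional ℝ V] in
theorem conj_reflection {t : ℕ} (ht : t < 15) :
    c * hyperplaneReflection (icosaRoot f g t) * c⁻¹ =
      hyperplaneReflection (icosaRoot f g ((t + 3) % 15)) := by
  rw [← D.reflection_shift ht, hyperplaneReflection_conj]
  congr 1
  obtain ⟨h1, h2, -⟩ := edge_lt t ht
  rw [icosaRoot, icosaRoot, map_sub, D.vertex_shift _ h1, D.vertex_shift _ h2, D.map_vertex _ h1,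
    D.map_vertex _ h2]

/-- The reflections with indices `0`, `2`, `1` multiply to `c`, and conjugation by `c` produces all
others from these three. -/
theorem isNoncrossing_top :
    IsNoncrossing (hyperplaneReflection '' icosaRoots f g) c (reflGroup (icosaRoots f g)) := by
  have hfac : IsFactorization 0 2 1 := by decide +kernel
  have hc := (D.prodR_eq_iff (by norm_num) (by norm_num) (by norm_num)).mpr hfac
  set L := [icosaRoot f g 0, icosaRoot f g 2, icosaRoot f g 1] with hL
  have hR : ∀ a ∈ L, a ∈ icosaRoots f g := by
    intro a ha
    simp only [hL, List.mem_cons, List.not_mem_nil, or_false] at ha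
    rcases ha with rfl | rfl | rfl
    exacts [⟨0, by norm_num, rfl⟩, ⟨2, by norm_num, rfl⟩, ⟨1, by norm_num, rfl⟩]
  have hcG : c ∈ reflGroup {a | a ∈ L} := by
    rw [← hc]
    exact prodR_mem fun a ha => hyperplaneReflection_mem_reflGroup ha
  have hmem : ∀ i, ∀ k < 3, 3 * i + k < 15 →
      hyperplaneReflection (icosaRoot f g (3 * i + k)) ∈ reflGroup {a | a ∈ L} := by
    intro i
    induction i with
    | zero =>
      intro k hk _
      refine hyperplaneReflection_mem_reflGroup ?_
      interval_cases k <;> simp [hL]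
    | succ i ih =>
      intro k hk hlt
      have h1 := D.conj_reflection (t := 3 * i + k) (by omega)
      rw [show (3 * i + k + 3) % 15 = 3 * (i + 1) + k by omega] at h1
      rw [← h1]
      exact mul_mem (mul_mem hcG (ih k hk (by omega))) (inv_mem hcG)
  have he : reflGroup (icosaRoots f g) = reflGroup {a | a ∈ L} := by
    refine le_antisymm ?_ (reflGroup_mono hR)
    rw [reflGroup, Subgroup.closure_le]
    rintro _ ⟨_, ⟨t, ht, rfl⟩, rfl⟩
    have := hmem (t / 3) (t % 3) (Nat.mod_lt _ (by norm_num)) (by omega)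
    rwa [Nat.div_add_mod] at this
  rw [he]
  exact D.isNoncrossing_of_prodR (L₁ := L) (L₂ := []) (by simpa using hR) hc le_rfl

end Factorizations

end IcosaFrame

end IcosahedronNoncrossing

/-! ### Transport of icosahedral frames, and vectors with small orbits. -/

section IcosahedronFrames

variable {V : Type*} [NormedAddCommGroup V] [InnerProductSpace ℝ V]

theorem vertex_map (w : V ≃ₗᵢ[ℝ] V) (f : ℤ → V) (g : V) (p : ℕ) :
    vertex (fun i => w (f i)) (w g) p = w (vertex f g p) := by
  rw [vertex, vertex]
  split_ifs
  · rfl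
  · rfl
  · exact (map_neg w g).symm

theorem icosaRoot_map (w : V ≃ₗᵢ[ℝ] V) (f : ℤ → V) (g : V) (t : ℕ) :
    icosaRoot (fun i => w (f i)) (w g) t = w (icosaRoot f g t) := by
  rw [icosaRoot, icosaRoot, vertex_map, vertex_map, map_sub]

theorem vertex_smul (f : ℤ → V) (g : V) (t : ℝ) (p : ℕ) :
    vertex (fun i => t • f i) (t • g) p = t • vertex f g p := by
  rw [vertex, vertex]
  split_ifs
  · rfl
  · rfl
  · exact (smul_neg t g).symm

theorem icosaRoots_smul (f : ℤ → V) (g : V) (t : ℝ) :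
    icosaRoots (fun i => t • f i) (t • g) = (fun y => t • y) '' icosaRoots f g := by
  have h : ∀ s, icosaRoot (fun i => t • f i) (t • g) s = t • icosaRoot f g s := fun s => by
    rw [icosaRoot, icosaRoot, vertex_smul, vertex_smul, smul_sub]
  ext a
  constructor
  · rintro ⟨s, hs, rfl⟩
    exact ⟨_, ⟨s, hs, rfl⟩, (h s).symm⟩
  · rintro ⟨_, ⟨s, hs, rfl⟩, rfl⟩
    exact ⟨s, hs, (h s).symm⟩

theorem span_frame_image {f : ℤ → V} {g : V} (h : Submodule.span ℝ (Set.range f ∪ {g}) = ⊤)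
    {φ : V →ₗ[ℝ] V} (hφ : Function.Surjective φ) :
    Submodule.span ℝ (Set.range (fun i => φ (f i)) ∪ {φ g}) = ⊤ := by
  have h1 : Set.range (fun i => φ (f i)) ∪ {φ g} = φ '' (Set.range f ∪ {g}) := by
    rw [Set.image_union, Set.image_singleton, ← Set.range_comp]
    rfl
  rw [h1, Submodule.span_image, h, Submodule.map_top, LinearMap.range_eq_top.mpr hφ]

namespace IcosaFrame

variable {c : V ≃ₗᵢ[ℝ] V} {f : ℤ → V} {g : V} {ρ : ℝ} (D : IcosaFrame c f g ρ)

include D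

theorem conj (w : V ≃ₗᵢ[ℝ] V) : IcosaFrame (w * c * w⁻¹) (fun i => w (f i)) (w g) ρ where
  map_f i := by
    change w (c (w⁻¹ (w (f i)))) = w (f (i + 1))
    rw [← D.map_f i]
    exact congrArg (fun x => w (c x)) (w.symm_apply_apply (f i))
  f_add i := by rw [D.f_add, map_neg]
  map_g := by
    change w (c (w⁻¹ (w g))) = -w g
    rw [← map_neg, ← D.map_g]
    exact congrArg (fun x => w (c x)) (w.symm_apply_apply g)
  rho_pos := D.rho_pos
  inner_zero := by rw [w.inner_map_map, D.inner_zero]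
  inner_one := by rw [w.inner_map_map, D.inner_one]
  inner_two := by rw [w.inner_map_map, D.inner_two]
  inner_fg := by rw [w.inner_map_map, D.inner_fg]
  inner_gg := by rw [w.inner_map_map, D.inner_gg]
  span := span_frame_image D.span (φ := w.toLinearEquiv.toLinearMap) w.surjective

theorem smul {t : ℝ} (ht : t ≠ 0) : IcosaFrame c (fun i => t • f i) (t • g) (t ^ 2 * ρ) := by
  have hin : ∀ x y : V, ⟪t • x, t • y⟫ = t ^ 2 * ⟪x, y⟫ := by
    intro x y
    rw [inner_smul_left, inner_smul_right, conj_trivial]; ring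
  refine ⟨fun i => ?_, fun i => ?_, ?_, mul_pos (by positivity) D.rho_pos, ?_, ?_, ?_, ?_, ?_, ?_⟩
  · rw [map_smul, D.map_f]
  · rw [D.f_add, smul_neg]
  · rw [map_smul, D.map_g, smul_neg]
  · rw [hin, D.inner_zero]; ring
  · rw [hin, D.inner_one]
  · rw [hin, D.inner_two]
  · rw [hin, D.inner_fg]
  · rw [hin, D.inner_gg]; ring
  · refine span_frame_image D.span (φ := LinearMap.lsmul ℝ V t) fun x => ⟨t⁻¹ • x, ?_⟩
    rw [LinearMap.lsmul_apply, smul_inv_smul₀ ht]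

/-- The sum of the vertices around `g`. -/
theorem sum_eq : f 0 - f 1 + f 2 - f 3 + f 4 = √5 • g := by
  have h5 : √5 * √5 = 5 := Real.mul_self_sqrt (by norm_num)
  rw [← sub_eq_zero]
  refine D.eq_zero_of_inner fun p hp => ?_
  have key : ∀ p < 12, gramRat 0 p - gramRat 1 p + gramRat 2 p - gramRat 3 p + gramRat 4 p =
      5 * gramSqrt 10 p ∧ gramSqrt 0 p - gramSqrt 1 p + gramSqrt 2 p - gramSqrt 3 p +
      gramSqrt 4 p = gramRat 10 p := by decide +kernel
  obtain ⟨e1, e2⟩ := key p hp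
  have e1' := congrArg (fun z : ℤ => (z : ℝ)) e1
  have e2' := congrArg (fun z : ℤ => (z : ℝ)) e2
  push_cast at e1' e2'
  have h0 := D.inner_vertex 0 (by norm_num) p hp
  have h1 := D.inner_vertex 1 (by norm_num) p hp
  have h2 := D.inner_vertex 2 (by norm_num) p hp
  have h3 := D.inner_vertex 3 (by norm_num) p hp
  have h4 := D.inner_vertex 4 (by norm_num) p hp
  have hg := D.inner_vertex 10 (by norm_num) p hp
  change ⟪f 0, _⟫ = _ at h0
  change ⟪f 1, _⟫ = _ at h1
  change ⟪f 2, _⟫ = _ at h2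
  change ⟪f 3, _⟫ = _ at h3
  change ⟪f 4, _⟫ = _ at h4
  change ⟪g, _⟫ = _ at hg
  rw [inner_sub_left, inner_add_left, inner_sub_left, inner_add_left, inner_sub_left,
    inner_smul_left, conj_trivial, h0, h1, h2, h3, h4, hg]
  linear_combination ρ * e1' + ρ * √5 * e2' - ρ * gramSqrt 10 p * h5

theorem eq_smul_g_of_map_map {v : V} (h : c (c v) = v) : v = (⟪v, f 0⟫ / ρ) • g := by
  have h1 : ∀ i, ⟪v, f (i + 2)⟫ = ⟪v, f i⟫ := by
    intro i
    rw [← c.inner_map_map v (f i), D.map_f, ← c.inner_map_map (c v), h, D.map_f]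
    norm_num [add_assoc]
  have h2 := h1 0
  have h4 := h1 2
  have h6 := h1 4
  have h8 := h1 6
  have h3 := h1 1
  have h5 := D.f_add 0
  have h9 := D.f_add 1
  norm_num at h2 h4 h6 h8 h3 h5 h9
  have e1 : ⟪v, f 1⟫ = -⟪v, f 0⟫ := by
    rw [h9, inner_neg_right] at h6
    linarith
  have h5' := D.sum_eq
  have h10 : √5 * ⟪v, g⟫ = 5 * ⟪v, f 0⟫ := by
    rw [← inner_smul_right, ← h5']
    simp only [inner_sub_right, inner_add_right]
    linarith
  have hs : √5 * √5 = 5 := Real.mul_self_sqrt (by norm_num)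
  have hs1 := one_lt_sqrt_five
  have hg : ⟪v, g⟫ = √5 * ⟪v, f 0⟫ := by
    have : √5 * (⟪v, g⟫ - √5 * ⟪v, f 0⟫) = 0 := by linear_combination h10 - ⟪v, f 0⟫ * hs
    rcases mul_eq_zero.mp this with h | h <;> linarith
  have hρ := D.rho_pos
  have key : ∀ i : ℕ, ⟪v, f i⟫ = (-1) ^ i * ⟪v, f 0⟫ := by
    have : ∀ i : ℕ, ⟪v, f i⟫ = (-1) ^ i * ⟪v, f 0⟫ ∧
        ⟪v, f (i + 1)⟫ = (-1) ^ (i + 1) * ⟪v, f 0⟫ := by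
      intro i
      induction i with
      | zero => exact ⟨by simp, by simp [e1]⟩
      | succ i ih =>
        push_cast
        refine ⟨ih.2, ?_⟩
        rw [add_assoc, show (1 : ℤ) + 1 = 2 by norm_num, h1, ih.1]
        ring
    exact fun i => (this i).1
  rw [← sub_eq_zero]
  refine D.eq_zero_of_inner fun p hp => ?_
  rw [inner_sub_left, inner_smul_left, conj_trivial, sub_eq_zero]
  have hgp := D.inner_vertex 10 (by norm_num) p hp
  change ⟪g, _⟫ = _ at hgp
  rw [hgp]
  have hgr : ∀ p < 10, gramRat 10 p = (-1) ^ p ∧ gramSqrt 10 p = 0 := by decide +kernel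
  rcases lt_or_ge p 10 with h | h
  · have hv : vertex f g p = f p := if_pos h
    rw [hv, key, (hgr p h).1, (hgr p h).2]
    push_cast
    field_simp
    ring
  · interval_cases p
    · change ⟪v, g⟫ = _
      rw [hg]
      simp only [gramRat, gramSqrt]
      norm_num
      field_simp
    · change ⟪v, -g⟫ = _
      rw [inner_neg_right, hg]
      simp only [gramRat, gramSqrt]
      norm_num
      field_simp

theorem pow_f (n : ℕ) (i : ℤ) : (c ^ n) (f i) = f (i + n) := D.toFrame.pow_f n i

theorem pow_five (v : V) : (c ^ 5) v = -v := by
  have h : (((c ^ 5 : V ≃ₗᵢ[ℝ] V).toLinearEquiv : V →ₗ[ℝ] V)) = -LinearMap.id := by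
    refine D.toFrame.ext_of_frame (fun i => ?_) ?_
    · change (c ^ 5) (f i) = -f i
      rw [D.pow_f, ← D.f_add]
      rfl
    · change c (c (c (c (c g)))) = -g
      simp only [map_neg, D.map_g, neg_neg]
  exact congrArg (fun φ : V →ₗ[ℝ] V => φ v) h

/-- Off the axis of the Coxeter element, its orbits have ten elements. -/
theorem pow_ne {v : V} (hv : ∀ t : ℝ, v ≠ t • g) {n : ℕ} (h0 : 0 < n) (h1 : n < 10) :
    (c ^ n) v ≠ v := by
  intro h
  have hv0 : v ≠ 0 := by simpa using hv 0
  have hm : ∀ k : ℕ, (c ^ (n * k)) v = v := by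
    intro k
    induction k with
    | zero => rw [mul_zero, pow_zero]; rfl
    | succ k ih =>
      rw [mul_add, mul_one, pow_add, LinearIsometryEquiv.coe_mul, Function.comp_apply, h, ih]
  have h10 : ∀ k : ℕ, (c ^ (10 * k)) v = v := by
    intro k
    induction k with
    | zero => rw [mul_zero, pow_zero]; rfl
    | succ k ih =>
      rw [mul_add, mul_one, pow_add, LinearIsometryEquiv.coe_mul, Function.comp_apply,
        show 10 = 5 + 5 from rfl, pow_add, LinearIsometryEquiv.coe_mul, Function.comp_apply,
        D.pow_five, D.pow_five, neg_neg, ← show 10 = 5 + 5 from rfl, ih]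
  have hadd : ∀ a k : ℕ, (c ^ (a + 10 * k)) v = (c ^ a) v := by
    intro a k
    rw [pow_add, LinearIsometryEquiv.coe_mul, Function.comp_apply, h10]
  have hodd : (c ^ 5) v ≠ v := by
    rw [D.pow_five]
    intro h
    have h2 : (2 : ℝ) • v = 0 := by
      rw [two_smul]
      nth_rewrite 1 [← h]
      exact neg_add_cancel v
    exact hv0 ((smul_eq_zero.mp h2).resolve_left two_ne_zero)
  have htwo : (c ^ 2) v ≠ v := fun h => hv _ (D.eq_smul_g_of_map_map h)
  -- Every `n` from `1` to `9` has a multiple congruent to `5` or `2` modulo `10`; the fifth power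
  -- is `-1`, and the second power fixes only the axis.
  have hcases : ∃ k j : ℕ, n * k = 5 + 10 * j ∨ n * k = 2 + 10 * j := by
    interval_cases n
    exacts [⟨5, 0, Or.inl rfl⟩, ⟨1, 0, Or.inr rfl⟩, ⟨5, 1, Or.inl rfl⟩, ⟨3, 1, Or.inr rfl⟩,
      ⟨1, 0, Or.inl rfl⟩, ⟨2, 1, Or.inr rfl⟩, ⟨5, 3, Or.inl rfl⟩, ⟨4, 3, Or.inr rfl⟩,
      ⟨5, 4, Or.inl rfl⟩]
  obtain ⟨k, j, hk | hk⟩ := hcases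
  · exact hodd (by rw [← hadd 5 j, ← hk, hm])
  · exact htwo (by rw [← hadd 2 j, ← hk, hm])

theorem abs_inner_pow (n : ℕ) (v : V) : |⟪(c ^ n) v, g⟫| = |⟪v, g⟫| := by
  induction n with
  | zero => rfl
  | succ n ih =>
    rw [← ih, pow_succ', LinearIsometryEquiv.coe_mul, Function.comp_apply, ← neg_neg g, ← D.map_g,
      inner_neg_right, c.inner_map_map, abs_neg, inner_neg_right, abs_neg, D.map_g,
      inner_neg_right, abs_neg]

variable {G : Subgroup (V ≃ₗᵢ[ℝ] V)} (hc : c ∈ G)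
  (horb : ∀ x ∈ pts f g, orbitOf G x = pts f g)

include hc

/-- The number `|⟪u, g⟫|` is constant on orbits of `c`, and off the axis these have ten points. Two
different values would give at least twenty points in an orbit of at most twelve. -/
theorem abs_inner_eq {v : V} (hv : ∀ u ∈ orbitOf G v, ∀ t : ℝ, u ≠ t • g)
    (hn : (orbitOf G v).encard ≤ 12) {u : V} (hu : u ∈ orbitOf G v) :
    |⟪u, g⟫| = |⟪v, g⟫| := by
  by_contra hne
  have hfin : (orbitOf G v).Finite := Set.finite_of_encard_le_coe hn
  have := hfin.fintype
  rw [Set.encard_eq_coe_toFinset_card, Set.toFinset_card] at hn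
  have hn' : Fintype.card (orbitOf G v) ≤ 12 := by exact_mod_cast hn
  have hmem : ∀ x ∈ orbitOf G v, ∀ n : ℕ, (c ^ n) x ∈ orbitOf G v := fun x hx n =>
    orbitOf_trans hx ⟨_, pow_mem hc n, rfl⟩
  have hinj : ∀ x ∈ orbitOf G v, ∀ i j : Fin 10, (c ^ (i : ℕ)) x = (c ^ (j : ℕ)) x → i = j := by
    have : ∀ x ∈ orbitOf G v, ∀ i j : Fin 10, i < j → (c ^ (i : ℕ)) x ≠ (c ^ (j : ℕ)) x := by
      intro x hx i j hij h
      refine D.pow_ne (hv x hx) (n := j - i) (by have : (i : ℕ) < j := hij; omega)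
        (by omega) ((c ^ (i : ℕ)).injective ?_)
      rw [h, ← Function.comp_apply (f := (c ^ (i : ℕ))), ← LinearIsometryEquiv.coe_mul, ← pow_add,
        Nat.add_sub_cancel' (le_of_lt hij)]
    intro x hx i j h
    rcases lt_trichotomy i j with h1 | h1 | h1
    · exact absurd h (this x hx i j h1)
    · exact h1
    · exact absurd h.symm (this x hx j i h1)
  let F : Fin 10 ⊕ Fin 10 → orbitOf G v := Sum.elim
    (fun i => ⟨(c ^ (i : ℕ)) v, hmem v (mem_orbitOf_self G v) i⟩)
    (fun i => ⟨(c ^ (i : ℕ)) u, hmem u hu i⟩)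
  have hF : Function.Injective F := by
    rintro (i | i) (j | j) h
    · exact congrArg Sum.inl (hinj v (mem_orbitOf_self G v) i j (congrArg Subtype.val h))
    · have h1 : (c ^ (i : ℕ)) v = (c ^ (j : ℕ)) u := congrArg Subtype.val h
      refine absurd ?_ hne
      rw [← D.abs_inner_pow j u, ← h1, D.abs_inner_pow]
    · have h1 : (c ^ (i : ℕ)) u = (c ^ (j : ℕ)) v := congrArg Subtype.val h
      refine absurd ?_ hne
      rw [← D.abs_inner_pow i u, h1, D.abs_inner_pow]
    · exact congrArg Sum.inr (hinj u hu i j (congrArg Subtype.val h))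
  have := Fintype.card_le_of_injective F hF
  rw [Fintype.card_sum, Fintype.card_fin] at this
  omega

include horb

/-- Otherwise no point of the orbit is on an axis through a vertex, and by transitivity the scalar
products of `v` with all vertices agree up to sign. They are not zero, so the relation `sum_eq`
would express `√5` as a sum of five signs. -/
theorem exists_eq_smul_of_encard_le {v : V} (hn : (orbitOf G v).encard ≤ 12) :
    ∃ t : ℝ, ∃ x ∈ pts f g, v = t • x := by
  by_contra! hv
  have hgo : ∀ x ∈ pts f g, ∃ w ∈ G, w g = x := fun x hx => by
    have : x ∈ orbitOf G g := by rw [horb g (g_mem_pts f g)]; exact hx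
    exact this
  have hv' : ∀ u ∈ orbitOf G v, ∀ t : ℝ, u ≠ t • g := by
    rintro _ ⟨w, hw, rfl⟩ t h
    have h1 : w⁻¹ g ∈ pts f g := by
      rw [← horb g (g_mem_pts f g)]
      exact ⟨_, inv_mem hw, rfl⟩
    refine hv t _ h1 ?_
    rw [← map_smul, ← h]
    exact (w.symm_apply_apply v).symm
  have habs : ∀ x ∈ pts f g, |⟪v, x⟫| = |⟪v, g⟫| := by
    intro x hx
    obtain ⟨w, hw, rfl⟩ := hgo x hx
    rw [← D.abs_inner_eq hc hv' hn ⟨w⁻¹, inv_mem hw, rfl⟩, ← w.inner_map_map (w⁻¹ v)]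
    congr 2
    exact (w.apply_symm_apply v).symm
  have hsign : ∀ x ∈ pts f g, ∃ s : ℤ, (s = 1 ∨ s = -1) ∧ ⟪v, x⟫ = s * ⟪v, g⟫ := by
    intro x hx
    rcases abs_eq_abs.mp (habs x hx) with h | h
    · exact ⟨1, Or.inl rfl, by simp [h]⟩
    · exact ⟨-1, Or.inr rfl, by simp [h]⟩
  have h5 : √5 * √5 = 5 := Real.mul_self_sqrt (by norm_num)
  obtain ⟨s0, -, e0⟩ := hsign _ (f_mem_pts f g 0)
  obtain ⟨s1, -, e1⟩ := hsign _ (f_mem_pts f g 1)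
  obtain ⟨s2, -, e2⟩ := hsign _ (f_mem_pts f g 2)
  obtain ⟨s3, -, e3⟩ := hsign _ (f_mem_pts f g 3)
  obtain ⟨s4, -, e4⟩ := hsign _ (f_mem_pts f g 4)
  have hsum := congrArg (fun x => ⟪v, x⟫) D.sum_eq
  simp only [inner_sub_right, inner_add_right, inner_smul_right, e0, e1, e2, e3, e4] at hsum
  have hg0 : ⟪v, g⟫ ≠ 0 := by
    intro h
    refine hv 0 g (g_mem_pts f g) ?_
    rw [zero_smul]
    refine D.eq_zero_of_inner fun p hp => ?_
    have := habs _ (D.mem_pts.mpr ⟨p, hp, rfl⟩)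
    rwa [h, abs_zero, abs_eq_zero] at this
  have hk : ((s0 - s1 + s2 - s3 + s4 : ℤ) : ℝ) = √5 := by
    refine mul_right_cancel₀ hg0 ?_
    rw [← hsum]
    push_cast
    ring
  generalize s0 - s1 + s2 - s3 + s4 = k at hk
  rw [← hk] at h5
  have h6 : k * k = 5 := by exact_mod_cast h5
  have h7 : k ≤ 2 := by nlinarith
  have h8 : -2 ≤ k := by nlinarith
  interval_cases k <;> omega

end IcosaFrame

end IcosahedronFrames

/-! ### The theorem in type `H₃`. -/

section TypeHThree

variable {V : Type*} [NormedAddCommGroup V] [InnerProductSpace ℝ V]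

/-- The icosahedron from simple roots of type `H₃`. -/
theorem exists_icosaFrame {R : Fin 3 → V} {φ : ℝ} (hφ : φ = (1 + √5) / 2)
    (h00 : ⟪R 0, R 0⟫ = 1) (h11 : ⟪R 1, R 1⟫ = 1) (h22 : ⟪R 2, R 2⟫ = 1)
    (h01 : ⟪R 0, R 1⟫ = -1 / 2) (h12 : ⟪R 1, R 2⟫ = -φ / 2) (h02 : ⟪R 0, R 2⟫ = 0)
    (hspan : Submodule.span ℝ (Set.range R) = ⊤) {σ τ : V ≃ₗᵢ[ℝ] V}
    (σ0 : σ (R 0) = -R 0) (σ1 : σ (R 1) = R 1 + R 0 + φ • R 2) (σ2 : σ (R 2) = -R 2)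
    (τ0 : τ (R 0) = R 0 + R 1) (τ1 : τ (R 1) = -R 1) (τ2 : τ (R 2) = R 2 + φ • R 1) :
    ∃ f g, IcosaFrame (σ * τ) f g (φ / 4) ∧ icosaRoot f g 0 = R 0 ∧ icosaRoot f g 1 = R 1 ∧
      icosaRoot f g 2 = -R 2 := by
  have h5 : √5 * √5 = 5 := Real.mul_self_sqrt (by norm_num)
  have hs : √5 = 2 * φ - 1 := by rw [hφ]; ring
  have hq : φ * φ = φ + 1 := by rw [hφ]; linear_combination h5 / 4
  have hφ0 : 0 < φ := by rw [hφ]; positivity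
  have hc : ∀ x y z : ℝ, (σ * τ) (x • R 0 + y • R 1 + z • R 2) =
      (-y + z * φ) • R 0 + (x - y + z * φ) • R 1 + (x * φ - y * φ + z * φ) • R 2 := by
    intro x y z
    rw [LinearIsometryEquiv.coe_mul, Function.comp_apply]
    simp only [map_add, map_smul, τ0, τ1, τ2, σ0, σ1, σ2, map_neg]
    match_scalars
    · ring
    · ring
    · linear_combination z * hq
  -- The starting vertex is half the fundamental weight of node `0`: its scalar products with the
  -- simple roots are `1 / 2`, `0`, `0`.
  set F : ℤ → V := fun i =>
    ((σ * τ) ^ i) (((φ + 2) / 2) • R 0 + (φ + 1) • R 1 + ((2 * φ + 1) / 2) • R 2) with hF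
  have hsucc : ∀ i, F (i + 1) = (σ * τ) (F i) := fun i => by
    simp only [hF]
    rw [add_comm, zpow_add, zpow_one, LinearIsometryEquiv.coe_mul, Function.comp_apply]
  have f0 : F 0 = ((φ + 2) / 2) • R 0 + (φ + 1) • R 1 + ((2 * φ + 1) / 2) • R 2 := by
    simp only [hF, zpow_zero]
    rfl
  have step : ∀ (i j : ℤ) (x y z x' y' z' : ℝ), j = i + 1 →
      F i = x • R 0 + y • R 1 + z • R 2 → x' = -y + z * φ → y' = x - y + z * φ →
      z' = x * φ - y * φ + z * φ → F j = x' • R 0 + y' • R 1 + z' • R 2 := by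
    rintro i j x y z x' y' z' rfl h rfl rfl rfl
    rw [hsucc, h, hc]
  have f1 := step 0 1 _ _ _ (φ / 2) (φ + 1) ((2 * φ + 1) / 2) (by norm_num) f0
    (by linear_combination -hq) (by linear_combination -hq) (by linear_combination -hq / 2)
  have f2 := step 1 2 _ _ _ (φ / 2) φ (1 / 2) (by norm_num) f1
    (by linear_combination -hq) (by linear_combination -hq) (by linear_combination -hq / 2)
  have f3 := step 2 3 _ _ _ (-φ / 2) 0 (-1 / 2) (by norm_num) f2
    (by ring) (by ring) (by linear_combination hq / 2)
  have f4 := step 3 4 _ _ _ (-φ / 2) (-φ) (-(2 * φ + 1) / 2) (by norm_num) f3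
    (by ring) (by ring) (by linear_combination hq / 2)
  have f5 := step 4 5 _ _ _ (-(φ + 2) / 2) (-(φ + 1)) (-(2 * φ + 1) / 2) (by norm_num) f4
    (by linear_combination hq) (by linear_combination hq) (by linear_combination hq / 2)
  have f5' : F 5 = -F 0 := by rw [f5, f0]; module
  -- A vector on the axis of `σ * τ`, scaled to the length of `F 0`.
  set g : V := (φ / 2) • R 0 + (0 : ℝ) • R 1 + (-1 / 2 : ℝ) • R 2 with hg
  have h10 : ⟪R 1, R 0⟫ = -1 / 2 := by rw [real_inner_comm, h01]
  have h21 : ⟪R 2, R 1⟫ = -φ / 2 := by rw [real_inner_comm, h12]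
  have h20 : ⟪R 2, R 0⟫ = 0 := by rw [real_inner_comm, h02]
  have hin : ∀ x y z : ℝ, ⟪F 0, x • R 0 + y • R 1 + z • R 2⟫ = x / 2 := by
    intro x y z
    rw [f0]
    simp only [inner_add_left, inner_add_right, inner_smul_left, inner_smul_right, conj_trivial,
      h00, h11, h22, h01, h12, h02, h10, h21, h20]
    linear_combination (-y / 2 - z / 2) * hq
  -- Up to sign the simple roots are the edges with labels `0, 1`, then `1, 9` (where `F 9 = -F 4`),
  -- and `3, 11`; this fixes the indices `0, 1, 2` of the simple reflections.
  have hR0 : F 0 - F 1 = R 0 := by rw [f0, f1]; module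
  have hR1 : F 1 + F 4 = R 1 := by rw [f1, f4]; module
  have hR2 : F 3 + g = -R 2 := by rw [f3, hg]; module
  have D : IcosaFrame (σ * τ) F g (φ / 4) := by
    refine ⟨fun i => (hsucc i).symm, fun i => ?_, ?_, by positivity, ?_, ?_, ?_, ?_, ?_, ?_⟩
    · have h1 : ∀ i, F i = ((σ * τ) ^ i) (F 0) := fun i => by rw [f0]
      have h2 : F 5 = ((σ * τ) ^ (5 : ℤ)) (F 0) := h1 5
      rw [h1 (i + 5), h1 i, zpow_add, LinearIsometryEquiv.coe_mul, Function.comp_apply, ← h2, f5',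
        map_neg]
    · rw [hg, hc]
      match_scalars
      · ring
      · ring
      · linear_combination hq / 2
    · nth_rewrite 2 [f0]
      rw [hin, hs]
      linear_combination -hq / 2
    · rw [f1, hin]; ring
    · rw [f2, hin]; ring
    · rw [hg, hin]; ring
    · rw [hg, hs]
      simp only [inner_add_left, inner_add_right, inner_smul_left, inner_smul_right, conj_trivial,
        h00, h11, h22, h01, h12, h02, h10, h21, h20]
      linear_combination -hq / 4
    · rw [eq_top_iff, ← hspan, Submodule.span_le]
      have hf : ∀ i, F i ∈ Submodule.span ℝ (Set.range F ∪ {g}) := fun i =>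
        Submodule.subset_span (Or.inl ⟨i, rfl⟩)
      have hg' : g ∈ Submodule.span ℝ (Set.range F ∪ {g}) := Submodule.subset_span (Or.inr rfl)
      rintro _ ⟨k, rfl⟩
      fin_cases k
      · change R 0 ∈ _
        rw [← hR0]; exact Submodule.sub_mem _ (hf 0) (hf 1)
      · change R 1 ∈ _
        rw [← hR1]; exact Submodule.add_mem _ (hf 1) (hf 4)
      · change R 2 ∈ _
        rw [← neg_neg (R 2), ← hR2]
        exact Submodule.neg_mem _ (Submodule.add_mem _ (hf 3) hg')
  refine ⟨F, g, D, hR0, ?_, ?_⟩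
  · change F 1 - F 9 = R 1
    have := D.f_add 4
    norm_num at this
    rw [this, sub_neg_eq_add, hR1]
  · change F 3 - -g = -R 2
    rw [sub_neg_eq_add, hR2]

namespace SimpleSystem

variable {ι : Type*} {M : CoxeterMatrix ι} (Δ : SimpleSystem M V)

section

variable {c : V ≃ₗᵢ[ℝ] V} {f : ℤ → V} {g : V} {ρ : ℝ} (D : IcosaFrame c f g ρ)
  {e : ι ≃ Fin 3} (hroot : ∀ k, hyperplaneReflection (icosaRoot f g (e k : ℕ)) =
    Δ.simpleReflection k)

include D hroot

/-- The fifteen reflections contain the simple ones and are closed under conjugation by these, by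
`exists_conj`. Conversely each is conjugate to a simple one under a power of `c`. -/
theorem reflections_eq_icosaRoots (hc : c ∈ Δ.group) :
    Δ.reflections = hyperplaneReflection '' icosaRoots f g := by
  refine Set.Subset.antisymm ?_ ?_
  · have hconj : ∀ w ∈ Δ.group, ∀ t ∈ hyperplaneReflection '' icosaRoots f g,
        w * t * w⁻¹ ∈ hyperplaneReflection '' icosaRoots f g := by
      have hgen : ∀ i, ∀ t ∈ hyperplaneReflection '' icosaRoots f g,
          Δ.simpleReflection i * t * Δ.simpleReflection i ∈
            hyperplaneReflection '' icosaRoots f g := by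
        rintro i _ ⟨_, ⟨t, ht, rfl⟩, rfl⟩
        have hi : (e i : ℕ) < 15 := by omega
        obtain ⟨s, hs, h⟩ := exists_conj (e i) (e i).isLt t ht
        refine ⟨_, ⟨s, hs, rfl⟩, ?_⟩
        rw [← hroot i]
        refine D.ext fun p hp => ?_
        rw [LinearIsometryEquiv.coe_mul, Function.comp_apply, LinearIsometryEquiv.coe_mul,
          Function.comp_apply, D.refl_vertex hi hp, D.refl_vertex ht (refl_lt _ hi p hp),
          D.refl_vertex hi (refl_lt t ht _ (refl_lt _ hi p hp)), D.refl_vertex hs hp, h p hp]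
      intro w hw
      rw [group] at hw
      induction hw using Subgroup.closure_induction'' with
      | mem t ht =>
        obtain ⟨i, rfl⟩ := ht
        intro t ht
        rw [simpleReflection, hyperplaneReflection_inv]
        exact hgen i t ht
      | inv_mem t ht =>
        obtain ⟨i, rfl⟩ := ht
        intro t ht
        rw [simpleReflection, hyperplaneReflection_inv, hyperplaneReflection_inv]
        exact hgen i t ht
      | one => intro t ht; simpa using ht
      | mul u v _ _ hu hv =>
        intro t ht
        have := hu _ (hv t ht)
        simpa only [mul_assoc, mul_inv_rev] using this
    rintro _ ⟨w, hw, i, rfl⟩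
    refine hconj w hw _ ⟨_, ⟨e i, by omega, rfl⟩, hroot i⟩
  · have key : ∀ n, ∀ k < 3, 3 * n + k < 15 →
        hyperplaneReflection (icosaRoot f g (3 * n + k)) ∈ Δ.reflections := by
      intro n
      induction n with
      | zero =>
        intro k hk _
        have h1 := hroot (e.symm ⟨k, hk⟩)
        rw [e.apply_symm_apply] at h1
        rw [mul_zero, zero_add, h1]
        exact ⟨1, one_mem _, _, by rw [one_mul, inv_one, mul_one]⟩
      | succ n ih =>
        intro k hk hlt
        have h1 := D.conj_reflection (t := 3 * n + k) (by omega)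
        rw [show (3 * n + k + 3) % 15 = 3 * (n + 1) + k by omega] at h1
        rw [← h1]
        exact Δ.conj_mem_reflections hc (ih k hk (by omega))
    rintro _ ⟨_, ⟨t, ht, rfl⟩, rfl⟩
    have := key (t / 3) (t % 3) (Nat.mod_lt _ (by norm_num)) (by omega)
    rwa [Nat.div_add_mod] at this

end

section

variable {c : V ≃ₗᵢ[ℝ] V} {f : ℤ → V} {g : V} {ρ : ℝ} (D : IcosaFrame c f g ρ)
  (hT : Δ.reflections = hyperplaneReflection '' icosaRoots f g)

include hT

theorem group_eq_icosaRoots : Δ.group = reflGroup (icosaRoots f g) := by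
  rw [reflGroup, ← hT]
  refine le_antisymm ?_ ?_
  · refine Subgroup.closure_mono ?_
    rintro _ ⟨i, rfl⟩
    exact ⟨1, one_mem _, i, by rw [one_mul, inv_one, mul_one]⟩
  · rw [Subgroup.closure_le]
    exact fun t ht => Δ.reflections_subset ht

include D

theorem orbitOf_eq_icosahedron {x : V} (hx : x ∈ pts f g) : orbitOf Δ.group x = pts f g := by
  rw [Δ.group_eq_icosaRoots hT]
  refine Set.Subset.antisymm (orbitOf_reflGroup_subset ?_ hx) fun y hy => ?_
  · rintro _ ⟨t, ht, rfl⟩ y hy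
    obtain ⟨p, hp, rfl⟩ := D.mem_pts.mp hy
    exact D.mem_pts.mpr ⟨_, refl_lt t ht p hp, D.refl_vertex ht hp⟩
  · obtain ⟨s, hs, d, hd, h⟩ := D.exists_prodR (k := 0) (by norm_num)
    have hR : ∀ a ∈ [icosaRoot f g 0, icosaRoot f g s, icosaRoot f g d], a ∈ icosaRoots f g := by
      intro a ha
      simp only [List.mem_cons, List.not_mem_nil, or_false] at ha
      rcases ha with rfl | rfl | rfl
      exacts [⟨0, by norm_num, rfl⟩, ⟨s, hs, rfl⟩, ⟨d, hd, rfl⟩]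
    exact orbitOf_mono (reflGroup_mono hR) (orbitOf_trans
      (orbitOf_symm (D.mem_orbitOf_of_prodR hR h hx)) (D.mem_orbitOf_of_prodR hR h hy))

omit D hT in
/-- A parabolic subgroup of a group of rank `3` is generated by at most two reflections, or is the
whole group. -/
theorem IsParabolic.cases {Δ : SimpleSystem M V} (e : ι ≃ Fin 3) {W' : Subgroup (V ≃ₗᵢ[ℝ] V)}
    (h : Δ.IsParabolic W') : W' = ⊥ ∨ W' = Δ.group ∨ ∃ a ∈ Δ.reflections, ∃ b ∈ Δ.reflections,
      W' = Subgroup.closure {a, b} := by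
  obtain ⟨w, hw, J, rfl⟩ := h
  have hmem : ∀ i, w * Δ.simpleReflection i * w⁻¹ ∈ Δ.reflections := fun i => ⟨w, hw, i, rfl⟩
  have himage : ∀ i, (MulAut.conj w).toMonoidHom (Δ.simpleReflection i) =
      w * Δ.simpleReflection i * w⁻¹ := fun i => rfl
  by_cases hJ : J = Set.univ
  · right; left
    rw [hJ, Set.image_univ]
    exact Subgroup.conj_smul_eq_self_of_mem hw
  obtain ⟨i, hi⟩ := (Set.ne_univ_iff_exists_notMem J).mp hJ
  have hsub : ∀ j ∈ J, j = e.symm (e i + 1) ∨ j = e.symm (e i + 2) := by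
    intro j hj
    have h3 : ∀ a b : Fin 3, a ≠ b → a = b + 1 ∨ a = b + 2 := by decide
    rcases h3 (e j) (e i) (fun h => hi (e.injective h ▸ hj)) with h | h
    · exact Or.inl (by rw [← h, e.symm_apply_apply])
    · exact Or.inr (by rw [← h, e.symm_apply_apply])
  generalize e.symm (e i + 1) = j at hsub
  generalize e.symm (e i + 2) = k at hsub
  rw [MonoidHom.map_closure, Set.image_image]
  have hJ' : J = ∅ ∨ ∃ a b, J = {a, b} := by
    by_cases h1 : j ∈ J <;> by_cases h2 : k ∈ J
    · exact Or.inr ⟨j, k, Set.Subset.antisymm (fun x hx => hsub x hx) (by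
        rintro x (rfl | rfl) <;> assumption)⟩
    · refine Or.inr ⟨j, j, Set.Subset.antisymm (fun x hx => ?_) (by
        rintro x (rfl | rfl) <;> assumption)⟩
      rcases hsub x hx with rfl | rfl
      · exact Or.inl rfl
      · exact absurd hx h2
    · refine Or.inr ⟨k, k, Set.Subset.antisymm (fun x hx => ?_) (by
        rintro x (rfl | rfl) <;> assumption)⟩
      rcases hsub x hx with rfl | rfl
      · exact absurd hx h1
      · exact Or.inl rfl
    · refine Or.inl (Set.eq_empty_of_forall_notMem fun x hx => ?_)
      rcases hsub x hx with rfl | rfl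
      · exact h1 hx
      · exact h2 hx
  rcases hJ' with rfl | ⟨a, b, rfl⟩
  · left
    rw [Set.image_empty, Subgroup.closure_empty]
  · right; right
    exact ⟨_, hmem a, _, hmem b, by rw [Set.image_pair]; rfl⟩

variable [FiniteDimensional ℝ V]

/-- The theorem for an orbit that is a multiple of the vertices of an icosahedron. -/
theorem main_of_icosaFrame (e : ι ≃ Fin 3) {t : ℝ} (ht : t ≠ 0) {x : V} (hx : x ∈ pts f g) :
    ProjectsToPolygonAndTwoOrigins (coxeterPlane c) (orbitOf Δ.group (t • x)) (orderOf c) ∧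
      ∀ W' : Subgroup (V ≃ₗᵢ[ℝ] V), Δ.IsParabolic W' →
        (IsNoncrossing Δ.reflections c W' ↔
          DiagramNoncrossing (coxeterPlane c) (orbitOf Δ.group (t • x)) W') := by
  have ho : orbitOf Δ.group (t • x) = pts (fun i => t • f i) (t • g) := by
    rw [orbitOf_smul, Δ.orbitOf_eq_icosahedron D hT hx, pts_smul]
  have hT' : Δ.reflections =
      hyperplaneReflection '' icosaRoots (fun i => t • f i) (t • g) := by
    rw [icosaRoots_smul, image_hyperplaneReflection_smul _ ht, hT]
  have D' := D.smul ht
  rw [ho]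
  refine ⟨D'.toFrame.projects, fun W' hW' => ?_⟩
  constructor
  · intro h
    rw [hT'] at h
    exact D'.diagramNoncrossing_of_isNoncrossing h
  · intro h
    rcases hW'.cases e with rfl | rfl | ⟨a, ha, b, hb, rfl⟩
    · rw [hT']
      exact D'.isNoncrossing_bot
    · rw [Δ.group_eq_icosaRoots hT', hT']
      exact D'.isNoncrossing_top
    · rw [hT'] at ha hb ⊢
      obtain ⟨_, ⟨s, hs, rfl⟩, rfl⟩ := ha
      obtain ⟨_, ⟨u, hu, rfl⟩, rfl⟩ := hb
      have hW : Subgroup.closure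
          {hyperplaneReflection (icosaRoot (fun i => t • f i) (t • g) s),
            hyperplaneReflection (icosaRoot (fun i => t • f i) (t • g) u)} =
          reflGroup {icosaRoot (fun i => t • f i) (t • g) s,
            icosaRoot (fun i => t • f i) (t • g) u} := by
        rw [reflGroup, Set.image_pair]
      rw [hW] at h ⊢
      exact D'.isNoncrossing_pair hs hu h

end

variable [Fintype ι] {ε : ι → Bool} (hε : IsBipartition M ε)

/-- The icosahedral frame of a bipartite Coxeter element of type `H₃`. -/
theorem exists_icosaFrame_coxeterElement {e : ι ≃ Fin 3} (hM : M.reindex e = CoxeterMatrix.H₃) :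
    ∃ f g ρ, IcosaFrame (Δ.coxeterElement hε) f g ρ ∧
      Δ.reflections = hyperplaneReflection '' icosaRoots f g := by
  set R : Fin 3 → V := fun k => Δ.root (e.symm k) with hR
  have hMe : ∀ j k, M (e.symm j) (e.symm k) = CoxeterMatrix.H₃ j k := fun j k => by
    rw [← hM]; rfl
  have hin : ∀ j k, ⟪R j, R k⟫ = -Real.cos (Real.pi / (CoxeterMatrix.H₃ j k : ℕ)) := fun j k => by
    rw [← hMe]; exact Δ.inner_root _ _
  have e01 : CoxeterMatrix.H₃ 0 1 = 3 := rfl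
  have e12 : CoxeterMatrix.H₃ 1 2 = 5 := rfl
  have e02 : CoxeterMatrix.H₃ 0 2 = 2 := rfl
  have hself : ∀ k, ⟪R k, R k⟫ = 1 := fun k => Δ.inner_root_self _
  obtain ⟨φ, hφ⟩ : ∃ φ : ℝ, φ = (1 + √5) / 2 := ⟨_, rfl⟩
  have h01 : ⟪R 0, R 1⟫ = -1 / 2 := by
    rw [hin, e01]; push_cast; rw [Real.cos_pi_div_three]; norm_num
  have h12 : ⟪R 1, R 2⟫ = -φ / 2 := by
    rw [hin, e12]; push_cast; rw [Real.cos_pi_div_five, hφ]; ring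
  have h02 : ⟪R 0, R 2⟫ = 0 := by
    rw [hin, e02]; push_cast; rw [Real.cos_pi_div_two]; norm_num
  have h10 : ⟪R 1, R 0⟫ = -1 / 2 := by rw [real_inner_comm, h01]
  have h21 : ⟪R 2, R 1⟫ = -φ / 2 := by rw [real_inner_comm, h12]
  have h20 : ⟪R 2, R 0⟫ = 0 := by rw [real_inner_comm, h02]
  have hspan : Submodule.span ℝ (Set.range R) = ⊤ := by
    rw [← Δ.span_root]
    congr 1
    exact e.symm.surjective.range_comp Δ.root
  set η : Fin 3 → Bool := fun k => ε (e.symm k) with hη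
  have hne : ∀ j k, j ≠ k → CoxeterMatrix.H₃ j k ≠ 2 → η j ≠ η k := by
    intro j k hjk h2 h
    exact h2 (by rw [← hMe]; exact hε _ _ (fun h' => hjk (e.symm.injective h')) h)
  have n01 : η 0 ≠ η 1 := hne 0 1 (by decide) (by rw [e01]; norm_num)
  have n12 : η 1 ≠ η 2 := hne 1 2 (by decide) (by rw [e12]; norm_num)
  have hη2 : η 2 = η 0 := by
    revert n01 n12
    cases η 0 <;> cases η 1 <;> cases η 2 <;> simp
  -- a class of the bipartition acts through the roots of that class
  have happ : ∀ (b : Bool) (x y : V), x - y ∈ Submodule.span ℝ (R '' {k | η k = b}) →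
      (∀ k, η k = b → ⟪R k, x + y⟫ = 0) → Δ.halfProduct hε b x = y := by
    intro b x y h1 h2
    refine Δ.halfProduct_apply hε b ?_ fun i hi => ?_
    · refine Submodule.span_mono ?_ h1
      rintro _ ⟨k, hk, rfl⟩
      exact ⟨_, hk, rfl⟩
    · have := h2 (e i) (by simp only [hη, e.symm_apply_apply]; exact hi)
      simpa only [hR, e.symm_apply_apply] using this
  have hcases : ∀ {P : Fin 3 → Prop}, P 0 → P 2 → ∀ k, η k = η 0 → P k := by
    intro P h0 h2 k hk
    fin_cases k
    · exact h0
    · exact absurd hk.symm n01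
    · exact h2
  have hcases' : ∀ {P : Fin 3 → Prop}, P 1 → ∀ k, η k = η 1 → P k := by
    intro P h1 k hk
    fin_cases k
    · exact absurd hk n01
    · exact h1
    · exact absurd hk.symm n12
  have m0 : R 0 ∈ Submodule.span ℝ (R '' {k | η k = η 0}) := Submodule.subset_span ⟨0, rfl, rfl⟩
  have m2 : R 2 ∈ Submodule.span ℝ (R '' {k | η k = η 0}) := Submodule.subset_span ⟨2, hη2, rfl⟩
  have m1 : R 1 ∈ Submodule.span ℝ (R '' {k | η k = η 1}) := Submodule.subset_span ⟨1, rfl, rfl⟩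
  obtain ⟨f, g, D, r0, r1, r2⟩ := exists_icosaFrame (R := R) hφ (hself 0) (hself 1) (hself 2)
    h01 h12 h02 hspan (σ := Δ.halfProduct hε (η 0)) (τ := Δ.halfProduct hε (η 1))
    (Δ.halfProduct_root hε _ rfl)
    (happ _ _ _ (by
        rw [show R 1 - (R 1 + R 0 + φ • R 2) = -R 0 - φ • R 2 by abel]
        exact Submodule.sub_mem _ (Submodule.neg_mem _ m0) (Submodule.smul_mem _ _ m2))
      (hcases (by
          simp only [inner_add_right, inner_smul_right, h01, h02, hself]; ring) (by
          simp only [inner_add_right, inner_smul_right, h21, h20, hself]; ring)))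
    (Δ.halfProduct_root hε _ hη2)
    (happ _ _ _ (by
        rw [show R 0 - (R 0 + R 1) = -R 1 by abel]
        exact Submodule.neg_mem _ m1)
      (hcases' (by simp only [inner_add_right, h10, hself]; ring)))
    (Δ.halfProduct_root hε _ rfl)
    (happ _ _ _ (by
        rw [show R 2 - (R 2 + φ • R 1) = -(φ • R 1) by abel]
        exact Submodule.neg_mem _ (Submodule.smul_mem _ _ m1))
      (hcases' (by simp only [inner_add_right, inner_smul_right, h12, hself]; ring)))
  have hc : Δ.halfProduct hε (η 0) * Δ.halfProduct hε (η 1) ∈ Δ.group :=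
    mul_mem (Δ.halfProduct_mem hε _) (Δ.halfProduct_mem hε _)
  have hroot : ∀ i, hyperplaneReflection (icosaRoot f g (e i : ℕ)) = Δ.simpleReflection i := by
    have : ∀ k : Fin 3, hyperplaneReflection (icosaRoot f g (k : ℕ)) =
        hyperplaneReflection (R k) := by
      intro k
      fin_cases k
      · exact congrArg hyperplaneReflection r0
      · exact congrArg hyperplaneReflection r1
      · exact (congrArg hyperplaneReflection r2).trans (hyperplaneReflection_neg _)
    intro i
    rw [this, simpleReflection]
    simp only [hR, e.symm_apply_apply]
  have hT := Δ.reflections_eq_icosaRoots D hroot hc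
  have hb : η 0 = false ∧ η 1 = true ∨ η 0 = true ∧ η 1 = false := by
    revert n01
    cases η 0 <;> cases η 1 <;> simp
  rcases hb with ⟨b0, b1⟩ | ⟨b0, b1⟩
  · rw [b0, b1] at D
    exact ⟨f, g, _, D, hT⟩
  · rw [b0, b1] at D
    -- the two Coxeter elements are conjugate
    have hw := Δ.halfProduct_mem hε true
    have h1 := D.conj (Δ.halfProduct hε true)
    have h2 := Δ.halfProduct_mul_self hε true
    have h3 : Δ.halfProduct hε true * (Δ.halfProduct hε true * Δ.halfProduct hε false) *
        (Δ.halfProduct hε true)⁻¹ = Δ.coxeterElement hε := by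
      rw [← mul_assoc, h2, one_mul, inv_eq_of_mul_eq_one_left h2]
      rfl
    rw [h3] at h1
    refine ⟨_, _, _, h1, ?_⟩
    have hconj : ∀ t, Δ.halfProduct hε true * hyperplaneReflection (icosaRoot f g t) *
        (Δ.halfProduct hε true)⁻¹ = hyperplaneReflection (icosaRoot
          (fun i => Δ.halfProduct hε true (f i)) (Δ.halfProduct hε true g) t) := fun t => by
      rw [hyperplaneReflection_conj, icosaRoot_map]
    ext t
    constructor
    · intro ht
      have h4 := Δ.conj_mem_reflections (inv_mem hw) ht
      rw [hT] at h4
      obtain ⟨_, ⟨s, hs, rfl⟩, h5⟩ := h4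
      refine ⟨_, ⟨s, hs, rfl⟩, ?_⟩
      rw [← hconj, h5]
      group
    · rintro ⟨_, ⟨s, hs, rfl⟩, rfl⟩
      rw [← hconj]
      refine Δ.conj_mem_reflections hw ?_
      rw [hT]
      exact ⟨_, ⟨s, hs, rfl⟩, rfl⟩

variable [FiniteDimensional ℝ V]

theorem main_of_isTypeH₃ (hM : IsTypeH₃ M) {v : V} (hv : v ≠ 0)
    (hmin : ∀ u : V, u ≠ 0 → (orbitOf Δ.group v).encard ≤ (orbitOf Δ.group u).encard) :
    ProjectsToPolygonAndTwoOrigins (coxeterPlane (Δ.coxeterElement hε)) (orbitOf Δ.group v)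
        (orderOf (Δ.coxeterElement hε)) ∧
      ∀ W' : Subgroup (V ≃ₗᵢ[ℝ] V), Δ.IsParabolic W' →
        (IsNoncrossing Δ.reflections (Δ.coxeterElement hε) W' ↔
          DiagramNoncrossing (coxeterPlane (Δ.coxeterElement hε)) (orbitOf Δ.group v) W') := by
  obtain ⟨e, hM⟩ := hM
  obtain ⟨f, g, ρ, D, hT⟩ := Δ.exists_icosaFrame_coxeterElement hε hM
  have horb : ∀ x ∈ pts f g, orbitOf Δ.group x = pts f g := fun x hx =>
    Δ.orbitOf_eq_icosahedron D hT hx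
  have hcard : (pts f g).encard ≤ 12 := by
    have hsub : pts f g ⊆ (fun p : Fin 12 => vertex f g p) '' Set.univ := by
      intro x hx
      obtain ⟨p, hp, rfl⟩ := D.mem_pts.mp hx
      exact ⟨⟨p, hp⟩, trivial, rfl⟩
    refine (Set.encard_le_encard hsub).trans ((Set.encard_image_le _ _).trans ?_)
    rw [Set.encard_univ]
    simp
  have hle : (orbitOf Δ.group v).encard ≤ 12 := by
    refine (hmin g D.toFrame.g_ne).trans ?_
    rwa [horb g (g_mem_pts f g)]
  obtain ⟨t, x, hx, rfl⟩ := D.exists_eq_smul_of_encard_le (Δ.coxeterElement_mem hε) horb hle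
  exact Δ.main_of_icosaFrame D hT e (fun h => hv (by rw [h, zero_smul])) hx

end SimpleSystem

end TypeHThree

end CoxeterPlanar

end

theorem mainTheorem6 {V : Type*} [NormedAddCommGroup V] [InnerProductSpace ℝ V]
    [FiniteDimensional ℝ V] {ι : Type*} [Fintype ι] (M : CoxeterMatrix ι)
    (hM : CoxeterPlanar.IsTypeD M ∨ CoxeterPlanar.IsTypeH₃ M)
    (Δ : CoxeterPlanar.SimpleSystem M V)
    (ε : ι → Bool) (hε : CoxeterPlanar.IsBipartition M ε)
    (o : Set V) (ho : Δ.IsSmallestOrbit o) :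
    CoxeterPlanar.ProjectsToPolygonAndTwoOrigins
        (CoxeterPlanar.coxeterPlane (Δ.coxeterElement hε)) o (orderOf (Δ.coxeterElement hε)) ∧
      ∀ W' : Subgroup (V ≃ₗᵢ[ℝ] V), Δ.IsParabolic W' →
        (CoxeterPlanar.IsNoncrossing Δ.reflections (Δ.coxeterElement hε) W' ↔
          CoxeterPlanar.DiagramNoncrossing
            (CoxeterPlanar.coxeterPlane (Δ.coxeterElement hε)) o W') := by
  obtain ⟨v, hv, rfl, hmin⟩ := ho
  rcases hM with hM | hM
  · exact Δ.main_of_isTypeD hε hM hv hmin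
  · exact Δ.main_of_isTypeH₃ hε hM hv hmin
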